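/- **Setting.** Let $(\gamma_{ij}(x,\rho),a_i(x,\rho))$ be smooth near $\rho=0$ on an $n$-dimensional coordinate patch, with $\gamma_{ij}$ symmetric and nondegenerate, and Taylor expansions $\gamma_{ij}=\sum_m\gamma^{(m)}_{ij}\rho^m$, $a_i=\sum_m a^{(m)}_i\rho^m$. The Weyl-ambient metric is $$\tilde g=2\rho\,dt^2+2t^2d\rho\Big(\frac{dt}{t}+a_idx^i\Big)+t^2(\gamma_{ij}-2\rho a_ia_j)dx^idx^j ,\qquad t>0 .$$ Let $\tilde\nabla$ and $\tilde R$ be its Levi-Civita connection and Riemann tensor, and let $\underline D_-=\frac1t\partial_\rho$, $\underline D_i=\partial_i-ta_i\partial_t+2\rho a_i\partial_\rho$. The extended Weyl-obstruction tensors are the components $\hat\Omega^{(m)}_{ij}=\underbrace{\tilde\nabla_-\cdots\tilde\nabla_-}_{m-1}\tilde R_{-ij-}\big|_{\rho=0,t=1}$ of the $(m-1)$-st covariant derivative of $\tilde R$ in this frame ($m\ge1$). Let $\hat\nabla$ be the Weyl-covariant derivative of $(\gamma^{(0)},a^{(0)})$: $\hat\nabla_iT=\nabla_iT+w_Ta^{(0)}_iT$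 for $T$ of Weyl weight $w_T$, where $\nabla$ is torsion-free with $\nabla_i\gamma^{(0)}_{jk}=2a^{(0)}_i\gamma^{(0)}_{jk}$. Let $\hat R_{ij}$, $\hat R$ be the Weyl-Ricci tensor and scalar, $\hat P_{ij}=\frac1{n-2}\big(\hat R_{ij}-\frac{\hat R}{2(n-1)}\gamma^{(0)}_{ij}\big)$ the Weyl-Schouten tensor, $\hat W_{ijkl}$ the Weyl tensor, and $\Delta=\hat\nabla_k\hat\nabla^k$. Indices are raised with $\gamma_{(0)}^{ij}$. A *tensor monomial* is an expression, independent of the dimension, formed by tensor products, contractions, index permutations and $\hat\nabla$ from $\gamma^{(0)}$, $\hat P$, $\hat W$ and $a^{(m)}$, $m\ge1$. A *formal tensor* is a finite combination of tensor monomials of rank 2 whose coefficients are rational functions of a complex variable $d$. For fixed $k$, a formal tensor *represents* a tensor $T_{ij}$ determined by $(\gamma,a)$ if, in every dimension $n\ge3$ with $n\notin\{4,6,\dots,2k\}$ and for every $(\gamma,a)$ as above whose Weyl-ambient metric satisfies $\tilde R_{IJ}=O(\rho^k)$ for coordinate indices $I,J\ne\rho$ and $\tilde R_{I\rho}=O(\rho^{k-1})$,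 the components of $T$ are obtained from it by setting $d=n$. **Proposition.** Let $k\ge2$ be an integer. The tensors $\hat\Omega^{(k-1)}_{ij}$ and $\gamma^{(k)}_{ij}$ are represented by formal tensors, denoted by the same symbols, with the following properties. 1. Both are holomorphic in $d\in\mathbb C\setminus\{4,6,\dots,2k\}$ and have a simple pole at $d=2k$: each coefficient has at most a simple pole there, and the residue is a tensor that does not vanish identically on $2k$-dimensional Weyl geometries. 2. The residues satisfy $$\operatorname{Res}_{d=2k}\hat\Omega^{(k-1)}_{ij}=\frac{k!}{2}\operatorname{Res}_{d=2k}\gamma^{(k)}_{ij}.$$ 3. $$\hat\Omega^{(k-1)}_{ij}=\frac{(-1)^{k-1}\Gamma(d/2-k)}{2^{k-1}\Gamma(d/2-1)}\Big(\Delta^{k-1}\hat P_{ij}-\Delta^{k-2}\hat\nabla_j\hat\nabla_k\hat P_i{}^k+L_{ij}\Big),$$ where $L_{ij}$ is a formal tensor, holomorphic in $d\in\mathbb C\setminus\{4,6,\dots,2k-2\}$, all of whose monomials contain fewer than $2k-2$ derivatives $\hat\nabla$. (The expression in brackets is the Weyl-obstruction tensor.) -/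

import Mathlib

open Filter Topology
open scoped ContDiff

noncomputable section

namespace WeylAmbient

/-! ### Local differential geometry in a coordinate patch with index type `ι` -/

section Local

variable {ι : Type} [Fintype ι] [DecidableEq ι]

/-- The partial derivative `∂_i f` at `x`. -/
def pd (i : ι) (f : (ι → ℝ) → ℝ) (x : ι → ℝ) : ℝ :=
  fderiv ℝ f x (Pi.single i 1)

/-- `christoffel g x k i j` is the Levi-Civita coefficient `Γ^k_{ij}` of the metric `g`. -/
def christoffel (g : (ι → ℝ) → Matrix ι ι ℝ) (x : ι → ℝ) (k i j : ι) : ℝ :=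
  (1 / 2 : ℝ) * ∑ l, (g x)⁻¹ k l *
    (pd i (fun y => g y j l) x + pd j (fun y => g y i l) x - pd l (fun y => g y i j) x)

/-- `curvature Γ x i j k l` is
`R^i_{jkl} = ∂_k Γ^i_{lj} - ∂_l Γ^i_{kj} + Γ^i_{km} Γ^m_{lj} - Γ^i_{lm} Γ^m_{kj}`. -/
def curvature (Γ : (ι → ℝ) → ι → ι → ι → ℝ) (x : ι → ℝ) (i j k l : ι) : ℝ :=
  pd k (fun y => Γ y i l j) x - pd l (fun y => Γ y i k j) x
    + ∑ m, (Γ x i k m * Γ x m l j - Γ x i l m * Γ x m k j)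

/-- The Ricci tensor `R_{ij} = R^k_{ikj}` of the connection `Γ`. -/
def ricci (Γ : (ι → ℝ) → ι → ι → ι → ℝ) (x : ι → ℝ) (i j : ι) : ℝ :=
  ∑ k, curvature Γ x k i k j

/-- The covariant derivative of a covariant tensor field `T` of rank `r` and Weyl weight `w`,
`∇_i T + w A_i T`, where `∇` has coefficients `Γ`. The differentiation index comes first. -/
def covDeriv (Γ : (ι → ℝ) → ι → ι → ι → ℝ) (A : (ι → ℝ) → ι → ℝ) (w : ℝ) {r : ℕ}
    (T : (ι → ℝ) → (Fin r → ι) → ℝ) (x : ι → ℝ) (I : Fin (r + 1) → ι) : ℝ :=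
  pd (I 0) (fun y => T y (Fin.tail I)) x
    - ∑ s : Fin r, ∑ m : ι,
        Γ x m (I 0) (Fin.tail I s) * T x (Function.update (Fin.tail I) s m)
    + w * A x (I 0) * T x (Fin.tail I)

/-- The Riemann tensor `R_{IJKL} = g_{IM} R^M_{JKL}` of the Levi-Civita connection of `g`. -/
def riemannLow (g : (ι → ℝ) → Matrix ι ι ℝ) (x : ι → ℝ) (I : Fin 4 → ι) : ℝ :=
  ∑ m, g x (I 0) m * curvature (christoffel g) x m (I 1) (I 2) (I 3)

/-- The iterated Levi-Civita covariant derivative `∇_{M_1} ⋯ ∇_{M_m} R_{IJKL}`. -/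
def iterDRiemann (g : (ι → ℝ) → Matrix ι ι ℝ) :
    (m : ℕ) → (ι → ℝ) → (Fin (4 + m) → ι) → ℝ
  | 0 => riemannLow g
  | m + 1 => covDeriv (christoffel g) (fun _ _ => 0) 0 (iterDRiemann g m)

end Local

/-! ### Weyl geometry of the `n`-dimensional boundary -/

/-- A metric `γ^{(0)}`, a Weyl connection `a^{(0)}` and the further modes `a^{(m)}`, `m ≥ 1`, in a
coordinate patch of dimension `n`. -/
structure WeylData (n : ℕ) where
  /-- the metric `γ^{(0)}_{ij}` -/
  metric : (Fin n → ℝ) → Matrix (Fin n) (Fin n) ℝ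
  /-- the modes `a^{(m)}_i`; `a^{(0)}` is the Weyl connection -/
  mode : ℕ → (Fin n → ℝ) → Fin n → ℝ

namespace WeylData

variable {n : ℕ} (B : WeylData n)

/-- The data are smooth and the metric is symmetric and nondegenerate on the open set `U`. -/
def IsRegularOn (U : Set (Fin n → ℝ)) : Prop :=
  IsOpen U ∧
  (∀ i j, ContDiffOn ℝ ∞ (fun x => B.metric x i j) U) ∧
  (∀ m i, ContDiffOn ℝ ∞ (fun x => B.mode m x i) U) ∧
  (∀ x ∈ U, (B.metric x).IsSymm) ∧
  (∀ x ∈ U, (B.metric x).det ≠ 0)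

/-- The torsion-free connection with `∇_i γ_{jk} = 2 a_i γ_{jk}`:
`Γ^k_{ij} = LC^k_{ij} - (a_i δ^k_j + a_j δ^k_i - a^k γ_{ij})`. -/
def conn (x : Fin n → ℝ) (k i j : Fin n) : ℝ :=
  christoffel B.metric x k i j
    - (B.mode 0 x i * (if k = j then 1 else 0) + B.mode 0 x j * (if k = i then 1 else 0)
        - (∑ l, (B.metric x)⁻¹ k l * B.mode 0 x l) * B.metric x i j)

/-- The curvature `F_{ij} = ∂_i a_j - ∂_j a_i` of the Weyl connection. -/
def fieldStrength (x : Fin n → ℝ) (i j : Fin n) : ℝ :=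
  pd i (fun y => B.mode 0 y j) x - pd j (fun y => B.mode 0 y i) x

/-- The Weyl-Riemann tensor `R^i_{jkl} + δ^i_j F_{kl}`. -/
def weylRiemann (x : Fin n → ℝ) (i j k l : Fin n) : ℝ :=
  curvature B.conn x i j k l + (if i = j then 1 else 0) * B.fieldStrength x k l

/-- The Weyl-Ricci tensor, the contraction of the first and third index. -/
def weylRicci (x : Fin n → ℝ) (i j : Fin n) : ℝ :=
  ∑ k, B.weylRiemann x k i k j

/-- The Weyl-Ricci scalar. -/
def weylScalar (x : Fin n → ℝ) : ℝ :=
  ∑ i, ∑ j, (B.metric x)⁻¹ i j * B.weylRicci x i j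

/-- The Weyl-Schouten tensor. -/
def schouten (x : Fin n → ℝ) (i j : Fin n) : ℝ :=
  (B.weylRicci x i j - B.weylScalar x / (2 * ((n : ℝ) - 1)) * B.metric x i j) / ((n : ℝ) - 2)

/-- The Weyl curvature tensor, the trace-free part of the Weyl-Riemann tensor, with all indices
lowered. -/
def weylTensor (x : Fin n → ℝ) (i j k l : Fin n) : ℝ :=
  (∑ m, B.metric x i m * B.weylRiemann x m j k l)
    - B.metric x i k * B.schouten x j l - B.schouten x i k * B.metric x j l
    + B.metric x i l * B.schouten x j k + B.schouten x i l * B.metric x j k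

end WeylData

/-! ### Tensor expressions for unspecified dimension -/

/-- Covariant tensor monomials of rank `r`: expressions built by tensor products, contractions,
permutations of indices and the Weyl-covariant derivative from the metric `γ^{(0)}`, the
Weyl-Schouten tensor, the Weyl tensor and the modes `a^{(m+1)}`. They make no reference to the
dimension. -/
inductive TMono : ℕ → Type
  | metric : TMono 2
  | schouten : TMono 2
  | weyl : TMono 4
  | mode (m : ℕ) : TMono 1
  | nabla {r : ℕ} (M : TMono r) : TMono (r + 1)
  | tensor {r s : ℕ} (M : TMono r) (N : TMono s) : TMono (r + s)
  | contr {r : ℕ} (M : TMono (r + 2)) : TMono r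
  | perm {r : ℕ} (σ : Equiv.Perm (Fin r)) (M : TMono r) : TMono r

namespace TMono

/-- The Weyl weight: `γ_{ij}` and `W_{ijkl}` have weight `-2`, the Weyl-Schouten tensor has weight
`0`, `a^{(m)}` has weight `2m`, the inverse metric has weight `2`. -/
def weight : {r : ℕ} → TMono r → ℤ
  | _, metric => -2
  | _, schouten => 0
  | _, weyl => -2
  | _, mode m => 2 * ((m : ℤ) + 1)
  | _, nabla M => weight M
  | _, tensor M N => weight M + weight N
  | _, contr M => weight M + 2
  | _, perm _ M => weight M

/-- The number of Weyl-covariant derivatives that occur in a monomial. -/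
def numNabla : {r : ℕ} → TMono r → ℕ
  | _, metric => 0
  | _, schouten => 0
  | _, weyl => 0
  | _, mode _ => 0
  | _, nabla M => numNabla M + 1
  | _, tensor M N => numNabla M + numNabla N
  | _, contr M => numNabla M
  | _, perm _ M => numNabla M

/-- The tensor field which a monomial denotes in an `n`-dimensional Weyl geometry. `contr` contracts
the first two indices with the inverse metric. -/
def eval {n : ℕ} (B : WeylData n) : {r : ℕ} → TMono r → (Fin n → ℝ) → (Fin r → Fin n) → ℝ
  | _, metric => fun x I => B.metric x (I 0) (I 1)
  | _, schouten => fun x I => B.schouten x (I 0) (I 1)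
  | _, weyl => fun x I => B.weylTensor x (I 0) (I 1) (I 2) (I 3)
  | _, mode m => fun x I => B.mode (m + 1) x (I 0)
  | _, nabla M => covDeriv B.conn (B.mode 0) (weight M : ℝ) (eval B M)
  | _, @tensor r s M N => fun x I =>
      eval B M x (fun p => I (Fin.castAdd s p)) * eval B N x (fun q => I (Fin.natAdd r q))
  | _, contr M => fun x I =>
      ∑ p, ∑ q, (B.metric x)⁻¹ p q * eval B M x (Fin.cons p (Fin.cons q I))
  | _, perm σ M => fun x I => eval B M x (fun p => I (σ p))

/-- The Weyl-covariant Laplacian `Δ T = ∇_k ∇^k T`. -/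
def laplace {r : ℕ} (M : TMono r) : TMono r := contr (nabla (nabla M))

/-- Iterated Laplacian `Δ^m T`. -/
def iterLaplace {r : ℕ} (m : ℕ) (M : TMono r) : TMono r := laplace^[m] M

/-- The covector `∇_k P_i{}^k`, where `P` is the Weyl-Schouten tensor. -/
def divSchouten : TMono 1 := contr (perm (Equiv.swap 1 2) (nabla schouten))

/-- The tensor `∇_j ∇_k P_i{}^k`, with indices in the order `i, j`. -/
def gradDivSchouten : TMono 2 := perm (Equiv.swap 0 1) (nabla divSchouten)

end TMono

/-- A tensor of rank 2 in formal dimension `d`: a finite formal combination of tensor monomials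
whose coefficients are rational functions of the complex variable `d`. -/
abbrev FormalTensor := TMono 2 →₀ RatFunc ℂ

namespace FormalTensor

/-- The coefficient of the monomial `M`, as a (meromorphic) function of `d ∈ ℂ`. -/
def coeff (E : FormalTensor) (M : TMono 2) (d : ℂ) : ℂ := (E M).eval (RingHom.id ℂ) d

/-- The components `E_{ij}` of the tensor at `d = n` in an `n`-dimensional Weyl geometry. -/
def evalAt (E : FormalTensor) {n : ℕ} (B : WeylData n) (x : Fin n → ℝ) (i j : Fin n) : ℂ :=
  ∑ M ∈ E.support, E.coeff M (n : ℂ) * ((M.eval B x ![i, j] : ℝ) : ℂ)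

/-- `E` depends holomorphically on `d` away from the points `2m`, `m ∈ S`. -/
def HolomorphicOff (E : FormalTensor) (S : Finset ℕ) : Prop :=
  ∀ M, ∀ d : ℂ, (∀ m ∈ S, d ≠ 2 * (m : ℂ)) → AnalyticAt ℂ (E.coeff M) d

end FormalTensor

/-- The components, in an `n`-dimensional Weyl geometry, of a formal combination of monomials with
constant coefficients. -/
def residueEval (R : TMono 2 →₀ ℂ) {n : ℕ} (B : WeylData n) (x : Fin n → ℝ) (i j : Fin n) : ℂ :=
  ∑ M ∈ R.support, R M * ((M.eval B x ![i, j] : ℝ) : ℂ)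

/-- `E` has a simple pole at `d = N` (`N` a natural number) with residue `R`: no coefficient has a
pole of order greater than one, the residues of the coefficients form `R`, and the tensor denoted
by `R` does not vanish identically on Weyl geometries of dimension `N`. -/
def HasSimplePole (E : FormalTensor) (N : ℕ) (R : TMono 2 →₀ ℂ) : Prop :=
  (∀ M, Tendsto (fun d : ℂ => (d - (N : ℂ)) * E.coeff M d) (𝓝[≠] (N : ℂ)) (𝓝 (R M))) ∧
  ∃ (B : WeylData N) (U : Set (Fin N → ℝ)), B.IsRegularOn U ∧
    ∃ x ∈ U, ∃ i j, residueEval R B x i j ≠ 0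

/-! ### The Weyl-ambient space -/

/-- The functions `γ_{ij}(x, ρ)` and `a_i(x, ρ)` which determine a Weyl-ambient metric. -/
structure AmbientData (n : ℕ) where
  /-- `γ_{ij}(x, ρ)` -/
  gam : (Fin n → ℝ) → ℝ → Matrix (Fin n) (Fin n) ℝ
  /-- `a_i(x, ρ)` -/
  a : (Fin n → ℝ) → ℝ → Fin n → ℝ

namespace AmbientData

variable {n : ℕ} (D : AmbientData n)

/-- The data are smooth, and `γ` is symmetric and nondegenerate, on the open set `O` of points
`(x, ρ)`. -/
def IsRegularOn (O : Set ((Fin n → ℝ) × ℝ)) : Prop :=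
  IsOpen O ∧
  (∀ i j, ContDiffOn ℝ ∞ (fun p : (Fin n → ℝ) × ℝ => D.gam p.1 p.2 i j) O) ∧
  (∀ i, ContDiffOn ℝ ∞ (fun p : (Fin n → ℝ) × ℝ => D.a p.1 p.2 i) O) ∧
  (∀ p ∈ O, (D.gam p.1 p.2).IsSymm) ∧
  (∀ p ∈ O, (D.gam p.1 p.2).det ≠ 0)

/-- The coefficient `γ^{(m)}_{ij}(x)` of `ρ^m` in the Taylor expansion of `γ_{ij}(x, ρ)`. -/
def gamCoeff (m : ℕ) (x : Fin n → ℝ) (i j : Fin n) : ℝ :=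
  iteratedDeriv m (fun ρ => D.gam x ρ i j) 0 / (m.factorial : ℝ)

/-- The coefficient `a^{(m)}_i(x)` of `ρ^m` in the Taylor expansion of `a_i(x, ρ)`. -/
def aCoeff (m : ℕ) (x : Fin n → ℝ) (i : Fin n) : ℝ :=
  iteratedDeriv m (fun ρ => D.a x ρ i) 0 / (m.factorial : ℝ)

/-- The Weyl geometry `(γ^{(0)}, a^{(0)})`, with the further modes `a^{(m)}`, at `ρ = 0`. -/
def boundary : WeylData n where
  metric x := D.gam x 0
  mode m x i := D.aCoeff m x i

/-- The point with coordinates `(t, x, ρ)`. The ambient coordinate index `inl i` stands for `x^i`,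
`inr 0` for `t` and `inr 1` for `ρ`. -/
def point (t : ℝ) (x : Fin n → ℝ) (ρ : ℝ) : Fin n ⊕ Fin 2 → ℝ := Sum.elim x ![t, ρ]

/-- The Weyl-ambient metric
`2ρ dt² + 2 t² dρ (dt / t + a_i dx^i) + t² (γ_{ij} - 2 ρ a_i a_j) dx^i dx^j`. -/
def ambientMetric (p : Fin n ⊕ Fin 2 → ℝ) : Matrix (Fin n ⊕ Fin 2) (Fin n ⊕ Fin 2) ℝ :=
  let t := p (Sum.inr 0)
  let ρ := p (Sum.inr 1)
  let x : Fin n → ℝ := fun i => p (Sum.inl i)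
  Matrix.fromBlocks
    (Matrix.of fun i j => t ^ 2 * (D.gam x ρ i j - 2 * ρ * D.a x ρ i * D.a x ρ j))
    (Matrix.of fun i => ![0, t ^ 2 * D.a x ρ i])
    (Matrix.of ![fun _ => 0, fun j => t ^ 2 * D.a x ρ j])
    !![2 * ρ, t; t, 0]

/-- The Ricci tensor of the ambient metric. -/
def ambientRicci (p : Fin n ⊕ Fin 2 → ℝ) (I J : Fin n ⊕ Fin 2) : ℝ :=
  ricci (christoffel D.ambientMetric) p I J

/-- The ambient metric is Ricci-flat at `ρ = 0` to the order which concerns the coefficients up to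
`ρ^k`: the components `R_{IJ}` are `O(ρ^k)` if neither index is `ρ`, and `O(ρ^{k-1})` otherwise. -/
def RicciFlatToOrder (O : Set ((Fin n → ℝ) × ℝ)) (k : ℕ) : Prop :=
  ∀ x : Fin n → ℝ, (x, (0 : ℝ)) ∈ O → ∀ t : ℝ, 0 < t → ∀ I J : Fin n ⊕ Fin 2, ∀ m : ℕ,
    (if I = Sum.inr 1 ∨ J = Sum.inr 1 then m + 1 < k else m < k) →
      iteratedDeriv m (fun ρ => D.ambientRicci (point t x ρ) I J) 0 = 0

/-- The components of the frame vectors in the coordinate basis. The frame index `inr 0` is `+`,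
`inr 1` is `-`, and
`D_+ = ∂_t - (ρ/t) ∂_ρ`, `D_i = ∂_i - t a_i ∂_t + 2 ρ a_i ∂_ρ`, `D_- = (1/t) ∂_ρ`. -/
def frame (p : Fin n ⊕ Fin 2 → ℝ) : Fin n ⊕ Fin 2 → Fin n ⊕ Fin 2 → ℝ :=
  let t := p (Sum.inr 0)
  let ρ := p (Sum.inr 1)
  let x : Fin n → ℝ := fun i => p (Sum.inl i)
  Sum.elim
    (fun i => Sum.elim (Pi.single i 1) ![-(t * D.a x ρ i), 2 * ρ * D.a x ρ i])
    ![Sum.elim (fun _ => 0) ![1, -(ρ / t)], Sum.elim (fun _ => 0) ![0, 1 / t]]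

/-- The component of a covariant ambient tensor along the frame vectors `D_{P_1}, …, D_{P_r}`. -/
def frameComp {r : ℕ} (T : (Fin n ⊕ Fin 2 → ℝ) → (Fin r → Fin n ⊕ Fin 2) → ℝ)
    (p : Fin n ⊕ Fin 2 → ℝ) (P : Fin r → Fin n ⊕ Fin 2) : ℝ :=
  ∑ I : Fin r → Fin n ⊕ Fin 2, T p I * ∏ s, D.frame p (P s) (I s)

/-- The extended Weyl-obstruction tensor `Ω^{(m+1)}_{ij}`, the frame component
`∇_- ⋯ ∇_- R_{-ij-}` with `m` covariant derivatives, at `ρ = 0`, `t = 1`. -/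
def extObstruction (m : ℕ) (x : Fin n → ℝ) (i j : Fin n) : ℝ :=
  D.frameComp (iterDRiemann D.ambientMetric m) (point 1 x 0)
    (fun s : Fin (4 + m) =>
      if (s : ℕ) = m + 1 then Sum.inl i else if (s : ℕ) = m + 2 then Sum.inl j else Sum.inr 1)

end AmbientData

/-- The formal tensor `E` is the expression, for variable dimension, of the tensor `T` which is
determined by Weyl-ambient metrics: in each dimension `n ≥ 3` other than `4, 6, …, 2k`, and for all
Weyl-ambient metrics that are Ricci-flat to the order which concerns `γ^{(0)}, …, γ^{(k)}`, the
components of `T` are those of `E` at `d = n`. -/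
def Represents (k : ℕ) (E : FormalTensor)
    (T : (n : ℕ) → AmbientData n → (Fin n → ℝ) → Fin n → Fin n → ℝ) : Prop :=
  ∀ n : ℕ, 3 ≤ n → (∀ m ∈ Finset.Icc 2 k, n ≠ 2 * m) →
    ∀ (D : AmbientData n) (O : Set ((Fin n → ℝ) × ℝ)),
      D.IsRegularOn O → D.RicciFlatToOrder O k →
        ∀ x : Fin n → ℝ, (x, (0 : ℝ)) ∈ O → ∀ i j : Fin n,
          ((T n D x i j : ℝ) : ℂ) = E.evalAt D.boundary x i j

/-- The factor `(-1)^{k-1} Γ(d/2 - k) / (2^{k-1} Γ(d/2 - 1))`. -/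
def gammaFactor (k : ℕ) (d : ℂ) : ℂ :=
  (-1) ^ (k - 1) * Complex.Gamma (d / 2 - k) / (2 ^ (k - 1) * Complex.Gamma (d / 2 - 1))

/-- The expression `Δ^{k-1} P_{ij} - Δ^{k-2} ∇_j ∇_k P_i{}^k`. -/
def leadingPart (k : ℕ) : FormalTensor :=
  Finsupp.single (TMono.iterLaplace (k - 1) TMono.schouten) 1
    - Finsupp.single (TMono.iterLaplace (k - 2) TMono.gradDivSchouten) 1

end WeylAmbient

end

set_option linter.unusedSectionVars false
set_option linter.unusedSimpArgs false
namespace WeylAmbient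

noncomputable section

section SmoothFunctions

open TopologicalSpace (Opens)

variable {ι : Type} [Fintype ι] [DecidableEq ι]

open Classical in
/-- The extension by zero of a function on `U`. -/
def extZero (U : Set (ι → ℝ)) (f : U → ℝ) (x : ι → ℝ) : ℝ :=
  if h : x ∈ U then f ⟨x, h⟩ else 0

theorem extZero_of_mem {U : Set (ι → ℝ)} {f : U → ℝ} {x : ι → ℝ} (h : x ∈ U) :
    extZero U f x = f ⟨x, h⟩ := by
  simp [extZero, h]

/-- The algebra of smooth functions on an open set. -/
def SmoothFn (U : Opens (ι → ℝ)) : Subalgebra ℝ (U → ℝ) where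
  carrier := {f | ContDiffOn ℝ ∞ (extZero (U : Set (ι → ℝ)) f) U}
  mul_mem' {f g} hf hg := by
    refine (ContDiffOn.mul hf hg).congr fun x hx => ?_
    simp only [Pi.mul_apply, extZero_of_mem hx]
  add_mem' {f g} hf hg := by
    refine (ContDiffOn.add hf hg).congr fun x hx => ?_
    simp only [Pi.add_apply, extZero_of_mem hx]
  algebraMap_mem' r := by
    refine (contDiffOn_const (c := r)).congr fun x hx => ?_
    rw [extZero_of_mem hx]; rfl

namespace SmoothFn

variable {U : Opens (ι → ℝ)}

/-- The smooth function on `U` given by a function which is smooth there. -/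
def ofFun (F : (ι → ℝ) → ℝ) (hF : ContDiffOn ℝ ∞ F U) : SmoothFn U :=
  ⟨fun x => F x, hF.congr fun _ hx => extZero_of_mem hx⟩

@[simp] theorem ofFun_apply {F : (ι → ℝ) → ℝ} (hF : ContDiffOn ℝ ∞ F U) (x : U) :
    (ofFun F hF : U → ℝ) x = F x := rfl

theorem smooth (f : SmoothFn U) : ContDiffOn ℝ ∞ (extZero (U : Set (ι → ℝ)) f) U := f.2

theorem differentiableAt (f : SmoothFn U) (x : U) :
    DifferentiableAt ℝ (extZero (U : Set (ι → ℝ)) f) x :=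
  ((smooth f).contDiffAt (U.2.mem_nhds x.2)).differentiableAt (by simp)

theorem extZero_eventuallyEq {f : U → ℝ} {F : (ι → ℝ) → ℝ} (h : ∀ y : U, f y = F y) (x : U) :
    extZero (U : Set (ι → ℝ)) f =ᶠ[𝓝 (x : ι → ℝ)] F := by
  filter_upwards [U.2.mem_nhds x.2] with y hy
  exact (extZero_of_mem hy).trans (h ⟨y, hy⟩)

theorem pd_congr {f : U → ℝ} {F : (ι → ℝ) → ℝ} (h : ∀ y : U, f y = F y) (i : ι) (x : U) :
    pd i F x = pd i (extZero (U : Set (ι → ℝ)) f) x := by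
  rw [pd, pd, (extZero_eventuallyEq h x).fderiv_eq]

/-- The partial derivative of a smooth function. -/
def pderiv (i : ι) : Derivation ℝ (SmoothFn U) (SmoothFn U) :=
  Derivation.mk'
    { toFun := fun f => ofFun (pd i (extZero (U : Set (ι → ℝ)) f))
        (((smooth f).fderiv_of_isOpen U.2 (by simp)).clm_apply contDiffOn_const)
      map_add' := fun f g => by
        ext x
        change pd i _ _ = pd i _ _ + pd i _ _
        refine (pd_congr (U := U) (F := fun y => extZero (U : Set (ι → ℝ)) f y
            + extZero (U : Set (ι → ℝ)) g y) (fun y => ?_) i x).symm.trans ?_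
        · simp [extZero_of_mem y.2]
        · rw [pd, fderiv_fun_add (differentiableAt f x) (differentiableAt g x)]
          rfl
      map_smul' := fun c f => by
        ext x
        change pd i _ _ = c * pd i _ _
        refine (pd_congr (U := U) (F := fun y => c * extZero (U : Set (ι → ℝ)) f y)
          (fun y => ?_) i x).symm.trans ?_
        · simp [extZero_of_mem y.2]
        · rw [pd, fderiv_const_mul (differentiableAt f x)]
          rfl }
    fun f g => by
      ext x
      change pd i _ _ = (f : U → ℝ) x * pd i _ _ + (g : U → ℝ) x * pd i _ _
      refine (pd_congr (U := U) (F := fun y => extZero (U : Set (ι → ℝ)) f y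
          * extZero (U : Set (ι → ℝ)) g y) (fun y => ?_) i x).symm.trans ?_
      · simp [extZero_of_mem y.2]
      · rw [pd, fderiv_fun_mul (differentiableAt f x) (differentiableAt g x)]
        simp [pd, extZero_of_mem x.2]

theorem pderiv_apply (i : ι) (f : SmoothFn U) (x : U) :
    (pderiv i f : U → ℝ) x = pd i (extZero (U : Set (ι → ℝ)) f) x := rfl

theorem pderiv_eq_pd (i : ι) (f : SmoothFn U) (F : (ι → ℝ) → ℝ)
    (h : ∀ y : U, (f : U → ℝ) y = F y) (x : U) : (pderiv i f : U → ℝ) x = pd i F x := by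
  rw [pd_congr h, pderiv_apply]

theorem pderiv_comm (i j : ι) (f : SmoothFn U) :
    pderiv i (pderiv j f) = pderiv j (pderiv i f) := by
  have key : ∀ (i j : ι) (x : U), (pderiv i (pderiv j f) : U → ℝ) x =
      fderiv ℝ (fderiv ℝ (extZero (U : Set (ι → ℝ)) f)) x (Pi.single i 1) (Pi.single j 1) := by
    intro i j x
    rw [pderiv_eq_pd i (pderiv j f) (pd j (extZero (U : Set (ι → ℝ)) f)) (fun y => rfl), pd]
    have hd : DifferentiableAt ℝ (fderiv ℝ (extZero (U : Set (ι → ℝ)) f)) x :=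
      (((smooth f).fderiv_of_isOpen U.2 (m := ∞) (by simp)).contDiffAt
        (U.2.mem_nhds x.2)).differentiableAt (by simp)
    have : (pd j (extZero (U : Set (ι → ℝ)) f)) =
        fun y => fderiv ℝ (extZero (U : Set (ι → ℝ)) f) y (Pi.single j 1) := rfl
    rw [this, fderiv_clm_apply hd (differentiableAt_const _)]
    simp
  ext x
  rw [key, key]
  exact (((smooth f).contDiffAt (U.2.mem_nhds x.2)).isSymmSndFDerivAt
    (by rw [minSmoothness_of_isRCLikeNormedField]; exact WithTop.coe_le_coe.2 le_top)) _ _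

theorem isUnit_of_ne_zero (f : SmoothFn U) (h : ∀ x : U, (f : U → ℝ) x ≠ 0) : IsUnit f := by
  refine IsUnit.of_mul_eq_one (ofFun (fun x => (extZero (U : Set (ι → ℝ)) f x)⁻¹)
    ((smooth f).inv fun x hx => by rw [extZero_of_mem hx]; exact h ⟨x, hx⟩)) ?_
  ext x
  change (f : U → ℝ) x * (extZero (U : Set (ι → ℝ)) f x)⁻¹ = 1
  rw [extZero_of_mem x.2]
  exact mul_inv_cancel₀ (h x)

/-- Evaluation at a point. -/
def evalAt (x : U) : SmoothFn U →ₐ[ℝ] ℝ := (Pi.evalAlgHom ℝ _ x).comp (SmoothFn U).val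

theorem evalAt_apply (x : U) (f : SmoothFn U) : evalAt x f = (f : U → ℝ) x := rfl

theorem ext_ev {f g : SmoothFn U} (h : ∀ x : U, (f : U → ℝ) x = (g : U → ℝ) x) : f = g :=
  Subtype.ext (funext h)

end SmoothFn

end SmoothFunctions

/-! ### Tensor calculus over a commutative algebra with derivations -/

section Algebraic

variable {A : Type*} [CommRing A] [Algebra ℝ A] {ι : Type} [Fintype ι] [DecidableEq ι]

/-- The Levi-Civita coefficients of the metric `G` with inverse `Gi`. -/
def lcCoeff (d : ι → Derivation ℝ A A) (G Gi : ι → ι → A) (k i j : ι) : A :=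
  (1 / 2 : ℝ) • ∑ l, Gi k l * (d i (G j l) + d j (G i l) - d l (G i j))

/-- The curvature `R^i_{jkl}` of the connection with coefficients `Γ^k_{ij}`. -/
def curv (d : ι → Derivation ℝ A A) (Γ : ι → ι → ι → A) (i j k l : ι) : A :=
  d k (Γ i l j) - d l (Γ i k j) + ∑ m, (Γ i k m * Γ m l j - Γ i l m * Γ m k j)

/-- The covariant derivative of weight `w` of a covariant tensor with index set `κ`. -/
def cov (d : ι → Derivation ℝ A A) (Γ : ι → ι → ι → A) (a : ι → A) (w : ℝ) {κ : Type} [Fintype κ]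
    [DecidableEq κ] (T : (κ → ι) → A) (i : ι) (I : κ → ι) : A :=
  d i (T I) - ∑ s, ∑ m, Γ m i (I s) * T (Function.update I s m) + w • (a i * T I)

end Algebraic

section Bridge

open TopologicalSpace (Opens)

variable {ι : Type} [Fintype ι] [DecidableEq ι] {U : Opens (ι → ℝ)}

theorem christoffel_eq {g : (ι → ℝ) → Matrix ι ι ℝ} {G Gi : ι → ι → SmoothFn U}
    (hG : ∀ (x : U) i j, g x i j = SmoothFn.evalAt x (G i j))
    (hGi : ∀ i j, ∑ m, G i m * Gi m j = if i = j then 1 else 0) (x : U) (k i j : ι) :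
    christoffel g x k i j = SmoothFn.evalAt x (lcCoeff SmoothFn.pderiv G Gi k i j) := by
  have hinv : (g x)⁻¹ = Matrix.of fun i j => SmoothFn.evalAt x (Gi i j) := by
    apply Matrix.inv_eq_right_inv
    ext i j
    have := congrArg (SmoothFn.evalAt x) (hGi i j)
    rw [Matrix.mul_apply, Matrix.one_apply]
    simp only [map_sum, map_mul] at this
    simp only [hG, Matrix.of_apply, this]
    split_ifs <;> simp
  have hd : ∀ i j k, pd i (fun y => g y j k) x = SmoothFn.evalAt x (SmoothFn.pderiv i (G j k)) :=
    fun i j k => (SmoothFn.pderiv_eq_pd i (G j k) (fun y => g y j k) (fun y => (hG y j k).symm)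
      x).symm
  rw [christoffel, lcCoeff]
  simp only [map_smul, map_sum, map_mul, map_add, map_sub, hd, hinv,
    Matrix.of_apply, smul_eq_mul]

theorem curvature_eq {Γ : (ι → ℝ) → ι → ι → ι → ℝ} {Γ' : ι → ι → ι → SmoothFn U}
    (hΓ : ∀ (x : U) k i j, Γ x k i j = SmoothFn.evalAt x (Γ' k i j)) (x : U) (i j k l : ι) :
    curvature Γ x i j k l = SmoothFn.evalAt x (curv SmoothFn.pderiv Γ' i j k l) := by
  have hd : ∀ p i j k, pd p (fun y => Γ y i j k) x = SmoothFn.evalAt x (SmoothFn.pderiv p (Γ' i j k)) :=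
    fun p i j k => (SmoothFn.pderiv_eq_pd p (Γ' i j k) (fun y => Γ y i j k)
      (fun y => (hΓ y i j k).symm) x).symm
  rw [curvature, curv]
  simp only [map_sum, map_mul, map_add, map_sub, hd, hΓ]

theorem covDeriv_eq {Γ : (ι → ℝ) → ι → ι → ι → ℝ} {Γ' : ι → ι → ι → SmoothFn U}
    {a : (ι → ℝ) → ι → ℝ} {a' : ι → SmoothFn U} {r : ℕ} {T : (ι → ℝ) → (Fin r → ι) → ℝ}
    {T' : (Fin r → ι) → SmoothFn U}
    (hΓ : ∀ (x : U) k i j, Γ x k i j = SmoothFn.evalAt x (Γ' k i j))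
    (ha : ∀ (x : U) i, a x i = SmoothFn.evalAt x (a' i))
    (hT : ∀ (x : U) I, T x I = SmoothFn.evalAt x (T' I)) (w : ℝ) (x : U) (I : Fin (r + 1) → ι) :
    covDeriv Γ a w T x I = SmoothFn.evalAt x (cov SmoothFn.pderiv Γ' a' w T' (I 0) (Fin.tail I)) := by
  have hd : ∀ p I, pd p (fun y => T y I) x = SmoothFn.evalAt x (SmoothFn.pderiv p (T' I)) :=
    fun p I => (SmoothFn.pderiv_eq_pd p (T' I) (fun y => T y I) (fun y => (hT y I).symm) x).symm
  rw [covDeriv, cov]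
  simp only [map_sum, map_mul, map_add, map_sub, map_smul, hd, hΓ, hT, ha,
    smul_eq_mul]
  ring

end Bridge

/-! ### Weyl geometry over a commutative algebra -/

/-- A metric with its inverse, a Weyl connection and further covectors over a commutative algebra
with commuting derivations. -/
structure Geo (n : ℕ) (A : Type) [CommRing A] [Algebra ℝ A] where
  /-- the coordinate derivations -/
  d : Fin n → Derivation ℝ A A
  d_comm : ∀ i j f, d i (d j f) = d j (d i f)
  /-- the metric -/
  g : Fin n → Fin n → A
  /-- the inverse metric -/
  gi : Fin n → Fin n → A
  g_symm : ∀ i j, g i j = g j i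
  gi_symm : ∀ i j, gi i j = gi j i
  g_gi : ∀ i j, ∑ m, g i m * gi m j = if i = j then 1 else 0
  /-- the modes of the Weyl connection -/
  a : ℕ → Fin n → A

namespace Geo

variable {n : ℕ} {A : Type} [CommRing A] [Algebra ℝ A] (B : Geo n A)

/-- The coefficients of the Weyl connection. -/
def Γ (k i j : Fin n) : A :=
  lcCoeff B.d B.g B.gi k i j - (B.a 0 i * (if k = j then 1 else 0)
    + B.a 0 j * (if k = i then 1 else 0) - (∑ l, B.gi k l * B.a 0 l) * B.g i j)

/-- The curvature of the Weyl connection on scalars. -/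
def F (i j : Fin n) : A := B.d i (B.a 0 j) - B.d j (B.a 0 i)

/-- The Weyl-Riemann tensor. -/
def riem (i j k l : Fin n) : A := curv B.d B.Γ i j k l + (if i = j then 1 else 0) * B.F k l

/-- The Weyl-Ricci tensor. -/
def ric (i j : Fin n) : A := ∑ k, B.riem k i k j

/-- The Weyl-Ricci scalar. -/
def scal : A := ∑ i, ∑ j, B.gi i j * B.ric i j

/-- The Weyl-Schouten tensor. -/
def P (i j : Fin n) : A :=
  ((n : ℝ) - 2)⁻¹ • (B.ric i j - (2 * ((n : ℝ) - 1))⁻¹ • (B.scal * B.g i j))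

/-- The Weyl curvature tensor. -/
def W (i j k l : Fin n) : A :=
  (∑ m, B.g i m * B.riem m j k l) - B.g i k * B.P j l - B.P i k * B.g j l + B.g i l * B.P j k
    + B.P i l * B.g j k

/-- The boundary covariant derivative. -/
def nab (w : ℝ) {κ : Type} [Fintype κ] [DecidableEq κ] (T : (κ → Fin n) → A) (i : Fin n)
    (I : κ → Fin n) : A := cov B.d B.Γ (B.a 0) w T i I

/-- The tensor denoted by a monomial. -/
def ev : {r : ℕ} → TMono r → (Fin r → Fin n) → A
  | _, .metric => fun I => B.g (I 0) (I 1)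
  | _, .schouten => fun I => B.P (I 0) (I 1)
  | _, .weyl => fun I => B.W (I 0) (I 1) (I 2) (I 3)
  | _, .mode m => fun I => B.a (m + 1) (I 0)
  | _, .nabla M => fun I => B.nab (M.weight : ℝ) (ev M) (I 0) (Fin.tail I)
  | _, @TMono.tensor r s M N => fun I =>
      ev M (fun p => I (Fin.castAdd s p)) * ev N (fun q => I (Fin.natAdd r q))
  | _, .contr M => fun I => ∑ p, ∑ q, B.gi p q * ev M (Fin.cons p (Fin.cons q I))
  | _, .perm σ M => fun I => ev M (fun p => I (σ p))

end Geo

section WeylBridge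

open TopologicalSpace (Opens)

variable {n : ℕ}

theorem exists_inverse {ι : Type} [Fintype ι] [DecidableEq ι] {κ : Type}
    [Fintype κ] [DecidableEq κ] {U : Opens (ι → ℝ)} (G : κ → κ → SmoothFn U)
    (h : ∀ x : U, (Matrix.of fun i j => SmoothFn.evalAt x (G i j)).det ≠ 0) :
    ∃ Gi : κ → κ → SmoothFn U, ∀ i j, ∑ m, G i m * Gi m j = if i = j then 1 else 0 := by
  have hu : IsUnit (Matrix.of G).det := by
    apply SmoothFn.isUnit_of_ne_zero
    intro x
    have h2 := h x
    have : (Matrix.of fun i j => SmoothFn.evalAt x (G i j)) =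
        (SmoothFn.evalAt x).toRingHom.mapMatrix (Matrix.of G) := by ext i j; rfl
    rw [this, ← RingHom.map_det] at h2
    exact h2
  refine ⟨fun i j => (Matrix.of G)⁻¹ i j, fun i j => ?_⟩
  have := congrFun (congrFun (Matrix.mul_nonsing_inv (Matrix.of G) hu) i) j
  rw [Matrix.mul_apply, Matrix.one_apply] at this
  exact this

theorem inverse_symm {A : Type*} [CommRing A] {κ : Type} [Fintype κ] [DecidableEq κ]
    {G Gi : κ → κ → A} (hs : ∀ i j, G i j = G j i)
    (h : ∀ i j, ∑ m, G i m * Gi m j = if i = j then 1 else 0) (i j : κ) : Gi i j = Gi j i := by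
  have h1 : Matrix.of G * Matrix.of Gi = 1 := by
    ext i j; rw [Matrix.mul_apply, Matrix.one_apply]; exact h i j
  have h2 : (Matrix.of G).transpose = Matrix.of G := by ext i j; exact hs j i
  have h3 : (Matrix.of Gi).transpose * Matrix.of G = 1 := by
    rw [← h2, ← Matrix.transpose_mul, h1, Matrix.transpose_one]
  have h4 : (Matrix.of Gi).transpose = Matrix.of Gi := left_inv_eq_right_inv h3 h1
  exact congrFun (congrFun h4 j) i

namespace WeylData

variable {B : WeylData n} {U : Opens (Fin n → ℝ)}

/-- The metric as a matrix of smooth functions. -/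
def gS (h : B.IsRegularOn U) (i j : Fin n) : SmoothFn U :=
  SmoothFn.ofFun (fun x => B.metric x i j) (h.2.1 i j)

theorem exists_gi (h : B.IsRegularOn U) :
    ∃ Gi : Fin n → Fin n → SmoothFn U, ∀ i j, ∑ m, gS h i m * Gi m j = if i = j then 1 else 0 :=
  exists_inverse (gS h) fun x => h.2.2.2.2 x x.2

theorem gS_symm (h : B.IsRegularOn U) (i j : Fin n) : gS h i j = gS h j i :=
  SmoothFn.ext_ev fun x => (h.2.2.2.1 x x.2).apply j i

/-- The Weyl geometry over the algebra of smooth functions on `U`. -/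
def geo (h : B.IsRegularOn U) : Geo n (SmoothFn U) where
  d := SmoothFn.pderiv
  d_comm := SmoothFn.pderiv_comm
  g := gS h
  gi := (exists_gi h).choose
  g_symm := gS_symm h
  gi_symm := inverse_symm (gS_symm h) (exists_gi h).choose_spec
  g_gi := (exists_gi h).choose_spec
  a m i := SmoothFn.ofFun (fun x => B.mode m x i) (h.2.2.1 m i)

variable (h : B.IsRegularOn U)

theorem geo_g (x : U) (i j : Fin n) : B.metric x i j = SmoothFn.evalAt x ((geo h).g i j) := rfl

theorem geo_a (m : ℕ) (x : U) (i : Fin n) : B.mode m x i = SmoothFn.evalAt x ((geo h).a m i) := rfl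

theorem geo_gi (x : U) (i j : Fin n) : (B.metric x)⁻¹ i j = SmoothFn.evalAt x ((geo h).gi i j) := by
  have hinv : (B.metric x)⁻¹ = Matrix.of fun i j => SmoothFn.evalAt x ((geo h).gi i j) := by
    apply Matrix.inv_eq_right_inv
    ext i j
    have := congrArg (SmoothFn.evalAt x) ((geo h).g_gi i j)
    rw [Matrix.mul_apply, Matrix.one_apply]
    simp only [map_sum, map_mul] at this
    simp only [geo_g h, Matrix.of_apply, this]
    split_ifs <;> simp
  rw [hinv]; rfl

theorem geo_conn (x : U) (k i j : Fin n) : B.conn x k i j = SmoothFn.evalAt x ((geo h).Γ k i j) := by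
  rw [conn, Geo.Γ, christoffel_eq (geo_g h) (geo h).g_gi x]
  simp only [map_sum, map_mul, map_add, map_sub, geo_g h, geo_a h, geo_gi h]
  split_ifs <;> simp <;> rfl

theorem geo_F (x : U) (i j : Fin n) : B.fieldStrength x i j = SmoothFn.evalAt x ((geo h).F i j) := by
  rw [fieldStrength, Geo.F, map_sub]
  exact congrArg₂ (· - ·)
    (SmoothFn.pderiv_eq_pd i ((geo h).a 0 j) (fun y => B.mode 0 y j) (fun y => rfl) x).symm
    (SmoothFn.pderiv_eq_pd j ((geo h).a 0 i) (fun y => B.mode 0 y i) (fun y => rfl) x).symm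

theorem geo_riem (x : U) (i j k l : Fin n) :
    B.weylRiemann x i j k l = SmoothFn.evalAt x ((geo h).riem i j k l) := by
  rw [weylRiemann, Geo.riem, curvature_eq (geo_conn h), geo_F h]
  split_ifs <;> simp <;> rfl

theorem geo_ric (x : U) (i j : Fin n) : B.weylRicci x i j = SmoothFn.evalAt x ((geo h).ric i j) := by
  rw [weylRicci, Geo.ric]
  simp only [map_sum, geo_riem h]

theorem geo_scal (x : U) : B.weylScalar x = SmoothFn.evalAt x ((geo h).scal) := by
  rw [weylScalar, Geo.scal]
  simp only [map_sum, map_mul, geo_ric h, geo_gi h]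

theorem geo_P (x : U) (i j : Fin n) : B.schouten x i j = SmoothFn.evalAt x ((geo h).P i j) := by
  rw [schouten, Geo.P]
  simp only [map_smul, map_sub, map_mul, geo_ric h, geo_scal h, geo_g h,
    smul_eq_mul]
  ring

theorem geo_W (x : U) (i j k l : Fin n) :
    B.weylTensor x i j k l = SmoothFn.evalAt x ((geo h).W i j k l) := by
  rw [weylTensor, Geo.W]
  simp only [map_sum, map_sub, map_add, map_mul, geo_riem h, geo_P h,
    geo_g h]

theorem geo_ev {r : ℕ} (M : TMono r) (x : U) (I : Fin r → Fin n) :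
    M.eval B x I = SmoothFn.evalAt x ((geo h).ev M I) := by
  induction M generalizing x with
  | metric => exact geo_g h x _ _
  | schouten => exact geo_P h x _ _
  | weyl => exact geo_W h x _ _ _ _
  | mode m => exact geo_a h _ x _
  | nabla M ih => exact covDeriv_eq (geo_conn h) (geo_a h 0) (fun y J => ih y J) _ x I
  | tensor M N ihM ihN => simp only [TMono.eval, Geo.ev, map_mul, ihM, ihN]
  | contr M ih => simp only [TMono.eval, Geo.ev, map_sum, map_mul, ih, geo_gi h]
  | perm σ M ih => exact ih _ _

end WeylData

end WeylBridge

end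

end WeylAmbient

namespace WeylAmbient

noncomputable section

/-! ### Power series in `ρ` -/

section Jets

open PowerSeries

variable {A A₀ : Type} [CommRing A] [Algebra ℝ A] [CommRing A₀] [Algebra ℝ A₀]

/-- The coefficientwise extension of a derivation to power series. -/
def liftD (D : Derivation ℝ A₀ A₀) : Derivation ℝ A₀⟦X⟧ A₀⟦X⟧ :=
  Derivation.mk'
    { toFun := fun f => PowerSeries.mk fun l => D (coeff l f)
      map_add' := fun f g => by ext l; simp
      map_smul' := fun c f => by ext l; simp }
    fun f g => by
      ext l
      simp only [LinearMap.coe_mk, AddHom.coe_mk, coeff_mk, coeff_mul, map_sum, Derivation.leibniz,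
        smul_eq_mul, map_add, Finset.sum_add_distrib]
      congr 1
      exact (Finset.Nat.sum_antidiagonal_swap
        (f := fun x => coeff x.1 g * D (coeff x.2 f))).symm ▸ rfl

@[simp] theorem coeff_liftD (D : Derivation ℝ A₀ A₀) (f : A₀⟦X⟧) (l : ℕ) :
    coeff l (liftD D f) = D (coeff l f) := by
  simp [liftD]

/-- The derivative with respect to the variable of power series. -/
def dX : Derivation ℝ A₀⟦X⟧ A₀⟦X⟧ := (PowerSeries.derivative A₀).restrictScalars ℝ

@[simp] theorem coeff_dX (f : A₀⟦X⟧) (l : ℕ) :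
    coeff l (dX f) = ((l : ℝ) + 1) • coeff (l + 1) f := by
  rw [dX, Derivation.restrictScalars_apply, coeff_derivative, Algebra.smul_def]
  simp [mul_comm]

theorem liftD_comm {D D' : Derivation ℝ A₀ A₀} (h : ∀ f, D (D' f) = D' (D f)) (f : A₀⟦X⟧) :
    liftD D (liftD D' f) = liftD D' (liftD D f) := by
  ext l; simp [h]

theorem liftD_dX (D : Derivation ℝ A₀ A₀) (f : A₀⟦X⟧) : liftD D (dX f) = dX (liftD D f) := by
  ext l; simp

theorem dX_X : dX (X : A₀⟦X⟧) = 1 := by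
  simp [dX]

theorem liftD_X (D : Derivation ℝ A₀ A₀) : liftD D (X : A₀⟦X⟧) = 0 := by
  ext l
  rw [coeff_liftD, coeff_X]
  split_ifs <;> simp

theorem liftD_C (D : Derivation ℝ A₀ A₀) (f : A₀) : liftD D (C f) = C (D f) := by
  ext l
  rw [coeff_liftD, coeff_C, coeff_C]
  split_ifs <;> simp

theorem dX_C (f : A₀) : dX (C f) = 0 := by
  ext l
  simp

theorem dX_injective {f g : A₀⟦X⟧} (h : dX f = dX g) (h0 : coeff 0 f = coeff 0 g) : f = g := by
  ext l
  cases l with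
  | zero => exact h0
  | succ l =>
    have := congrArg (coeff l) h
    simp only [coeff_dX] at this
    have hl : (l : ℝ) + 1 ≠ 0 := by positivity
    simpa [smul_smul, inv_mul_cancel₀ hl] using congrArg (fun z => ((l : ℝ) + 1)⁻¹ • z) this

/-- The Taylor series of `f` along `dr`, with coefficients restricted by `res`. -/
def jetFun (dr : Derivation ℝ A A) (res : A →ₐ[ℝ] A₀) (f : A) : A₀⟦X⟧ :=
  PowerSeries.mk fun l => ((l.factorial : ℝ)⁻¹) • res (dr^[l] f)

variable (dr : Derivation ℝ A A) (res : A →ₐ[ℝ] A₀)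

theorem jetFun_add (f g : A) : jetFun dr res (f + g) = jetFun dr res f + jetFun dr res g := by
  ext l; simp [jetFun]

theorem jetFun_dr (f : A) : jetFun dr res (dr f) = dX (jetFun dr res f) := by
  ext l
  simp only [jetFun, coeff_dX, coeff_mk, smul_smul, ← Function.iterate_succ_apply]
  congr 1
  rw [Nat.factorial_succ]
  have hl : (l : ℝ) + 1 ≠ 0 := by positivity
  push_cast
  field_simp

theorem coeff_zero_jetFun (f : A) : coeff 0 (jetFun dr res f) = res f := by
  simp [jetFun]

theorem jetFun_mul (f g : A) : jetFun dr res (f * g) = jetFun dr res f * jetFun dr res g := by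
  have key : ∀ l : ℕ, ∀ f g : A, coeff l (jetFun dr res (f * g)) =
      coeff l (jetFun dr res f * jetFun dr res g) := by
    intro l
    induction l with
    | zero => intro f g; simp [coeff_zero_jetFun, coeff_mul]
    | succ l ih =>
      intro f g
      have h1 : coeff l (dX (jetFun dr res (f * g))) =
          coeff l (dX (jetFun dr res f * jetFun dr res g)) := by
        rw [← jetFun_dr, Derivation.leibniz, Derivation.leibniz, jetFun_add, map_add, map_add,
          smul_eq_mul, smul_eq_mul, smul_eq_mul, smul_eq_mul, ih, ih, jetFun_dr, jetFun_dr]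
      simp only [coeff_dX] at h1
      have hl : (l : ℝ) + 1 ≠ 0 := by positivity
      simpa [smul_smul, inv_mul_cancel₀ hl] using congrArg (fun z => ((l : ℝ) + 1)⁻¹ • z) h1
  ext l
  exact key l f g

/-- The Taylor series along `dr` as an algebra homomorphism. -/
def jet : A →ₐ[ℝ] A₀⟦X⟧ where
  toFun := jetFun dr res
  map_one' := by
    refine dX_injective ?_ ?_
    · rw [← jetFun_dr, Derivation.map_one_eq_zero, Derivation.map_one_eq_zero]
      have := jetFun_add dr res 0 0
      simpa using this
    · simp [coeff_zero_jetFun]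
  map_mul' := jetFun_mul dr res
  map_zero' := by simpa using jetFun_add dr res 0 0
  map_add' := jetFun_add dr res
  commutes' c := by
    refine dX_injective ?_ ?_
    · rw [← jetFun_dr, Derivation.map_algebraMap, Derivation.map_algebraMap]
      simpa using jetFun_add dr res 0 0
    · rw [coeff_zero_jetFun, AlgHom.commutes, Algebra.algebraMap_eq_smul_one,
        Algebra.algebraMap_eq_smul_one]
      simp

theorem coeff_jet (f : A) (l : ℕ) :
    coeff l (jet dr res f) = ((l.factorial : ℝ)⁻¹) • res (dr^[l] f) := by
  change coeff l (jetFun dr res f) = _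
  simp [jetFun]

theorem jet_dr (f : A) : jet dr res (dr f) = dX (jet dr res f) := jetFun_dr dr res f

theorem jet_deriv {D : Derivation ℝ A A} {D₀ : Derivation ℝ A₀ A₀}
    (hc : ∀ f, D (dr f) = dr (D f)) (hr : ∀ f, res (D f) = D₀ (res f)) (f : A) :
    jet dr res (D f) = liftD D₀ (jet dr res f) := by
  ext l
  rw [coeff_liftD, coeff_jet, coeff_jet, Derivation.map_smul, ← hr]
  congr 2
  induction l generalizing f with
  | zero => rfl
  | succ l ih => rw [Function.iterate_succ_apply, Function.iterate_succ_apply, ← hc, ih]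

theorem jet_of_deriv_eq_one {f : A} (hf : dr f = 1) (h0 : res f = 0) : jet dr res f = X := by
  refine dX_injective ?_ ?_
  · rw [← jet_dr, hf, map_one, dX_X]
  · simp [coeff_jet, h0]

end Jets

/-! ### Frames -/

section Frames

variable {A : Type} [CommRing A] [Algebra ℝ A] {ι : Type} [Fintype ι] [DecidableEq ι]

/-- The Levi-Civita connection is torsion-free. -/
theorem lcCoeff_symm {d : ι → Derivation ℝ A A} {G Gi : ι → ι → A} (hs : ∀ i j, G i j = G j i)
    (k i j : ι) : lcCoeff d G Gi k i j = lcCoeff d G Gi k j i := by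
  simp only [lcCoeff]
  congr 1
  refine Finset.sum_congr rfl fun l _ => ?_
  rw [hs j i]; ring

theorem lower_lcCoeff {d : ι → Derivation ℝ A A} {G Gi : ι → ι → A}
    (h : ∀ i j, ∑ m, G i m * Gi m j = if i = j then 1 else 0) (l i j : ι) :
    ∑ k, G l k * lcCoeff d G Gi k i j = (1 / 2 : ℝ) • (d i (G j l) + d j (G i l) - d l (G i j)) := by
  simp only [lcCoeff, mul_smul_comm, ← Finset.smul_sum, Finset.mul_sum]
  rw [Finset.sum_comm]
  simp only [← mul_assoc, ← Finset.sum_mul, h]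
  simp

/-- The Levi-Civita connection is metric. -/
theorem lcCoeff_metric {d : ι → Derivation ℝ A A} {G Gi : ι → ι → A} (hs : ∀ i j, G i j = G j i)
    (h : ∀ i j, ∑ m, G i m * Gi m j = if i = j then 1 else 0) (i j l : ι) :
    d i (G j l) = ∑ k, G l k * lcCoeff d G Gi k i j + ∑ k, G j k * lcCoeff d G Gi k i l := by
  rw [lower_lcCoeff h, lower_lcCoeff h, ← smul_add, hs l j, hs i l, hs i j]
  have : d i (G j l) + d j (G l i) - d l (G j i) + (d i (G j l) + d l (G j i) - d j (G l i))
    = (2 : ℝ) • d i (G j l) := by rw [two_smul]; ring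
  rw [this, smul_smul]; norm_num

theorem eq_zero_of_symm_of_antisymm {z : ι → ι → ι → A} (h1 : ∀ a b c, z a b c = z b a c)
    (h2 : ∀ a b c, z a b c = - z a c b) (a b c : ι) : z a b c = 0 := by
  have : z a b c = - z a b c := by
    linear_combination h1 a b c + h2 b a c - h1 b c a - h2 c b a + h1 c a b + h2 a c b
  have h3 : (2 : ℝ) • z a b c = 0 := by
    rw [two_smul]; nth_rewrite 1 [this]; ring
  simpa [smul_smul] using congrArg (fun y => (2⁻¹ : ℝ) • y) h3

/-- The derivation along the frame vector `E_a`. -/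
def frameD (d : ι → Derivation ℝ A A) (E : ι → ι → A) (a : ι) : Derivation ℝ A A :=
  ∑ i, E a i • d i

theorem frameD_apply (d : ι → Derivation ℝ A A) (E : ι → ι → A) (a : ι) (f : A) :
    frameD d E a f = ∑ i, E a i * d i f := by
  refine (congrFun (map_sum Derivation.coeFnAddMonoidHom (fun i => E a i • d i) Finset.univ)
    f).trans ?_
  simp only [Finset.sum_apply, Derivation.coeFnAddMonoidHom_apply, Derivation.coe_smul,
    Pi.smul_apply, smul_eq_mul]

/-- The components `(∇_{E_a} E_b)^k` of the covariant derivatives of the frame vectors. -/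
def frameNab (d : ι → Derivation ℝ A A) (Γ : ι → ι → ι → A) (E : ι → ι → A) (a b k : ι) : A :=
  frameD d E a (E b k) + ∑ i, ∑ j, E a i * Γ k i j * E b j

theorem sum3_reverse {f : ι → ι → ι → A} :
    ∑ a, ∑ b, ∑ c, f a b c = ∑ c, ∑ b, ∑ a, f a b c := by
  rw [Finset.sum_comm, Finset.sum_congr rfl fun b _ => Finset.sum_comm (f := fun a c => f a b c)]
  exact Finset.sum_comm

theorem sum3_rotate {f : ι → ι → ι → A} :
    ∑ a, ∑ b, ∑ c, f a b c = ∑ b, ∑ c, ∑ a, f a b c := by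
  rw [Finset.sum_comm]
  exact Finset.sum_congr rfl fun _ _ => Finset.sum_comm

theorem frameNab_metric {d : ι → Derivation ℝ A A} {G Gi : ι → ι → A} (E : ι → ι → A)
    (hs : ∀ i j, G i j = G j i) (h : ∀ i j, ∑ m, G i m * Gi m j = if i = j then 1 else 0)
    (a b c : ι) :
    frameD d E a (∑ i, ∑ j, G i j * E b i * E c j)
      = ∑ i, ∑ j, G i j * frameNab d (lcCoeff d G Gi) E a b i * E c j
        + ∑ i, ∑ j, G i j * E b i * frameNab d (lcCoeff d G Gi) E a c j := by
  set Γa : ι → ι → A := fun k j => ∑ i, E a i * lcCoeff d G Gi k i j with hΓa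
  have hN : ∀ b k, frameNab d (lcCoeff d G Gi) E a b k
      = frameD d E a (E b k) + ∑ j, Γa k j * E b j := by
    intro b k
    simp only [frameNab, hΓa, Finset.sum_mul]
    rw [Finset.sum_comm]
  have hG : ∀ i j, frameD d E a (G i j) = ∑ k, G j k * Γa k i + ∑ k, G i k * Γa k j := by
    intro i j
    rw [frameD_apply]
    simp only [lcCoeff_metric (d := d) hs h, mul_add, Finset.sum_add_distrib, hΓa, Finset.mul_sum]
    congr 1 <;> rw [Finset.sum_comm] <;>
      exact Finset.sum_congr rfl fun _ _ => Finset.sum_congr rfl fun _ _ => by ring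
  have e1 : ∑ i, ∑ j, (∑ k, G j k * Γa k i) * E b i * E c j
      = ∑ i, ∑ j, G i j * (∑ m, Γa i m * E b m) * E c j := by
    simp only [Finset.mul_sum, Finset.sum_mul]
    rw [sum3_reverse]
    refine Finset.sum_congr rfl fun i _ => Finset.sum_congr rfl fun j _ =>
      Finset.sum_congr rfl fun k _ => ?_
    rw [hs j i]; ring
  have e2 : ∑ i, ∑ j, (∑ k, G i k * Γa k j) * E b i * E c j
      = ∑ i, ∑ j, G i j * E b i * (∑ m, Γa j m * E c m) := by
    simp only [Finset.mul_sum, Finset.sum_mul]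
    refine Finset.sum_congr rfl fun i _ => ?_
    rw [Finset.sum_comm]
    exact Finset.sum_congr rfl fun j _ => Finset.sum_congr rfl fun k _ => by ring
  simp only [map_sum, Derivation.leibniz, smul_eq_mul, hG, hN, mul_add, add_mul,
    Finset.sum_add_distrib, ← e1, ← e2]
  have c1 : ∀ (f g : ι → ι → A), (∀ i j, f i j = g i j) → ∑ i, ∑ j, f i j = ∑ i, ∑ j, g i j :=
    fun f g hfg => Finset.sum_congr rfl fun i _ => Finset.sum_congr rfl fun j _ => hfg i j
  rw [c1 (fun i j => G i j * E b i * frameD d E a (E c j))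
      (fun i j => G i j * E b i * frameD d E a (E c j)) (fun _ _ => rfl),
    c1 (fun i j => E c j * (G i j * frameD d E a (E b i)))
      (fun i j => G i j * frameD d E a (E b i) * E c j) (fun _ _ => by ring),
    c1 (fun i j => E c j * (E b i * ∑ k, G j k * Γa k i))
      (fun i j => (∑ k, G j k * Γa k i) * E b i * E c j) (fun _ _ => by ring),
    c1 (fun i j => E c j * (E b i * ∑ k, G i k * Γa k j))
      (fun i j => (∑ k, G i k * Γa k j) * E b i * E c j) (fun _ _ => by ring)]
  ring

/-- Uniqueness of the Levi-Civita connection: coefficients `om a b c` in the frame `E` that are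
metric and torsion-free are those of the Levi-Civita connection. -/
theorem frameNab_eq {d : ι → Derivation ℝ A A} {G Gi : ι → ι → A} {E Ei : ι → ι → A}
    {om : ι → ι → ι → A} (hs : ∀ i j, G i j = G j i)
    (h : ∀ i j, ∑ m, G i m * Gi m j = if i = j then 1 else 0)
    (hE : ∀ i j, ∑ a, Ei i a * E a j = if i = j then 1 else 0)
    (ht : ∀ a b k, frameD d E a (E b k) - frameD d E b (E a k)
      = ∑ c, (om a b c - om b a c) * E c k)
    (hm : ∀ a b c, frameD d E a (∑ i, ∑ j, G i j * E b i * E c j)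
      = ∑ e, om a b e * (∑ i, ∑ j, G i j * E e i * E c j)
        + ∑ e, om a c e * (∑ i, ∑ j, G i j * E b i * E e j)) (a b k : ι) :
    frameNab d (lcCoeff d G Gi) E a b k = ∑ c, om a b c * E c k := by
  set N := frameNab d (lcCoeff d G Gi) E with hN
  set Z : ι → ι → ι → A := fun a b k => N a b k - ∑ c, om a b c * E c k with hZ
  have hZs : ∀ a b k, Z a b k = Z b a k := by
    intro a b k
    have h1 : N a b k - N b a k = frameD d E a (E b k) - frameD d E b (E a k) := by
      have : ∑ i, ∑ j, E a i * lcCoeff d G Gi k i j * E b j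
          = ∑ i, ∑ j, E b i * lcCoeff d G Gi k i j * E a j := by
        rw [Finset.sum_comm]
        refine Finset.sum_congr rfl fun i _ => Finset.sum_congr rfl fun j _ => ?_
        rw [lcCoeff_symm hs k j i]; ring
      simp only [hN, frameNab, this]; ring
    have h2 := ht a b k
    simp only [sub_mul, Finset.sum_sub_distrib] at h2
    simp only [hZ]
    linear_combination h1 + h2
  have hz : ∀ a b c, ∑ i, ∑ j, G i j * Z a b i * E c j = 0 := by
    refine eq_zero_of_symm_of_antisymm (fun a b c => by simp only [hZs a b]) ?_
    intro a b c
    have h1 := frameNab_metric (d := d) E hs h a b c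
    rw [hm a b c] at h1
    have e1 : ∑ i, ∑ j, G i j * (∑ e, om a b e * E e i) * E c j
        = ∑ e, om a b e * ∑ i, ∑ j, G i j * E e i * E c j := by
      simp only [Finset.mul_sum, Finset.sum_mul]
      conv_rhs => rw [sum3_rotate]
      exact Finset.sum_congr rfl fun i _ => Finset.sum_congr rfl fun j _ =>
        Finset.sum_congr rfl fun k _ => by ring
    have e2 : ∑ i, ∑ j, G i j * E b i * (∑ e, om a c e * E e j)
        = ∑ e, om a c e * ∑ i, ∑ j, G i j * E b i * E e j := by
      simp only [Finset.mul_sum]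
      conv_rhs => rw [sum3_rotate]
      exact Finset.sum_congr rfl fun i _ => Finset.sum_congr rfl fun j _ =>
        Finset.sum_congr rfl fun k _ => by ring
    have e3 : ∑ i, ∑ j, G i j * Z a c i * E b j = ∑ i, ∑ j, G i j * E b i * Z a c j := by
      rw [Finset.sum_comm]
      refine Finset.sum_congr rfl fun i _ => Finset.sum_congr rfl fun j _ => ?_
      rw [hs j i]; ring
    rw [e3]
    simp only [hZ, mul_sub, sub_mul, Finset.sum_sub_distrib, e1, e2]
    rw [← hN] at h1
    linear_combination -h1
  have hzero : Z a b k = 0 := by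
    have h1 : ∀ j, ∑ i, G i j * Z a b i = 0 := by
      intro j
      have : ∑ c, Ei j c * ∑ i, ∑ j, G i j * Z a b i * E c j = ∑ i, G i j * Z a b i := by
        simp only [Finset.mul_sum]
        rw [sum3_rotate]
        refine Finset.sum_congr rfl fun i _ => ?_
        have : ∀ m, ∑ c, Ei j c * (G i m * Z a b i * E c m)
            = (if j = m then 1 else 0) * (G i m * Z a b i) := by
          intro m
          rw [← hE j m, Finset.sum_mul]
          exact Finset.sum_congr rfl fun c _ => by ring
        simp [this]
      rw [← this]; simp [hz]
    have h2 : ∑ j, Gi k j * ∑ i, G i j * Z a b i = Z a b k := by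
      simp only [Finset.mul_sum]
      rw [Finset.sum_comm]
      have : ∀ i, ∑ j, Gi k j * (G i j * Z a b i) = (if i = k then 1 else 0) * Z a b i := by
        intro i
        rw [← h i k, Finset.sum_mul]
        refine Finset.sum_congr rfl fun j _ => ?_
        rw [inverse_symm hs h k j]; ring
      simp [this]
    rw [← h2]; simp [h1]
  simpa [hZ, sub_eq_zero] using hzero

/-- The covariant derivative of a vector field in a coordinate direction. -/
def vecNab (d : ι → Derivation ℝ A A) (Γ : ι → ι → ι → A) (i : ι) (V : ι → A) (k : ι) : A :=
  d i (V k) + ∑ j, Γ k i j * V j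

theorem vecNab_add (d : ι → Derivation ℝ A A) (Γ : ι → ι → ι → A) (i : ι) (V W : ι → A) (k : ι) :
    vecNab d Γ i (fun k => V k + W k) k = vecNab d Γ i V k + vecNab d Γ i W k := by
  simp only [vecNab, map_add, mul_add, Finset.sum_add_distrib]; ring

theorem vecNab_mul (d : ι → Derivation ℝ A A) (Γ : ι → ι → ι → A) (i : ι) (f : A) (V : ι → A)
    (k : ι) : vecNab d Γ i (fun k => f * V k) k = d i f * V k + f * vecNab d Γ i V k := by
  simp only [vecNab, Derivation.leibniz, smul_eq_mul, mul_add, Finset.mul_sum]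
  rw [Finset.sum_congr rfl fun j _ => show Γ k i j * (f * V j) = f * (Γ k i j * V j) by ring]
  ring

theorem vecNab_sum (d : ι → Derivation ℝ A A) (Γ : ι → ι → ι → A) (i : ι) (s : Finset ι)
    (V : ι → ι → A) (k : ι) :
    vecNab d Γ i (fun k => ∑ a ∈ s, V a k) k = ∑ a ∈ s, vecNab d Γ i (V a) k := by
  classical
  induction s using Finset.induction_on with
  | empty => simp [vecNab]
  | insert a s ha ih =>
    simp only [Finset.sum_insert ha]
    rw [← ih, ← vecNab_add]

theorem vecNab_comm {d : ι → Derivation ℝ A A} (hd : ∀ i j f, d i (d j f) = d j (d i f))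
    (Γ : ι → ι → ι → A) (i j : ι) (V : ι → A) (k : ι) :
    vecNab d Γ i (vecNab d Γ j V) k - vecNab d Γ j (vecNab d Γ i V) k
      = ∑ b, curv d Γ k b i j * V b := by
  simp only [vecNab, curv, map_add, map_sum, Derivation.leibniz, smul_eq_mul, mul_add, add_mul,
    sub_mul, Finset.sum_add_distrib, Finset.sum_sub_distrib, Finset.mul_sum, Finset.sum_mul]
  rw [hd i j, Finset.sum_comm (f := fun m l => Γ k i m * (Γ m j l * V l)),
    Finset.sum_comm (f := fun m l => Γ k j m * (Γ m i l * V l))]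
  simp only [← mul_assoc, mul_comm (V _) ((d _) _)]
  ring

/-- The curvature in a frame with connection coefficients `om`. -/
def frameCurv (e : ι → A → A) (om : ι → ι → ι → A) (a b c d : ι) : A :=
  e c (om d b a) - e d (om c b a) + ∑ f, (om c f a * om d b f - om d f a * om c b f)
    - ∑ f, (om c d f - om d c f) * om f b a

theorem frameNab_eq_vecNab (d : ι → Derivation ℝ A A) (Γ : ι → ι → ι → A) (E : ι → ι → A)
    (a b k : ι) : frameNab d Γ E a b k = ∑ i, E a i * vecNab d Γ i (E b) k := by
  simp only [frameNab, vecNab, frameD_apply, mul_add, Finset.sum_add_distrib, Finset.mul_sum,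
    mul_assoc]

theorem frameCurv_eq {d : ι → Derivation ℝ A A} (hd : ∀ i j f, d i (d j f) = d j (d i f))
    {Γ : ι → ι → ι → A} (hΓ : ∀ k i j, Γ k i j = Γ k j i) {E : ι → ι → A} {om : ι → ι → ι → A}
    (hN : ∀ a b k, frameNab d Γ E a b k = ∑ c, om a b c * E c k) (b c e k : ι) :
    ∑ j, ∑ l, ∑ m, curv d Γ k j l m * E b j * E c l * E e m
      = ∑ a, frameCurv (fun a => frameD d E a) om a b c e * E a k := by
  have h0 : ∀ a b k, ∑ i, E a i * vecNab d Γ i (E b) k = ∑ c, om a b c * E c k := fun a b k => by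
    rw [← hN, frameNab_eq_vecNab]
  have h1 : ∀ c e, ∑ i, E c i * vecNab d Γ i (fun k => ∑ j, E e j * vecNab d Γ j (E b) k) k
      = ∑ a, (frameD d E c (om e b a) * E a k + om e b a * ∑ f, om c a f * E f k) := by
    intro c e
    have : (fun k => ∑ j, E e j * vecNab d Γ j (E b) k) = fun k => ∑ a, om e b a * E a k :=
      funext fun k => h0 e b k
    simp only [← h0]
    rw [this]
    simp only [vecNab_sum, vecNab_mul, frameD_apply, Finset.mul_sum, Finset.sum_mul,
      ← Finset.sum_add_distrib]
    rw [Finset.sum_comm]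
    exact Finset.sum_congr rfl fun a _ => Finset.sum_congr rfl fun i _ => by ring
  have h2 : ∀ c e, ∑ i, E c i * vecNab d Γ i (fun k => ∑ j, E e j * vecNab d Γ j (E b) k) k
      = ∑ j, frameD d E c (E e j) * vecNab d Γ j (E b) k
        + ∑ i, ∑ j, E c i * E e j * vecNab d Γ i (vecNab d Γ j (E b)) k := by
    intro c e
    simp only [vecNab_sum, vecNab_mul, frameD_apply, Finset.mul_sum, Finset.sum_mul, mul_add,
      Finset.sum_add_distrib]
    congr 1
    · rw [Finset.sum_comm]
      exact Finset.sum_congr rfl fun a _ => Finset.sum_congr rfl fun i _ => by ring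
    · exact Finset.sum_congr rfl fun a _ => Finset.sum_congr rfl fun i _ => by ring
  have h3 : ∀ j, frameD d E c (E e j) - frameD d E e (E c j)
      = ∑ f, (om c e f - om e c f) * E f j := by
    intro j
    simp only [sub_mul, Finset.sum_sub_distrib, ← hN, frameNab]
    have : ∑ p, ∑ q, E c p * Γ j p q * E e q = ∑ p, ∑ q, E e p * Γ j p q * E c q := by
      rw [Finset.sum_comm]
      exact Finset.sum_congr rfl fun p _ => Finset.sum_congr rfl fun q _ => by rw [hΓ]; ring
    rw [this]; ring
  have h4 : ∑ j, ∑ l, ∑ m, curv d Γ k j l m * E b j * E c l * E e m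
      = ∑ l, ∑ m, E c l * E e m * vecNab d Γ l (vecNab d Γ m (E b)) k
        - ∑ l, ∑ m, E e l * E c m * vecNab d Γ l (vecNab d Γ m (E b)) k := by
    rw [Finset.sum_comm (f := fun l m => E e l * E c m * vecNab d Γ l (vecNab d Γ m (E b)) k),
      ← Finset.sum_sub_distrib]
    rw [sum3_rotate]
    refine Finset.sum_congr rfl fun l _ => ?_
    rw [← Finset.sum_sub_distrib]
    refine Finset.sum_congr rfl fun m _ => ?_
    have := vecNab_comm hd Γ l m (E b) k
    rw [show E c l * E e m * vecNab d Γ l (vecNab d Γ m (E b)) k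
      - E e m * E c l * vecNab d Γ m (vecNab d Γ l (E b)) k
      = E c l * E e m * (vecNab d Γ l (vecNab d Γ m (E b)) k
      - vecNab d Γ m (vecNab d Γ l (E b)) k) by ring, this, Finset.mul_sum]
    exact Finset.sum_congr rfl fun a _ => by ring
  have h5 : ∑ j, frameD d E c (E e j) * vecNab d Γ j (E b) k
      - ∑ j, frameD d E e (E c j) * vecNab d Γ j (E b) k
      = ∑ a, (∑ f, (om c e f - om e c f) * om f b a) * E a k := by
    rw [← Finset.sum_sub_distrib]
    simp only [← sub_mul, h3, Finset.sum_mul]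
    rw [Finset.sum_comm]
    conv_rhs => rw [Finset.sum_comm]
    refine Finset.sum_congr rfl fun f _ => ?_
    simp only [mul_assoc, ← Finset.mul_sum, h0]
  have h6 : ∀ c e, ∑ a, om e b a * ∑ f, om c a f * E f k
      = ∑ a, (∑ f, om c f a * om e b f) * E a k := by
    intro c e
    simp only [Finset.mul_sum, Finset.sum_mul]
    rw [Finset.sum_comm]
    exact Finset.sum_congr rfl fun a _ => Finset.sum_congr rfl fun i _ => by ring
  have hc := h1 c e
  have hr := h1 e c
  rw [h2, Finset.sum_add_distrib, h6] at hc hr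
  simp only [frameCurv, add_mul, sub_mul, Finset.sum_add_distrib, Finset.sum_sub_distrib]
  simp only [sub_mul, Finset.sum_sub_distrib] at h5
  rw [h4]
  linear_combination hc - hr - h5

/-- The components of a covariant tensor in a frame. -/
def frameT (E : ι → ι → A) {κ : Type} [Fintype κ] [DecidableEq κ] (T : (κ → ι) → A) (P : κ → ι) :
    A :=
  ∑ I : κ → ι, T I * ∏ s, E (P s) (I s)

/-- The covariant derivative of a tensor in a frame with connection coefficients `om`. -/
def frameCov (e : ι → A → A) (om : ι → ι → ι → A) {κ : Type} [Fintype κ] [DecidableEq κ]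
    (T : (κ → ι) → A) (a : ι) (P : κ → ι) : A :=
  e a (T P) - ∑ s, ∑ c, om a (P s) c * T (Function.update P s c)

theorem sum_update {κ : Type} [Fintype κ] [DecidableEq κ] (s : κ) (f : (κ → ι) → ι → A) :
    ∑ I : κ → ι, ∑ m, f I m = ∑ I : κ → ι, ∑ m, f (Function.update I s m) (I s) := by
  rw [← Fintype.sum_prod_type', ← Fintype.sum_prod_type']
  refine Fintype.sum_equiv
    { toFun := fun x => (Function.update x.1 s x.2, x.1 s)
      invFun := fun x => (Function.update x.1 s x.2, x.1 s)
      left_inv := fun x => by simp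
      right_inv := fun x => by simp } _ _ fun x => by simp

theorem prod_update {κ : Type} [Fintype κ] [DecidableEq κ] (E : ι → ι → A) (P I : κ → ι) (s : κ)
    (m : ι) : ∏ t, E (P t) (Function.update I s m t)
      = E (P s) m * ∏ t ∈ Finset.univ.erase s, E (P t) (I t) := by
  rw [← Finset.mul_prod_erase _ _ (Finset.mem_univ s)]
  simp only [Function.update_self]
  congr 1
  refine Finset.prod_congr rfl fun t ht => ?_
  rw [Function.update_of_ne (Finset.ne_of_mem_erase ht)]

theorem derivation_prod {κ : Type} [DecidableEq κ] (D : Derivation ℝ A A) (s : Finset κ)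
    (f : κ → A) : D (∏ t ∈ s, f t) = ∑ t ∈ s, D (f t) * ∏ u ∈ s.erase t, f u := by
  induction s using Finset.induction_on with
  | empty => simp
  | insert a s ha ih =>
    rw [Finset.prod_insert ha, Derivation.leibniz, Finset.sum_insert ha, Finset.erase_insert ha, ih]
    simp only [smul_eq_mul, Finset.mul_sum]
    rw [add_comm, mul_comm]
    congr 1
    refine Finset.sum_congr rfl fun t ht => ?_
    rw [Finset.erase_insert_of_ne (by rintro rfl; exact ha ht), Finset.prod_insert]
    · ring
    · exact fun h => ha (Finset.mem_of_mem_erase h)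

theorem prod_update_left {κ : Type} [Fintype κ] [DecidableEq κ] (E : ι → ι → A) (P I : κ → ι)
    (s : κ) (c : ι) : ∏ t, E (Function.update P s c t) (I t)
      = E c (I s) * ∏ t ∈ Finset.univ.erase s, E (P t) (I t) := by
  rw [← Finset.mul_prod_erase _ _ (Finset.mem_univ s)]
  simp only [Function.update_self]
  congr 1
  refine Finset.prod_congr rfl fun t ht => ?_
  rw [Function.update_of_ne (Finset.ne_of_mem_erase ht)]

theorem frameT_cov {d : ι → Derivation ℝ A A} {Γ : ι → ι → ι → A} {E : ι → ι → A}
    {om : ι → ι → ι → A} (hN : ∀ a b k, frameNab d Γ E a b k = ∑ c, om a b c * E c k)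
    {κ : Type} [Fintype κ] [DecidableEq κ] (T : (κ → ι) → A) (a : ι) (P : κ → ι) :
    ∑ i, E a i * frameT E (cov d Γ (fun _ => 0) 0 T i) P
      = frameCov (fun a => frameD d E a) om (frameT E T) a P := by
  set Q : κ → (κ → ι) → A := fun s I => ∏ t ∈ Finset.univ.erase s, E (P t) (I t) with hQ
  have hL : ∀ i, frameT E (cov d Γ (fun _ => 0) 0 T i) P = ∑ I, d i (T I) * ∏ t, E (P t) (I t)
      - ∑ s, ∑ I : κ → ι, ∑ m, Γ (I s) i m * T I * (E (P s) m * Q s I) := by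
    intro i
    simp only [frameT, cov, zero_smul, add_zero, sub_mul, Finset.sum_sub_distrib, Finset.sum_mul]
    congr 1
    rw [Finset.sum_comm]
    refine Finset.sum_congr rfl fun s _ => ?_
    rw [sum_update s]
    simp only [Function.update_self, Function.update_idem, Function.update_eq_self, prod_update, hQ]
  have h1 : frameD d E a (frameT E T P) = ∑ I, frameD d E a (T I) * ∏ t, E (P t) (I t)
      + ∑ s, ∑ I : κ → ι, T I * (frameD d E a (E (P s) (I s)) * Q s I) := by
    simp only [frameT, map_sum, Derivation.leibniz, smul_eq_mul, derivation_prod, Finset.mul_sum]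
    rw [Finset.sum_add_distrib, add_comm, Finset.sum_comm]
    congr 1
    exact Finset.sum_congr rfl fun I _ => mul_comm _ _
  have h2 : ∀ s, ∑ c, om a (P s) c * frameT E T (Function.update P s c)
      = ∑ I : κ → ι, T I * (frameD d E a (E (P s) (I s)) * Q s I)
        + ∑ i, E a i * ∑ I : κ → ι, ∑ m, Γ (I s) i m * T I * (E (P s) m * Q s I) := by
    intro s
    have : ∑ c, om a (P s) c * frameT E T (Function.update P s c)
        = ∑ I : κ → ι, T I * (frameNab d Γ E a (P s) (I s) * Q s I) := by
      simp only [hN, frameT, Finset.mul_sum, Finset.sum_mul, prod_update_left, hQ]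
      rw [Finset.sum_comm]
      exact Finset.sum_congr rfl fun I _ => Finset.sum_congr rfl fun c _ => by ring
    rw [this]
    simp only [frameNab, add_mul, mul_add, Finset.sum_add_distrib, Finset.mul_sum, Finset.sum_mul]
    congr 1
    conv_rhs => rw [Finset.sum_comm]
    exact Finset.sum_congr rfl fun I _ => Finset.sum_congr rfl fun i _ =>
      Finset.sum_congr rfl fun m _ => by ring
  simp only [frameCov, hL, h1, h2, mul_sub, Finset.sum_sub_distrib, Finset.sum_add_distrib]
  have h3 : ∑ i, E a i * ∑ I, d i (T I) * ∏ t, E (P t) (I t)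
      = ∑ I, frameD d E a (T I) * ∏ t, E (P t) (I t) := by
    simp only [frameD_apply, Finset.mul_sum, Finset.sum_mul]
    rw [Finset.sum_comm]
    exact Finset.sum_congr rfl fun I _ => Finset.sum_congr rfl fun i _ => by ring
  have h4 : ∑ i, E a i * ∑ s, ∑ I : κ → ι, ∑ m, Γ (I s) i m * T I * (E (P s) m * Q s I)
      = ∑ s, ∑ i, E a i * ∑ I : κ → ι, ∑ m, Γ (I s) i m * T I * (E (P s) m * Q s I) := by
    rw [Finset.sum_comm]
    exact Finset.sum_congr rfl fun i _ => Finset.mul_sum _ _ _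
  rw [h3, h4]
  ring

end Frames

end

end WeylAmbient

namespace WeylAmbient

noncomputable section

/-! ### The Weyl-ambient connection -/

theorem amb_cases {n : ℕ} (b : Fin n ⊕ Fin 2) : (∃ i, b = .inl i) ∨ b = .inr 0 ∨ b = .inr 1 := by
  rcases b with i | b
  · exact .inl ⟨i, rfl⟩
  · fin_cases b <;> simp

/-- A `ρ`-dependent metric `g` and Weyl connection `a` over a commutative algebra. -/
structure RhoGeo (n : ℕ) (S : Type) [CommRing S] [Algebra ℝ S] where
  /-- the coordinate derivations -/
  d : Fin n → Derivation ℝ S S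
  /-- the derivation with respect to `ρ` -/
  dr : Derivation ℝ S S
  /-- the coordinate `ρ` -/
  ρ : S
  d_comm : ∀ i j f, d i (d j f) = d j (d i f)
  d_dr : ∀ i f, d i (dr f) = dr (d i f)
  d_ρ : ∀ i, d i ρ = 0
  dr_ρ : dr ρ = 1
  /-- the metric `γ_{ij}` -/
  g : Fin n → Fin n → S
  /-- the inverse metric -/
  gi : Fin n → Fin n → S
  g_symm : ∀ i j, g i j = g j i
  gi_symm : ∀ i j, gi i j = gi j i
  g_gi : ∀ i j, ∑ m, g i m * gi m j = if i = j then 1 else 0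
  /-- the Weyl connection `a_i` -/
  a : Fin n → S

namespace RhoGeo

variable {n : ℕ} {S : Type} [CommRing S] [Algebra ℝ S] (R : RhoGeo n S)

/-- The horizontal derivation `∂_i + 2 ρ a_i ∂_ρ`. -/
def h (i : Fin n) : Derivation ℝ S S := R.d i + (2 * R.ρ * R.a i) • R.dr

theorem h_apply (i : Fin n) (x : S) : R.h i x = R.d i x + 2 * R.ρ * R.a i * R.dr x := rfl

/-- The frame derivations on functions that do not depend on `t`. -/
def e : Fin n ⊕ Fin 2 → Derivation ℝ S S := Sum.elim R.h ![(-R.ρ) • R.dr, R.dr]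

/-- The curvature `f_{ij}` of `a`. -/
def f (i j : Fin n) : S := R.h i (R.a j) - R.h j (R.a i)

/-- `ψ_{ij} = (∂_ρ γ_{ij} + f_{ij}) / 2`. -/
def ψ (i j : Fin n) : S := (1 / 2 : ℝ) • (R.dr (R.g i j) + R.f i j)

/-- `ψ_i{}^k`. -/
def ψu (i k : Fin n) : S := ∑ m, R.ψ i m * R.gi m k

/-- `∂_ρ a_m` with its index raised. -/
def au (k : Fin n) : S := ∑ m, R.gi k m * R.dr (R.a m)

/-- The Weyl-covariant derivative `h_i γ_{jl} - 2 a_i γ_{jl}` without connection terms. -/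
def b (i j l : Fin n) : S := R.h i (R.g j l) - 2 * R.a i * R.g j l

/-- The horizontal connection coefficients. -/
def Γh (k i j : Fin n) : S :=
  ∑ l, R.gi k l * ((1 / 2 : ℝ) • (R.b i j l + R.b j i l - R.b l i j))

/-- The ambient connection coefficients: `om A B C` is the coefficient of `D_C` in `∇_{D_A} D_B`,
for the frame `D_i = ∂_i - t a_i ∂_t + 2 ρ a_i ∂_ρ`, `D_+ = t ∂_t - ρ ∂_ρ`, `D_- = ∂_ρ`. -/
def om : Fin n ⊕ Fin 2 → Fin n ⊕ Fin 2 → Fin n ⊕ Fin 2 → S :=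
  Sum.elim
    (fun i => Sum.elim
      (fun j => Sum.elim (fun k => R.Γh k i j) ![-R.ψ i j, -R.g i j + R.ρ * R.ψ i j])
      ![Sum.elim (fun k => (if i = k then 1 else 0) - R.ρ * R.ψu i k) ![0, 0],
        Sum.elim (fun k => R.ψu i k) ![0, -2 * R.a i]])
    ![Sum.elim
        (fun j => Sum.elim (fun k => (if j = k then 1 else 0) - R.ρ * R.ψu j k)
          ![R.ρ * R.dr (R.a j), -(R.ρ ^ 2 * R.dr (R.a j))])
        ![Sum.elim (fun k => R.ρ ^ 2 * R.au k) ![1, 0], Sum.elim (fun k => -(R.ρ * R.au k)) ![0, 1]],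
      Sum.elim
        (fun j => Sum.elim (fun k => R.ψu j k) ![-R.dr (R.a j), R.ρ * R.dr (R.a j)])
        ![Sum.elim (fun k => -(R.ρ * R.au k)) ![0, 0], Sum.elim (fun k => R.au k) ![0, 0]]]

@[simp] theorem om_hhh (i j k : Fin n) :
    R.om (.inl i) (.inl j) (.inl k) = R.Γh k i j := rfl

@[simp] theorem om_hhp (i j : Fin n) :
    R.om (.inl i) (.inl j) (.inr 0) = -R.ψ i j := rfl

@[simp] theorem om_hhm (i j : Fin n) :
    R.om (.inl i) (.inl j) (.inr 1) = -R.g i j + R.ρ * R.ψ i j := rfl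

@[simp] theorem om_hph (i k : Fin n) :
    R.om (.inl i) (.inr 0) (.inl k) = (if i = k then 1 else 0) - R.ρ * R.ψu i k := rfl

@[simp] theorem om_hpp (i : Fin n) :
    R.om (.inl i) (.inr 0) (.inr 0) = 0 := rfl

@[simp] theorem om_hpm (i : Fin n) :
    R.om (.inl i) (.inr 0) (.inr 1) = 0 := rfl

@[simp] theorem om_hmh (i k : Fin n) :
    R.om (.inl i) (.inr 1) (.inl k) = R.ψu i k := rfl

@[simp] theorem om_hmp (i : Fin n) :
    R.om (.inl i) (.inr 1) (.inr 0) = 0 := rfl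

@[simp] theorem om_hmm (i : Fin n) :
    R.om (.inl i) (.inr 1) (.inr 1) = -2 * R.a i := rfl

@[simp] theorem om_phh (j k : Fin n) :
    R.om (.inr 0) (.inl j) (.inl k) = (if j = k then 1 else 0) - R.ρ * R.ψu j k := rfl

@[simp] theorem om_php (j : Fin n) :
    R.om (.inr 0) (.inl j) (.inr 0) = R.ρ * R.dr (R.a j) := rfl

@[simp] theorem om_phm (j : Fin n) :
    R.om (.inr 0) (.inl j) (.inr 1) = -(R.ρ ^ 2 * R.dr (R.a j)) := rfl

@[simp] theorem om_pph (k : Fin n) :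
    R.om (.inr 0) (.inr 0) (.inl k) = R.ρ ^ 2 * R.au k := rfl

@[simp] theorem om_ppp :
    R.om (.inr 0) (.inr 0) (.inr 0) = 1 := rfl

@[simp] theorem om_ppm :
    R.om (.inr 0) (.inr 0) (.inr 1) = 0 := rfl

@[simp] theorem om_pmh (k : Fin n) :
    R.om (.inr 0) (.inr 1) (.inl k) = -(R.ρ * R.au k) := rfl

@[simp] theorem om_pmp :
    R.om (.inr 0) (.inr 1) (.inr 0) = 0 := rfl

@[simp] theorem om_pmm :
    R.om (.inr 0) (.inr 1) (.inr 1) = 1 := rfl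

@[simp] theorem om_mhh (j k : Fin n) :
    R.om (.inr 1) (.inl j) (.inl k) = R.ψu j k := rfl

@[simp] theorem om_mhp (j : Fin n) :
    R.om (.inr 1) (.inl j) (.inr 0) = -R.dr (R.a j) := rfl

@[simp] theorem om_mhm (j : Fin n) :
    R.om (.inr 1) (.inl j) (.inr 1) = R.ρ * R.dr (R.a j) := rfl

@[simp] theorem om_mph (k : Fin n) :
    R.om (.inr 1) (.inr 0) (.inl k) = -(R.ρ * R.au k) := rfl

@[simp] theorem om_mpp :
    R.om (.inr 1) (.inr 0) (.inr 0) = 0 := rfl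

@[simp] theorem om_mpm :
    R.om (.inr 1) (.inr 0) (.inr 1) = 0 := rfl

@[simp] theorem om_mmh (k : Fin n) :
    R.om (.inr 1) (.inr 1) (.inl k) = R.au k := rfl

@[simp] theorem om_mmp :
    R.om (.inr 1) (.inr 1) (.inr 0) = 0 := rfl

@[simp] theorem om_mmm :
    R.om (.inr 1) (.inr 1) (.inr 1) = 0 := rfl

@[simp] theorem e_h (i : Fin n) (x : S) : R.e (.inl i) x = R.h i x := rfl

@[simp] theorem e_p (x : S) : R.e (.inr 0) x = -(R.ρ * R.dr x) := by
  simp [e]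

@[simp] theorem e_m (x : S) : R.e (.inr 1) x = R.dr x := rfl

@[simp] theorem h_ρ (i : Fin n) : R.h i R.ρ = 2 * R.ρ * R.a i := by
  simp [h_apply, R.d_ρ, R.dr_ρ]

theorem f_antisymm (i j : Fin n) : R.f i j = -R.f j i := by simp [f]

theorem ψ_sub (i j : Fin n) : R.ψ i j - R.ψ j i = R.f i j := by
  rw [ψ, ψ, R.f_antisymm j i, R.g_symm j i, ← smul_sub]
  have : R.dr (R.g i j) + R.f i j - (R.dr (R.g i j) + -R.f i j) = (2 : ℝ) • R.f i j := by
    rw [two_smul]; ring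
  rw [this, smul_smul]; norm_num

theorem ψ_add (i j : Fin n) : R.ψ i j + R.ψ j i = R.dr (R.g i j) := by
  rw [ψ, ψ, R.f_antisymm j i, R.g_symm j i, ← smul_add]
  have : R.dr (R.g i j) + R.f i j + (R.dr (R.g i j) + -R.f i j) = (2 : ℝ) • R.dr (R.g i j) := by
    rw [two_smul]; ring
  rw [this, smul_smul]; norm_num

theorem gi_g (i j : Fin n) : ∑ m, R.gi i m * R.g m j = if i = j then 1 else 0 := by
  have := R.g_gi j i
  rw [eq_comm] at this
  rw [if_congr (eq_comm (a := i)) rfl rfl, this]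
  exact Finset.sum_congr rfl fun m _ => by rw [R.g_symm j m, R.gi_symm m i]; ring

theorem sum_gi_g (u : Fin n → S) (j : Fin n) : ∑ k, (∑ m, u m * R.gi m k) * R.g k j = u j := by
  simp only [Finset.sum_mul]
  rw [Finset.sum_comm]
  simp only [mul_assoc, ← Finset.mul_sum, gi_g]
  simp

theorem ψu_g (i j : Fin n) : ∑ k, R.ψu i k * R.g k j = R.ψ i j := R.sum_gi_g _ _

theorem au_g (j : Fin n) : ∑ k, R.au k * R.g k j = R.dr (R.a j) := by
  have := R.sum_gi_g (fun m => R.dr (R.a m)) j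
  rw [← this]
  refine Finset.sum_congr rfl fun k _ => ?_
  rw [au]
  congr 1
  exact Finset.sum_congr rfl fun m _ => by rw [R.gi_symm]; ring

theorem Γh_g (i j l : Fin n) :
    ∑ k, R.Γh k i j * R.g k l = (1 / 2 : ℝ) • (R.b i j l + R.b j i l - R.b l i j) := by
  rw [← R.sum_gi_g (fun l => (1 / 2 : ℝ) • (R.b i j l + R.b j i l - R.b l i j)) l]
  refine Finset.sum_congr rfl fun k _ => ?_
  rw [Γh]
  congr 1
  exact Finset.sum_congr rfl fun m _ => by rw [R.gi_symm]; ring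

theorem b_symm (i j l : Fin n) : R.b i j l = R.b i l j := by rw [b, b, R.g_symm]

theorem Γh_symm (k i j : Fin n) : R.Γh k i j = R.Γh k j i := by
  simp only [Γh, R.b_symm _ i j]
  exact Finset.sum_congr rfl fun m _ => by rw [add_comm (R.b i j m)]

theorem Γh_metric (i j l : Fin n) :
    R.h i (R.g j l) = ∑ k, R.Γh k i j * R.g k l + ∑ k, R.Γh k i l * R.g k j
      + 2 * R.a i * R.g j l := by
  rw [Γh_g, Γh_g, ← smul_add, R.b_symm i l j,
    show R.b i j l + R.b j i l - R.b l i j + (R.b i j l + R.b l i j - R.b j i l)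
      = (2 : ℝ) • R.b i j l by rw [two_smul]; ring, smul_smul, b]
  norm_num

/-- The metric in the frame, without the factor `t ^ 2`. -/
def gF : Fin n ⊕ Fin 2 → Fin n ⊕ Fin 2 → S :=
  Sum.elim (fun i => Sum.elim (fun j => R.g i j) ![0, 0])
    ![Sum.elim (fun _ => 0) ![0, 1], Sum.elim (fun _ => 0) ![1, 0]]

/-- The derivatives of `log t` along the frame. -/
def wt : Fin n ⊕ Fin 2 → S := Sum.elim (fun i => -R.a i) ![1, 0]

/-- The curvature of the ambient connection in the frame. -/
def fc (a b c d : Fin n ⊕ Fin 2) : S := frameCurv (fun a => R.e a) R.om a b c d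

/-- The covariant derivative of a tensor `t ^ 2 Y` in the frame, without the factor `t ^ 2`. -/
def covF {r : ℕ} (Y : (Fin r → Fin n ⊕ Fin 2) → S) (a : Fin n ⊕ Fin 2)
    (P : Fin r → Fin n ⊕ Fin 2) : S :=
  R.e a (Y P) + 2 * R.wt a * Y P - ∑ s, ∑ c, R.om a (P s) c * Y (Function.update P s c)

/-- The frame components of `∇^m R`, without the factor `t ^ 2`. -/
def Y : (m : ℕ) → (Fin (4 + m) → Fin n ⊕ Fin 2) → S
  | 0 => fun P => ∑ b, R.gF (P 0) b * R.fc b (P 1) (P 2) (P 3)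
  | m + 1 => fun P => R.covF (Y m) (P 0) (Fin.tail P)

/-- A homomorphism of algebras that preserves all data. -/
structure Hom {T : Type} [CommRing T] [Algebra ℝ T] (R : RhoGeo n S) (R' : RhoGeo n T) where
  /-- the underlying homomorphism of algebras -/
  φ : S →ₐ[ℝ] T
  map_d : ∀ i f, φ (R.d i f) = R'.d i (φ f)
  map_dr : ∀ f, φ (R.dr f) = R'.dr (φ f)
  map_ρ : φ R.ρ = R'.ρ
  map_g : ∀ i j, φ (R.g i j) = R'.g i j
  map_gi : ∀ i j, φ (R.gi i j) = R'.gi i j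
  map_a : ∀ i, φ (R.a i) = R'.a i

namespace Hom

variable {R} {T : Type} [CommRing T] [Algebra ℝ T] {R' : RhoGeo n T} (F : Hom R R')

theorem map_h (i : Fin n) (x : S) : F.φ (R.h i x) = R'.h i (F.φ x) := by
  have h2 : F.φ 2 = 2 := map_ofNat F.φ 2
  simp [h_apply, F.map_d, F.map_dr, F.map_ρ, F.map_a, h2]

theorem map_e (a : Fin n ⊕ Fin 2) (x : S) : F.φ (R.e a x) = R'.e a (F.φ x) := by
  obtain ⟨i, rfl⟩ | rfl | rfl := amb_cases a <;> simp [F.map_h, F.map_dr, F.map_ρ]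

theorem map_ψ (i j : Fin n) : F.φ (R.ψ i j) = R'.ψ i j := by
  simp [ψ, f, F.map_h, F.map_dr, F.map_a, F.map_g]

theorem map_ψu (i j : Fin n) : F.φ (R.ψu i j) = R'.ψu i j := by
  simp [ψu, F.map_ψ, F.map_gi]

theorem map_au (i : Fin n) : F.φ (R.au i) = R'.au i := by
  simp [au, F.map_dr, F.map_gi, F.map_a]

theorem map_Γh (k i j : Fin n) : F.φ (R.Γh k i j) = R'.Γh k i j := by
  have h2 : F.φ 2 = 2 := map_ofNat F.φ 2
  simp [Γh, b, F.map_gi, F.map_h, F.map_g, F.map_a, h2]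

theorem map_om (a b c : Fin n ⊕ Fin 2) : F.φ (R.om a b c) = R'.om a b c := by
  have hi : ∀ p : Prop, ∀ [Decidable p], F.φ (if p then 1 else 0) = if p then 1 else 0 := by
    intro p _; split_ifs <;> simp
  have h2 : F.φ 2 = 2 := map_ofNat F.φ 2
  obtain ⟨i, rfl⟩ | rfl | rfl := amb_cases a <;> obtain ⟨j, rfl⟩ | rfl | rfl := amb_cases b <;>
  obtain ⟨k, rfl⟩ | rfl | rfl := amb_cases c <;>
  simp [F.map_ψ, F.map_ψu, F.map_au, F.map_Γh, F.map_dr, F.map_a, F.map_g, F.map_ρ, hi, h2]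

theorem map_fc (a b c d : Fin n ⊕ Fin 2) : F.φ (R.fc a b c d) = R'.fc a b c d := by
  simp [fc, frameCurv, F.map_e, F.map_om]

theorem map_gF (a b : Fin n ⊕ Fin 2) : F.φ (R.gF a b) = R'.gF a b := by
  obtain ⟨i, rfl⟩ | rfl | rfl := amb_cases a <;> obtain ⟨j, rfl⟩ | rfl | rfl := amb_cases b <;>
  simp [gF, F.map_g]

theorem map_wt (a : Fin n ⊕ Fin 2) : F.φ (R.wt a) = R'.wt a := by
  obtain ⟨i, rfl⟩ | rfl | rfl := amb_cases a <;> simp [wt, F.map_a]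

theorem map_Y (m : ℕ) (P : Fin (4 + m) → Fin n ⊕ Fin 2) : F.φ (R.Y m P) = R'.Y m P := by
  induction m with
  | zero => simp [Y, F.map_gF, F.map_fc]
  | succ m ih =>
    have h2 : F.φ 2 = 2 := map_ofNat F.φ 2
    simp [Y, covF, F.map_e, F.map_wt, F.map_om, ih, h2]

end Hom

end RhoGeo

/-- The Weyl-ambient space over a commutative algebra. -/
structure AmbAlg (n : ℕ) (A : Type) [CommRing A] [Algebra ℝ A] extends RhoGeo n A where
  /-- the derivation with respect to `t` -/
  dt : Derivation ℝ A A
  /-- the coordinate `t` -/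
  t : A
  /-- its inverse -/
  ti : A
  t_ti : t * ti = 1
  d_dt : ∀ i f, d i (dt f) = dt (d i f)
  dr_dt : ∀ f, dr (dt f) = dt (dr f)
  d_t : ∀ i, d i t = 0
  dr_t : dr t = 0
  dt_t : dt t = 1
  dt_ρ : dt ρ = 0
  dt_g : ∀ i j, dt (g i j) = 0
  dt_gi : ∀ i j, dt (gi i j) = 0
  dt_a : ∀ i, dt (a i) = 0

namespace AmbAlg

variable {n : ℕ} {A : Type} [CommRing A] [Algebra ℝ A] (M : AmbAlg n A)

/-- All coordinate derivations. -/
def D : Fin n ⊕ Fin 2 → Derivation ℝ A A := Sum.elim M.d ![M.dt, M.dr]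

/-- The frame. -/
def E : Fin n ⊕ Fin 2 → Fin n ⊕ Fin 2 → A :=
  Sum.elim (fun i => Sum.elim (fun j => if i = j then 1 else 0) ![-(M.t * M.a i), 2 * M.ρ * M.a i])
    ![Sum.elim (fun _ => 0) ![M.t, -M.ρ], Sum.elim (fun _ => 0) ![0, 1]]

/-- The inverse of the matrix of the frame. -/
def Ei : Fin n ⊕ Fin 2 → Fin n ⊕ Fin 2 → A :=
  Sum.elim (fun i => Sum.elim (fun j => if i = j then 1 else 0) ![M.a i, -(M.ρ * M.a i)])
    ![Sum.elim (fun _ => 0) ![M.ti, M.ti * M.ρ], Sum.elim (fun _ => 0) ![0, 1]]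

/-- The metric in the frame. -/
def gT : Fin n ⊕ Fin 2 → Fin n ⊕ Fin 2 → A :=
  Sum.elim (fun i => Sum.elim (fun j => M.t ^ 2 * M.g i j) ![0, 0])
    ![Sum.elim (fun _ => 0) ![0, M.t ^ 2], Sum.elim (fun _ => 0) ![M.t ^ 2, 0]]

/-- The inverse metric in the frame. -/
def gFi : Fin n ⊕ Fin 2 → Fin n ⊕ Fin 2 → A :=
  Sum.elim (fun i => Sum.elim (fun j => M.ti ^ 2 * M.gi i j) ![0, 0])
    ![Sum.elim (fun _ => 0) ![0, M.ti ^ 2], Sum.elim (fun _ => 0) ![M.ti ^ 2, 0]]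

/-- The Weyl-ambient metric in coordinates. -/
def G : Fin n ⊕ Fin 2 → Fin n ⊕ Fin 2 → A :=
  Sum.elim
    (fun i => Sum.elim (fun j => M.t ^ 2 * (M.g i j - 2 * M.ρ * M.a i * M.a j))
      ![0, M.t ^ 2 * M.a i])
    ![Sum.elim (fun _ => 0) ![2 * M.ρ, M.t],
      Sum.elim (fun j => M.t ^ 2 * M.a j) ![M.t, 0]]

@[simp] theorem E_hh (i j : Fin n) : M.E (.inl i) (.inl j) = if i = j then 1 else 0 := rfl

@[simp] theorem E_ht (i : Fin n) : M.E (.inl i) (.inr 0) = -(M.t * M.a i) := rfl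

@[simp] theorem E_hr (i : Fin n) : M.E (.inl i) (.inr 1) = 2 * M.ρ * M.a i := rfl

@[simp] theorem E_ph (j : Fin n) : M.E (.inr 0) (.inl j) = 0 := rfl

@[simp] theorem E_pt : M.E (.inr 0) (.inr 0) = M.t := rfl

@[simp] theorem E_pr : M.E (.inr 0) (.inr 1) = -M.ρ := rfl

@[simp] theorem E_mh (j : Fin n) : M.E (.inr 1) (.inl j) = 0 := rfl

@[simp] theorem E_mt : M.E (.inr 1) (.inr 0) = 0 := rfl

@[simp] theorem E_mr : M.E (.inr 1) (.inr 1) = 1 := rfl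

@[simp] theorem gT_hh (i j : Fin n) : M.gT (.inl i) (.inl j) = M.t ^ 2 * M.g i j := rfl

@[simp] theorem gT_h0 (i : Fin n) : M.gT (.inl i) (.inr 0) = 0 := rfl

@[simp] theorem gT_0h (i : Fin n) : M.gT (.inr 0) (.inl i) = 0 := rfl

@[simp] theorem gT_00 : M.gT (.inr 0) (.inr 0) = 0 := rfl

@[simp] theorem gT_01 : M.gT (.inr 0) (.inr 1) = M.t ^ 2 := rfl

@[simp] theorem gT_h1 (i : Fin n) : M.gT (.inl i) (.inr 1) = 0 := rfl

@[simp] theorem gT_1h (i : Fin n) : M.gT (.inr 1) (.inl i) = 0 := rfl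

@[simp] theorem gT_10 : M.gT (.inr 1) (.inr 0) = M.t ^ 2 := rfl

@[simp] theorem gT_11 : M.gT (.inr 1) (.inr 1) = 0 := rfl

theorem E_Ei (a b : Fin n ⊕ Fin 2) : ∑ i, M.E a i * M.Ei i b = if a = b then 1 else 0 := by
  have := M.t_ti
  rcases a with i | a <;> rcases b with j | b
  · simp [E, Ei]
  · fin_cases b <;> simp [E, Ei]
    · linear_combination -M.a i * this
    · linear_combination -M.a i * M.ρ * this
  · fin_cases a <;> simp [E, Ei]
  · fin_cases a <;> fin_cases b <;> simp [E, Ei]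
    · linear_combination this
    · linear_combination M.ρ * this

theorem gT_gFi (a b : Fin n ⊕ Fin 2) : ∑ i, M.gT a i * M.gFi i b = if a = b then 1 else 0 := by
  have h := M.t_ti
  have h2 : M.t ^ 2 * M.ti ^ 2 = 1 := by rw [← mul_pow, h, one_pow]
  rcases a with i | a <;> rcases b with j | b
  · simp only [gT, gFi, Fintype.sum_sum_type, Fin.sum_univ_two, Sum.elim_inl, Sum.elim_inr,
      Matrix.cons_val_zero, Matrix.cons_val_one, mul_zero, add_zero, Sum.inl.injEq]
    rw [← M.g_gi i j]
    exact Finset.sum_congr rfl fun m _ => by linear_combination M.g i m * M.gi m j * h2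
  · fin_cases b <;> simp [gT, gFi]
  · fin_cases a <;> simp [gT, gFi]
  · fin_cases a <;> fin_cases b <;> simp [gT, gFi, h2]

theorem G_eq (I J : Fin n ⊕ Fin 2) :
    M.G I J = ∑ a, ∑ b, M.Ei I a * M.gT a b * M.Ei J b := by
  have h := M.t_ti
  have h2 : M.t ^ 2 * M.ti ^ 2 = 1 := by rw [← mul_pow, h, one_pow]
  rcases I with i | I <;> rcases J with j | J
  · simp [G, Ei, gT]; ring
  · fin_cases J
    · simp [G, Ei, gT]
      ring
    · simp [G, Ei, gT, mul_comm]
  · fin_cases I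
    · simp [G, Ei, gT]
      ring
    · simp [G, Ei, gT]
  · fin_cases I <;> fin_cases J <;> simp [G, Ei, gT]
    · linear_combination -2 * M.ρ * h2
    · linear_combination -M.t * h
    · linear_combination -M.t * h

theorem Ei_E (a b : Fin n ⊕ Fin 2) : ∑ i, M.Ei a i * M.E i b = if a = b then 1 else 0 := by
  have h1 : Matrix.of M.E * Matrix.of M.Ei = 1 := by
    ext i j; rw [Matrix.mul_apply, Matrix.one_apply]; exact M.E_Ei i j
  have h2 := mul_eq_one_comm.1 h1
  have := congrFun (congrFun h2 a) b
  rwa [Matrix.mul_apply, Matrix.one_apply] at this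

theorem G_symm (I J : Fin n ⊕ Fin 2) : M.G I J = M.G J I := by
  rcases I with i | I <;> rcases J with j | J
  · simp [G, M.g_symm i j]; ring
  · fin_cases J <;> simp [G]
  · fin_cases I <;> simp [G]
  · fin_cases I <;> fin_cases J <;> simp [G]

/-- The inverse ambient metric in coordinates. -/
def Gi (I J : Fin n ⊕ Fin 2) : A := ∑ a, ∑ b, M.E a I * M.gFi a b * M.E b J

theorem matrix_G : Matrix.of M.G = Matrix.of M.Ei * Matrix.of M.gT * (Matrix.of M.Ei).transpose := by
  ext I J
  simp only [Matrix.mul_apply, Matrix.of_apply, Matrix.transpose_apply, G_eq, Finset.sum_mul]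
  exact Finset.sum_comm

theorem matrix_Gi :
    Matrix.of M.Gi = (Matrix.of M.E).transpose * Matrix.of M.gFi * Matrix.of M.E := by
  ext I J
  simp only [Matrix.mul_apply, Matrix.of_apply, Matrix.transpose_apply, Gi, Finset.sum_mul]
  exact Finset.sum_comm

theorem matrix_E_Ei : Matrix.of M.E * Matrix.of M.Ei = 1 := by
  ext i j; rw [Matrix.mul_apply, Matrix.one_apply]; exact M.E_Ei i j

theorem G_Gi (I J : Fin n ⊕ Fin 2) : ∑ K, M.G I K * M.Gi K J = if I = J then 1 else 0 := by
  have h1 := M.matrix_E_Ei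
  have h2 := mul_eq_one_comm.1 h1
  have h3 : Matrix.of M.gT * Matrix.of M.gFi = 1 := by
    ext i j; rw [Matrix.mul_apply, Matrix.one_apply]; exact M.gT_gFi i j
  have h4 : (Matrix.of M.Ei).transpose * (Matrix.of M.E).transpose = 1 := by
    rw [← Matrix.transpose_mul, h1, Matrix.transpose_one]
  have : Matrix.of M.G * Matrix.of M.Gi = 1 := by
    rw [matrix_G, matrix_Gi]
    calc _ = Matrix.of M.Ei * Matrix.of M.gT * ((Matrix.of M.Ei).transpose
          * (Matrix.of M.E).transpose) * Matrix.of M.gFi * Matrix.of M.E := by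
          simp only [Matrix.mul_assoc]
      _ = Matrix.of M.Ei * (Matrix.of M.gT * Matrix.of M.gFi) * Matrix.of M.E := by
          rw [h4, Matrix.mul_one]; simp only [Matrix.mul_assoc]
      _ = 1 := by rw [h3, Matrix.mul_one, h2]
  have := congrFun (congrFun this I) J
  rwa [Matrix.mul_apply, Matrix.one_apply] at this

theorem frame_metric (a b : Fin n ⊕ Fin 2) :
    ∑ i, ∑ j, M.G i j * M.E a i * M.E b j = M.gT a b := by
  have h4 : (Matrix.of M.Ei).transpose * (Matrix.of M.E).transpose = 1 := by
    rw [← Matrix.transpose_mul, matrix_E_Ei, Matrix.transpose_one]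
  have : Matrix.of M.E * Matrix.of M.G * (Matrix.of M.E).transpose = Matrix.of M.gT := by
    rw [matrix_G]
    calc _ = (Matrix.of M.E * Matrix.of M.Ei) * Matrix.of M.gT * ((Matrix.of M.Ei).transpose
          * (Matrix.of M.E).transpose) := by simp only [Matrix.mul_assoc]
      _ = _ := by rw [matrix_E_Ei, h4, Matrix.one_mul, Matrix.mul_one]
  have := congrFun (congrFun this a) b
  simp only [Matrix.mul_apply, Matrix.of_apply, Matrix.transpose_apply, Finset.sum_mul] at this
  rw [← this, Finset.sum_comm]
  exact Finset.sum_congr rfl fun i _ => Finset.sum_congr rfl fun j _ => by ring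

/-- The coefficient of `t ∂_t` in the frame vectors. -/
def wtT : Fin n ⊕ Fin 2 → A := Sum.elim (fun i => -M.a i) ![1, 0]

theorem frameD_eq (a : Fin n ⊕ Fin 2) (x : A) :
    frameD M.D M.E a x = M.e a x + M.wtT a * (M.t * M.dt x) := by
  rw [frameD_apply]
  rcases a with i | a
  · simp [D, E, RhoGeo.e, RhoGeo.h_apply, wtT]; ring
  · fin_cases a <;> simp [D, E, RhoGeo.e, wtT]
    ring

theorem e_t (a : Fin n ⊕ Fin 2) : M.e a M.t = 0 := by
  rcases a with i | a
  · simp [RhoGeo.e, RhoGeo.h_apply, M.d_t, M.dr_t]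
  · fin_cases a <;> simp [RhoGeo.e, M.dr_t]

theorem frameD_t (a : Fin n ⊕ Fin 2) : frameD M.D M.E a M.t = M.wtT a * M.t := by
  rw [frameD_eq, e_t, M.dt_t]; ring

@[simp] theorem wtT_h (i : Fin n) : M.wtT (.inl i) = -M.a i := rfl

@[simp] theorem wtT_p : M.wtT (.inr 0) = 1 := rfl

@[simp] theorem wtT_m : M.wtT (.inr 1) = 0 := rfl

theorem frameD_a (a : Fin n ⊕ Fin 2) (i : Fin n) : frameD M.D M.E a (M.a i) = M.e a (M.a i) := by
  rw [frameD_eq, M.dt_a]; ring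

theorem frameD_g (a : Fin n ⊕ Fin 2) (i j : Fin n) :
    frameD M.D M.E a (M.g i j) = M.e a (M.g i j) := by
  rw [frameD_eq, M.dt_g]; ring

theorem frameD_ρ (a : Fin n ⊕ Fin 2) : frameD M.D M.E a M.ρ = M.e a M.ρ := by
  rw [frameD_eq, M.dt_ρ]; ring

theorem frameD_ite (a : Fin n ⊕ Fin 2) (p : Prop) [Decidable p] :
    frameD M.D M.E a (if p then 1 else 0) = 0 := by
  split_ifs <;> simp

theorem frameD_two (a : Fin n ⊕ Fin 2) : frameD M.D M.E a 2 = 0 := by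
  have := (frameD M.D M.E a).map_natCast 2
  simpa using this

theorem frame_torsion (a b k : Fin n ⊕ Fin 2) :
    frameD M.D M.E a (M.E b k) - frameD M.D M.E b (M.E a k)
      = ∑ c, (M.om a b c - M.om b a c) * M.E c k := by
  have hψ : ∀ i j, M.h i (M.a j) - M.h j (M.a i) = M.ψ i j - M.ψ j i :=
    fun i j => (M.ψ_sub i j).symm
  have hΓ : ∀ i j k, M.Γh k i j - M.Γh k j i = 0 := fun i j k => by rw [M.Γh_symm, sub_self]
  obtain ⟨i, rfl⟩ | rfl | rfl := amb_cases a <;> obtain ⟨j, rfl⟩ | rfl | rfl := amb_cases b <;>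
  obtain ⟨k, rfl⟩ | rfl | rfl := amb_cases k <;>
  simp [frameD_t, frameD_a, frameD_ρ, frameD_ite, frameD_two, M.dr_ρ, Derivation.leibniz, hΓ]
  case inl.inl.inr.inl => linear_combination -M.t * hψ i j
  case inl.inl.inr.inr => linear_combination 2 * M.ρ * hψ i j + M.g_symm i j
  all_goals ring

theorem frame_compat (a b c : Fin n ⊕ Fin 2) :
    frameD M.D M.E a (M.gT b c) = ∑ f, M.om a b f * M.gT f c + ∑ f, M.om a c f * M.gT b f := by
  have pull : ∀ (u : Fin n → A) (k : Fin n) (v : A), ∑ x, u x * M.g x k = v →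
      ∑ x, u x * (M.t ^ 2 * M.g x k) = M.t ^ 2 * v ∧
      ∑ x, u x * (M.t ^ 2 * M.g k x) = M.t ^ 2 * v := by
    intro u k v hv
    have h1 : ∑ x, u x * (M.t ^ 2 * M.g x k) = M.t ^ 2 * v := by
      rw [← hv, Finset.mul_sum]
      exact Finset.sum_congr rfl fun x _ => by ring
    exact ⟨h1, by simpa only [M.g_symm k] using h1⟩
  have p1 := fun i j => pull _ _ _ (M.ψu_g i j)
  have p2 := fun j => pull _ _ _ (M.au_g j)
  have p3 := fun i j l => pull _ _ _ (M.Γh_g i j l)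
  obtain ⟨i, rfl⟩ | rfl | rfl := amb_cases a <;> obtain ⟨j, rfl⟩ | rfl | rfl := amb_cases b <;>
  obtain ⟨k, rfl⟩ | rfl | rfl := amb_cases c <;>
  simp [frameD_t, frameD_g, Derivation.leibniz, Derivation.leibniz_pow, sub_mul, mul_assoc,
    ← Finset.mul_sum, fun i j => (p1 i j).1, fun i j => (p1 i j).2, fun j => (p2 j).1,
    fun j => (p2 j).2, fun i j l => (p3 i j l).1, fun i j l => (p3 i j l).2]
  case inl.inl.inl =>
    have h1 := M.Γh_metric i j k
    rw [RhoGeo.Γh_g, RhoGeo.Γh_g] at h1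
    have h2 := congrArg (M.t ^ 2 * ·) h1
    simp only [one_div, mul_add, mul_smul_comm] at h2
    linear_combination h2
  case inl.inl.inr.inl i j => linear_combination -M.t ^ 2 * M.g_symm j i
  case inr.inl.inl.inl j k =>
    linear_combination M.ρ * M.t ^ 2 * M.ψ_add j k
  case inr.inr.inl.inl j k => linear_combination -M.t ^ 2 * M.ψ_add j k
  all_goals ring

/-- The Levi-Civita connection of the ambient metric. -/
def LC : Fin n ⊕ Fin 2 → Fin n ⊕ Fin 2 → Fin n ⊕ Fin 2 → A := lcCoeff M.D M.G M.Gi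

theorem frameNab_LC (a b k : Fin n ⊕ Fin 2) :
    frameNab M.D M.LC M.E a b k = ∑ c, M.om a b c * M.E c k := by
  refine frameNab_eq M.G_symm M.G_Gi M.Ei_E M.frame_torsion ?_ a b k
  intro a b c
  simp only [frame_metric]
  exact M.frame_compat a b c

theorem dt_h (i : Fin n) (x : A) : M.dt (M.h i x) = M.h i (M.dt x) := by
  have h2 : M.dt 2 = 0 := by simpa using M.dt.map_natCast 2
  simp [RhoGeo.h_apply, Derivation.leibniz, M.d_dt, M.dr_dt, M.dt_ρ, M.dt_a, h2]

theorem dt_e (a : Fin n ⊕ Fin 2) (x : A) : M.dt (M.e a x) = M.e a (M.dt x) := by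
  obtain ⟨i, rfl⟩ | rfl | rfl := amb_cases a <;>
    simp [M.dt_h, M.dr_dt, Derivation.leibniz, M.dt_ρ]

theorem dt_ψ (i j : Fin n) : M.dt (M.ψ i j) = 0 := by
  simp [RhoGeo.ψ, RhoGeo.f, M.dt_h, M.dt_a, M.dt_g, ← M.dr_dt]

theorem dt_ψu (i j : Fin n) : M.dt (M.ψu i j) = 0 := by
  simp [RhoGeo.ψu, Derivation.leibniz, dt_ψ, M.dt_gi]

theorem dt_au (i : Fin n) : M.dt (M.au i) = 0 := by
  simp [RhoGeo.au, Derivation.leibniz, M.dt_a, M.dt_gi, ← M.dr_dt]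

theorem dt_Γh (k i j : Fin n) : M.dt (M.Γh k i j) = 0 := by
  have h2 : M.dt 2 = 0 := by simpa using M.dt.map_natCast 2
  simp [RhoGeo.Γh, RhoGeo.b, Derivation.leibniz, M.dt_a, M.dt_gi, M.dt_g, M.dt_h, h2]

theorem dt_om (a b c : Fin n ⊕ Fin 2) : M.dt (M.om a b c) = 0 := by
  have hi : ∀ p : Prop, ∀ [Decidable p], M.dt (if p then 1 else 0) = 0 := by
    intro p _; split_ifs <;> simp
  have h2 : M.dt 2 = 0 := by simpa using M.dt.map_natCast 2
  obtain ⟨i, rfl⟩ | rfl | rfl := amb_cases a <;> obtain ⟨j, rfl⟩ | rfl | rfl := amb_cases b <;>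
  obtain ⟨k, rfl⟩ | rfl | rfl := amb_cases c <;>
  simp [dt_ψ, dt_ψu, dt_au, dt_Γh, ← M.dr_dt, M.dt_a, M.dt_g, M.dt_ρ, hi, Derivation.leibniz,
    Derivation.leibniz_pow, h2]

theorem frameCurv_LC (a b c d : Fin n ⊕ Fin 2) :
    frameCurv (fun a => frameD M.D M.E a) M.om a b c d = M.fc a b c d := by
  simp [RhoGeo.fc, frameCurv, frameD_eq, dt_om]

theorem dt_fc (a b c d : Fin n ⊕ Fin 2) : M.dt (M.fc a b c d) = 0 := by
  simp [RhoGeo.fc, frameCurv, dt_om, dt_e, Derivation.leibniz]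

theorem dt_gF (a b : Fin n ⊕ Fin 2) : M.dt (M.gF a b) = 0 := by
  obtain ⟨i, rfl⟩ | rfl | rfl := amb_cases a <;> obtain ⟨j, rfl⟩ | rfl | rfl := amb_cases b <;>
  simp [RhoGeo.gF, M.dt_g]

theorem dt_wt (a : Fin n ⊕ Fin 2) : M.dt (M.wt a) = 0 := by
  obtain ⟨i, rfl⟩ | rfl | rfl := amb_cases a <;> simp [RhoGeo.wt, M.dt_a]

theorem dt_Y (m : ℕ) (P : Fin (4 + m) → Fin n ⊕ Fin 2) : M.dt (M.Y m P) = 0 := by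
  have h2 : M.dt 2 = 0 := by simpa using M.dt.map_natCast 2
  induction m with
  | zero => simp [RhoGeo.Y, Derivation.leibniz, dt_gF, dt_fc]
  | succ m ih =>
    simp [RhoGeo.Y, RhoGeo.covF, Derivation.leibniz, dt_e, dt_wt, dt_om, ih, h2]

theorem D_comm (I J : Fin n ⊕ Fin 2) (x : A) : M.D I (M.D J x) = M.D J (M.D I x) := by
  obtain ⟨i, rfl⟩ | rfl | rfl := amb_cases I <;> obtain ⟨j, rfl⟩ | rfl | rfl := amb_cases J <;>
  simp [D, M.d_comm, M.d_dr, M.d_dt, M.dr_dt]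

theorem LC_symm (k i j : Fin n ⊕ Fin 2) : M.LC k i j = M.LC k j i := lcCoeff_symm M.G_symm k i j

theorem frame_curv (b c e k : Fin n ⊕ Fin 2) :
    ∑ j, ∑ l, ∑ m, curv M.D M.LC k j l m * M.E b j * M.E c l * M.E e m
      = ∑ a, M.fc a b c e * M.E a k := by
  rw [frameCurv_eq M.D_comm M.LC_symm M.frameNab_LC]
  simp only [frameCurv_LC]

/-- The Ricci tensor in coordinates. -/
def ric (I J : Fin n ⊕ Fin 2) : A := ∑ K, curv M.D M.LC K I K J

theorem frame_ric (b e : Fin n ⊕ Fin 2) :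
    ∑ I, ∑ J, M.ric I J * M.E b I * M.E e J = ∑ a, M.fc a b a e := by
  have h1 : ∀ a, ∑ k, M.Ei k a * ∑ f, M.fc f b a e * M.E f k = M.fc a b a e := by
    intro a
    simp only [Finset.mul_sum]
    rw [Finset.sum_comm]
    have : ∀ f, ∑ k, M.Ei k a * (M.fc f b a e * M.E f k)
        = (if f = a then 1 else 0) * M.fc f b a e := by
      intro f
      rw [← M.E_Ei f a, Finset.sum_mul]
      exact Finset.sum_congr rfl fun k _ => by ring
    simp [this]
  have h2 : ∑ a, M.fc a b a e = ∑ k, ∑ l, (∑ a, M.Ei k a * M.E a l)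
      * ∑ j, ∑ m, curv M.D M.LC k j l m * M.E b j * M.E e m := by
    simp only [← h1, ← frame_curv, Finset.mul_sum, Finset.sum_mul]
    rw [Finset.sum_comm]
    refine Finset.sum_congr rfl fun k _ => ?_
    rw [Finset.sum_congr rfl fun a _ => sum3_rotate (f := fun j l m => M.Ei k a *
      (curv M.D M.LC k j l m * M.E b j * M.E a l * M.E e m))]
    rw [Finset.sum_comm]
    refine Finset.sum_congr rfl fun l _ => ?_
    rw [Finset.sum_congr rfl fun a _ => Finset.sum_comm]
    conv_rhs => rw [sum3_rotate]
    conv_rhs => rw [sum3_rotate]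
    exact Finset.sum_congr rfl fun a _ => Finset.sum_congr rfl fun j _ =>
      Finset.sum_congr rfl fun m _ => by ring
  rw [h2]
  simp only [Ei_E, ric, Finset.sum_mul]
  simp only [ite_mul, one_mul, zero_mul, Finset.sum_ite_eq, Finset.mem_univ, if_true]
  rw [sum3_rotate, sum3_rotate]

end AmbAlg

end

end WeylAmbient

namespace WeylAmbient

noncomputable section

open PowerSeries in
/-- The Taylor expansions in `ρ` of a metric and a Weyl connection, over an algebra of functions on
the boundary. -/
structure Expansion (n : ℕ) (A : Type) [CommRing A] [Algebra ℝ A] extends Geo n A where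
  /-- the metric `γ_{ij}` as a power series in `ρ` -/
  γ : Fin n → Fin n → A⟦X⟧
  /-- its inverse -/
  γi : Fin n → Fin n → A⟦X⟧
  γ_symm : ∀ i j, γ i j = γ j i
  γi_symm : ∀ i j, γi i j = γi j i
  γ_γi : ∀ i j, ∑ m, γ i m * γi m j = if i = j then 1 else 0
  coeff_zero_γ : ∀ i j, coeff 0 (γ i j) = g i j

namespace Expansion

open PowerSeries

variable {n : ℕ} {A : Type} [CommRing A] [Algebra ℝ A] (B : Expansion n A)

/-- The underlying `ρ`-dependent geometry. -/
def rho : RhoGeo n A⟦X⟧ where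
  d i := liftD (B.d i)
  dr := dX
  ρ := X
  d_comm i j f := liftD_comm (B.d_comm i j) f
  d_dr _ f := liftD_dX _ f
  d_ρ _ := liftD_X _
  dr_ρ := dX_X
  g := B.γ
  gi := B.γi
  g_symm := B.γ_symm
  gi_symm := B.γi_symm
  g_gi := B.γ_γi
  a i := PowerSeries.mk fun l => B.a l i

/-- The Ricci tensor of the ambient metric vanishes to the order `k`. -/
def IsFlat (k : ℕ) : Prop :=
  (∀ i j, (X : A⟦X⟧) ^ k ∣ ∑ c, B.rho.fc c (.inl i) c (.inl j)) ∧
  (∀ b e, (X : A⟦X⟧) ^ (k - 1) ∣ ∑ c, B.rho.fc c b c e)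

end Expansion

namespace AmbAlg

variable {n : ℕ} {A : Type} [CommRing A] [Algebra ℝ A] (M : AmbAlg n A)

/-- The Riemann tensor in coordinates. -/
def riemLow (I : Fin 4 → Fin n ⊕ Fin 2) : A :=
  ∑ m, M.G (I 0) m * curv M.D M.LC m (I 1) (I 2) (I 3)

/-- The iterated covariant derivatives of the Riemann tensor in coordinates. -/
def iterD : (m : ℕ) → (Fin (4 + m) → Fin n ⊕ Fin 2) → A
  | 0 => M.riemLow
  | m + 1 => fun I => cov M.D M.LC (fun _ => 0) 0 (iterD m) (I 0) (Fin.tail I)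

theorem frameT_succ {r : ℕ} (E : Fin n ⊕ Fin 2 → Fin n ⊕ Fin 2 → A)
    (T : (Fin (r + 1) → Fin n ⊕ Fin 2) → A) (P : Fin (r + 1) → Fin n ⊕ Fin 2) :
    frameT E T P = ∑ i, E (P 0) i * frameT E (fun I => T (Fin.cons i I)) (Fin.tail P) := by
  rw [frameT, ← (Fin.consEquiv fun _ => Fin n ⊕ Fin 2).sum_comp, Fintype.sum_prod_type]
  refine Finset.sum_congr rfl fun i _ => ?_
  rw [frameT, Finset.mul_sum]
  refine Finset.sum_congr rfl fun I _ => ?_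
  rw [Fin.prod_univ_succ]
  simp only [Fin.consEquiv_apply, Fin.cons_zero, Fin.cons_succ, Fin.tail]
  change T (Fin.cons i I) * _ = _
  ring

theorem frameT_zero (E : Fin n ⊕ Fin 2 → Fin n ⊕ Fin 2 → A)
    (T : (Fin 0 → Fin n ⊕ Fin 2) → A) (P : Fin 0 → Fin n ⊕ Fin 2) :
    frameT E T P = T Fin.elim0 := by
  rw [frameT, Fintype.sum_eq_single Fin.elim0 fun x hx => absurd (Subsingleton.elim _ _) hx]
  simp

theorem gT_eq (a b : Fin n ⊕ Fin 2) : M.gT a b = M.t ^ 2 * M.gF a b := by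
  obtain ⟨i, rfl⟩ | rfl | rfl := amb_cases a <;> obtain ⟨j, rfl⟩ | rfl | rfl := amb_cases b <;>
  simp [RhoGeo.gF]

theorem frameT_riemLow (P : Fin 4 → Fin n ⊕ Fin 2) :
    frameT M.E M.riemLow P = M.t ^ 2 * M.Y 0 P := by
  have h1 : frameT M.E M.riemLow P = ∑ i, ∑ j, ∑ l, ∑ p, ∑ m,
      M.E (P 0) i * (M.G i m * (curv M.D M.LC m j l p * M.E (P 1) j * M.E (P 2) l * M.E (P 3) p)) := by
    rw [frameT_succ]
    refine Finset.sum_congr rfl fun i _ => ?_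
    rw [frameT_succ, Finset.mul_sum]
    refine Finset.sum_congr rfl fun j _ => ?_
    rw [frameT_succ, Finset.mul_sum, Finset.mul_sum]
    refine Finset.sum_congr rfl fun l _ => ?_
    rw [frameT_succ, Finset.mul_sum, Finset.mul_sum, Finset.mul_sum]
    refine Finset.sum_congr rfl fun p _ => ?_
    rw [frameT_zero, riemLow, Finset.mul_sum, Finset.mul_sum, Finset.mul_sum, Finset.mul_sum]
    refine Finset.sum_congr rfl fun m _ => ?_
    change M.E (P 0) i * (M.E (P 1) j * (M.E (P 2) l * (M.E (P 3) p *
      (M.G i m * curv M.D M.LC m j l p)))) = _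
    ring
  have h2 : ∀ i, ∑ j, ∑ l, ∑ p, ∑ m,
      M.E (P 0) i * (M.G i m * (curv M.D M.LC m j l p * M.E (P 1) j * M.E (P 2) l * M.E (P 3) p))
      = ∑ m, M.E (P 0) i * (M.G i m * ∑ a, M.fc a (P 1) (P 2) (P 3) * M.E a m) := by
    intro i
    simp only [← frame_curv, Finset.mul_sum]
    rw [Finset.sum_congr rfl fun j _ => sum3_reverse]
    rw [Finset.sum_comm]
    refine Finset.sum_congr rfl fun m _ => Finset.sum_congr rfl fun j _ => ?_
    rw [Finset.sum_comm]
  rw [h1, Finset.sum_congr rfl fun i _ => h2 i]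
  change _ = M.t ^ 2 * ∑ b, M.gF (P 0) b * M.fc b (P 1) (P 2) (P 3)
  simp only [Finset.mul_sum, ← mul_assoc, ← gT_eq, ← frame_metric, Finset.sum_mul]
  rw [sum3_rotate, sum3_rotate]
  refine Finset.sum_congr rfl fun a _ => Finset.sum_congr rfl fun i _ =>
    Finset.sum_congr rfl fun m _ => by ring

theorem frameT_iterD (m : ℕ) (P : Fin (4 + m) → Fin n ⊕ Fin 2) :
    frameT M.E (M.iterD m) P = M.t ^ 2 * M.Y m P := by
  induction m with
  | zero => exact M.frameT_riemLow P
  | succ m ih =>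
    have h := frameT_cov M.frameNab_LC (M.iterD m) (P 0) (Fin.tail P)
    have h0 : frameT M.E (M.iterD (m + 1)) P = ∑ i, M.E (P 0) i *
        frameT M.E (cov M.D M.LC (fun _ => 0) 0 (M.iterD m) i) (Fin.tail P) :=
      frameT_succ M.E (M.iterD (m + 1)) P
    rw [h0, h, frameCov]
    change _ = M.t ^ 2 * M.covF (M.Y m) (P 0) (Fin.tail P)
    simp only [ih, RhoGeo.covF, Derivation.leibniz, Derivation.leibniz_pow, frameD_eq,
      dt_Y, smul_eq_mul, mul_zero, add_zero, mul_sub, mul_add, Finset.mul_sum]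
    have hw : M.wt (P 0) = M.wtT (P 0) := rfl
    rw [hw]
    congr 1
    · simp only [nsmul_eq_mul, e_t, M.dt_t]; push_cast; ring
    · exact Finset.sum_congr rfl fun s _ => Finset.sum_congr rfl fun c _ => by ring

end AmbAlg

end

end WeylAmbient

namespace WeylAmbient

noncomputable section

section Coordinates

open TopologicalSpace (Opens)

variable {ι : Type} [Fintype ι] [DecidableEq ι] {U : Opens (ι → ℝ)}

theorem pd_coord (i j : ι) (x : ι → ℝ) : pd i (fun y => y j) x = if i = j then 1 else 0 := by
  rw [pd, (hasFDerivAt_apply j x).fderiv]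
  simp [Pi.single_apply, eq_comm]

theorem pd_comp_eq_zero {E : Type*} [NormedAddCommGroup E] [NormedSpace ℝ E] {F : E → ℝ}
    (L : (ι → ℝ) →L[ℝ] E) (i : ι) (hL : L (Pi.single i 1) = 0) {x : ι → ℝ}
    (hF : DifferentiableAt ℝ F (L x)) : pd i (fun y => F (L y)) x = 0 := by
  have := (hF.hasFDerivAt.comp x L.hasFDerivAt).fderiv
  rw [pd]
  change (fderiv ℝ (F ∘ L) x) _ = 0
  rw [this]
  simp [hL]

theorem derivation_inverse_eq_zero {A : Type} [CommRing A] [Algebra ℝ A] {κ : Type} [Fintype κ]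
    [DecidableEq κ] {G Gi : κ → κ → A}
    (h : ∀ i j, ∑ m, G i m * Gi m j = if i = j then 1 else 0) (D : Derivation ℝ A A)
    (hD : ∀ i j, D (G i j) = 0) (i j : κ) : D (Gi i j) = 0 := by
  have h1 : ∀ i j, ∑ m, G i m * D (Gi m j) = 0 := by
    intro i j
    have := congrArg D (h i j)
    rw [map_sum] at this
    simp only [Derivation.leibniz, hD, smul_eq_mul, mul_zero, add_zero] at this
    rw [this]
    split_ifs <;> simp
  have h2 : ∀ i j, ∑ m, Gi i m * G m j = if i = j then 1 else 0 := by
    have e1 : Matrix.of G * Matrix.of Gi = 1 := by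
      ext i j; rw [Matrix.mul_apply, Matrix.one_apply]; exact h i j
    have e2 := mul_eq_one_comm.1 e1
    intro i j
    have := congrFun (congrFun e2 i) j
    rwa [Matrix.mul_apply, Matrix.one_apply] at this
  calc D (Gi i j) = ∑ l, (∑ m, Gi i m * G m l) * D (Gi l j) := by simp [h2]
    _ = ∑ m, Gi i m * ∑ l, G m l * D (Gi l j) := by
      simp only [Finset.sum_mul, Finset.mul_sum]
      rw [Finset.sum_comm]
      simp only [mul_assoc]
    _ = 0 := by simp [h1]

end Coordinates

namespace AmbientData

open TopologicalSpace (Opens)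

variable {n : ℕ} {D : AmbientData n} {O : Set ((Fin n → ℝ) × ℝ)}

/-- The projection `(t, x, ρ) ↦ (x, ρ)`. -/
def proj (n : ℕ) : (Fin n ⊕ Fin 2 → ℝ) →L[ℝ] (Fin n → ℝ) × ℝ :=
  (ContinuousLinearMap.pi fun i => ContinuousLinearMap.proj (Sum.inl i)).prod
    (ContinuousLinearMap.proj (Sum.inr 1))

theorem proj_point (t : ℝ) (x : Fin n → ℝ) (ρ : ℝ) : proj n (point t x ρ) = (x, ρ) := by
  simp [proj, point]

/-- The domain of the ambient metric. -/
def dom (hO : IsOpen O) : Opens (Fin n ⊕ Fin 2 → ℝ) where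
  carrier := {p | 0 < p (Sum.inr 0) ∧ proj n p ∈ O}
  is_open' := (isOpen_lt continuous_const (continuous_apply _)).inter
    (hO.preimage (proj n).continuous)

/-- The domain of the boundary data. -/
def bdom (hO : IsOpen O) : Opens (Fin n → ℝ) where
  carrier := {x | (x, (0 : ℝ)) ∈ O}
  is_open' := hO.preimage (by fun_prop)

theorem point_mem (hO : IsOpen O) {t : ℝ} (ht : 0 < t) {x : Fin n → ℝ} {ρ : ℝ} (h : (x, ρ) ∈ O) :
    point t x ρ ∈ dom hO := by
  refine ⟨ht, ?_⟩
  rw [proj_point]; exact h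

variable (h : D.IsRegularOn O)

/-- The pull-back of a function of `(x, ρ)`. -/
def pull (hO : IsOpen O) (F : (Fin n → ℝ) × ℝ → ℝ) (hF : ContDiffOn ℝ ∞ F O) :
    SmoothFn (dom hO) :=
  SmoothFn.ofFun (fun p => F (proj n p)) (hF.comp (proj n).contDiff.contDiffOn fun _ hp => hp.2)

theorem pderiv_pull (hO : IsOpen O) (F : (Fin n → ℝ) × ℝ → ℝ) (hF : ContDiffOn ℝ ∞ F O) :
    SmoothFn.pderiv (Sum.inr 0) (pull hO F hF) = 0 := by
  refine SmoothFn.ext_ev fun x => ?_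
  rw [SmoothFn.pderiv_eq_pd (Sum.inr 0) _ (fun p => F (proj n p)) (fun _ => rfl)]
  refine pd_comp_eq_zero (proj n) _ ?_ ?_
  · ext i <;> simp [proj]
  · exact (hF.contDiffAt (hO.mem_nhds x.2.2)).differentiableAt (by simp)

/-- A coordinate function. -/
def coordFn (hO : IsOpen O) (I : Fin n ⊕ Fin 2) : SmoothFn (dom hO) :=
  SmoothFn.ofFun (fun p => p I) (contDiff_apply ℝ ℝ I).contDiffOn

theorem pderiv_coordFn (hO : IsOpen O) (I J : Fin n ⊕ Fin 2) :
    SmoothFn.pderiv I (coordFn hO J) = if I = J then 1 else 0 := by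
  refine SmoothFn.ext_ev fun x => ?_
  rw [SmoothFn.pderiv_eq_pd I _ (fun p => p J) (fun _ => rfl), pd_coord]
  split_ifs <;> rfl

/-- `γ_{ij}` as a smooth function on the ambient space. -/
def gamS (i j : Fin n) : SmoothFn (dom h.1) := pull h.1 _ (h.2.1 i j)

theorem gamS_symm (i j : Fin n) : gamS h i j = gamS h j i :=
  SmoothFn.ext_ev fun p => (h.2.2.2.1 _ p.2.2).apply j i

theorem exists_gamI :
    ∃ Gi : Fin n → Fin n → SmoothFn (dom h.1),
      ∀ i j, ∑ m, gamS h i m * Gi m j = if i = j then 1 else 0 :=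
  exists_inverse (gamS h) fun p => h.2.2.2.2 _ p.2.2

/-- The Weyl-ambient space over the algebra of smooth functions. -/
def amb : AmbAlg n (SmoothFn (dom h.1)) where
  d i := SmoothFn.pderiv (Sum.inl i)
  dr := SmoothFn.pderiv (Sum.inr 1)
  dt := SmoothFn.pderiv (Sum.inr 0)
  ρ := coordFn h.1 (Sum.inr 1)
  t := coordFn h.1 (Sum.inr 0)
  ti := SmoothFn.ofFun (fun p => (p (Sum.inr 0))⁻¹)
    ((contDiff_apply ℝ ℝ _).contDiffOn.inv fun _ hp => hp.1.ne')
  d_comm _ _ := SmoothFn.pderiv_comm _ _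
  d_dr _ := SmoothFn.pderiv_comm _ _
  d_dt _ := SmoothFn.pderiv_comm _ _
  dr_dt := SmoothFn.pderiv_comm _ _
  d_ρ _ := by simp [pderiv_coordFn]
  dr_ρ := by simp [pderiv_coordFn]
  d_t _ := by simp [pderiv_coordFn]
  dr_t := by simp [pderiv_coordFn]
  dt_t := by simp [pderiv_coordFn]
  dt_ρ := by simp [pderiv_coordFn]
  t_ti := SmoothFn.ext_ev fun p => mul_inv_cancel₀ p.2.1.ne'
  g := gamS h
  gi := (exists_gamI h).choose
  g_symm := gamS_symm h
  gi_symm := inverse_symm (gamS_symm h) (exists_gamI h).choose_spec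
  g_gi := (exists_gamI h).choose_spec
  a i := pull h.1 _ (h.2.2.1 i)
  dt_g _ _ := pderiv_pull _ _ _
  dt_gi := derivation_inverse_eq_zero (exists_gamI h).choose_spec _
    fun _ _ => pderiv_pull _ _ _
  dt_a _ := pderiv_pull _ _ _

theorem amb_D : (amb h).D = SmoothFn.pderiv := by
  funext I
  obtain ⟨i, rfl⟩ | rfl | rfl := amb_cases I <;> rfl

theorem amb_G (p : dom h.1) (I J : Fin n ⊕ Fin 2) :
    D.ambientMetric p I J = SmoothFn.evalAt p ((amb h).G I J) := by
  obtain ⟨i, rfl⟩ | rfl | rfl := amb_cases I <;> obtain ⟨j, rfl⟩ | rfl | rfl := amb_cases J <;> rfl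

theorem amb_LC (p : dom h.1) (k i j : Fin n ⊕ Fin 2) :
    christoffel D.ambientMetric p k i j = SmoothFn.evalAt p ((amb h).LC k i j) := by
  rw [christoffel_eq (amb_G h) (amb h).G_Gi, AmbAlg.LC, amb_D]

theorem amb_ric (p : dom h.1) (I J : Fin n ⊕ Fin 2) :
    D.ambientRicci p I J = SmoothFn.evalAt p ((amb h).ric I J) := by
  rw [ambientRicci, ricci, AmbAlg.ric, map_sum, amb_D]
  exact Finset.sum_congr rfl fun K _ => curvature_eq (amb_LC h) p K I K J

theorem amb_iterD (m : ℕ) (p : dom h.1) (I : Fin (4 + m) → Fin n ⊕ Fin 2) :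
    iterDRiemann D.ambientMetric m p I = SmoothFn.evalAt p ((amb h).iterD m I) := by
  induction m generalizing p with
  | zero =>
    change riemannLow _ _ _ = _
    rw [riemannLow, AmbAlg.iterD, AmbAlg.riemLow, map_sum, amb_D]
    exact Finset.sum_congr rfl fun K _ => by
      rw [map_mul, ← amb_G, curvature_eq (amb_LC h)]
  | succ m ih =>
    have := covDeriv_eq (a := fun _ _ => 0) (a' := fun _ => 0) (amb_LC h)
      (fun _ _ => (map_zero _).symm) (fun q J => ih q J) 0 p I
    rw [AmbAlg.iterD, amb_D]
    exact this

theorem amb_frameComp (m : ℕ) (p : dom h.1) (hp : (p : Fin n ⊕ Fin 2 → ℝ) (Sum.inr 0) = 1)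
    (P : Fin (4 + m) → Fin n ⊕ Fin 2) :
    D.frameComp (iterDRiemann D.ambientMetric m) p P = SmoothFn.evalAt p ((amb h).Y m P) := by
  have hE : ∀ a I, D.frame p a I = SmoothFn.evalAt p ((amb h).E a I) := by
    intro a I
    obtain ⟨i, rfl⟩ | rfl | rfl := amb_cases a <;> obtain ⟨j, rfl⟩ | rfl | rfl := amb_cases I
    · by_cases hij : i = j
      · subst hij; simp [frame]
      · simp [frame, hij, Ne.symm hij]
    · rfl
    · rfl
    · simp [frame]
    · exact hp.symm
    · simp [frame, hp]; rfl
    · simp [frame]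
    · simp [frame]
    · simp [frame, hp]
  have ht : SmoothFn.evalAt p (amb h).t = 1 := hp
  have := congrArg (SmoothFn.evalAt p) ((amb h).frameT_iterD m P)
  rw [map_mul, map_pow, ht, one_pow, one_mul] at this
  rw [← this, frameT, map_sum, frameComp]
  exact Finset.sum_congr rfl fun I _ => by rw [map_mul, map_prod, amb_iterD h]; simp only [hE]

/-! ### Restriction to the boundary -/

/-- The inclusion of the boundary. -/
def incl (hO : IsOpen O) (x : bdom hO) : dom hO := ⟨point 1 x 0, point_mem hO one_pos x.2⟩

theorem contDiff_point : ContDiff ℝ ∞ (fun q : (Fin n → ℝ) × ℝ => point 1 q.1 q.2) := by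
  rw [contDiff_pi]
  intro I
  obtain ⟨i, rfl⟩ | rfl | rfl := amb_cases I
  · exact (contDiff_apply ℝ ℝ i).comp contDiff_fst
  · exact contDiff_const
  · exact contDiff_snd

/-- Restriction of functions to the boundary, at `t = 1`. -/
def res (hO : IsOpen O) : SmoothFn (dom hO) →ₐ[ℝ] SmoothFn (bdom hO) where
  toFun f := SmoothFn.ofFun (fun x => extZero (dom hO : Set (Fin n ⊕ Fin 2 → ℝ)) f (point 1 x 0))
    ((SmoothFn.smooth f).comp ((contDiff_point.comp (f := fun x : Fin n → ℝ => (x, (0 : ℝ)))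
      (by fun_prop)).contDiffOn) fun x hx => point_mem hO one_pos hx)
  map_one' := SmoothFn.ext_ev fun x => by
    rw [SmoothFn.ofFun_apply, extZero_of_mem (point_mem hO one_pos x.2)]; rfl
  map_zero' := SmoothFn.ext_ev fun x => by
    rw [SmoothFn.ofFun_apply, extZero_of_mem (point_mem hO one_pos x.2)]; rfl
  map_mul' f g := SmoothFn.ext_ev fun x => by
    rw [SmoothFn.ofFun_apply, extZero_of_mem (point_mem hO one_pos x.2)]
    change _ = extZero _ _ _ * extZero _ _ _
    rw [extZero_of_mem (point_mem hO one_pos x.2), extZero_of_mem (point_mem hO one_pos x.2)]; rfl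
  map_add' f g := SmoothFn.ext_ev fun x => by
    rw [SmoothFn.ofFun_apply, extZero_of_mem (point_mem hO one_pos x.2)]
    change _ = extZero _ _ _ + extZero _ _ _
    rw [extZero_of_mem (point_mem hO one_pos x.2), extZero_of_mem (point_mem hO one_pos x.2)]; rfl
  commutes' c := SmoothFn.ext_ev fun x => by
    rw [SmoothFn.ofFun_apply, extZero_of_mem (point_mem hO one_pos x.2)]; rfl

theorem evalAt_res (hO : IsOpen O) (f : SmoothFn (dom hO)) (x : bdom hO) :
    SmoothFn.evalAt x (res hO f) = SmoothFn.evalAt (incl hO x) f :=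
  extZero_of_mem (incl hO x).2

theorem res_pderiv (hO : IsOpen O) (i : Fin n) (f : SmoothFn (dom hO)) :
    res hO (SmoothFn.pderiv (Sum.inl i) f) = SmoothFn.pderiv i (res hO f) := by
  refine SmoothFn.ext_ev fun x => ?_
  rw [SmoothFn.pderiv_eq_pd i (res hO f) (fun x => extZero (dom hO : Set (Fin n ⊕ Fin 2 → ℝ)) f
    (point 1 x 0)) (fun _ => rfl)]
  rw [← SmoothFn.evalAt_apply, evalAt_res, SmoothFn.evalAt_apply, SmoothFn.pderiv_apply, pd, pd]
  have hd : HasFDerivAt (fun x : Fin n → ℝ => point 1 x 0)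
      (ContinuousLinearMap.pi (Sum.elim (fun i => (ContinuousLinearMap.proj i : (Fin n → ℝ) →L[ℝ] ℝ))
        fun _ => 0)) x.1 := by
    rw [hasFDerivAt_pi]
    intro I
    obtain ⟨i, rfl⟩ | rfl | rfl := amb_cases I
    · exact hasFDerivAt_apply (𝕜 := ℝ) i x.1
    · exact hasFDerivAt_const (𝕜 := ℝ) (1 : ℝ) x.1
    · exact hasFDerivAt_const (𝕜 := ℝ) (0 : ℝ) x.1
  have := ((SmoothFn.differentiableAt f (incl hO x)).hasFDerivAt.comp x.1 hd).fderiv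
  have e : (fun x => extZero (dom hO : Set (Fin n ⊕ Fin 2 → ℝ)) f (point 1 x 0))
    = extZero (dom hO : Set (Fin n ⊕ Fin 2 → ℝ)) f ∘ fun x => point 1 x 0 := rfl
  rw [e, this]
  change _ = (fderiv ℝ _ _) _
  congr 1
  funext I
  obtain ⟨j, rfl⟩ | rfl | rfl := amb_cases I <;> simp [Pi.single_apply]

theorem iterate_pderiv (hO : IsOpen O) (F : (Fin n ⊕ Fin 2 → ℝ) → ℝ) (f : SmoothFn (dom hO))
    (hF : ∀ p : dom hO, F p = SmoothFn.evalAt p f) (l : ℕ) (x : Fin n → ℝ) (ρ : ℝ)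
    (hx : (x, ρ) ∈ O) :
    SmoothFn.evalAt ⟨point 1 x ρ, point_mem hO one_pos hx⟩ ((SmoothFn.pderiv (Sum.inr 1))^[l] f)
      = iteratedDeriv l (fun ρ => F (point 1 x ρ)) ρ := by
  induction l generalizing ρ with
  | zero => simp [hF ⟨point 1 x ρ, point_mem hO one_pos hx⟩]
  | succ l ih =>
    rw [Function.iterate_succ_apply', iteratedDeriv_succ]
    set f' := (SmoothFn.pderiv (Sum.inr 1))^[l] f
    have hev : iteratedDeriv l (fun ρ => F (point 1 x ρ)) =ᶠ[𝓝 ρ]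
        fun ρ => extZero (dom hO : Set (Fin n ⊕ Fin 2 → ℝ)) f' (point 1 x ρ) := by
      have : ∀ᶠ r in 𝓝 ρ, (x, r) ∈ O :=
        (hO.preimage (f := fun r : ℝ => (x, r)) (by fun_prop)).mem_nhds hx
      filter_upwards [this] with r hr
      rw [← ih r hr, extZero_of_mem (point_mem hO one_pos hr)]; rfl
    rw [hev.deriv_eq, SmoothFn.evalAt_apply, SmoothFn.pderiv_apply, pd]
    have hd : HasDerivAt (fun r : ℝ => point 1 x r) (Pi.single (Sum.inr 1) 1) ρ := by
      rw [hasDerivAt_pi]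
      intro I
      obtain ⟨i, rfl⟩ | rfl | rfl := amb_cases I
      · simpa [point] using hasDerivAt_const ρ (x i)
      · simpa [point] using hasDerivAt_const ρ (1 : ℝ)
      · simpa [point] using hasDerivAt_id' ρ
    exact ((SmoothFn.differentiableAt f' ⟨point 1 x ρ, point_mem hO one_pos hx⟩).hasFDerivAt.comp_hasDerivAt
      ρ hd).deriv.symm

/-- The Taylor expansion at `ρ = 0`. -/
def taylor (hO : IsOpen O) : SmoothFn (dom hO) →ₐ[ℝ] PowerSeries (SmoothFn (bdom hO)) :=
  jet (SmoothFn.pderiv (Sum.inr 1)) (res hO)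

theorem taylor_pderiv (hO : IsOpen O) (i : Fin n) (f : SmoothFn (dom hO)) :
    taylor hO (SmoothFn.pderiv (Sum.inl i) f) = liftD (SmoothFn.pderiv i) (taylor hO f) := by
  have h1 : ∀ f : SmoothFn (dom hO), SmoothFn.pderiv (Sum.inl i) (SmoothFn.pderiv (Sum.inr 1) f)
      = SmoothFn.pderiv (Sum.inr 1) (SmoothFn.pderiv (Sum.inl i) f) :=
    SmoothFn.pderiv_comm (Sum.inl i) (Sum.inr 1)
  have h2 := res_pderiv hO i
  generalize SmoothFn.pderiv (U := dom hO) (Sum.inl i) = D1 at *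
  generalize SmoothFn.pderiv (U := bdom hO) i = D2 at *
  rw [taylor]
  generalize SmoothFn.pderiv (U := dom hO) (Sum.inr 1) = D3 at *
  exact jet_deriv D3 (res hO) h1 h2 f

theorem coeff_taylor (hO : IsOpen O) (F : (Fin n ⊕ Fin 2 → ℝ) → ℝ) (f : SmoothFn (dom hO))
    (hF : ∀ p : dom hO, F p = SmoothFn.evalAt p f) (l : ℕ) (x : bdom hO) :
    SmoothFn.evalAt x (PowerSeries.coeff l (taylor hO f))
      = iteratedDeriv l (fun ρ => F (point 1 x ρ)) 0 / (l.factorial : ℝ) := by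
  rw [taylor, coeff_jet, map_smul, evalAt_res]
  have := iterate_pderiv hO F f hF l x 0 x.2
  rw [← this, smul_eq_mul, inv_mul_eq_div]
  rfl

variable (h : D.IsRegularOn O)

theorem coeff_taylor_g (l : ℕ) (x : bdom h.1) (i j : Fin n) :
    SmoothFn.evalAt x (PowerSeries.coeff l (taylor h.1 ((amb h).g i j))) = D.gamCoeff l x i j :=
  coeff_taylor h.1 (fun p => D.gam (proj n p).1 (proj n p).2 i j) _ (fun _ => rfl) l x

theorem coeff_taylor_a (l : ℕ) (x : bdom h.1) (i : Fin n) :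
    SmoothFn.evalAt x (PowerSeries.coeff l (taylor h.1 ((amb h).a i))) = D.aCoeff l x i :=
  coeff_taylor h.1 (fun p => D.a (proj n p).1 (proj n p).2 i) _ (fun _ => rfl) l x

theorem boundary_isRegularOn : D.boundary.IsRegularOn (bdom h.1) := by
  refine ⟨(bdom h.1).2, fun i j => ?_, fun m i => ?_, fun x hx => h.2.2.2.1 _ hx,
    fun x hx => h.2.2.2.2 _ hx⟩
  · exact (h.2.1 i j).comp (f := fun x : Fin n → ℝ => (x, (0 : ℝ)))
      (ContDiff.contDiffOn (by fun_prop)) fun x hx => hx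
  · refine (SmoothFn.smooth (PowerSeries.coeff m (taylor h.1 ((amb h).a i)))).congr fun x hx => ?_
    rw [extZero_of_mem hx]
    exact (coeff_taylor_a h m ⟨x, hx⟩ i).symm

/-- The Taylor expansion of the Weyl-ambient data. -/
def expansion : Expansion n (SmoothFn (bdom h.1)) where
  toGeo := D.boundary.geo (boundary_isRegularOn h)
  γ i j := taylor h.1 ((amb h).g i j)
  γi i j := taylor h.1 ((amb h).gi i j)
  γ_symm i j := by rw [(amb h).g_symm]
  γi_symm i j := by rw [(amb h).gi_symm]
  γ_γi i j := by
    have := congrArg (taylor h.1) ((amb h).g_gi i j)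
    rw [map_sum] at this
    simp only [map_mul] at this
    rw [this]
    split_ifs <;> simp
  coeff_zero_γ i j := SmoothFn.ext_ev fun x => by
    rw [← SmoothFn.evalAt_apply, coeff_taylor_g, gamCoeff]
    simp only [iteratedDeriv_zero, Nat.factorial_zero, Nat.cast_one, div_one]
    rfl

/-- The Taylor expansion preserves all data. -/
def taylorHom : RhoGeo.Hom (amb h).toRhoGeo (expansion h).rho where
  φ := taylor h.1
  map_d i f := taylor_pderiv h.1 i f
  map_dr f := jet_dr _ _ f
  map_ρ := jet_of_deriv_eq_one _ _ (amb h).dr_ρ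
    (SmoothFn.ext_ev fun x => by rw [← SmoothFn.evalAt_apply, evalAt_res]; rfl)
  map_g _ _ := rfl
  map_gi _ _ := rfl
  map_a i := by
    ext1 l
    refine SmoothFn.ext_ev fun x => ?_
    rw [← SmoothFn.evalAt_apply, coeff_taylor_a]
    have : PowerSeries.coeff l ((expansion h).rho.a i) = (expansion h).a l i :=
      PowerSeries.coeff_mk l fun l => (expansion h).a l i
    rw [this]
    rfl

open PowerSeries in
theorem isFlat_expansion {k : ℕ} (hk : 1 ≤ k) (hR : D.RicciFlatToOrder O k) :
    (expansion h).IsFlat k := by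
  have hc : ∀ (I J : Fin n ⊕ Fin 2) (m : ℕ),
      (if I = Sum.inr 1 ∨ J = Sum.inr 1 then m + 1 < k else m < k) →
      coeff m (taylor h.1 ((amb h).ric I J)) = 0 := by
    intro I J m hm
    refine SmoothFn.ext_ev fun x => ?_
    rw [← SmoothFn.evalAt_apply,
      coeff_taylor h.1 (fun p => D.ambientRicci p I J) _ (amb_ric h · I J),
      hR x x.2 1 one_pos I J m hm, zero_div]
    rfl
  have h1 : ∀ I J, (X : (SmoothFn (bdom h.1))⟦X⟧) ^ (k - 1) ∣ taylor h.1 ((amb h).ric I J) := by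
    intro I J
    rw [X_pow_dvd_iff]
    intro m hm
    apply hc
    split_ifs <;> omega
  have h2 : ∀ I J, I ≠ Sum.inr 1 → J ≠ Sum.inr 1 →
      (X : (SmoothFn (bdom h.1))⟦X⟧) ^ k ∣ taylor h.1 ((amb h).ric I J) := by
    intro I J hI hJ
    rw [X_pow_dvd_iff]
    intro m hm
    apply hc
    simpa [hI, hJ] using hm
  have hf : ∀ b e, ∑ c, (expansion h).rho.fc c b c e = ∑ I, ∑ J, taylor h.1 ((amb h).ric I J)
      * taylor h.1 ((amb h).E b I) * taylor h.1 ((amb h).E e J) := by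
    intro b e
    have := congrArg (taylor h.1) ((amb h).frame_ric b e)
    simp only [map_sum, map_mul] at this
    rw [this]
    exact Finset.sum_congr rfl fun c _ => ((taylorHom h).map_fc c b c e).symm
  have hX : ∀ i, (X : (SmoothFn (bdom h.1))⟦X⟧) ∣ taylor h.1 ((amb h).E (.inl i) (.inr 1)) := by
    intro i
    rw [AmbAlg.E_hr, map_mul, map_mul]
    have : taylor h.1 (amb h).ρ = X := (taylorHom h).map_ρ
    rw [this]
    exact Dvd.dvd.mul_right (Dvd.intro_left _ rfl) _
  have hk' : (X : (SmoothFn (bdom h.1))⟦X⟧) ^ k = X ^ (k - 1) * X := by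
    rw [← pow_succ, Nat.sub_add_cancel hk]
  refine ⟨fun i j => ?_, fun b e => ?_⟩
  · rw [hf]
    refine Finset.dvd_sum fun I _ => Finset.dvd_sum fun J _ => ?_
    by_cases hI : I = Sum.inr 1
    · subst hI
      rw [hk']
      exact Dvd.dvd.mul_right (mul_dvd_mul (h1 _ _) (hX i)) _
    · by_cases hJ : J = Sum.inr 1
      · subst hJ
        rw [hk']
        exact mul_dvd_mul (Dvd.dvd.mul_right (h1 _ _) _) (hX j)
      · exact Dvd.dvd.mul_right (Dvd.dvd.mul_right (h2 I J hI hJ) _) _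
  · rw [hf]
    exact Finset.dvd_sum fun I _ => Finset.dvd_sum fun J _ =>
      Dvd.dvd.mul_right (Dvd.dvd.mul_right (h1 I J) _) _

theorem extObstruction_eq (m : ℕ) (x : bdom h.1) (i j : Fin n) :
    D.extObstruction m x i j = SmoothFn.evalAt x (PowerSeries.coeff 0 ((expansion h).rho.Y m
      fun s : Fin (4 + m) =>
        if (s : ℕ) = m + 1 then Sum.inl i else if (s : ℕ) = m + 2 then Sum.inl j else Sum.inr 1)) := by
  rw [← (taylorHom h).map_Y]
  change _ = SmoothFn.evalAt x (PowerSeries.coeff 0 (taylor h.1 _))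
  rw [taylor, coeff_jet]
  simp only [Nat.factorial_zero, Nat.cast_one, inv_one, Function.iterate_zero, id_eq, one_smul]
  rw [evalAt_res]
  exact amb_frameComp h m (incl h.1 x) rfl _

end AmbientData

end

end WeylAmbient

namespace WeylAmbient

noncomputable section

/-! ### Calculus of the boundary covariant derivative -/

/-- Prefix two indices. -/
def cons2 {κ α : Type} (p q : α) (I : κ → α) : Option (Option κ) → α
  | none => p
  | some none => q
  | some (some s) => I s

/-- Prefix one index. -/
def cons1 {κ α : Type} (p : α) (I : κ → α) : Option κ → α
  | none => p
  | some s => I s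

namespace Geo

variable {n : ℕ} {A : Type} [CommRing A] [Algebra ℝ A] (B : Geo n A)
variable {κ κ' : Type} [Fintype κ] [DecidableEq κ] [Fintype κ'] [DecidableEq κ']

/-- Contraction of two indices with the inverse metric. -/
def ctr {κ : Type} (T : (Option (Option κ) → Fin n) → A) (I : κ → Fin n) : A :=
  ∑ p, ∑ q, B.gi p q * T (cons2 p q I)

theorem nab_def (w : ℝ) (T : (κ → Fin n) → A) (i : Fin n) (I : κ → Fin n) :
    B.nab w T i I = B.d i (T I) - ∑ s, ∑ m, B.Γ m i (I s) * T (Function.update I s m)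
      + w • (B.a 0 i * T I) := rfl

theorem nab_add (w : ℝ) (T T' : (κ → Fin n) → A) (i : Fin n) (I : κ → Fin n) :
    B.nab w (fun I => T I + T' I) i I = B.nab w T i I + B.nab w T' i I := by
  simp only [nab_def, map_add, mul_add, Finset.sum_add_distrib, smul_add]; ring

theorem nab_zero (w : ℝ) (i : Fin n) (I : κ → Fin n) : B.nab w (fun _ => 0) i I = 0 := by
  simp [nab_def]

theorem nab_smul (w c : ℝ) (T : (κ → Fin n) → A) (i : Fin n) (I : κ → Fin n) :
    B.nab w (fun I => c • T I) i I = c • B.nab w T i I := by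
  simp only [nab_def, Derivation.map_smul, mul_smul_comm, ← Finset.smul_sum, smul_add, smul_sub]
  rw [smul_comm w c]

theorem nab_neg (w : ℝ) (T : (κ → Fin n) → A) (i : Fin n) (I : κ → Fin n) :
    B.nab w (fun I => -T I) i I = -B.nab w T i I := by
  have := B.nab_smul w (-1) T i I
  simpa using this

theorem nab_sub (w : ℝ) (T T' : (κ → Fin n) → A) (i : Fin n) (I : κ → Fin n) :
    B.nab w (fun I => T I - T' I) i I = B.nab w T i I - B.nab w T' i I := by
  simp only [sub_eq_add_neg, nab_add, nab_neg]

theorem nab_reindex (w : ℝ) (T : (κ → Fin n) → A) (e : κ ≃ κ') (i : Fin n) (I : κ' → Fin n) :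
    B.nab w (fun I => T (fun s => I (e s))) i I = B.nab w T i (fun s => I (e s)) := by
  simp only [nab_def]
  congr 2
  rw [← e.sum_comp]
  refine Finset.sum_congr rfl fun s _ => Finset.sum_congr rfl fun m _ => ?_
  congr 2
  funext t
  by_cases h : t = s
  · subst h; simp
  · simp [Function.update_of_ne, h]

theorem nab_mul (w w' : ℝ) (T : (κ → Fin n) → A) (T' : (κ' → Fin n) → A) (i : Fin n)
    (I : κ ⊕ κ' → Fin n) :
    B.nab (w + w') (fun I : κ ⊕ κ' → Fin n => T (fun s => I (.inl s)) * T' (fun s => I (.inr s))) i I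
      = B.nab w T i (fun s => I (.inl s)) * T' (fun s => I (.inr s))
        + T (fun s => I (.inl s)) * B.nab w' T' i (fun s => I (.inr s)) := by
  have h1 : ∀ s m, (fun t => Function.update I (.inl s) m (.inl t))
      = Function.update (fun t => I (.inl t)) s m := by
    intro s m; funext t
    by_cases h : t = s
    · subst h; simp
    · simp [Function.update_of_ne, h]
  have h2 : ∀ s m, (fun t => Function.update I (.inr s) m (.inr t))
      = Function.update (fun t => I (.inr t)) s m := by
    intro s m; funext t
    by_cases h : t = s
    · subst h; simp
    · simp [Function.update_of_ne, h]
  have h3 : ∀ s m, (fun t => Function.update I (.inl s) m (.inr t)) = fun t => I (.inr t) := by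
    intro s m; funext t; simp
  have h4 : ∀ s m, (fun t => Function.update I (.inr s) m (.inl t)) = fun t => I (.inl t) := by
    intro s m; funext t; simp
  simp only [nab_def, Fintype.sum_sum_type, h1, h2, h3, h4, Derivation.leibniz, smul_eq_mul, add_smul,
    ← mul_assoc, ← Finset.sum_mul]
  simp only [Algebra.smul_def]
  have h5 : ∀ (u : A), ∑ s, ∑ m, B.Γ m i (I (.inr s)) * u
      * T' (Function.update (fun t => I (.inr t)) s m) = u * ∑ s, ∑ m, B.Γ m i (I (.inr s))
      * T' (Function.update (fun t => I (.inr t)) s m) := by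
    intro u
    simp only [Finset.mul_sum]
    exact Finset.sum_congr rfl fun _ _ => Finset.sum_congr rfl fun _ _ => by ring
  rw [h5]
  ring

theorem gi_g (i j : Fin n) : ∑ m, B.gi i m * B.g m j = if i = j then 1 else 0 := by
  have := B.g_gi j i
  rw [eq_comm] at this
  rw [if_congr (eq_comm (a := i)) rfl rfl, this]
  exact Finset.sum_congr rfl fun m _ => by rw [B.g_symm j m, B.gi_symm m i]; ring

theorem Γ_symm (k i j : Fin n) : B.Γ k i j = B.Γ k j i := by
  rw [Γ, Γ, lcCoeff_symm B.g_symm, B.g_symm i j]; ring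

/-- The Weyl connection preserves the metric. -/
theorem d_g (i j l : Fin n) : B.d i (B.g j l) = ∑ m, B.Γ m i j * B.g m l + ∑ m, B.Γ m i l * B.g j m
    + 2 * B.a 0 i * B.g j l := by
  have h := lcCoeff_metric (d := B.d) B.g_symm B.g_gi i j l
  have h1 : ∀ j l, ∑ m, B.Γ m i j * B.g m l = ∑ m, lcCoeff B.d B.g B.gi m i j * B.g m l
      - (B.a 0 i * B.g j l + B.a 0 j * B.g i l - B.a 0 l * B.g i j) := by
    intro j l
    simp only [Γ, sub_mul, add_mul, Finset.sum_sub_distrib, Finset.sum_add_distrib]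
    have e1 : ∀ c : A, ∀ p : Fin n, ∑ x, c * (if x = p then 1 else 0) * B.g x l = c * B.g p l := by
      intro c p; simp
    have e2 : ∑ x, (∑ m, B.gi x m * B.a 0 m) * B.g i j * B.g x l = B.a 0 l * B.g i j := by
      have : ∑ x, (∑ m, B.gi x m * B.a 0 m) * B.g x l = B.a 0 l := by
        simp only [Finset.sum_mul]
        rw [Finset.sum_comm]
        have : ∀ m, ∑ x, B.gi x m * B.a 0 m * B.g x l = B.a 0 m * if m = l then 1 else 0 := by
          intro m
          rw [← B.gi_g m l, Finset.mul_sum]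
          exact Finset.sum_congr rfl fun x _ => by rw [B.gi_symm x m]; ring
        simp [this]
      rw [← this, Finset.sum_mul]
      exact Finset.sum_congr rfl fun _ _ => by ring
    rw [e1, e1, e2]
  have h2 : ∑ m, B.Γ m i l * B.g j m = ∑ m, B.Γ m i l * B.g m j :=
    Finset.sum_congr rfl fun m _ => by rw [B.g_symm j m]
  rw [h2, h1, h1, h, B.g_symm l j]
  have h3 : ∀ j l, ∑ m, B.g j m * lcCoeff B.d B.g B.gi m i l
      = ∑ m, lcCoeff B.d B.g B.gi m i l * B.g m j :=
    fun j l => Finset.sum_congr rfl fun m _ => by rw [B.g_symm j m]; ring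
  simp only [h3]
  ring

theorem d_gi (i j l : Fin n) : B.d i (B.gi j l) = -(∑ m, B.Γ j i m * B.gi m l)
    - ∑ m, B.Γ l i m * B.gi j m - 2 * B.a 0 i * B.gi j l := by
  have h1 : ∀ j l, ∑ m, B.g j m * B.d i (B.gi m l) = -∑ m, B.d i (B.g j m) * B.gi m l := by
    intro j l
    have := congrArg (B.d i) (B.g_gi j l)
    rw [map_sum] at this
    simp only [Derivation.leibniz, smul_eq_mul, Finset.sum_add_distrib] at this
    have h0 : B.d i (if j = l then 1 else 0) = 0 := by split_ifs <;> simp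
    rw [h0] at this
    rw [eq_neg_iff_add_eq_zero, ← this]
    congr 1
    exact Finset.sum_congr rfl fun _ _ => mul_comm _ _
  have h2 : B.d i (B.gi j l) = ∑ p, B.gi j p * ∑ m, B.g p m * B.d i (B.gi m l) := by
    simp only [Finset.mul_sum, ← mul_assoc]
    rw [Finset.sum_comm]
    simp only [← Finset.sum_mul, gi_g]
    simp
  rw [h2]
  simp only [h1, d_g, add_mul, Finset.sum_add_distrib, mul_neg, mul_add, Finset.sum_neg_distrib,
    neg_add]
  have e1 : ∑ p, B.gi j p * ∑ x, (∑ m, B.Γ m i p * B.g m x) * B.gi x l = ∑ m, B.Γ l i m * B.gi j m := by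
    have : ∀ p, ∑ x, (∑ m, B.Γ m i p * B.g m x) * B.gi x l = B.Γ l i p := by
      intro p
      simp only [Finset.sum_mul]
      rw [Finset.sum_comm]
      simp only [mul_assoc, ← Finset.mul_sum, g_gi]
      simp
    simp only [this]
    exact Finset.sum_congr rfl fun _ _ => mul_comm _ _
  have e2 : ∑ p, B.gi j p * ∑ x, (∑ m, B.Γ m i x * B.g p m) * B.gi x l = ∑ m, B.Γ j i m * B.gi m l := by
    simp only [Finset.mul_sum, Finset.sum_mul]
    rw [Finset.sum_comm]
    refine Finset.sum_congr rfl fun x _ => ?_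
    rw [Finset.sum_comm]
    have : ∀ m, ∑ p, B.gi j p * (B.Γ m i x * B.g p m * B.gi x l)
        = (if j = m then 1 else 0) * (B.Γ m i x * B.gi x l) := by
      intro m
      rw [← gi_g, Finset.sum_mul]
      exact Finset.sum_congr rfl fun _ _ => by ring
    simp [this]
  have e3 : ∑ p, B.gi j p * ∑ x, 2 * B.a 0 i * B.g p x * B.gi x l = 2 * B.a 0 i * B.gi j l := by
    have : ∀ p, ∑ x, 2 * B.a 0 i * B.g p x * B.gi x l
        = 2 * B.a 0 i * (if p = l then 1 else 0) := by
      intro p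
      rw [← B.g_gi, Finset.mul_sum]
      exact Finset.sum_congr rfl fun _ _ => by ring
    simp [this]; ring
  rw [e1, e2, e3]
  ring

theorem nab_ctr (w : ℝ) (T : (Option (Option κ) → Fin n) → A) (i : Fin n) (I : κ → Fin n) :
    B.nab (w + 2) (B.ctr T) i I = B.ctr (fun J => B.nab w T i J) I := by
  have u1 : ∀ (p q m : Fin n), Function.update (cons2 p q I) none m = cons2 m q I := by
    intro p q m; funext t; rcases t with _ | _ | t <;> simp [cons2]
  have u2 : ∀ (p q m : Fin n), Function.update (cons2 p q I) (some none) m = cons2 p m I := by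
    intro p q m; funext t; rcases t with _ | _ | t <;> simp [cons2]
  have u3 : ∀ (p q : Fin n) (s : κ) (m : Fin n),
      Function.update (cons2 p q I) (some (some s)) m = cons2 p q (Function.update I s m) := by
    intro p q s m; funext t; rcases t with _ | _ | t <;> simp [cons2]
    by_cases h : t = s
    · subst h; simp
    · simp [Function.update_of_ne, h]; rfl
  simp only [nab_def, ctr, Fintype.sum_option, u1, u2, u3]
  simp only [cons2, map_sum, Derivation.leibniz, smul_eq_mul, d_gi]
  have e1 : ∑ p, ∑ q, B.gi p q * ∑ m, B.Γ m i p * T (cons2 m q I)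
      = ∑ p, ∑ q, T (cons2 p q I) * ∑ m, B.Γ p i m * B.gi m q := by
    simp only [Finset.mul_sum]
    rw [sum3_reverse]
    refine Finset.sum_congr rfl fun m _ => Finset.sum_congr rfl fun q _ =>
      Finset.sum_congr rfl fun p _ => by ring
  have e2 : ∑ p, ∑ q, B.gi p q * ∑ m, B.Γ m i q * T (cons2 p m I)
      = ∑ p, ∑ q, T (cons2 p q I) * ∑ m, B.Γ q i m * B.gi p m := by
    simp only [Finset.mul_sum]
    refine Finset.sum_congr rfl fun p _ => ?_
    rw [Finset.sum_comm]
    refine Finset.sum_congr rfl fun m _ => Finset.sum_congr rfl fun q _ => by ring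
  have e3 : ∑ s, ∑ m, B.Γ m i (I s) * ∑ p, ∑ q, B.gi p q * T (cons2 p q (Function.update I s m))
      = ∑ p, ∑ q, B.gi p q * ∑ s, ∑ m, B.Γ m i (I s) * T (cons2 p q (Function.update I s m)) := by
    simp only [Finset.mul_sum]
    rw [Finset.sum_congr rfl fun s _ => sum3_rotate]
    rw [Finset.sum_comm, Finset.sum_congr rfl fun p _ => Finset.sum_comm]
    refine Finset.sum_congr rfl fun p _ => Finset.sum_congr rfl fun q _ =>
      Finset.sum_congr rfl fun s _ => Finset.sum_congr rfl fun m _ => by ring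
  have e4 : (2 : ℝ) • (B.a 0 i * ∑ p, ∑ q, B.gi p q * T (cons2 p q I))
      = ∑ p, ∑ q, T (cons2 p q I) * (2 * B.a 0 i * B.gi p q) := by
    rw [two_smul]
    simp only [Finset.mul_sum, ← Finset.sum_add_distrib]
    exact Finset.sum_congr rfl fun p _ => Finset.sum_congr rfl fun q _ => by ring
  have e5 : w • (B.a 0 i * ∑ p, ∑ q, B.gi p q * T (cons2 p q I))
      = ∑ p, ∑ q, B.gi p q * w • (B.a 0 i * T (cons2 p q I)) := by
    simp only [Finset.mul_sum, Finset.smul_sum]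
    refine Finset.sum_congr rfl fun p _ => Finset.sum_congr rfl fun q _ => ?_
    rw [mul_smul_comm]; congr 1; ring
  rw [e3, add_smul, e4, e5]
  simp only [mul_add, mul_sub, Finset.sum_add_distrib, Finset.sum_sub_distrib, mul_neg,
    Finset.sum_neg_distrib, e1, e2]
  ring

theorem nab_metric (i : Fin n) (I : Fin 2 → Fin n) :
    B.nab (-2) (fun I : Fin 2 → Fin n => B.g (I 0) (I 1)) i I = 0 := by
  simp only [nab_def, Fin.sum_univ_two, d_g]
  simp only [neg_smul, two_smul]
  simp [Function.update_of_ne]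
  ring

theorem sum_update_comm (T : (κ → Fin n) → A) (i j : Fin n) (I : κ → Fin n) :
    ∑ s, ∑ m, B.Γ m i (I s) * (∑ s', ∑ p, B.Γ p j (Function.update I s m s')
        * T (Function.update (Function.update I s m) s' p))
      - ∑ s, ∑ m, B.Γ m j (I s) * (∑ s', ∑ p, B.Γ p i (Function.update I s m s')
        * T (Function.update (Function.update I s m) s' p))
      = ∑ s, ∑ p, (∑ m, (B.Γ p j m * B.Γ m i (I s) - B.Γ p i m * B.Γ m j (I s)))
        * T (Function.update I s p) := by
  set R : Fin n → Fin n → κ → κ → A := fun i j s s' => ∑ m, ∑ p, B.Γ m i (I s)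
    * (B.Γ p j (Function.update I s m s') * T (Function.update (Function.update I s m) s' p)) with hR
  have h1 : ∀ i j, ∑ s, ∑ m, B.Γ m i (I s) * (∑ s', ∑ p, B.Γ p j (Function.update I s m s')
        * T (Function.update (Function.update I s m) s' p)) = ∑ s, ∑ s', R i j s s' := by
    intro i j
    simp only [hR, Finset.mul_sum]
    exact Finset.sum_congr rfl fun s _ => Finset.sum_comm
  have h2 : ∀ s s', s ≠ s' → R i j s s' = R j i s' s := by
    intro s s' hs
    simp only [hR]
    rw [Finset.sum_comm]
    refine Finset.sum_congr rfl fun p _ => Finset.sum_congr rfl fun m _ => ?_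
    rw [Function.update_of_ne hs.symm, Function.update_of_ne hs, Function.update_comm hs]
    ring
  have h3 : ∑ s, ∑ s', R j i s s' = ∑ s, ∑ s', R j i s' s := Finset.sum_comm
  rw [h1, h1, h3, ← Finset.sum_sub_distrib]
  refine Finset.sum_congr rfl fun s _ => ?_
  rw [← Finset.sum_sub_distrib, Finset.sum_eq_single s (fun s' _ hs' => by
    rw [h2 s s' hs'.symm, sub_self]) (by simp)]
  simp only [hR, Function.update_self, Function.update_idem, Finset.sum_mul, sub_mul,
    Finset.sum_sub_distrib]
  congr 1 <;> rw [Finset.sum_comm] <;>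
    exact Finset.sum_congr rfl fun _ _ => Finset.sum_congr rfl fun _ _ => by ring

/-- The Ricci identity. -/
theorem nab_nab_comm (w : ℝ) (T : (κ → Fin n) → A) (i j : Fin n) (I : κ → Fin n) :
    B.nab w (fun J : Option κ → Fin n => B.nab w T (J none) (fun s => J (some s))) i (cons1 j I)
      - B.nab w (fun J : Option κ → Fin n => B.nab w T (J none) (fun s => J (some s))) j (cons1 i I)
      = -(∑ s, ∑ m, curv B.d B.Γ m (I s) i j * T (Function.update I s m)) + w • (B.F i j * T I) := by
  have u1 : ∀ (p m : Fin n), Function.update (cons1 p I) none m = cons1 m I := by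
    intro p m; funext t; rcases t with _ | t <;> simp [cons1]
  have u2 : ∀ (p : Fin n) (s : κ) (m : Fin n),
      Function.update (cons1 p I) (some s) m = cons1 p (Function.update I s m) := by
    intro p s m; funext t; rcases t with _ | t <;> simp [cons1]
    by_cases h : t = s
    · subst h; simp
    · simp [Function.update_of_ne, h]; rfl
  have key := B.sum_update_comm T i j I
  have hN : ∀ i j, B.nab w (fun J : Option κ → Fin n => B.nab w T (J none) (fun s => J (some s))) i
      (cons1 j I) = B.d i (B.nab w T j I) - ∑ m, B.Γ m i j * B.nab w T m I
        - ∑ s, ∑ m, B.Γ m i (I s) * B.nab w T j (Function.update I s m)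
        + w • (B.a 0 i * B.nab w T j I) := by
    intro i j
    rw [nab_def]
    simp only [Fintype.sum_option, u1, u2]
    simp only [cons1]
    ring
  have hΓ : ∑ m, B.Γ m i j * B.nab w T m I = ∑ m, B.Γ m j i * B.nab w T m I :=
    Finset.sum_congr rfl fun m _ => by rw [Γ_symm]
  rw [hN, hN, hΓ]
  simp only [nab_def, map_add, map_sub, map_sum, Derivation.leibniz, smul_eq_mul, mul_add, mul_sub,
    Finset.sum_add_distrib, Finset.sum_sub_distrib, Derivation.map_smul, curv, add_mul, sub_mul, F,
    smul_add, smul_sub, mul_smul_comm, B.d_comm j i, ← Finset.smul_sum] at key ⊢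
  have e1 : ∀ i j, ∑ s, ∑ m, B.Γ m i (I s) * (B.a 0 j * T (Function.update I s m))
      = B.a 0 j * ∑ s, ∑ m, B.Γ m i (I s) * T (Function.update I s m) := by
    intro i j
    simp only [Finset.mul_sum]
    exact Finset.sum_congr rfl fun _ _ => Finset.sum_congr rfl fun _ _ => by ring
  have e2 : ∀ i j, ∑ s, ∑ m, T (Function.update I s m) * B.d i (B.Γ m j (I s))
      = ∑ s, ∑ m, B.d i (B.Γ m j (I s)) * T (Function.update I s m) :=
    fun i j => Finset.sum_congr rfl fun _ _ => Finset.sum_congr rfl fun _ _ => mul_comm _ _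
  simp only [e1, e2, Finset.sum_mul] at key ⊢
  have e3 : w • (B.a 0 i * w • (B.a 0 j * T I)) = w • (B.a 0 j * w • (B.a 0 i * T I)) := by
    simp only [mul_smul_comm]; congr 2; ring
  have e4 : ∀ i j, w • (T I * B.d i (B.a 0 j)) = w • (B.d i (B.a 0 j) * T I) :=
    fun i j => by rw [mul_comm]
  simp only [mul_smul_comm] at e3
  simp only [e4] 
  linear_combination (exp := 1) key + e3

end Geo

end

end WeylAmbient

namespace WeylAmbient

noncomputable section

namespace TMono

/-- The order of a monomial in the curvatures and modes; a mode counts twice. -/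
def ord : {r : ℕ} → TMono r → ℕ
  | _, metric => 0
  | _, schouten => 1
  | _, weyl => 1
  | _, mode _ => 2
  | _, nabla M => ord M
  | _, tensor M N => ord M + ord N
  | _, contr M => ord M
  | _, perm _ M => ord M

theorem two_mul_rank_add_weight {r : ℕ} (M : TMono r) :
    (2 * M.numNabla + 3 * M.ord : ℤ) ≤ 2 * (r + M.weight) := by
  induction M with
  | metric => simp [numNabla, ord, weight]
  | schouten => simp [numNabla, ord, weight]
  | weyl => simp [numNabla, ord, weight]
  | mode m => simp [numNabla, ord, weight]; omega
  | nabla M ih => simp only [numNabla, ord, weight]; push_cast; omega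
  | tensor M N ihM ihN => simp only [numNabla, ord, weight]; push_cast; omega
  | contr M ih => simp only [numNabla, ord, weight]; push_cast at ih ⊢; omega
  | perm σ M ih => simpa only [numNabla, ord, weight] using ih

theorem rank_add_weight_of_ord {r : ℕ} (M : TMono r) (h : M.ord = 0) :
    (r + M.weight : ℤ) = M.numNabla := by
  induction M with
  | metric => simp [numNabla, weight]
  | schouten => simp [ord] at h
  | weyl => simp [ord] at h
  | mode m => simp [ord] at h
  | nabla M ih =>
    have := ih h
    simp only [numNabla, weight]; push_cast; omega
  | tensor M N ihM ihN =>
    simp only [ord, Nat.add_eq_zero_iff] at h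
    have h1 := ihM h.1
    have h2 := ihN h.2
    simp only [numNabla, weight]; push_cast; omega
  | contr M ih =>
    have := ih h
    simp only [numNabla, weight]; push_cast at this; omega
  | perm σ M ih => exact ih h

end TMono

/-- The first two indices separated. -/
def finOptEquiv (r : ℕ) : Fin (r + 2) ≃ Option (Option (Fin r)) :=
  (finSuccEquiv (r + 1)).trans (Equiv.optionCongr (finSuccEquiv r))

theorem cons2_finOptEquiv {r : ℕ} {α : Type} (p q : α) (I : Fin r → α) :
    (fun s => cons2 p q I (finOptEquiv r s)) = Fin.cons p (Fin.cons q I) := by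
  funext s
  refine Fin.cases ?_ (fun s => ?_) s
  · simp [finOptEquiv, cons2]
  · refine Fin.cases ?_ (fun s => ?_) s
    · rw [finOptEquiv, Equiv.trans_apply, finSuccEquiv_succ]
      simp [cons2]
    · simp [finOptEquiv, cons2]

namespace Geo

variable {n : ℕ} {A : Type} [CommRing A] [Algebra ℝ A] (B : Geo n A)

theorem ev_contr {r : ℕ} (M : TMono (r + 2)) (I : Fin r → Fin n) :
    B.ev (.contr M) I = B.ctr (fun J => B.ev M fun s => J (finOptEquiv r s)) I := by
  simp only [ev, ctr, cons2_finOptEquiv]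

theorem ev_of_ord_eq_zero {r : ℕ} (M : TMono r) (h : M.ord = 0) :
    (∀ i I, B.nab (M.weight : ℝ) (B.ev M) i I = 0) ∧ (0 < M.numNabla → ∀ I, B.ev M I = 0) := by
  induction M with
  | metric =>
    refine ⟨fun i I => ?_, fun h => absurd h (by simp [TMono.numNabla])⟩
    have := B.nab_metric i I
    have hw : ((TMono.weight .metric : ℤ) : ℝ) = -2 := by simp [TMono.weight]
    rw [hw]
    exact this
  | schouten => simp [TMono.ord] at h
  | weyl => simp [TMono.ord] at h
  | mode m => simp [TMono.ord] at h
  | nabla M ih =>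
    have h1 : B.ev (.nabla M) = fun _ => 0 := by
      funext I; exact (ih h).1 _ _
    exact ⟨fun i I => by rw [h1, nab_zero], fun _ I => by rw [h1]⟩
  | @tensor r s M N ihM ihN =>
    simp only [TMono.ord, Nat.add_eq_zero_iff] at h
    obtain ⟨hM, hM'⟩ := ihM h.1
    obtain ⟨hN, hN'⟩ := ihN h.2
    refine ⟨fun i I => ?_, fun hp I => ?_⟩
    · have h1 := B.nab_reindex (((M.tensor N).weight : ℤ) : ℝ)
        (fun I : Fin r ⊕ Fin s → Fin n => B.ev M (fun p => I (.inl p)) * B.ev N (fun q => I (.inr q)))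
        finSumFinEquiv i I
      have h2 := B.nab_mul M.weight N.weight (B.ev M) (B.ev N) i (fun p => I (finSumFinEquiv p))
      rw [hM, hN, zero_mul, mul_zero, add_zero] at h2
      rw [TMono.weight, Int.cast_add, h2] at h1
      simp only [finSumFinEquiv_apply_left, finSumFinEquiv_apply_right] at h1
      rw [TMono.weight, Int.cast_add]
      exact h1
    · simp only [TMono.numNabla, Nat.add_pos_iff_pos_or_pos] at hp
      rcases hp with hp | hp
      · simp [ev, hM' hp]
      · simp [ev, hN' hp]
  | @contr r M ih =>
    obtain ⟨h1, h2⟩ := ih h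
    refine ⟨fun i I => ?_, fun hp I => ?_⟩
    · have h3 := B.nab_ctr M.weight (fun J => B.ev M fun s => J (finOptEquiv r s)) i I
      have h4 : ∀ J, B.nab M.weight (fun J => B.ev M fun s => J (finOptEquiv r s)) i J = 0 := by
        intro J; rw [nab_reindex, h1]
      simp only [h4] at h3
      have : B.ev (.contr M) = B.ctr (fun J => B.ev M fun s => J (finOptEquiv r s)) :=
        funext fun I => B.ev_contr M I
      rw [this, TMono.weight]
      push_cast
      rw [h3]
      simp [ctr]
    · simp [ev, h2 hp]
  | perm σ M ih =>
    obtain ⟨h1, h2⟩ := ih h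
    exact ⟨fun i I => (B.nab_reindex M.weight (B.ev M) σ i I).trans (h1 _ _),
      fun hp I => h2 hp _⟩

end Geo

/-! ### Representable tensors -/

/-- The expansion of a Weyl-ambient metric which is Ricci-flat to the order `k`. -/
structure Sit (k : ℕ) : Type 1 where
  /-- the dimension -/
  n : ℕ
  /-- the functions on the boundary -/
  A : Type
  [ring : CommRing A]
  [alg : Algebra ℝ A]
  three_le : 3 ≤ n
  ne_even : ∀ m ∈ Finset.Icc 2 k, n ≠ 2 * m
  /-- the expansion -/
  B : Expansion n A
  flat : B.IsFlat k

attribute [instance] Sit.ring Sit.alg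

/-- Tensors with index set `κ` determined by Weyl-ambient metrics. -/
abbrev Fld (k : ℕ) (κ : Type) : Type 1 := ∀ σ : Sit k, (κ → Fin σ.n) → σ.A

/-- The denominator of a coefficient. -/
def den (s n : ℕ) : ℝ := ∏ j ∈ Finset.Icc 2 s, ((n : ℝ) - 2 * j)

/-- A rational function of the dimension with poles at most at `4, …, 2s`. -/
def IsCf (s : ℕ) (c : ℕ → ℝ) : Prop :=
  ∃ (p : Polynomial ℝ) (N : ℕ), ∀ n : ℕ, c n * den s n ^ N = p.eval (n : ℝ)

theorem den_ne_zero {s n : ℕ} (h : ∀ m ∈ Finset.Icc 2 s, n ≠ 2 * m) : den s n ≠ 0 := by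
  rw [den, Finset.prod_ne_zero_iff]
  intro j hj h0
  exact h j hj (by exact_mod_cast sub_eq_zero.1 h0)

namespace IsCf

/-- The denominator as a polynomial. -/
def denP (s : ℕ) : Polynomial ℝ := ∏ j ∈ Finset.Icc 2 s, (Polynomial.X - Polynomial.C (2 * (j : ℝ)))

theorem eval_denP (s n : ℕ) : (denP s).eval (n : ℝ) = den s n := by
  simp [denP, den, Polynomial.eval_prod]

theorem of_poly {s : ℕ} (p : Polynomial ℝ) : IsCf s fun n => p.eval (n : ℝ) := ⟨p, 0, by simp⟩

theorem const {s : ℕ} (c : ℝ) : IsCf s fun _ => c := ⟨Polynomial.C c, 0, by simp⟩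

theorem mul {s : ℕ} {c c' : ℕ → ℝ} (h : IsCf s c) (h' : IsCf s c') :
    IsCf s fun n => c n * c' n := by
  obtain ⟨p, N, hp⟩ := h
  obtain ⟨p', N', hp'⟩ := h'
  refine ⟨p * p', N + N', fun n => ?_⟩
  rw [Polynomial.eval_mul, ← hp, ← hp', pow_add]; ring

theorem mono {s s' : ℕ} (hs : s ≤ s') {c : ℕ → ℝ} (h : IsCf s c) : IsCf s' c := by
  obtain ⟨p, N, hp⟩ := h
  refine ⟨p * (∏ j ∈ Finset.Icc 2 s' \ Finset.Icc 2 s,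
    (Polynomial.X - Polynomial.C (2 * (j : ℝ)))) ^ N, N, fun n => ?_⟩
  have : den s' n = den s n * ∏ j ∈ Finset.Icc 2 s' \ Finset.Icc 2 s, ((n : ℝ) - 2 * j) := by
    rw [den, den, mul_comm, Finset.prod_sdiff (Finset.Icc_subset_Icc_right hs)]
  rw [Polynomial.eval_mul, ← hp, this, mul_pow, Polynomial.eval_pow, Polynomial.eval_prod]
  simp [mul_assoc]

end IsCf

/-- `Rep k s o w T` means that `T` is a combination of tensor monomials of order at least `o` and
weight `w`, with coefficients that have poles at most at `4, …, 2s`. -/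
inductive Rep (k s : ℕ) : ℕ → ℤ → {κ : Type} → Fld k κ → Prop
  | mono {κ : Type} {o r : ℕ} (M : TMono r) (e : Fin r ≃ κ) (ho : o ≤ M.ord) :
      Rep k s o M.weight (fun σ (I : κ → Fin σ.n) => σ.B.ev M fun p => I (e p))
  | one {κ : Type} [IsEmpty κ] : Rep k s 0 0 (fun σ (_ : κ → Fin σ.n) => 1)
  | zero {κ : Type} {o : ℕ} {w : ℤ} : Rep k s o w (fun σ (_ : κ → Fin σ.n) => 0)
  | add {κ : Type} {o : ℕ} {w : ℤ} {T T' : Fld k κ} : Rep k s o w T → Rep k s o w T' →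
      Rep k s o w (fun σ I => T σ I + T' σ I)
  | smul {κ : Type} {o : ℕ} {w : ℤ} {T : Fld k κ} {c : ℕ → ℝ} : IsCf s c → Rep k s o w T →
      Rep k s o w (fun σ I => c σ.n • T σ I)

namespace Rep

variable {k s : ℕ} {o o' : ℕ} {w w' : ℤ} {κ κ' : Type}

theorem congr {T T' : Fld k κ} (h : Rep k s o w T) (e : ∀ σ I, T' σ I = T σ I) : Rep k s o w T' := by
  have : T' = T := by funext σ I; exact e σ I
  rwa [this]

theorem csmul {T : Fld k κ} (c : ℝ) (h : Rep k s o w T) : Rep k s o w (fun σ I => c • T σ I) :=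
  h.smul (IsCf.const c)

theorem neg {T : Fld k κ} (h : Rep k s o w T) : Rep k s o w (fun σ I => -T σ I) :=
  (h.csmul (-1)).congr fun _ _ => by simp

theorem sub {T T' : Fld k κ} (h : Rep k s o w T) (h' : Rep k s o w T') :
    Rep k s o w (fun σ I => T σ I - T' σ I) :=
  (h.add h'.neg).congr fun _ _ => sub_eq_add_neg _ _

theorem sum {α : Type*} (S : Finset α) {T : α → Fld k κ} (h : ∀ a ∈ S, Rep k s o w (T a)) :
    Rep k s o w (fun σ I => ∑ a ∈ S, T a σ I) := by
  classical
  induction S using Finset.induction_on with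
  | empty => simpa using Rep.zero
  | insert a S ha ih =>
    simp only [Finset.sum_insert ha]
    exact (h a (Finset.mem_insert_self _ _)).add
      (ih fun b hb => h b (Finset.mem_insert_of_mem hb))

theorem mono_ord {T : Fld k κ} (h : Rep k s o w T) (ho : o' ≤ o) : Rep k s o' w T := by
  induction h with
  | mono M e h => exact .mono M e (ho.trans h)
  | one => obtain rfl := Nat.le_zero.1 ho; exact .one
  | zero => exact .zero
  | add _ _ ih ih' => exact .add (ih ho) (ih' ho)
  | smul hc _ ih => exact .smul hc (ih ho)

theorem mono_cf {s' : ℕ} (hs : s ≤ s') {T : Fld k κ} (h : Rep k s o w T) : Rep k s' o w T := by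
  induction h with
  | mono M e h => exact .mono M e h
  | one => exact .one
  | zero => exact .zero
  | add _ _ ih ih' => exact .add ih ih'
  | smul hc _ ih => exact .smul (hc.mono hs) ih

theorem reindex {T : Fld k κ} (h : Rep k s o w T) (e : κ ≃ κ') :
    Rep k s o w (fun σ I => T σ fun p => I (e p)) := by
  induction h with
  | mono M e' h => exact .mono M (e'.trans e) h
  | @one κ hκ => have := e.symm.isEmpty; exact .one
  | zero => exact .zero
  | add _ _ ih ih' => exact .add (ih e) (ih' e)
  | smul hc _ ih => exact .smul hc (ih e)

theorem tensor {T : Fld k κ} {T' : Fld k κ'} (h : Rep k s o w T) (h' : Rep k s o' w' T') :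
    Rep k s (o + o') (w + w')
      (fun σ (I : κ ⊕ κ' → Fin σ.n) => T σ (fun p => I (.inl p)) * T' σ fun q => I (.inr q)) := by
  induction h with
  | @mono κ o r M e ho =>
    induction h' with
    | @mono κ' o' r' N e' ho' =>
      refine (Rep.mono (M.tensor N) (finSumFinEquiv.symm.trans (Equiv.sumCongr e e'))
        (Nat.add_le_add ho ho')).congr fun σ I => ?_
      simp [Geo.ev]
    | @one κ' hκ' =>
      rw [add_zero]
      rw [add_zero]
      refine (Rep.mono M (e.trans (Equiv.sumEmpty κ κ').symm) ho).congr fun σ I => ?_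
      simp
    | zero => exact Rep.zero.congr fun σ I => by simp
    | add _ _ ih ih' => exact (ih.add ih').congr fun σ I => by rw [mul_add]
    | smul hc _ ih => exact (ih.smul hc).congr fun σ I => by rw [mul_smul_comm]
  | @one κ hκ =>
    rw [zero_add, zero_add]
    exact (h'.reindex (Equiv.emptySum κ κ').symm).congr fun σ I => by simp
  | zero => exact Rep.zero.congr fun σ I => by simp
  | add _ _ ih ih' => exact (ih.add ih').congr fun σ I => by rw [add_mul]
  | smul hc _ ih => exact (ih.smul hc).congr fun σ I => by rw [smul_mul_assoc]

theorem nabla {T : Fld k κ} [Fintype κ] [DecidableEq κ] (h : Rep k s o w T) :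
    Rep k s o w (fun σ (I : Option κ → Fin σ.n) =>
      σ.B.nab (w : ℝ) (T σ) (I none) fun p => I (some p)) := by
  rename_i i1 i2
  revert i1 i2
  induction h with
  | @mono κ o r M e ho =>
    intro _ _
    refine (Rep.mono (M.nabla) ((finSuccEquiv r).trans (Equiv.optionCongr e)) ho).congr fun σ I => ?_
    rw [Geo.nab_reindex]
    simp only [Geo.ev, Equiv.trans_apply, finSuccEquiv_zero]
    congr 1
  | one =>
    intro _ _
    exact Rep.zero.congr fun σ I => by simp [Geo.nab_def]
  | zero => intro _ _; exact Rep.zero.congr fun σ I => by rw [Geo.nab_zero]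
  | add _ _ ih ih' =>
    intro _ _
    exact (ih.add ih').congr fun σ I => Geo.nab_add _ _ _ _ _ _
  | smul hc _ ih =>
    intro _ _
    exact (ih.smul hc).congr fun σ I => Geo.nab_smul _ _ _ _ _ _

theorem contr_equiv {T : Fld k κ'} (h : Rep k s o w T) (e : κ' ≃ Option (Option κ)) :
    Rep k s o (w + 2) (fun σ I => σ.B.ctr (fun J => T σ fun p => J (e p)) I) := by
  induction h with
  | @mono κ' o r M e1 ho =>
    have : Fintype (Option (Option κ)) := Fintype.ofEquiv _ (e1.trans e)
    have : Fintype κ := Fintype.ofInjective (fun x : κ => some (some x))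
      fun x y h => by simpa using h
    obtain ⟨r', ⟨e'⟩⟩ : ∃ r', Nonempty (Fin r' ≃ κ) := ⟨_, ⟨(Fintype.equivFin κ).symm⟩⟩
    have hr : r = r' + 2 := by
      have h1 := Nat.card_congr (e1.trans e)
      have h2 := Nat.card_congr e'
      simp only [Finite.card_option, Nat.card_fin] at h1 h2
      omega
    subst hr
    set c := (finOptEquiv r').trans (Equiv.optionCongr (Equiv.optionCongr e')) with hc
    refine (Rep.mono (s := s) (k := k) (.contr (.perm ((e1.trans e).trans c.symm) M)) e' ho).congr
      fun σ I => ?_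
    rw [Geo.ev_contr]
    simp only [Geo.ctr, Geo.ev]
    refine Finset.sum_congr rfl fun p _ => Finset.sum_congr rfl fun q _ => ?_
    congr 2
    funext t
    have : e (e1 t) = c (c.symm (e (e1 t))) := (c.apply_symm_apply _).symm
    conv_lhs => rw [this]
    simp only [Equiv.trans_apply]
    generalize c.symm (e (e1 t)) = u
    rw [hc]
    simp only [Equiv.trans_apply]
    rcases finOptEquiv r' u with _ | _ | v <;> rfl
  | @one κ' hκ' => exact (hκ'.false (e.symm none)).elim
  | zero => exact Rep.zero.congr fun σ I => by simp [Geo.ctr]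
  | add _ _ ih ih' =>
    exact ((ih e).add (ih' e)).congr fun σ I => by
      simp [Geo.ctr, mul_add, Finset.sum_add_distrib]
  | smul hc _ ih =>
    exact ((ih e).smul hc).congr fun σ I => by
      simp [Geo.ctr, Finset.smul_sum]

/-- A tensor of positive homogeneity has order at least one. -/
theorem ord_one {T : Fld k κ} [Fintype κ] (h : Rep k s o w T) (hw : 0 < (Fintype.card κ : ℤ) + w) :
    Rep k s 1 w T := by
  rename_i i1
  revert i1
  induction h with
  | @mono κ o r M e ho =>
    intro _ hw
    by_cases h1 : 1 ≤ M.ord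
    · exact .mono M e h1
    · have h0 : M.ord = 0 := by omega
      have := M.rank_add_weight_of_ord h0
      have hc := Fintype.card_congr e
      rw [Fintype.card_fin] at hc
      exact Rep.zero.congr fun σ I => (σ.B.ev_of_ord_eq_zero M h0).2 (by omega) _
  | @one κ hκ => intro _ hw; simp at hw
  | zero => intro _ _; exact .zero
  | add _ _ ih ih' => intro _ hw; exact .add (ih hw) (ih' hw)
  | smul hc _ ih => intro _ hw; exact .smul hc (ih hw)

end Rep

end

end WeylAmbient

namespace WeylAmbient

noncomputable section

/-! ### The ambient Ricci tensor in the frame -/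

theorem derivation_inverse {A : Type} [CommRing A] [Algebra ℝ A] {κ : Type} [Fintype κ]
    [DecidableEq κ] {G Gi : κ → κ → A}
    (h : ∀ i j, ∑ m, G i m * Gi m j = if i = j then 1 else 0)
    (h' : ∀ i j, ∑ m, Gi i m * G m j = if i = j then 1 else 0) (D : Derivation ℝ A A) (i j : κ) :
    D (Gi i j) = -∑ p, ∑ q, Gi i p * D (G p q) * Gi q j := by
  have h1 : ∀ i j, ∑ m, G i m * D (Gi m j) = -∑ m, D (G i m) * Gi m j := by
    intro i j
    have := congrArg D (h i j)
    rw [map_sum] at this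
    simp only [Derivation.leibniz, smul_eq_mul, Finset.sum_add_distrib] at this
    have h0 : D (if i = j then 1 else 0) = 0 := by split_ifs <;> simp
    rw [h0] at this
    rw [eq_neg_iff_add_eq_zero, ← this]
    congr 1
    exact Finset.sum_congr rfl fun _ _ => mul_comm _ _
  calc D (Gi i j) = ∑ l, (∑ m, Gi i m * G m l) * D (Gi l j) := by simp [h']
    _ = ∑ m, Gi i m * ∑ l, G m l * D (Gi l j) := by
      simp only [Finset.sum_mul, Finset.mul_sum]
      rw [Finset.sum_comm]
      simp only [mul_assoc]
    _ = _ := by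
      simp only [h1, mul_neg, Finset.mul_sum, Finset.sum_neg_distrib, mul_assoc]

namespace RhoGeo

variable {n : ℕ} {S : Type} [CommRing S] [Algebra ℝ S] (R : RhoGeo n S)

/-- The trace of `ψ`. -/
def trψ : S := ∑ l, R.ψu l l

/-- The Ricci tensor of the horizontal connection. -/
def Rh (k j : Fin n) : S :=
  ∑ l, (R.h l (R.Γh l j k) - R.h j (R.Γh l l k)
    + ∑ m, (R.Γh l l m * R.Γh m j k - R.Γh l j m * R.Γh m l k))

/-- The horizontal covariant derivative of `∂_ρ a`, of weight 2. -/
def N1 (j k : Fin n) : S :=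
  R.h j (R.dr (R.a k)) + 2 * R.a j * R.dr (R.a k) - ∑ m, R.Γh m j k * R.dr (R.a m)

/-- The horizontal covariant derivative of `ψ`. -/
def N2 (i j k : Fin n) : S :=
  R.h i (R.ψ j k) - ∑ m, R.Γh m i j * R.ψ m k - ∑ m, R.Γh m i k * R.ψ j m

/-- The component `R_{-kj-}` of the curvature. -/
def r (k j : Fin n) : S :=
  R.dr (R.ψ j k) - ∑ m, R.ψ j m * R.ψu k m - R.N1 j k - 2 * R.ρ * R.dr (R.a k) * R.dr (R.a j)

theorem sum_g_ψu (j k : Fin n) : ∑ m, R.g j m * R.ψu k m = R.ψ k j := by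
  rw [← R.ψu_g k j]
  exact Finset.sum_congr rfl fun m _ => by rw [R.g_symm j m, mul_comm]

theorem fc_phmh (k j : Fin n) : R.fc (.inr 0) (.inl k) (.inr 0) (.inl j) = R.ρ * R.r k j := by
  simp only [fc, frameCurv, Fintype.sum_sum_type, Fin.sum_univ_two, om_hhh, om_hhp, om_hhm, om_hph,
    om_hpp, om_hpm, om_hmh, om_hmp, om_hmm, om_phh, om_php, om_phm, om_pph, om_ppp, om_ppm, om_pmh,
    om_pmp, om_pmm, om_mhh, om_mhp, om_mhm, om_mph, om_mpp, om_mpm, om_mmh, om_mmp, om_mmm, e_h,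
    e_p, e_m, Derivation.leibniz, smul_eq_mul, h_ρ, r, N1, map_neg]
  simp [mul_sub, Finset.sum_sub_distrib, Finset.mul_sum, sub_mul, Finset.sum_add_distrib]
  have e1 : ∑ x, R.ψ j x * (R.ρ * R.ψu k x) = ∑ x, R.ρ * (R.ψ j x * R.ψu k x) :=
    Finset.sum_congr rfl fun _ _ => by ring
  have e2 : ∑ x, R.ρ * (R.Γh x j k * R.dr (R.a x)) = ∑ x, R.ρ * R.dr (R.a x) * R.Γh x j k :=
    Finset.sum_congr rfl fun _ _ => by ring
  linear_combination -e1 - e2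

theorem fc_mhmh (k j : Fin n) : R.fc (.inr 1) (.inl k) (.inr 1) (.inl j) = R.ρ * R.r k j := by
  have e0 := R.sum_g_ψu j k
  have e3 := R.ψ_add j k
  simp only [fc, frameCurv, Fintype.sum_sum_type, Fin.sum_univ_two, om_hhh, om_hhp, om_hhm, om_hph,
    om_hpp, om_hpm, om_hmh, om_hmp, om_hmm, om_phh, om_php, om_phm, om_pph, om_ppp, om_ppm, om_pmh,
    om_pmp, om_pmm, om_mhh, om_mhp, om_mhm, om_mph, om_mpp, om_mpm, om_mmh, om_mmp, om_mmm, e_h,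
    e_p, e_m, Derivation.leibniz, smul_eq_mul, h_ρ, r, N1, map_neg, map_add, R.dr_ρ]
  simp [mul_sub, Finset.sum_sub_distrib, Finset.mul_sum, sub_mul, add_mul, Finset.sum_add_distrib]
  have e1 : ∑ x, R.ρ * R.ψ j x * R.ψu k x = ∑ x, R.ρ * (R.ψ j x * R.ψu k x) :=
    Finset.sum_congr rfl fun _ _ => by ring
  have e2 : ∑ x, R.ρ * (R.Γh x j k * R.dr (R.a x)) = ∑ x, R.ρ * R.dr (R.a x) * R.Γh x j k :=
    Finset.sum_congr rfl fun _ _ => by ring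
  linear_combination -e1 - e2 + e0 + e3

theorem fc_phhm (k j : Fin n) : R.fc (.inr 0) (.inl k) (.inl j) (.inr 1) = R.r k j := by
  simp only [fc, frameCurv, Fintype.sum_sum_type, Fin.sum_univ_two, om_hhh, om_hhp, om_hhm, om_hph,
    om_hpp, om_hpm, om_hmh, om_hmp, om_hmm, om_phh, om_php, om_phm, om_pph, om_ppp, om_ppm, om_pmh,
    om_pmp, om_pmm, om_mhh, om_mhp, om_mhm, om_mph, om_mpp, om_mpm, om_mmh, om_mmp, om_mmm, e_h,
    e_p, e_m, Derivation.leibniz, smul_eq_mul, h_ρ, r, N1, map_neg]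
  simp [mul_sub, Finset.sum_sub_distrib, Finset.mul_sum, sub_mul, Finset.sum_add_distrib]
  have e2 : ∑ x, R.Γh x j k * R.dr (R.a x) = ∑ x, R.dr (R.a x) * R.Γh x j k :=
    Finset.sum_congr rfl fun _ _ => by ring
  linear_combination -e2

theorem fc_hhhh_trace (k j : Fin n) : ∑ l, R.fc (.inl l) (.inl k) (.inl l) (.inl j)
    = R.Rh k j + R.f k j - ((n : ℝ) - 2) • R.ψ j k - R.g j k * R.trψ
      + 2 * R.ρ * (R.trψ * R.ψ j k - ∑ l, R.ψu j l * R.ψ l k - ∑ l, R.f l j * R.ψu k l) := by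
  have hl : ∀ l, R.fc (.inl l) (.inl k) (.inl l) (.inl j)
      = (R.h l (R.Γh l j k) - R.h j (R.Γh l l k)
        + ∑ m, (R.Γh l l m * R.Γh m j k - R.Γh l j m * R.Γh m l k))
        + (-R.ψ j k + R.ρ * R.ψu l l * R.ψ j k + R.ψu l l * (-R.g j k + R.ρ * R.ψ j k)
        + (if j = l then R.ψ l k else 0) + (R.ψu j l * R.g l k - 2 * R.ρ * (R.ψu j l * R.ψ l k))
        + (if k = l then R.f l j else 0) - 2 * R.ρ * (R.f l j * R.ψu k l)) := by
    intro l
    simp only [fc, frameCurv, Fintype.sum_sum_type, Fin.sum_univ_two, om_hhh, om_hhp, om_hhm, om_hph,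
      om_hpp, om_hpm, om_hmh, om_hmp, om_hmm, om_phh, om_php, om_phm, om_pph, om_ppp, om_ppm, om_pmh,
      om_pmp, om_pmm, om_mhh, om_mhp, om_mhm, om_mph, om_mpp, om_mpm, om_mmh, om_mmp, om_mmm, e_h,
      R.Γh_symm _ j l, sub_self, zero_mul, Finset.sum_const_zero, zero_add, if_true]
    rw [R.g_symm j l, ← R.ψ_sub l j]
    split_ifs <;> ring
  have e1 := R.ψu_g j k
  simp only [hl, Finset.sum_add_distrib, Finset.sum_sub_distrib, Finset.sum_ite_eq, Finset.mem_univ,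
    if_true, e1, ← Finset.mul_sum, ← Finset.sum_mul, Rh, trψ]
  simp [Finset.card_univ, sub_smul, ← Nat.cast_smul_eq_nsmul ℝ, two_smul]
  ring

/-- The tangential components of the ambient Ricci tensor. -/
theorem ric_hh (k j : Fin n) : ∑ c, R.fc c (.inl k) c (.inl j)
    = R.Rh k j + R.f k j - ((n : ℝ) - 2) • R.ψ j k - R.g j k * R.trψ
      + 2 * R.ρ * (R.trψ * R.ψ j k - ∑ l, R.ψu j l * R.ψ l k - ∑ l, R.f l j * R.ψu k l
        + R.r k j) := by
  rw [Fintype.sum_sum_type, fc_hhhh_trace, Fin.sum_univ_two, fc_phmh, fc_mhmh]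
  ring

theorem h_gi (i j l : Fin n) : R.h i (R.gi j l) = -(∑ m, R.Γh j i m * R.gi m l)
    - ∑ m, R.Γh l i m * R.gi j m - 2 * R.a i * R.gi j l := by
  have e1 : ∑ p, ∑ q, R.gi j p * (∑ k, R.Γh k i p * R.g k q) * R.gi q l
      = ∑ m, R.Γh l i m * R.gi j m := by
    have : ∀ p, ∑ q, R.gi j p * (∑ k, R.Γh k i p * R.g k q) * R.gi q l = R.Γh l i p * R.gi j p := by
      intro p
      simp only [Finset.sum_mul, Finset.mul_sum]
      rw [Finset.sum_comm]
      have : ∀ k, ∑ q, R.gi j p * (R.Γh k i p * R.g k q) * R.gi q l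
          = R.gi j p * R.Γh k i p * (if k = l then 1 else 0) := by
        intro k
        rw [← R.g_gi, Finset.mul_sum]
        exact Finset.sum_congr rfl fun _ _ => by ring
      simp only [this]
      simp [mul_comm]
    exact Finset.sum_congr rfl fun p _ => this p
  have e2 : ∑ p, ∑ q, R.gi j p * (∑ k, R.Γh k i q * R.g k p) * R.gi q l
      = ∑ m, R.Γh j i m * R.gi m l := by
    rw [Finset.sum_comm]
    have : ∀ q, ∑ p, R.gi j p * (∑ k, R.Γh k i q * R.g k p) * R.gi q l = R.Γh j i q * R.gi q l := by
      intro q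
      simp only [Finset.sum_mul, Finset.mul_sum]
      rw [Finset.sum_comm]
      have : ∀ k, ∑ p, R.gi j p * (R.Γh k i q * R.g k p) * R.gi q l
          = (if j = k then 1 else 0) * (R.Γh k i q * R.gi q l) := by
        intro k
        rw [← R.gi_g, Finset.sum_mul]
        exact Finset.sum_congr rfl fun _ _ => by rw [R.g_symm k]; ring
      simp [this]
    exact Finset.sum_congr rfl fun p _ => this p
  have e3 : ∑ p, ∑ q, R.gi j p * (2 * R.a i * R.g p q) * R.gi q l = 2 * R.a i * R.gi j l := by
    have : ∀ p, ∑ q, R.gi j p * (2 * R.a i * R.g p q) * R.gi q l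
        = 2 * R.a i * (R.gi j p * if p = l then 1 else 0) := by
      intro p
      rw [← R.g_gi, Finset.mul_sum, Finset.mul_sum]
      exact Finset.sum_congr rfl fun _ _ => by ring
    simp [this]
  rw [derivation_inverse R.g_gi R.gi_g]
  simp only [Γh_metric, mul_add, add_mul, Finset.sum_add_distrib]
  rw [e1, e2, e3]
  ring

/-- The divergence of a contravariant vector in terms of the covariant one. -/
theorem div_raise (u : Fin n → S) :
    ∑ l, (R.h l (∑ m, u m * R.gi m l) + ∑ m, R.Γh l l m * ∑ p, u p * R.gi p m)
      = ∑ l, ∑ m, R.gi l m * (R.h l (u m) - ∑ p, R.Γh p l m * u p - 2 * R.a l * u m) := by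
  simp only [map_sum, Derivation.leibniz, smul_eq_mul, h_gi, Finset.sum_add_distrib, mul_add, mul_sub,
    Finset.sum_sub_distrib, Finset.mul_sum, mul_neg, Finset.sum_neg_distrib]
  have e1 : ∑ l, ∑ m, ∑ p, u m * (R.Γh l l p * R.gi m p)
      = ∑ l, ∑ m, ∑ p, R.Γh l l m * (u p * R.gi p m) := by
    refine Finset.sum_congr rfl fun l _ => ?_
    rw [Finset.sum_comm]
    exact Finset.sum_congr rfl fun _ _ => Finset.sum_congr rfl fun _ _ => by ring
  have e2 : ∑ l, ∑ m, ∑ p, u m * (R.Γh m l p * R.gi p l)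
      = ∑ l, ∑ m, ∑ p, R.gi l m * (R.Γh p l m * u p) := by
    refine Finset.sum_congr rfl fun l _ => ?_
    rw [Finset.sum_comm]
    exact Finset.sum_congr rfl fun p _ => Finset.sum_congr rfl fun m _ => by
      rw [R.gi_symm l p]; ring
  have e3 : ∑ l, ∑ m, u m * (2 * R.a l * R.gi m l) = ∑ l, ∑ m, R.gi l m * (2 * R.a l * u m) :=
    Finset.sum_congr rfl fun l _ => Finset.sum_congr rfl fun m _ => by rw [R.gi_symm l m]; ring
  have e4 : ∑ l, ∑ m, R.gi m l * R.h l (u m) = ∑ l, ∑ m, R.gi l m * R.h l (u m) :=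
    Finset.sum_congr rfl fun l _ => Finset.sum_congr rfl fun m _ => by rw [R.gi_symm l m]
  linear_combination -e1 - e2 - e3 + e4

theorem au_eq (k : Fin n) : R.au k = ∑ m, R.dr (R.a m) * R.gi m k :=
  Finset.sum_congr rfl fun m _ => by rw [R.gi_symm, mul_comm]

theorem trψ_eq : R.trψ = ∑ l, ∑ m, R.gi l m * R.ψ l m := by
  rw [trψ]
  exact Finset.sum_congr rfl fun l _ => Finset.sum_congr rfl fun m _ => by rw [R.gi_symm, mul_comm]

theorem h_trψ (j : Fin n) :
    R.h j R.trψ + 2 * R.a j * R.trψ = ∑ l, ∑ m, R.gi l m * R.N2 j l m := by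
  have e1 : ∑ l, ∑ m, ∑ p, R.Γh l j p * R.gi p m * R.ψ l m
      = ∑ l, ∑ m, ∑ p, R.gi l m * (R.Γh p j l * R.ψ p m) := by
    rw [sum3_reverse]
    exact Finset.sum_congr rfl fun _ _ => Finset.sum_congr rfl fun _ _ =>
      Finset.sum_congr rfl fun _ _ => by ring
  have e2 : ∑ l, ∑ m, ∑ p, R.Γh m j p * R.gi l p * R.ψ l m
      = ∑ l, ∑ m, ∑ p, R.gi l m * (R.Γh p j m * R.ψ l p) := by
    refine Finset.sum_congr rfl fun _ _ => ?_
    rw [Finset.sum_comm]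
    exact Finset.sum_congr rfl fun _ _ => Finset.sum_congr rfl fun _ _ => by ring
  rw [trψ_eq]
  simp only [map_sum, Derivation.leibniz, smul_eq_mul, h_gi, N2, mul_sub, Finset.sum_sub_distrib,
    Finset.mul_sum, Finset.sum_add_distrib, sub_mul, mul_neg, Finset.sum_neg_distrib, neg_mul]
  have e3 : ∑ l, ∑ m, R.ψ l m * (2 * R.a j * R.gi l m) = ∑ l, ∑ m, 2 * R.a j * (R.gi l m * R.ψ l m) :=
    Finset.sum_congr rfl fun _ _ => Finset.sum_congr rfl fun _ _ => by ring
  have e4 : ∑ l, ∑ m, ∑ p, R.ψ l m * (R.Γh l j p * R.gi p m)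
      = ∑ l, ∑ m, ∑ p, R.Γh l j p * R.gi p m * R.ψ l m :=
    Finset.sum_congr rfl fun _ _ => Finset.sum_congr rfl fun _ _ =>
      Finset.sum_congr rfl fun _ _ => by ring
  have e5 : ∑ l, ∑ m, ∑ p, R.ψ l m * (R.Γh m j p * R.gi l p)
      = ∑ l, ∑ m, ∑ p, R.Γh m j p * R.gi l p * R.ψ l m :=
    Finset.sum_congr rfl fun _ _ => Finset.sum_congr rfl fun _ _ =>
      Finset.sum_congr rfl fun _ _ => by ring
  linear_combination -e3 - e4 - e5 - e1 - e2

/-- The mixed components of the ambient Ricci tensor. -/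
theorem ric_mh (j : Fin n) : ∑ c, R.fc c (.inr 1) c (.inl j)
    = ∑ l, ∑ m, R.gi l m * (R.N2 l j m - R.N2 j l m) - 2 * R.ρ * ∑ l, R.f l j * R.au l := by
  have e0 : ∑ x, R.dr (R.a x) * R.ψu j x = ∑ x, R.ψ j x * R.au x := by
    simp only [← R.au_g, ← R.ψu_g j, Finset.sum_mul]
    rw [Finset.sum_comm]
    exact Finset.sum_congr rfl fun x _ => Finset.sum_congr rfl fun y _ => by
      rw [R.g_symm x y]; ring
  have e0' : ∑ x, R.g j x * R.au x = R.dr (R.a j) := by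
    rw [← R.au_g]
    exact Finset.sum_congr rfl fun x _ => by rw [R.g_symm j x, mul_comm]
  have hp : R.fc (.inr 0) (.inr 1) (.inr 0) (.inl j) = 0 := by
    simp [fc, frameCurv, mul_assoc, ← Finset.mul_sum, mul_left_comm _ R.ρ, e0]
  have hm : R.fc (.inr 1) (.inr 1) (.inr 1) (.inl j) = 0 := by
    have h2 : R.dr 2 = 0 := by simpa using R.dr.map_natCast 2
    simp [fc, frameCurv, Derivation.leibniz, h2, add_mul, Finset.sum_add_distrib, mul_assoc,
      ← Finset.mul_sum, e0, e0']
    ring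
  have hl : ∀ l, R.fc (.inl l) (.inr 1) (.inl l) (.inl j) = (R.h l (R.ψu j l)
      + ∑ m, R.Γh l l m * R.ψu j m) - R.h j (R.ψu l l) - 2 * R.a j * R.ψu l l
      - ∑ m, R.Γh l j m * R.ψu l m + 2 * R.a l * R.ψu j l - 2 * R.ρ * (R.f l j * R.au l) := by
    intro l
    simp [fc, frameCurv, R.Γh_symm _ j l, Finset.sum_sub_distrib]
    rw [R.g_symm j l, ← R.ψ_sub l j]
    ring
  have hd : ∑ l, (R.h l (R.ψu j l) + ∑ m, R.Γh l l m * R.ψu j m)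
      = ∑ l, ∑ m, R.gi l m * (R.h l (R.ψ j m) - ∑ p, R.Γh p l m * R.ψ j p - 2 * R.a l * R.ψ j m) :=
    R.div_raise (R.ψ j)
  have e1 : ∑ l, ∑ m, R.Γh l j m * R.ψu l m = ∑ l, ∑ m, ∑ p, R.gi l m * (R.Γh p l j * R.ψ p m) := by
    simp only [ψu, Finset.mul_sum]
    rw [sum3_rotate]
    refine Finset.sum_congr rfl fun l _ => Finset.sum_congr rfl fun m _ =>
      Finset.sum_congr rfl fun p _ => ?_
    rw [R.gi_symm m l, R.Γh_symm p j l]; ring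
  have e2 : ∑ l, 2 * R.a l * R.ψu j l = ∑ l, ∑ m, R.gi l m * (2 * R.a l * R.ψ j m) := by
    simp only [ψu, Finset.mul_sum]
    exact Finset.sum_congr rfl fun l _ => Finset.sum_congr rfl fun m _ => by
      rw [R.gi_symm m l]; ring
  have e3 := R.h_trψ j
  rw [trψ, map_sum, Finset.mul_sum] at e3
  rw [Fintype.sum_sum_type, Fin.sum_univ_two, hp, hm]
  simp only [hl, Finset.sum_add_distrib, Finset.sum_sub_distrib, ← Finset.mul_sum] at hd e3 ⊢
  simp only [Finset.mul_sum, mul_sub, Finset.sum_sub_distrib, N2] at hd e1 e2 e3 ⊢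
  linear_combination hd - e3 - e1 + e2

/-- The component of the ambient Ricci tensor along `D_-`. -/
theorem ric_mm : ∑ c, R.fc c (.inr 1) c (.inr 1) = -∑ j, ∑ k, R.gi j k * R.r k j := by
  have hp : R.fc (.inr 0) (.inr 1) (.inr 0) (.inr 1) = 0 := by
    simp [fc, frameCurv, mul_assoc, ← Finset.mul_sum, mul_left_comm _ R.ρ]
  have hm : R.fc (.inr 1) (.inr 1) (.inr 1) (.inr 1) = 0 := by
    simp [fc, frameCurv]
  have hl : ∀ l, R.fc (.inl l) (.inr 1) (.inl l) (.inr 1) = (R.h l (R.au l)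
      + ∑ m, R.Γh l l m * R.au m) - R.dr (R.ψu l l) - ∑ m, R.ψu m l * R.ψu l m
      + 4 * R.a l * R.au l + 2 * R.ρ * (R.dr (R.a l) * R.au l) := by
    intro l
    simp [fc, frameCurv, Finset.sum_sub_distrib]
    ring
  have hd := R.div_raise (fun m => R.dr (R.a m))
  have hau : ∀ l, R.au l = ∑ m, R.dr (R.a m) * R.gi m l := R.au_eq
  have e1 : ∑ l, 4 * R.a l * R.au l = ∑ l, ∑ m, R.gi l m * (4 * R.a l * R.dr (R.a m)) := by
    simp only [au, Finset.mul_sum]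
    exact Finset.sum_congr rfl fun l _ => Finset.sum_congr rfl fun m _ => by ring
  have e2 : ∑ l, 2 * R.ρ * (R.dr (R.a l) * R.au l)
      = ∑ l, ∑ m, R.gi l m * (2 * R.ρ * R.dr (R.a m) * R.dr (R.a l)) := by
    simp only [au, Finset.mul_sum]
    exact Finset.sum_congr rfl fun l _ => Finset.sum_congr rfl fun m _ => by ring
  have e3 : ∑ l, R.dr (R.ψu l l) = ∑ l, ∑ m, R.gi l m * R.dr (R.ψ l m)
      - ∑ l, ∑ m, R.ψu m l * R.ψu l m - ∑ l, ∑ m, ∑ p, R.gi l m * (R.ψ l p * R.ψu m p) := by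
    have h1 : ∀ l, R.dr (R.ψu l l) = ∑ m, R.gi l m * R.dr (R.ψ l m)
        - ∑ p, R.ψu l p * R.ψu p l - ∑ p, ∑ q, R.ψu l p * (R.gi l q * R.ψ q p) := by
      intro l
      have h2 : ∀ m, R.dr (R.gi m l) = -∑ p, ∑ q, R.gi m p * (R.ψ p q + R.ψ q p) * R.gi q l := by
        intro m
        simp only [ψ_add]
        exact derivation_inverse R.g_gi R.gi_g R.dr m l
      have h3 : ∑ m, ∑ p, ∑ q, R.ψ l m * (R.gi m p * R.ψ p q * R.gi q l)
          = ∑ p, R.ψu l p * R.ψu p l := by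
        simp only [ψu, Finset.sum_mul, Finset.mul_sum]
        rw [sum3_rotate]
        refine Finset.sum_congr rfl fun _ _ => Finset.sum_congr rfl fun _ _ =>
          Finset.sum_congr rfl fun _ _ => by ring
      have h4 : ∑ m, ∑ p, ∑ q, R.ψ l m * (R.gi m p * R.ψ q p * R.gi q l)
          = ∑ p, ∑ q, R.ψu l p * (R.gi l q * R.ψ q p) := by
        simp only [ψu, Finset.sum_mul]
        rw [sum3_rotate]
        refine Finset.sum_congr rfl fun _ _ => Finset.sum_congr rfl fun q _ =>
          Finset.sum_congr rfl fun _ _ => by rw [R.gi_symm l q]; ring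
      rw [ψu, map_sum]
      simp only [Derivation.leibniz, smul_eq_mul, h2, mul_neg, Finset.mul_sum, mul_add, add_mul,
        Finset.sum_add_distrib, Finset.sum_neg_distrib]
      rw [h3, h4]
      have h5 : ∑ m, R.gi m l * R.dr (R.ψ l m) = ∑ m, R.gi l m * R.dr (R.ψ l m) :=
        Finset.sum_congr rfl fun m _ => by rw [R.gi_symm]
      rw [h5]
      ring
    simp only [h1, Finset.sum_sub_distrib]
    congr 1
    · congr 1
      exact Finset.sum_congr rfl fun _ _ => Finset.sum_congr rfl fun _ _ => mul_comm _ _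
    · rw [sum3_rotate, sum3_rotate]
      refine Finset.sum_congr rfl fun q _ => Finset.sum_congr rfl fun l _ =>
        Finset.sum_congr rfl fun _ _ => ?_
      rw [R.gi_symm l q]; ring
  rw [Fintype.sum_sum_type, Fin.sum_univ_two, hp, hm]
  simp only [← hau, hl, Finset.sum_add_distrib, Finset.sum_sub_distrib] at hd ⊢
  simp only [r, N1, mul_sub, mul_add, Finset.mul_sum, Finset.sum_sub_distrib, Finset.sum_add_distrib] at hd e1 e2 e3 ⊢
  rw [hd, e3, e1, e2]
  ring_nf
  simp only [← Finset.sum_mul]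
  have e5 : ∑ x, (∑ y, R.ρ * R.gi x y * R.dr (R.a y)) * R.dr (R.a x)
      = ∑ x, (∑ y, R.gi x y * R.ρ * R.dr (R.a y)) * R.dr (R.a x) :=
    Finset.sum_congr rfl fun _ _ => by
      congr 1; exact Finset.sum_congr rfl fun _ _ => by ring
  linear_combination -2 * e5

end RhoGeo

end

end WeylAmbient

namespace WeylAmbient

noncomputable section

/-! ### Representable power series -/

open PowerSeries

namespace Rep

variable {k s : ℕ} {o o' : ℕ} {w w' : ℤ} {κ κ' κ₁ κ₂ : Type}

theorem map {T : Fld k κ'} (h : Rep k s o w T) (f : κ' → κ) (hf : Function.Bijective f) :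
    Rep k s o w (fun σ I => T σ fun p => I (f p)) := h.reindex (Equiv.ofBijective f hf)

theorem mul_map {T : Fld k κ₁} {T' : Fld k κ₂} (h : Rep k s o w T) (h' : Rep k s o' w' T')
    (f : κ₁ ⊕ κ₂ → κ) (hf : Function.Bijective f) :
    Rep k s (o + o') (w + w')
      (fun σ I => T σ (fun p => I (f (.inl p))) * T' σ fun q => I (f (.inr q))) :=
  (h.tensor h').map f hf

theorem ctr_map {T : Fld k κ'} (h : Rep k s o w T) (f : κ' → Option (Option κ))
    (hf : Function.Bijective f) :
    Rep k s o (w + 2)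
      (fun σ I => ∑ p, ∑ q, σ.B.gi p q * T σ fun t => cons2 p q I (f t)) :=
  (h.contr_equiv (Equiv.ofBijective f hf)).congr fun _ _ => rfl

end Rep

/-- Families of tensors with values in power series in `ρ`. -/
abbrev SFld (k : ℕ) (κ : Type) : Type 1 := ∀ σ : Sit k, (κ → Fin σ.n) → PowerSeries σ.A

/-- The coefficients of `ρ^l`, `l < K`, are representable tensors of weight `w + 2 l`. -/
def SRep (k s o : ℕ) (w : ℤ) (K : ℕ) {κ : Type} (T : SFld k κ) : Prop :=
  ∀ l < K, Rep k s o (w + 2 * l) (fun σ I => coeff l (T σ I))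

/-- The boundary covariant derivative of a power series, where `ρ` has weight `-2`. -/
def Geo.snab {n : ℕ} {A : Type} [CommRing A] [Algebra ℝ A] (B : Geo n A) (w : ℤ) {κ : Type}
    [Fintype κ] [DecidableEq κ] (T : (κ → Fin n) → A⟦X⟧) (i : Fin n) (I : κ → Fin n) : A⟦X⟧ :=
  liftD (B.d i) (T I) + 2 * X * C (B.a 0 i) * dX (T I)
    - ∑ s, ∑ m, C (B.Γ m i (I s)) * T (Function.update I s m) + (w : ℝ) • (C (B.a 0 i) * T I)

theorem coeff_X_mul_dX {A : Type} [CommRing A] [Algebra ℝ A] (f : A⟦X⟧) (l : ℕ) :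
    coeff l (X * dX f) = (l : ℝ) • coeff l f := by
  rcases l with _ | l
  · simp
  · rw [coeff_succ_X_mul, coeff_dX]; push_cast; rfl

theorem Geo.coeff_snab {n : ℕ} {A : Type} [CommRing A] [Algebra ℝ A] (B : Geo n A) (w : ℤ)
    {κ : Type} [Fintype κ] [DecidableEq κ] (T : (κ → Fin n) → A⟦X⟧) (i : Fin n) (I : κ → Fin n)
    (l : ℕ) : coeff l (B.snab w T i I) = B.nab ((w + 2 * l : ℤ) : ℝ) (fun I => coeff l (T I)) i I := by
  have h : 2 * X * C (B.a 0 i) * dX (T I) = (2 : ℝ) • (C (B.a 0 i) * (X * dX (T I))) := by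
    rw [two_smul]; ring
  rw [snab, nab_def, h]
  simp only [map_add, map_sub, map_sum, coeff_liftD, coeff_C_mul, coeff_X_mul_dX, coeff_smul]
  push_cast
  rw [add_smul, mul_smul_comm, smul_smul]
  abel

namespace SRep

variable {k s : ℕ} {o o' : ℕ} {w w' : ℤ} {K K' : ℕ} {κ κ' κ₁ κ₂ : Type}

theorem congr {T T' : SFld k κ} (h : SRep k s o w K T) (e : ∀ σ I, T' σ I = T σ I) :
    SRep k s o w K T' := fun l hl => (h l hl).congr fun σ I => by rw [e]

theorem zero : SRep k s o w K (fun σ (_ : κ → Fin σ.n) => 0) :=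
  fun _ _ => Rep.zero.congr fun _ _ => by simp

theorem add {T T' : SFld k κ} (h : SRep k s o w K T) (h' : SRep k s o w K T') :
    SRep k s o w K (fun σ I => T σ I + T' σ I) :=
  fun l hl => ((h l hl).add (h' l hl)).congr fun _ _ => by rw [map_add]

theorem smul {T : SFld k κ} {c : ℕ → ℝ} (hc : IsCf s c) (h : SRep k s o w K T) :
    SRep k s o w K (fun σ I => c σ.n • T σ I) :=
  fun l hl => ((h l hl).smul hc).congr fun _ _ => by rw [coeff_smul]

theorem csmul {T : SFld k κ} (c : ℝ) (h : SRep k s o w K T) :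
    SRep k s o w K (fun σ I => c • T σ I) := h.smul (IsCf.const c)

theorem neg {T : SFld k κ} (h : SRep k s o w K T) : SRep k s o w K (fun σ I => -T σ I) :=
  (h.csmul (-1)).congr fun _ _ => by simp

theorem sub {T T' : SFld k κ} (h : SRep k s o w K T) (h' : SRep k s o w K T') :
    SRep k s o w K (fun σ I => T σ I - T' σ I) :=
  (h.add h'.neg).congr fun _ _ => sub_eq_add_neg _ _

theorem mono_ord {T : SFld k κ} (h : SRep k s o w K T) (ho : o' ≤ o) : SRep k s o' w K T :=
  fun l hl => (h l hl).mono_ord ho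

theorem mono_K {T : SFld k κ} (h : SRep k s o w K T) (hK : K' ≤ K) : SRep k s o w K' T :=
  fun l hl => h l (hl.trans_le hK)

theorem cast {T : SFld k κ} (h : SRep k s o w K T) (hw : w = w') : SRep k s o w' K T := hw ▸ h

theorem map {T : SFld k κ'} (h : SRep k s o w K T) (f : κ' → κ) (hf : Function.Bijective f) :
    SRep k s o w K (fun σ I => T σ fun p => I (f p)) := fun l hl => (h l hl).map f hf

theorem const {T : Fld k κ} (h : Rep k s o w T) : SRep k s o w K (fun σ I => C (T σ I)) := by
  intro l _
  rcases l with _ | l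
  · refine Rep.congr ?_ (T := T) fun _ _ => by simp
    simpa using h
  · exact Rep.zero.congr fun _ _ => by rw [coeff_C, if_neg (Nat.succ_ne_zero l)]

theorem coeff_zero {T : SFld k κ} (h : SRep k s o w (K + 1) T) :
    Rep k s o w (fun σ I => coeff 0 (T σ I)) := by
  simpa using h 0 (Nat.succ_pos K)

/-- Products, where the factors vanish to the orders `v` and `v'`. -/
theorem mul_map_of_vanish {K₁ K₂ v v' : ℕ} {T : SFld k κ₁} {T' : SFld k κ₂}
    (h : SRep k s o w K₁ T) (h' : SRep k s o' w' K₂ T')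
    (hv : ∀ l < v, ∀ σ I, coeff l (T σ I) = 0) (hv' : ∀ l < v', ∀ σ I, coeff l (T' σ I) = 0)
    (h₁ : K ≤ K₁ + v') (h₂ : K ≤ K₂ + v) (f : κ₁ ⊕ κ₂ → κ) (hf : Function.Bijective f) :
    SRep k s (o + o') (w + w') K
      (fun σ I => T σ (fun p => I (f (.inl p))) * T' σ fun q => I (f (.inr q))) := by
  intro l hl
  simp only [coeff_mul]
  refine Rep.sum _ fun x hx => ?_
  have hx := Finset.HasAntidiagonal.mem_antidiagonal.1 hx
  by_cases h1 : x.1 < v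
  · exact Rep.zero.congr fun σ I => by rw [hv _ h1, zero_mul]
  by_cases h2 : x.2 < v'
  · exact Rep.zero.congr fun σ I => by rw [hv' _ h2, mul_zero]
  have := (h x.1 (by omega)).mul_map (h' x.2 (by omega)) f hf
  have hw : w + 2 * (x.1 : ℤ) + (w' + 2 * (x.2 : ℤ)) = w + w' + 2 * l := by
    rw [← hx]; push_cast; ring
  rwa [hw] at this

theorem mul_map {T : SFld k κ₁} {T' : SFld k κ₂} (h : SRep k s o w K T) (h' : SRep k s o' w' K T')
    (f : κ₁ ⊕ κ₂ → κ) (hf : Function.Bijective f) :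
    SRep k s (o + o') (w + w') K
      (fun σ I => T σ (fun p => I (f (.inl p))) * T' σ fun q => I (f (.inr q))) :=
  mul_map_of_vanish h h' (v := 0) (v' := 0) (by simp) (by simp) le_rfl le_rfl f hf

theorem ctr_map {T : SFld k κ'} (h : SRep k s o w K T) (f : κ' → Option (Option κ))
    (hf : Function.Bijective f) :
    SRep k s o (w + 2) K
      (fun σ I => ∑ p, ∑ q, C (σ.B.gi p q) * T σ fun t => cons2 p q I (f t)) := by
  intro l hl
  have := (h l hl).ctr_map f hf
  rw [add_right_comm] at this
  exact this.congr fun _ _ => by simp only [map_sum, coeff_C_mul]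

theorem deriv {T : SFld k κ} (h : SRep k s o w (K + 1) T) :
    SRep k s o (w + 2) K (fun σ I => dX (T σ I)) := by
  intro l hl
  have := (h (l + 1) (by omega)).csmul ((l : ℝ) + 1)
  have hw : w + 2 * ((l + 1 : ℕ) : ℤ) = w + 2 + 2 * (l : ℤ) := by push_cast; ring
  rw [hw] at this
  exact this.congr fun _ _ => by rw [coeff_dX]

theorem X_mul {T : SFld k κ} (h : SRep k s o w K T) :
    SRep k s o (w - 2) (K + 1) (fun σ I => X * T σ I) := by
  intro l hl
  rcases l with _ | l
  · exact Rep.zero.congr fun _ _ => by simp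
  · have := h l (by omega)
    have hw : w + 2 * (l : ℤ) = w - 2 + 2 * ((l + 1 : ℕ) : ℤ) := by push_cast; ring
    rw [hw] at this
    exact this.congr fun _ _ => by rw [coeff_succ_X_mul]

theorem snab {T : SFld k κ} [Fintype κ] [DecidableEq κ] (h : SRep k s o w K T) :
    SRep k s o w K (fun σ (I : Option κ → Fin σ.n) =>
      σ.B.snab w (T σ) (I none) fun p => I (some p)) := by
  intro l hl
  refine (h l hl).nabla.congr fun σ I => ?_
  rw [Geo.coeff_snab]

theorem snab_map {T : SFld k κ'} [Fintype κ'] [DecidableEq κ'] (h : SRep k s o w K T)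
    (f : Option κ' → κ) (hf : Function.Bijective f) :
    SRep k s o w K (fun σ (I : κ → Fin σ.n) =>
      σ.B.snab w (T σ) (I (f none)) fun p => I (f (some p))) := h.snab.map f hf

theorem ord_one {T : SFld k κ} [Fintype κ] (h : SRep k s o w K T)
    (h0 : ∀ l < K, 0 < (Fintype.card κ : ℤ) + w + 2 * l ∨ ∀ σ I, coeff l (T σ I) = 0) :
    SRep k s 1 w K T := by
  intro l hl
  rcases h0 l hl with h1 | h1
  · exact (h l hl).ord_one (by omega)
  · exact Rep.zero.congr h1

end SRep

/-! ### The expansion of the metric and the connection -/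

namespace Expansion

variable {n : ℕ} {A : Type} [CommRing A] [Algebra ℝ A] (B : Expansion n A)

/-- The difference of `γ` and its value at `ρ = 0`. -/
def hh (i j : Fin n) : A⟦X⟧ := B.γ i j - C (B.g i j)

/-- The difference of `a` and its value at `ρ = 0`. -/
def al (i : Fin n) : A⟦X⟧ := B.rho.a i - C (B.a 0 i)

/-- The inverse metric with its indices lowered. -/
def gt (i j : Fin n) : A⟦X⟧ := ∑ p, ∑ q, C (B.g i p) * B.γi p q * C (B.g q j)

theorem coeff_zero_hh (i j : Fin n) : coeff 0 (B.hh i j) = 0 := by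
  rw [hh, map_sub, B.coeff_zero_γ, coeff_C, if_pos rfl, sub_self]

theorem coeff_zero_al (i : Fin n) : coeff 0 (B.al i) = 0 := by
  simp [al, rho]

theorem coeff_succ_al (l : ℕ) (i : Fin n) : coeff (l + 1) (B.al i) = B.a (l + 1) i := by
  simp [al, rho, coeff_C]

theorem sum_C_gi_g (p r : Fin n) : ∑ q, C (B.gi p q) * C (B.g q r) = if p = r then (1 : A⟦X⟧) else 0 := by
  simp only [← map_mul, ← map_sum, B.toGeo.gi_g]
  split_ifs <;> simp

theorem sum_C_g_gi (p r : Fin n) : ∑ q, C (B.g p q) * C (B.gi q r) = if p = r then (1 : A⟦X⟧) else 0 := by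
  simp only [← map_mul, ← map_sum, B.g_gi]
  split_ifs <;> simp

theorem sum_gi_gt (p j : Fin n) : ∑ q, C (B.gi p q) * B.gt q j = ∑ q, B.γi p q * C (B.g q j) := by
  simp only [gt, Finset.mul_sum]
  rw [sum3_rotate]
  have : ∀ x y, ∑ q, C (B.gi p q) * (C (B.g q x) * B.γi x y * C (B.g y j))
      = (if p = x then 1 else 0) * (B.γi x y * C (B.g y j)) := by
    intro x y
    rw [← sum_C_gi_g, Finset.sum_mul]
    exact Finset.sum_congr rfl fun _ _ => by ring
  simp [this]

theorem γi_eq (p q : Fin n) : B.γi p q = ∑ a, ∑ b, C (B.gi p a) * C (B.gi q b) * B.gt a b := by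
  have h1 : ∀ a, ∑ b, C (B.gi p a) * C (B.gi q b) * B.gt a b
      = ∑ b, C (B.gi q b) * (C (B.gi p a) * B.gt a b) :=
    fun a => Finset.sum_congr rfl fun _ _ => by ring
  simp only [h1]
  rw [Finset.sum_comm]
  simp only [← Finset.mul_sum, sum_gi_gt]
  simp only [Finset.mul_sum]
  rw [Finset.sum_comm]
  have : ∀ y, ∑ x, C (B.gi q x) * (B.γi p y * C (B.g y x)) = (if q = y then 1 else 0) * B.γi p y := by
    intro y
    rw [← sum_C_gi_g, Finset.sum_mul]
    exact Finset.sum_congr rfl fun x _ => by rw [B.g_symm y x]; ring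
  simp [this]

theorem gt_eq (i j : Fin n) :
    B.gt i j = C (B.g i j) - ∑ p, ∑ q, C (B.gi p q) * (B.hh i p * B.gt q j) := by
  have h1 : ∀ p, ∑ q, C (B.gi p q) * (B.hh i p * B.gt q j)
      = B.hh i p * ∑ q, B.γi p q * C (B.g q j) := by
    intro p
    rw [← sum_gi_gt, Finset.mul_sum]
    exact Finset.sum_congr rfl fun _ _ => by ring
  simp only [h1]
  simp only [hh, sub_mul, Finset.sum_sub_distrib]
  have h2 : ∑ p, B.γ i p * ∑ q, B.γi p q * C (B.g q j) = C (B.g i j) := by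
    simp only [Finset.mul_sum]
    rw [Finset.sum_comm]
    simp only [← mul_assoc, ← Finset.sum_mul, B.γ_γi]
    simp
  have h3 : ∑ p, C (B.g i p) * ∑ q, B.γi p q * C (B.g q j) = B.gt i j := by
    simp only [gt, Finset.mul_sum, mul_assoc]
  rw [h2, h3]; ring

theorem coeff_zero_gt_sub (i j : Fin n) : coeff 0 (B.gt i j - C (B.g i j)) = 0 := by
  have h1 : ∀ p q, coeff 0 (C (B.gi p q) * (B.hh i p * B.gt q j)) = 0 := by
    intro p q
    rw [coeff_C_mul, coeff_mul]; simp [B.coeff_zero_hh, -coeff_zero_eq_constantCoeff]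
  rw [gt_eq, sub_sub_cancel_left, map_neg, map_sum, neg_eq_zero]
  refine Finset.sum_eq_zero fun p _ => ?_
  rw [map_sum]
  exact Finset.sum_eq_zero fun q _ => h1 p q

end Expansion

namespace SRep

variable {k s : ℕ} {o : ℕ} {w : ℤ} {K : ℕ} {κ : Type}

theorem metric : SRep k s 0 (-2) K (fun σ (I : Fin 2 → Fin σ.n) => C (σ.B.g (I 0) (I 1))) :=
  const (T := fun σ (I : Fin 2 → Fin σ.n) => σ.B.g (I 0) (I 1))
    ((Rep.mono .metric (Equiv.refl _) le_rfl).congr fun _ _ => rfl)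

theorem al : SRep k s 2 0 K (fun σ (I : Fin 1 → Fin σ.n) => σ.B.al (I 0)) := by
  intro l _
  rcases l with _ | l
  · exact Rep.zero.congr fun σ I => σ.B.coeff_zero_al _
  · have := Rep.mono (k := k) (s := s) (o := 2) (.mode l) (Equiv.refl (Fin 1)) le_rfl
    have hw : (TMono.mode l).weight = 0 + 2 * ((l + 1 : ℕ) : ℤ) := by
      simp only [TMono.weight]; push_cast; ring
    rw [hw] at this
    exact this.congr fun σ I => σ.B.coeff_succ_al l _

theorem hh (hγ : SRep k s 0 (-2) K (fun σ (I : Fin 2 → Fin σ.n) => σ.B.γ (I 0) (I 1))) :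
    SRep k s 1 (-2) K (fun σ (I : Fin 2 → Fin σ.n) => σ.B.hh (I 0) (I 1)) := by
  refine ord_one (hγ.sub metric) fun l _ => ?_
  rcases l with _ | l
  · exact .inr fun σ I => σ.B.coeff_zero_hh _ _
  · left; simp only [Fintype.card_fin]; push_cast; omega

theorem gt_aux (hγ : SRep k s 0 (-2) K (fun σ (I : Fin 2 → Fin σ.n) => σ.B.γ (I 0) (I 1)))
    (K' : ℕ) (hK : K' ≤ K) :
    SRep k s 0 (-2) K' (fun σ (I : Fin 2 → Fin σ.n) => σ.B.gt (I 0) (I 1)) := by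
  induction K' with
  | zero => exact fun l hl => absurd hl (Nat.not_lt_zero l)
  | succ K' ih =>
    have h1 := mul_map_of_vanish (K := K' + 1) (v := 1) (v' := 0) ((hh hγ).mono_K hK)
      (ih (by omega)) (fun l hl σ I => by
        obtain rfl := Nat.lt_one_iff.1 hl
        exact σ.B.coeff_zero_hh _ _) (by simp) le_rfl le_rfl
      (Sum.elim ![0, 1] ![2, 3] : Fin 2 ⊕ Fin 2 → Fin 4) (by decide)
    have h2 := h1.ctr_map (![some (some 0), none, some none, some (some 1)] :
      Fin 4 → Option (Option (Fin 2))) (by decide)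
    exact (metric.sub (h2.mono_ord (Nat.zero_le _))).congr fun σ I => σ.B.gt_eq _ _

theorem gt (hγ : SRep k s 0 (-2) K (fun σ (I : Fin 2 → Fin σ.n) => σ.B.γ (I 0) (I 1))) :
    SRep k s 0 (-2) K (fun σ (I : Fin 2 → Fin σ.n) => σ.B.gt (I 0) (I 1)) :=
  gt_aux hγ K le_rfl

theorem gt_sub (hγ : SRep k s 0 (-2) K (fun σ (I : Fin 2 → Fin σ.n) => σ.B.γ (I 0) (I 1))) :
    SRep k s 1 (-2) K
    (fun σ (I : Fin 2 → Fin σ.n) => σ.B.gt (I 0) (I 1) - C (σ.B.g (I 0) (I 1))) := by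
  refine ord_one ((gt hγ).sub metric) fun l _ => ?_
  rcases l with _ | l
  · exact .inr fun σ I => σ.B.coeff_zero_gt_sub _ _
  · left; simp only [Fintype.card_fin]; push_cast; omega

end SRep

end

end WeylAmbient

namespace WeylAmbient

noncomputable section

/-! ### The horizontal connection of an expansion -/

open PowerSeries

namespace Expansion

variable {n : ℕ} {A : Type} [CommRing A] [Algebra ℝ A] (B : Expansion n A)

theorem rho_a (i : Fin n) : B.rho.a i = C (B.a 0 i) + B.al i := by rw [al]; ring

theorem rho_h (i : Fin n) (f : A⟦X⟧) :
    B.rho.h i f = liftD (B.d i) f + 2 * X * C (B.a 0 i) * dX f + 2 * X * B.al i * dX f := by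
  rw [RhoGeo.h_apply, rho_a]
  change liftD (B.d i) f + 2 * X * (C (B.a 0 i) + B.al i) * dX f = _
  ring

theorem dX_rho_a (i : Fin n) : dX (B.rho.a i) = dX (B.al i) := by
  rw [rho_a, map_add, dX_C, zero_add]

/-- The difference of the horizontal connection and the boundary connection. -/
def Cu (k i j : Fin n) : A⟦X⟧ := B.rho.Γh k i j - C (B.Γ k i j)

/-- The lowered form of `Cu`, with the boundary metric. -/
def Cd (p i j : Fin n) : A⟦X⟧ := ∑ k, C (B.g p k) * B.Cu k i j

/-- The boundary derivative of `γ`, corrected for the change of `a`. -/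
def Bt (i j l : Fin n) : A⟦X⟧ :=
  B.snab (-2) (fun I : Fin 2 → Fin n => B.γ (I 0) (I 1)) i ![j, l]
    + 2 * (X * (B.al i * dX (B.γ j l))) - 2 * (B.al i * B.γ j l)

/-- The lowered form of `Cu`, with the metric `γ`. -/
def Cl (l i j : Fin n) : A⟦X⟧ := (1 / 2 : ℝ) • (B.Bt i j l + B.Bt j i l - B.Bt l i j)

theorem rho_b (i j l : Fin n) : B.rho.b i j l
    = B.Bt i j l + ∑ m, C (B.Γ m i j) * B.γ m l + ∑ m, C (B.Γ m i l) * B.γ j m := by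
  rw [RhoGeo.b, rho_h, rho_a, Bt, Geo.snab]
  simp only [Fin.sum_univ_two]
  have h1 : ∀ m, Function.update ![j, l] 0 m = ![m, l] := fun m => by ext t; fin_cases t <;> rfl
  have h2 : ∀ m, Function.update ![j, l] 1 m = ![j, m] := fun m => by ext t; fin_cases t <;> rfl
  simp only [h1, h2]
  change _ + _ + 2 * X * B.al i * dX (B.γ j l) - 2 * (C (B.a 0 i) + B.al i) * B.γ j l = _
  simp only [Matrix.cons_val_zero, Matrix.cons_val_one]
  have : ((-2 : ℤ) : ℝ) • (C (B.a 0 i) * B.γ j l) = -(2 * (C (B.a 0 i) * B.γ j l)) := by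
    push_cast; rw [neg_smul, two_smul]; ring
  rw [this]
  change liftD (B.d i) (B.γ j l) + 2 * X * C (B.a 0 i) * dX (B.γ j l) + _ - _ = _
  ring

theorem sum_Cu_γ (i j l : Fin n) : ∑ k, B.Cu k i j * B.γ k l = B.Cl l i j := by
  have h1 : ∑ k, B.rho.Γh k i j * B.γ k l = _ := B.rho.Γh_g i j l
  simp only [Cu, sub_mul, Finset.sum_sub_distrib]
  rw [h1, Cl, rho_b, rho_b, rho_b]
  have h2 : ∑ m, C (B.Γ m j i) * B.γ m l = ∑ m, C (B.Γ m i j) * B.γ m l :=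
    Finset.sum_congr rfl fun m _ => by rw [B.toGeo.Γ_symm]
  have h3 : ∑ m, C (B.Γ m l i) * B.γ m j = ∑ m, C (B.Γ m i l) * B.γ j m :=
    Finset.sum_congr rfl fun m _ => by rw [B.toGeo.Γ_symm, B.γ_symm]
  have h4 : ∑ m, C (B.Γ m l j) * B.γ i m = ∑ m, C (B.Γ m j l) * B.γ i m :=
    Finset.sum_congr rfl fun m _ => by rw [B.toGeo.Γ_symm]
  rw [h2, h3, h4]
  have h5 : ∀ a b c S T U : A⟦X⟧, (1 / 2 : ℝ) • (a + S + T + (b + S + U) - (c + T + U)) - S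
      = (1 / 2 : ℝ) • (a + b - c) := by
    intro a b c S T U
    have : a + S + T + (b + S + U) - (c + T + U) = a + b - c + (2 : ℝ) • S := by
      rw [two_smul]; ring
    rw [this, smul_add, smul_smul]; norm_num
  exact h5 _ _ _ _ _ _

theorem Cu_eq (k i j : Fin n) : B.Cu k i j = ∑ l, B.γi k l * B.Cl l i j := by
  simp only [← sum_Cu_γ, Finset.mul_sum]
  rw [Finset.sum_comm]
  have : ∀ m, ∑ l, B.γi k l * (B.Cu m i j * B.γ m l) = (if m = k then 1 else 0) * B.Cu m i j := by
    intro m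
    rw [← B.γ_γi, Finset.sum_mul]
    exact Finset.sum_congr rfl fun l _ => by rw [B.γi_symm k l]; ring
  simp [this]

theorem Cu_eq_Cd (k i j : Fin n) : B.Cu k i j = ∑ p, C (B.gi k p) * B.Cd p i j := by
  simp only [Cd, Finset.mul_sum, ← mul_assoc]
  rw [Finset.sum_comm]
  simp only [← Finset.sum_mul, sum_C_gi_g]
  simp

theorem Cd_eq (p i j : Fin n) :
    B.Cd p i j = ∑ m, ∑ l, C (B.gi m l) * (B.gt p m * B.Cl l i j) := by
  have h : ∀ l, ∑ m, C (B.gi m l) * B.gt p m = ∑ k, C (B.g p k) * B.γi k l := by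
    intro l
    simp only [gt, Finset.mul_sum]
    rw [sum3_rotate]
    refine Finset.sum_congr rfl fun k _ => ?_
    have : ∀ x, ∑ m, C (B.gi m l) * (C (B.g p k) * B.γi k x * C (B.g x m))
        = C (B.g p k) * B.γi k x * (if x = l then 1 else 0) := by
      intro x
      rw [← sum_C_g_gi, Finset.mul_sum]
      exact Finset.sum_congr rfl fun _ _ => by ring
    simp [this]
  rw [Finset.sum_comm]
  simp only [← mul_assoc, ← Finset.sum_mul, h]
  simp only [Cd, Cu_eq, Finset.mul_sum, Finset.sum_mul, ← mul_assoc]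
  exact Finset.sum_comm

theorem Γh_eq (k i j : Fin n) : B.rho.Γh k i j = C (B.Γ k i j) + B.Cu k i j := by rw [Cu]; ring

theorem f_eq (i j : Fin n) : B.rho.f i j = C (B.F i j)
    + (B.snab 0 (fun I : Fin 1 → Fin n => B.al (I 0)) i ![j]
      - B.snab 0 (fun I : Fin 1 → Fin n => B.al (I 0)) j ![i]
      + 2 * (X * (B.al i * dX (B.al j))) - 2 * (X * (B.al j * dX (B.al i)))) := by
  have h1 : ∀ i m : Fin n, Function.update ![i] 0 m = ![m] := fun i m => by
    ext t; fin_cases t; rfl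
  rw [RhoGeo.f, rho_h, rho_h, dX_rho_a, dX_rho_a, rho_a, rho_a, Geo.snab, Geo.snab, Geo.F]
  simp only [Fin.sum_univ_one, h1, map_add, liftD_C, map_sub, Matrix.cons_val_zero, Int.cast_zero,
    zero_smul]
  have h2 : ∑ m, C (B.Γ m j i) * B.al m = ∑ m, C (B.Γ m i j) * B.al m :=
    Finset.sum_congr rfl fun m _ => by rw [B.toGeo.Γ_symm]
  simp only [Matrix.cons_val_fin_one, h2]
  ring

theorem ψ_eq (i j : Fin n) : B.rho.ψ i j = (1 / 2 : ℝ) • (dX (B.γ i j) + B.rho.f i j) := rfl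

theorem ψu_eq (i k : Fin n) : B.rho.ψu i k = ∑ m, B.rho.ψ i m * B.γi m k := rfl

theorem N2_eq (i j k : Fin n) : B.rho.N2 i j k
    = B.snab 0 (fun I : Fin 2 → Fin n => B.rho.ψ (I 0) (I 1)) i ![j, k]
      + 2 * (X * (B.al i * dX (B.rho.ψ j k))) - ∑ m, B.Cu m i j * B.rho.ψ m k
      - ∑ m, B.Cu m i k * B.rho.ψ j m := by
  have h1 : ∀ m, Function.update ![j, k] 0 m = ![m, k] := fun m => by ext t; fin_cases t <;> rfl
  have h2 : ∀ m, Function.update ![j, k] 1 m = ![j, m] := fun m => by ext t; fin_cases t <;> rfl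
  rw [RhoGeo.N2, rho_h, Geo.snab]
  simp only [Fin.sum_univ_two, h1, h2, Γh_eq, add_mul, Finset.sum_add_distrib, Int.cast_zero,
    zero_smul, Matrix.cons_val_zero, Matrix.cons_val_one]
  ring

theorem N1_eq (j k : Fin n) : B.rho.N1 j k
    = B.snab 2 (fun I : Fin 1 → Fin n => dX (B.al (I 0))) j ![k]
      + 2 * (X * (B.al j * dX (dX (B.al k)))) + 2 * (B.al j * dX (B.al k))
      - ∑ m, B.Cu m j k * dX (B.al m) := by
  have h1 : ∀ i m : Fin n, Function.update ![i] 0 m = ![m] := fun i m => by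
    ext t; fin_cases t; rfl
  have hd : ∀ i, B.rho.dr (B.rho.a i) = dX (B.al i) := B.dX_rho_a
  rw [RhoGeo.N1]
  simp only [hd]
  rw [rho_h, Geo.snab, rho_a]
  simp only [Fin.sum_univ_one, h1, Γh_eq, add_mul, Finset.sum_add_distrib, Int.cast_ofNat,
    two_smul, Matrix.cons_val_zero, Matrix.cons_val_fin_one]
  ring

/-- The horizontal derivative of `Cd`. -/
def DCd (i p j k : Fin n) : A⟦X⟧ :=
  B.snab (-2) (fun I : Fin 3 → Fin n => B.Cd (I 0) (I 1) (I 2)) i ![p, j, k]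
    + 2 * (X * (B.al i * dX (B.Cd p j k)))

theorem h_Cu (i l j k : Fin n) : B.rho.h i (B.Cu l j k) + ∑ m, C (B.Γ l i m) * B.Cu m j k
    - ∑ m, C (B.Γ m i j) * B.Cu l m k - ∑ m, C (B.Γ m i k) * B.Cu l j m
    = ∑ p, C (B.gi l p) * B.DCd i p j k := by
  have h0 : ∀ p m, Function.update ![p, j, k] 0 m = ![m, j, k] :=
    fun p m => by ext t; fin_cases t <;> rfl
  have h1 : ∀ p m, Function.update ![p, j, k] 1 m = ![p, m, k] :=
    fun p m => by ext t; fin_cases t <;> rfl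
  have h2 : ∀ p m, Function.update ![p, j, k] 2 m = ![p, j, m] :=
    fun p m => by ext t; fin_cases t <;> rfl
  have e1 : ∑ m, C (B.Γ l i m) * ∑ p, C (B.gi m p) * B.Cd p j k
      = ∑ p, (∑ m, C (B.Γ l i m) * C (B.gi m p)) * B.Cd p j k := by
    simp only [Finset.mul_sum, Finset.sum_mul, mul_assoc]; exact Finset.sum_comm
  have e2 : ∑ m, C (B.Γ m i j) * ∑ p, C (B.gi l p) * B.Cd p m k
      = ∑ p, C (B.gi l p) * ∑ m, C (B.Γ m i j) * B.Cd p m k := by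
    simp only [Finset.mul_sum]; rw [Finset.sum_comm]
    exact Finset.sum_congr rfl fun _ _ => Finset.sum_congr rfl fun _ _ => by ring
  have e3 : ∑ m, C (B.Γ m i k) * ∑ p, C (B.gi l p) * B.Cd p j m
      = ∑ p, C (B.gi l p) * ∑ m, C (B.Γ m i k) * B.Cd p j m := by
    simp only [Finset.mul_sum]; rw [Finset.sum_comm]
    exact Finset.sum_congr rfl fun _ _ => Finset.sum_congr rfl fun _ _ => by ring
  have e4 : ∑ p, (∑ m, C (B.Γ p i m) * C (B.gi l m)) * B.Cd p j k
      = ∑ p, C (B.gi l p) * ∑ m, C (B.Γ m i p) * B.Cd m j k := by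
    simp only [Finset.mul_sum, Finset.sum_mul]; rw [Finset.sum_comm]
    exact Finset.sum_congr rfl fun _ _ => Finset.sum_congr rfl fun _ _ => by ring
  have e5 : ∀ p, ((-2 : ℤ) : ℝ) • (C (B.a 0 i) * B.Cd p j k) = -(2 * (C (B.a 0 i) * B.Cd p j k)) := by
    intro p; push_cast; rw [neg_smul, two_smul]; ring
  simp only [DCd, Geo.snab, Fin.sum_univ_three, h0, h1, h2, e5]
  rw [rho_h]
  simp only [B.Cu_eq_Cd, e1, e2, e3]
  simp only [map_sum, Derivation.leibniz, liftD_C, dX_C, smul_eq_mul, B.toGeo.d_gi, map_sub, map_neg,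
    map_mul, mul_zero, add_zero, Matrix.cons_val_zero, Matrix.cons_val_one, Matrix.cons_val,
    Finset.mul_sum]
  have e6 := sub_eq_zero.2 e4.symm
  have e7 : (C 2 : A⟦X⟧) = 2 := map_ofNat C 2
  simp only [← Finset.sum_add_distrib, ← Finset.sum_sub_distrib] at e6 ⊢
  rw [← sub_eq_zero, ← Finset.sum_sub_distrib, ← e6]
  refine Finset.sum_congr rfl fun x _ => ?_
  simp only [Finset.sum_add_distrib, e5, e7, ← Finset.mul_sum]
  ring

theorem Rh_eq (k j : Fin n) : B.rho.Rh k j = C (∑ l, curv B.d B.Γ l k l j)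
    + (∑ l, ∑ p, C (B.gi l p) * B.DCd l p j k - ∑ l, ∑ p, C (B.gi l p) * B.DCd j p l k)
    + (∑ l, ∑ m, B.Cu l l m * B.Cu m j k - ∑ l, ∑ m, B.Cu l j m * B.Cu m l k) := by
  simp only [← h_Cu]
  simp only [RhoGeo.Rh, Γh_eq, curv, map_sum, map_add, map_sub, map_mul, rho_h, liftD_C, dX_C,
    add_mul, mul_add, Finset.sum_add_distrib, Finset.sum_sub_distrib, mul_zero, add_zero]
  have e1 : ∑ l, ∑ m, C (B.Γ m l j) * B.Cu l m k = ∑ l, ∑ m, C (B.Γ m j l) * B.Cu l m k :=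
    Finset.sum_congr rfl fun _ _ => Finset.sum_congr rfl fun _ _ => by rw [B.toGeo.Γ_symm]
  have e2 : ∑ l, ∑ m, B.Cu l l m * C (B.Γ m j k) = ∑ l, ∑ m, C (B.Γ m j k) * B.Cu l l m :=
    Finset.sum_congr rfl fun _ _ => Finset.sum_congr rfl fun _ _ => mul_comm _ _
  have e3 : ∑ l, ∑ m, B.Cu l j m * C (B.Γ m l k) = ∑ l, ∑ m, C (B.Γ m l k) * B.Cu l j m :=
    Finset.sum_congr rfl fun _ _ => Finset.sum_congr rfl fun _ _ => mul_comm _ _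
  linear_combination e1 + e2 - e3

end Expansion

end

end WeylAmbient

namespace WeylAmbient

noncomputable section

/-! ### Representability of the horizontal connection -/

open PowerSeries

namespace SRep

variable {k s : ℕ} {o o' : ℕ} {w w' : ℤ} {K K' : ℕ} {κ κ' : Type}

/-- The position of the four indices in `raise`. -/
def raiseMap {κ : Type} : Fin 2 ⊕ Option (Option κ) → Option (Option (Option (Option κ)))
  | .inl 0 => some (some none)
  | .inl 1 => none
  | .inr none => some (some (some none))
  | .inr (some none) => some none
  | .inr (some (some x)) => some (some (some (some x)))

theorem raiseMap_bijective : Function.Bijective (raiseMap (κ := κ)) := by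
  constructor
  · rintro (i | _ | _ | x) (j | _ | _ | y) <;> (try fin_cases i) <;> (try fin_cases j) <;>
      simp [raiseMap]
  · rintro (_ | _ | _ | _ | x)
    exacts [⟨.inl 1, rfl⟩, ⟨.inr (some none), rfl⟩, ⟨.inl 0, rfl⟩, ⟨.inr none, rfl⟩,
      ⟨.inr (some (some x)), rfl⟩]

theorem raise {K₁ K₂ v : ℕ} {G : SFld k (Fin 2)} {T : SFld k κ'} (hG : SRep k s o (-2) K₁ G)
    (h : SRep k s o' w K₂ T) (hv : ∀ l < v, ∀ σ I, coeff l (G σ I) = 0) (h₁ : K ≤ K₁)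
    (h₂ : K ≤ K₂ + v) (f : κ' → Option (Option κ)) (hf : Function.Bijective f) :
    SRep k s (o + o') (w + 2) K (fun σ I => ∑ p, ∑ q,
      (∑ a, ∑ b, C (σ.B.gi p a) * C (σ.B.gi q b) * G σ ![a, b])
        * T σ fun t => cons2 p q I (f t)) := by
  have h1 := mul_map_of_vanish (K := K) (v' := 0) hG (h.map f hf) hv (by simp) h₁ h₂ raiseMap
    raiseMap_bijective
  have h2 := ((h1.ctr_map id Function.bijective_id).ctr_map id Function.bijective_id).cast
    (w' := w + 2) (by ring)
  refine h2.congr fun σ I => ?_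
  simp only [Finset.sum_mul, Finset.mul_sum]
  have e : ∀ t : Fin σ.n → Fin σ.n → Fin σ.n → Fin σ.n → PowerSeries σ.A,
      ∑ p, ∑ q, ∑ a, ∑ b, t p q a b = ∑ a, ∑ p, ∑ b, ∑ q, t p q a b := by
    intro t
    rw [Finset.sum_comm (f := fun a p => ∑ b, ∑ q, t p q a b)]
    refine Finset.sum_congr rfl fun p _ => ?_
    rw [sum3_rotate]
  rw [e]
  refine Finset.sum_congr rfl fun a _ => Finset.sum_congr rfl fun p _ =>
    Finset.sum_congr rfl fun b _ => Finset.sum_congr rfl fun q _ => ?_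
  rw [σ.B.gi_symm p a, σ.B.gi_symm q b]
  have e1 : (fun p_1 : Fin 2 => cons2 b q (cons2 a p I) (id (raiseMap (Sum.inl p_1)))) = ![a, b] := by
    ext i; fin_cases i <;> rfl
  have e2 : (fun t => cons2 b q (cons2 a p I) (id (raiseMap (Sum.inr (f t)))))
      = fun t => cons2 p q I (f t) := by
    funext t
    rcases f t with _ | _ | t <;> rfl
  simp only [id] at e1 e2 ⊢
  rw [e1, e2]
  ring

/-- The metric `γ` is representable. -/
abbrev HG (k s K : ℕ) : Prop :=
  SRep k s 0 (-2) K (fun σ (I : Fin 2 → Fin σ.n) => σ.B.γ (I 0) (I 1))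

theorem ictr_map (hγ : HG k s K) {T : SFld k κ'} (h : SRep k s o w K T)
    (f : κ' → Option (Option κ)) (hf : Function.Bijective f) :
    SRep k s o (w + 2) K
      (fun σ I => ∑ p, ∑ q, σ.B.γi p q * T σ fun t => cons2 p q I (f t)) := by
  have := raise (v := 0) (gt hγ) h (by simp) le_rfl le_rfl f hf
  rw [zero_add] at this
  refine this.congr fun σ I => ?_
  simp only [Expansion.γi_eq]
  rfl

theorem ictr_sub_map (hγ : HG k s K) {T : SFld k κ'} (h : SRep k s o w K' T) (hK : K ≤ K' + 1)
    (f : κ' → Option (Option κ)) (hf : Function.Bijective f) :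
    SRep k s (1 + o) (w + 2) K
      (fun σ I => ∑ p, ∑ q, (σ.B.γi p q - C (σ.B.gi p q)) * T σ fun t => cons2 p q I (f t)) := by
  refine (raise (v := 1) (gt_sub hγ) h (fun l hl σ I => by
    obtain rfl := Nat.lt_one_iff.1 hl
    exact σ.B.coeff_zero_gt_sub _ _) le_rfl hK f hf).congr fun σ I => ?_
  refine Finset.sum_congr rfl fun p _ => Finset.sum_congr rfl fun q _ => ?_
  congr 1
  simp only [mul_sub, Finset.sum_sub_distrib, Expansion.γi_eq, Matrix.cons_val_zero,
    Matrix.cons_val_one]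
  congr 1
  have : ∀ a, ∑ b, C (σ.B.gi p a) * C (σ.B.gi q b) * C (σ.B.g a b)
      = C (σ.B.gi p a) * if q = a then 1 else 0 := by
    intro a
    rw [← σ.B.sum_C_gi_g, Finset.mul_sum]
    exact Finset.sum_congr rfl fun b _ => by rw [σ.B.g_symm a b]; ring
  simp [this]

theorem X_al_dX {T : SFld k κ'} (h : SRep k s o w K T) (f : Fin 1 ⊕ κ' → κ)
    (hf : Function.Bijective f) : SRep k s (2 + o) w K
      (fun σ I => X * (σ.B.al (I (f (.inl 0))) * dX (T σ fun q => I (f (.inr q))))) := by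
  rcases K with _ | K
  · exact fun l hl => absurd hl (Nat.not_lt_zero l)
  · exact (((al.mul_map h.deriv f hf).X_mul).cast (by ring))

theorem Bt_sub (hγ : HG k s K) : SRep k s 2 (-2) K (fun σ (I : Fin 3 → Fin σ.n) =>
    σ.B.Bt (I 0) (I 1) (I 2) - σ.B.snab (-2) (fun I : Fin 2 → Fin σ.n => σ.B.γ (I 0) (I 1))
      (I 0) ![I 1, I 2]) := by
  have h1 := X_al_dX hγ (Sum.elim ![0] ![1, 2] : Fin 1 ⊕ Fin 2 → Fin 3) (by decide)
  have h2 := (al (k := k) (s := s)).mul_map hγ (Sum.elim ![0] ![1, 2] : Fin 1 ⊕ Fin 2 → Fin 3)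
    (by decide)
  refine ((h1.csmul 2).sub (h2.csmul 2)).congr fun σ I => ?_
  rw [Expansion.Bt, two_smul, two_smul]
  simp
  ring

theorem snab_γ (hγ : HG k s K) : SRep k s 1 (-2) K (fun σ (I : Fin 3 → Fin σ.n) =>
    σ.B.snab (-2) (fun I : Fin 2 → Fin σ.n => σ.B.γ (I 0) (I 1)) (I 0) ![I 1, I 2]) := by
  refine ord_one (o := 0) ?_ fun l _ => .inl ?_
  · refine (hγ.snab_map (Option.elim · 0 ![1, 2] : Option (Fin 2) → Fin 3) (by decide)).congr
      fun σ I => ?_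
    congr 1
    ext i; fin_cases i <;> rfl
  · simp only [Fintype.card_fin]; push_cast; omega

theorem Bt (hγ : HG k s K) : SRep k s 1 (-2) K (fun σ (I : Fin 3 → Fin σ.n) =>
    σ.B.Bt (I 0) (I 1) (I 2)) :=
  (((Bt_sub hγ).mono_ord (by omega)).add (snab_γ hγ)).congr fun σ I => by ring

end SRep

/-- The leading part of `Cd`. -/
def Expansion.Lc {n : ℕ} {A : Type} [CommRing A] [Algebra ℝ A] (B : Expansion n A)
    (l i j : Fin n) : A⟦X⟧ := (1 / 2 : ℝ) •
  (B.snab (-2) (fun I : Fin 2 → Fin n => B.γ (I 0) (I 1)) i ![j, l]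
    + B.snab (-2) (fun I : Fin 2 → Fin n => B.γ (I 0) (I 1)) j ![i, l]
    - B.snab (-2) (fun I : Fin 2 → Fin n => B.γ (I 0) (I 1)) l ![i, j])

namespace SRep

variable {k s : ℕ} {o o' : ℕ} {w w' : ℤ} {K K' : ℕ} {κ κ' : Type}

theorem Cl (hγ : HG k s K) : SRep k s 1 (-2) K (fun σ (I : Fin 3 → Fin σ.n) =>
    σ.B.Cl (I 0) (I 1) (I 2)) :=
  (((((Bt hγ).map ![1, 2, 0] (by decide)).add ((Bt hγ).map ![2, 1, 0] (by decide))).sub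
    (Bt hγ)).csmul (1 / 2)).congr fun _ _ => rfl

theorem Lc (hγ : HG k s K) : SRep k s 1 (-2) K (fun σ (I : Fin 3 → Fin σ.n) =>
    σ.B.Lc (I 0) (I 1) (I 2)) :=
  (((((snab_γ hγ).map ![1, 2, 0] (by decide)).add ((snab_γ hγ).map ![2, 1, 0] (by decide))).sub
    (snab_γ hγ)).csmul (1 / 2)).congr fun _ _ => rfl

theorem Cd_sub (hγ : HG k s K) : SRep k s 2 (-2) K (fun σ (I : Fin 3 → Fin σ.n) =>
    σ.B.Cd (I 0) (I 1) (I 2) - σ.B.Lc (I 0) (I 1) (I 2)) := by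
  have h1 := (((((Bt_sub hγ).map ![1, 2, 0] (by decide)).add ((Bt_sub hγ).map ![2, 1, 0]
    (by decide))).sub (Bt_sub hγ)).csmul (1 / 2))
  have h2 := ((gt_sub hγ).mul_map (Cl hγ) (Sum.elim ![0, 1] ![2, 3, 4] : Fin 2 ⊕ Fin 3 → Fin 5)
    (by decide)).ctr_map (![some (some 0), none, some none, some (some 1), some (some 2)] :
      Fin 5 → Option (Option (Fin 3))) (by decide)
  refine ((h2.cast (by ring)).add h1).congr fun σ I => ?_
  have e : σ.B.Cl (I 0) (I 1) (I 2) = ∑ m, ∑ l, C (σ.B.gi m l) * (C (σ.B.g (I 0) m)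
      * σ.B.Cl l (I 1) (I 2)) := by
    rw [Finset.sum_comm]
    have : ∀ l, ∑ m, C (σ.B.gi m l) * (C (σ.B.g (I 0) m) * σ.B.Cl l (I 1) (I 2))
        = (if I 0 = l then 1 else 0) * σ.B.Cl l (I 1) (I 2) := by
      intro l
      rw [← σ.B.sum_C_g_gi, Finset.sum_mul]
      exact Finset.sum_congr rfl fun _ _ => by ring
    simp [this]
  have e2 : σ.B.Cd (I 0) (I 1) (I 2) = ∑ m, ∑ l, C (σ.B.gi m l) * ((σ.B.gt (I 0) m
      - C (σ.B.g (I 0) m)) * σ.B.Cl l (I 1) (I 2)) + σ.B.Cl (I 0) (I 1) (I 2) := by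
    rw [Expansion.Cd_eq, e]
    simp only [sub_mul, mul_sub, Finset.sum_sub_distrib]
    rw [sub_add_cancel]
  rw [e2, add_sub_assoc]
  congr 1
  rw [Expansion.Cl, Expansion.Lc, ← smul_sub]
  congr 1
  simp only [Matrix.cons_val_zero, Matrix.cons_val_one, Matrix.cons_val]
  ring

theorem Cd (hγ : HG k s K) : SRep k s 1 (-2) K (fun σ (I : Fin 3 → Fin σ.n) =>
    σ.B.Cd (I 0) (I 1) (I 2)) :=
  (((Cd_sub hγ).mono_ord (by omega)).add (Lc hγ)).congr fun σ I => by ring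

theorem f_sub : SRep k s 2 0 K (fun σ (I : Fin 2 → Fin σ.n) =>
    σ.B.rho.f (I 0) (I 1) - C (σ.B.F (I 0) (I 1))) := by
  have h1 := (al (k := k) (s := s) (K := K)).snab_map
    (Option.elim · 0 ![1] : Option (Fin 1) → Fin 2) (by decide)
  have h2 := X_al_dX (al (k := k) (s := s) (K := K))
    (Sum.elim ![0] ![1] : Fin 1 ⊕ Fin 1 → Fin 2) (by decide)
  replace h2 := h2.mono_ord (o' := 2) (by omega)
  refine (((h1.sub (h1.map ![1, 0] (by decide))).add (h2.csmul 2)).sub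
    ((h2.map ![1, 0] (by decide)).csmul 2)).congr fun σ I => ?_
  rw [Expansion.f_eq, add_sub_cancel_left]
  have e : ∀ a b : Fin 2, (fun p : Fin 1 => I (![b] p)) = ![I b] := fun a b => by
    ext i; fin_cases i; rfl
  have e' : ∀ a : Fin σ.n, (fun p : Fin 1 => a) = ![a] := fun a => by
    ext i; fin_cases i; rfl
  simp [two_smul, e']
  ring

end SRep

end

end WeylAmbient

namespace WeylAmbient

noncomputable section

/-! ### The Ricci tensor at `ρ = 0` -/

open PowerSeries

namespace Expansion

variable {n : ℕ} {A : Type} [CommRing A] [Algebra ℝ A] (B : Expansion n A)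

theorem coeff_zero_mul' (f g : A⟦X⟧) : coeff 0 (f * g) = coeff 0 f * coeff 0 g := by
  simp only [coeff_zero_eq_constantCoeff, map_mul]

theorem coeff_zero_X_mul' (f : A⟦X⟧) : coeff 0 (X * f) = 0 := by
  rw [coeff_zero_mul', coeff_zero_X, zero_mul]

theorem coeff_zero_C' (a : A) : coeff 0 (C a : A⟦X⟧) = a := by simp

theorem coeff_zero_Bt (i j l : Fin n) : coeff 0 (B.Bt i j l) = 0 := by
  have h : (fun I : Fin 2 → Fin n => coeff 0 (B.γ (I 0) (I 1))) = fun I => B.g (I 0) (I 1) := by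
    funext I; exact B.coeff_zero_γ _ _
  have h2 := B.toGeo.nab_metric i ![j, l]
  rw [Bt, map_sub, map_add, Geo.coeff_snab, h]
  simp only [coeff_zero_mul', coeff_zero_X_mul', B.coeff_zero_al]
  simpa using h2

theorem coeff_zero_Cu (k i j : Fin n) : coeff 0 (B.Cu k i j) = 0 := by
  rw [Cu_eq, map_sum]
  refine Finset.sum_eq_zero fun l _ => ?_
  rw [coeff_zero_mul', Cl, coeff_smul]
  simp only [map_add, map_sub, coeff_zero_Bt]
  simp

theorem coeff_zero_Cd (k i j : Fin n) : coeff 0 (B.Cd k i j) = 0 := by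
  rw [Cd, map_sum]
  exact Finset.sum_eq_zero fun l _ => by rw [coeff_zero_mul', coeff_zero_Cu, mul_zero]

theorem coeff_zero_DCd (i p j k : Fin n) : coeff 0 (B.DCd i p j k) = 0 := by
  have h : (fun I : Fin 3 → Fin n => coeff 0 (B.Cd (I 0) (I 1) (I 2))) = fun _ => 0 := by
    funext I; exact B.coeff_zero_Cd _ _ _
  rw [DCd, map_add, Geo.coeff_snab, h, Geo.nab_zero, zero_add, coeff_zero_mul', coeff_zero_X_mul',
    mul_zero]

theorem coeff_zero_Rh (k j : Fin n) :
    coeff 0 (B.rho.Rh k j) = ∑ l, curv B.d B.Γ l k l j := by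
  rw [Rh_eq]
  simp only [map_add, map_sub, map_sum, coeff_zero_mul', coeff_zero_DCd, coeff_zero_Cu,
    coeff_zero_C']
  simp

theorem coeff_zero_f (i j : Fin n) : coeff 0 (B.rho.f i j) = B.F i j := by
  have h : (fun I : Fin 1 → Fin n => coeff 0 (B.al (I 0))) = fun _ => 0 := by
    funext I; exact B.coeff_zero_al _
  rw [f_eq]
  simp only [map_add, map_sub, Geo.coeff_snab, h, Geo.nab_zero, coeff_zero_mul', coeff_zero_X_mul',
    coeff_zero_C']
  simp

theorem coeff_zero_γi (i j : Fin n) : coeff 0 (B.γi i j) = B.gi i j := by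
  have h : ∀ a b, coeff 0 (B.gt a b) = B.g a b := fun a b => by
    have := B.coeff_zero_gt_sub a b
    rwa [map_sub, coeff_zero_C', sub_eq_zero] at this
  rw [γi_eq]
  simp only [map_sum, coeff_zero_mul', coeff_zero_C', h, mul_assoc]
  have : ∀ a, ∑ b, B.gi i a * (B.gi j b * B.g a b) = B.gi i a * if j = a then 1 else 0 := by
    intro a
    rw [← B.toGeo.gi_g, Finset.mul_sum]
    exact Finset.sum_congr rfl fun b _ => by rw [B.g_symm a b]
  simp [this]

theorem coeff_zero_N2 (i j k : Fin n) : coeff 0 (B.rho.N2 i j k)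
    = B.nab 0 (fun I : Fin 2 → Fin n => coeff 0 (B.rho.ψ (I 0) (I 1))) i ![j, k] := by
  rw [N2_eq]
  simp only [map_add, map_sub, map_sum, Geo.coeff_snab, coeff_zero_mul', coeff_zero_X_mul',
    coeff_zero_Cu]
  simp

theorem trψ_series : B.rho.trψ = ∑ l, ∑ m, B.γi l m * B.rho.ψ l m := B.rho.trψ_eq

end Expansion

namespace Sit

variable {k : ℕ} (σ : Sit k)

theorem coeff_ric_hh {l : ℕ} (hl : l < k) (i j : Fin σ.n) :
    coeff l (∑ c, σ.B.rho.fc c (.inl i) c (.inl j)) = 0 :=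
  X_pow_dvd_iff.1 (σ.flat.1 i j) l hl

theorem coeff_ric {l : ℕ} (hl : l + 1 < k) (b e : Fin σ.n ⊕ Fin 2) :
    coeff l (∑ c, σ.B.rho.fc c b c e) = 0 :=
  X_pow_dvd_iff.1 (σ.flat.2 b e) l (by omega)

/-- `ψ_{jk} = P_{kj}` at `ρ = 0`. -/
theorem coeff_zero_ψ (hk : 1 ≤ k) (j l : Fin σ.n) : coeff 0 (σ.B.rho.ψ j l) = σ.B.P l j := by
  set t : σ.A := ∑ l, ∑ m, σ.B.gi l m * coeff 0 (σ.B.rho.ψ l m) with ht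
  have hn : (3 : ℝ) ≤ (σ.n : ℝ) := by exact_mod_cast σ.three_le
  have h1 : ∀ j l, σ.B.ric l j = ((σ.n : ℝ) - 2) • coeff 0 (σ.B.rho.ψ j l) + t * σ.B.g l j := by
    intro j l
    have h := σ.coeff_ric_hh (by omega : 0 < k) l j
    rw [σ.B.rho.ric_hh, Expansion.trψ_series] at h
    have hX : ∀ f : PowerSeries σ.A, coeff 0 (2 * σ.B.rho.ρ * f) = 0 := fun f => by
      change coeff 0 (2 * X * f) = 0
      rw [mul_assoc, Expansion.coeff_zero_mul', Expansion.coeff_zero_X_mul', mul_zero]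
    have hg : coeff 0 (σ.B.rho.g j l) = σ.B.g l j :=
      (σ.B.coeff_zero_γ j l).trans (σ.B.g_symm j l)
    simp only [map_add, map_sub, hX, Expansion.coeff_zero_Rh, Expansion.coeff_zero_f, coeff_smul,
      Expansion.coeff_zero_mul', map_sum, Expansion.coeff_zero_γi] at h
    rw [← ht, hg] at h
    have h2 : σ.B.ric l j = ∑ c, curv σ.B.d σ.B.Γ c l c j + σ.B.F l j := by
      simp [Geo.ric, Geo.riem, Finset.sum_add_distrib]
    rw [h2]
    linear_combination h
  have h2 : σ.B.scal = (2 * ((σ.n : ℝ) - 1)) • t := by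
    have e1 : ∑ i, ∑ j, σ.B.gi i j * (((σ.n : ℝ) - 2) • coeff 0 (σ.B.rho.ψ j i))
        = ((σ.n : ℝ) - 2) • t := by
      rw [ht, Finset.sum_comm]
      simp only [mul_smul_comm, Finset.smul_sum]
      exact Finset.sum_congr rfl fun _ _ => Finset.sum_congr rfl fun _ _ => by rw [σ.B.gi_symm]
    have e2 : ∑ i, ∑ j, σ.B.gi i j * (t * σ.B.g i j) = (σ.n : ℝ) • t := by
      have : ∀ i, ∑ j, σ.B.gi i j * (t * σ.B.g i j) = t := by
        intro i
        have h3 := σ.B.toGeo.gi_g i i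
        rw [if_pos rfl] at h3
        have h4 : ∑ j, σ.B.gi i j * (t * σ.B.g i j) = t * ∑ j, σ.B.gi i j * σ.B.g j i := by
          rw [Finset.mul_sum]
          exact Finset.sum_congr rfl fun j _ => by rw [σ.B.g_symm i j]; ring
        rw [h4, h3, mul_one]
      simp only [this]
      rw [Finset.sum_const, Finset.card_univ, Fintype.card_fin, Nat.cast_smul_eq_nsmul]
    simp only [Geo.scal, h1, mul_add, Finset.sum_add_distrib]
    rw [e1, e2, ← add_smul]
    congr 1; ring
  rw [Geo.P, h2, h1, smul_mul_assoc, smul_smul, inv_mul_cancel₀ (by nlinarith), one_smul,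
    add_sub_cancel_right, smul_smul, inv_mul_cancel₀ (by linarith), one_smul]

theorem F_eq (hk : 1 ≤ k) (i j : Fin σ.n) : σ.B.F i j = σ.B.P j i - σ.B.P i j := by
  rw [← σ.coeff_zero_ψ hk, ← σ.coeff_zero_ψ hk, ← σ.B.coeff_zero_f, ← map_sub]
  exact congrArg _ (σ.B.rho.ψ_sub i j).symm

/-- The contracted Bianchi identity. -/
theorem div_P (hk : 2 ≤ k) (j : Fin σ.n) :
    ∑ l, ∑ m, σ.B.gi l m * σ.B.nab 0 (fun I : Fin 2 → Fin σ.n => σ.B.P (I 1) (I 0)) l ![j, m]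
      = ∑ l, ∑ m, σ.B.gi l m * σ.B.nab 0 (fun I : Fin 2 → Fin σ.n => σ.B.P (I 1) (I 0)) j ![l, m] := by
  have h := σ.coeff_ric (by omega : 0 + 1 < k) (.inr 1) (.inl j)
  rw [σ.B.rho.ric_mh] at h
  have hX : ∀ f : PowerSeries σ.A, coeff 0 (2 * σ.B.rho.ρ * f) = 0 := fun f => by
    change coeff 0 (2 * X * f) = 0
    rw [mul_assoc, Expansion.coeff_zero_mul', Expansion.coeff_zero_X_mul', mul_zero]
  have hg : ∀ l j, coeff 0 (σ.B.rho.gi l j) = σ.B.gi l j := σ.B.coeff_zero_γi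
  simp only [map_sub, hX, map_sum, Expansion.coeff_zero_mul', hg, Expansion.coeff_zero_N2,
    σ.coeff_zero_ψ (by omega : 1 ≤ k), mul_sub, Finset.sum_sub_distrib, sub_zero] at h
  exact sub_eq_zero.1 h

end Sit

namespace Rep

variable {k s : ℕ}

theorem schouten : Rep k s 1 0 (fun σ (I : Fin 2 → Fin σ.n) => σ.B.P (I 0) (I 1)) :=
  Rep.mono .schouten (Equiv.refl _) le_rfl

theorem fieldStrength (hk : 1 ≤ k) :
    Rep k s 1 0 (fun σ (I : Fin 2 → Fin σ.n) => σ.B.F (I 0) (I 1)) :=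
  ((schouten.map ![1, 0] (by decide)).sub schouten).congr fun σ I => σ.F_eq hk _ _

end Rep

namespace SRep

variable {k s : ℕ} {o o' : ℕ} {w w' : ℤ} {K K' : ℕ} {κ κ' : Type}

theorem f (hk : 1 ≤ k) : SRep k s 1 0 K (fun σ (I : Fin 2 → Fin σ.n) =>
    σ.B.rho.f (I 0) (I 1)) :=
  ((f_sub.mono_ord (by omega)).add (const (Rep.fieldStrength hk))).congr fun σ I => by
    rw [sub_add_cancel]

theorem ψ (hk : 1 ≤ k) (hγ : HG k s (K + 1)) : SRep k s 1 0 K (fun σ (I : Fin 2 → Fin σ.n) =>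
    σ.B.rho.ψ (I 0) (I 1)) := by
  refine ord_one (o := 0) ?_ fun l _ => .inl (by simp only [Fintype.card_fin]; push_cast; omega)
  exact (((hγ.deriv.cast (by ring)).add ((f hk).mono_ord (by omega))).csmul (1 / 2)).congr
    fun _ _ => rfl

/-- The positions of the indices in `Cu_mul`. -/
def CuMap {κ : Type} : Fin 3 ⊕ Option κ → Option (Option (Fin 2 ⊕ κ))
  | .inl 0 => some none
  | .inl 1 => some (some (.inl 0))
  | .inl 2 => some (some (.inl 1))
  | .inr none => none
  | .inr (some x) => some (some (.inr x))

theorem CuMap_bijective : Function.Bijective (CuMap (κ := κ)) := by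
  constructor
  · rintro (i | _ | x) (j | _ | y) <;> (try fin_cases i) <;> (try fin_cases j) <;> simp [CuMap]
  · rintro (_ | _ | i | x)
    · exact ⟨.inr none, rfl⟩
    · exact ⟨.inl 0, rfl⟩
    · fin_cases i
      exacts [⟨.inl 1, rfl⟩, ⟨.inl 2, rfl⟩]
    · exact ⟨.inr (some x), rfl⟩

/-- Contraction of `Cu` with a tensor. -/
theorem Cu_mul (hγ : HG k s K) {T : SFld k (Option κ)} (h : SRep k s o w K T) :
    SRep k s (1 + o) w K (fun σ (I : Fin 2 ⊕ κ → Fin σ.n) =>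
      ∑ m, σ.B.Cu m (I (.inl 0)) (I (.inl 1)) * T σ (cons1 m fun x => I (.inr x))) := by
  refine ((((Cd hγ).mul_map h CuMap CuMap_bijective).ctr_map id Function.bijective_id).cast
    (by ring)).congr fun σ I => Finset.sum_congr rfl fun m _ => ?_
  rw [Expansion.Cu_eq_Cd, Finset.sum_mul]
  refine Finset.sum_congr rfl fun p _ => ?_
  have e : (fun x => cons2 m p I (id (CuMap (.inr x)))) = cons1 m fun x => I (.inr x) := by
    funext x; rcases x with _ | x <;> rfl
  rw [e, mul_assoc]
  rfl

theorem N2_sub (hk : 1 ≤ k) (hγ : HG k s (K + 1)) :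
    SRep k s 2 0 K (fun σ (I : Fin 3 → Fin σ.n) => σ.B.rho.N2 (I 0) (I 1) (I 2)
      - σ.B.snab 0 (fun I : Fin 2 → Fin σ.n => σ.B.rho.ψ (I 0) (I 1)) (I 0) ![I 1, I 2]) := by
  have hψ := ψ hk hγ
  have h1 := (X_al_dX hψ (Sum.elim ![0] ![1, 2] : Fin 1 ⊕ Fin 2 → Fin 3) (by decide)).mono_ord
    (o' := 2) (by omega)
  have h2 := (Cu_mul (hγ.mono_K (Nat.le_succ K)) (hψ.map (![none, some 0] : Fin 2 → Option (Fin 1))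
    (by decide))).map (Sum.elim ![0, 1] ![2] : Fin 2 ⊕ Fin 1 → Fin 3) (by decide)
  have h3 := (Cu_mul (hγ.mono_K (Nat.le_succ K)) (hψ.map (![some 0, none] : Fin 2 → Option (Fin 1))
    (by decide))).map (Sum.elim ![0, 2] ![1] : Fin 2 ⊕ Fin 1 → Fin 3) (by decide)
  refine (((h1.csmul 2).sub h2).sub h3).congr fun σ I => ?_
  rw [Expansion.N2_eq, add_sub_assoc, add_sub_assoc, add_sub_cancel_left, two_smul]
  simp [cons1]
  ring

theorem snab_ψ (hk : 1 ≤ k) (hγ : HG k s (K + 1)) : SRep k s 1 0 K (fun σ (I : Fin 3 → Fin σ.n) =>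
    σ.B.snab 0 (fun I : Fin 2 → Fin σ.n => σ.B.rho.ψ (I 0) (I 1)) (I 0) ![I 1, I 2]) := by
  refine ((ψ hk hγ).snab_map (Option.elim · 0 ![1, 2] : Option (Fin 2) → Fin 3) (by decide)).congr
      fun σ I => ?_
  congr 1
  ext i; fin_cases i <;> rfl

theorem N2 (hk : 1 ≤ k) (hγ : HG k s (K + 1)) :
    SRep k s 1 0 K (fun σ (I : Fin 3 → Fin σ.n) => σ.B.rho.N2 (I 0) (I 1) (I 2)) :=
  (((N2_sub hk hγ).mono_ord (by omega)).add (snab_ψ hk hγ)).congr fun σ I => by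
    rw [sub_add_cancel]

theorem dX_al : SRep k s 2 2 K (fun σ (I : Fin 1 → Fin σ.n) => dX (σ.B.al (I 0))) :=
  (al (K := K + 1)).deriv.cast (by ring)

theorem N1 (hγ : HG k s K) :
    SRep k s 2 2 K (fun σ (I : Fin 2 → Fin σ.n) => σ.B.rho.N1 (I 0) (I 1)) := by
  have h0 := (dX_al (k := k) (s := s) (K := K)).snab_map
    (Option.elim · 0 ![1] : Option (Fin 1) → Fin 2) (by decide)
  have h1 := (X_al_dX (dX_al (k := k) (s := s) (K := K))
    (Sum.elim ![0] ![1] : Fin 1 ⊕ Fin 1 → Fin 2) (by decide)).mono_ord (o' := 2) (by omega)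
  have h2 := (((al (k := k) (s := s) (K := K)).mul_map dX_al
    (Sum.elim ![0] ![1] : Fin 1 ⊕ Fin 1 → Fin 2) (by decide)).cast (w' := 2) (by ring)).mono_ord
      (o' := 2) (by omega)
  have h3 := ((Cu_mul hγ ((dX_al (k := k) (s := s) (K := K)).map (![none] : Fin 1 → Option (Fin 0))
    (by decide))).map (Sum.elim ![0, 1] ![] : Fin 2 ⊕ Fin 0 → Fin 2) (by decide)).mono_ord
      (o' := 2) (by omega)
  refine (((h0.add (h1.csmul 2)).add (h2.csmul 2)).sub h3).congr fun σ I => ?_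
  have e' : ∀ a : Fin σ.n, (fun p : Fin 1 => a) = ![a] := fun a => by
    ext i; fin_cases i; rfl
  rw [Expansion.N1_eq]
  simp [two_smul, e', cons1]
  ring

/-- `r` up to terms of second order; the indices are those of `r`. -/
theorem r_sub (hk : 1 ≤ k) (hγ : HG k s (K + 1)) : SRep k s 2 2 K (fun σ (I : Fin 2 → Fin σ.n) =>
    σ.B.rho.r (I 0) (I 1) - dX (σ.B.rho.ψ (I 1) (I 0))) := by
  have hψ := ψ hk hγ
  have h1 := ictr_map (hγ.mono_K (Nat.le_succ K)) ((hψ.mul_map hψ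
    (Sum.elim ![0, 1] ![2, 3] : Fin 2 ⊕ Fin 2 → Fin 4) (by decide)).cast (w' := 0) (by ring))
    (![some (some 1), some none, some (some 0), none] : Fin 4 → Option (Option (Fin 2))) (by decide)
  have h2 := (N1 (hγ.mono_K (Nat.le_succ K))).map (![1, 0] : Fin 2 → Fin 2) (by decide)
  have h3 := (((dX_al (k := k) (s := s) (K := K)).mul_map dX_al
    (Sum.elim ![0] ![1] : Fin 1 ⊕ Fin 1 → Fin 2) (by decide)).X_mul.cast
      (w' := 2) (by ring)).mono_ord (o' := 2) (by omega) |>.mono_K (Nat.le_succ K)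
  refine (((h1.cast (w' := 2) (by ring)).neg.sub h2).sub (h3.csmul 2)).congr fun σ I => ?_
  have e1 : ∑ m, σ.B.rho.ψ (I 1) m * σ.B.rho.ψu (I 0) m
      = ∑ p, ∑ q, σ.B.γi p q * (σ.B.rho.ψ (I 1) q * σ.B.rho.ψ (I 0) p) := by
    simp only [Expansion.ψu_eq, Finset.mul_sum]
    rw [Finset.sum_comm]
    exact Finset.sum_congr rfl fun p _ => Finset.sum_congr rfl fun q _ => by ring
  have e2 : ∀ i, σ.B.rho.dr (σ.B.rho.a i) = dX (σ.B.al i) := σ.B.dX_rho_a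
  have e3 : σ.B.rho.dr (σ.B.rho.ψ (I 1) (I 0)) = dX (σ.B.rho.ψ (I 1) (I 0)) := rfl
  have e4 : σ.B.rho.ρ = X := rfl
  rw [RhoGeo.r, e1, e2, e2, e3, e4]
  simp [cons2, two_smul]
  ring

end SRep

end

end WeylAmbient

namespace WeylAmbient

noncomputable section

/-! ### The linearized Ricci tensor -/

open PowerSeries

theorem Geo.snab_sub {n : ℕ} {A : Type} [CommRing A] [Algebra ℝ A] (B : Geo n A) (w : ℤ)
    {κ : Type} [Fintype κ] [DecidableEq κ] (T T' : (κ → Fin n) → A⟦X⟧) (i : Fin n) (I : κ → Fin n) :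
    B.snab w (fun I => T I - T' I) i I = B.snab w T i I - B.snab w T' i I := by
  ext l
  simp only [map_sub, Geo.coeff_snab, Geo.nab_sub]

/-- The part of the Ricci tensor of the horizontal connection that is linear in `γ`. -/
def Expansion.LinRh {n : ℕ} {A : Type} [CommRing A] [Algebra ℝ A] (B : Expansion n A)
    (k j : Fin n) : A⟦X⟧ := ∑ l, ∑ p, C (B.gi l p) *
  (B.snab (-2) (fun I : Fin 3 → Fin n => B.Lc (I 0) (I 1) (I 2)) l ![p, j, k]
    - B.snab (-2) (fun I : Fin 3 → Fin n => B.Lc (I 0) (I 1) (I 2)) j ![p, l, k])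

namespace SRep

variable {k s : ℕ} {o o' : ℕ} {w w' : ℤ} {K K' : ℕ} {κ κ' : Type}

theorem DCd_sub (hγ : HG k s K) : SRep k s 2 (-2) K (fun σ (I : Fin 4 → Fin σ.n) =>
    σ.B.DCd (I 0) (I 1) (I 2) (I 3)
      - σ.B.snab (-2) (fun I : Fin 3 → Fin σ.n => σ.B.Lc (I 0) (I 1) (I 2)) (I 0) ![I 1, I 2, I 3]) := by
  have h1 := (Cd_sub hγ).snab_map (Option.elim · 0 ![1, 2, 3] : Option (Fin 3) → Fin 4) (by decide)
  have h2 := (X_al_dX (Cd hγ) (Sum.elim ![0] ![1, 2, 3] : Fin 1 ⊕ Fin 3 → Fin 4)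
    (by decide)).mono_ord (o' := 2) (by omega)
  refine (h1.add (h2.csmul 2)).congr fun σ I => ?_
  have e : (fun p : Fin 3 => I ((some p : Option (Fin 3)).elim 0 ![1, 2, 3])) = ![I 1, I 2, I 3] := by
    ext i; fin_cases i <;> rfl
  rw [Geo.snab_sub, e, Expansion.DCd, two_smul]
  simp
  ring

theorem Rh_sub (hγ : HG k s K) : SRep k s 2 0 K (fun σ (I : Fin 2 → Fin σ.n) =>
    σ.B.rho.Rh (I 0) (I 1) - C (∑ l, curv σ.B.d σ.B.Γ l (I 0) l (I 1))
      - σ.B.LinRh (I 0) (I 1)) := by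
  have h1 := (DCd_sub hγ).ctr_map (![none, some none, some (some 1), some (some 0)] :
    Fin 4 → Option (Option (Fin 2))) (by decide)
  have h2 := (DCd_sub hγ).ctr_map (![some (some 1), some none, none, some (some 0)] :
    Fin 4 → Option (Option (Fin 2))) (by decide)
  have h3 := (Cd hγ).ctr_map (![some none, none, some (some none)] :
    Fin 3 → Option (Option (Option (Fin 0)))) (by decide)
  have h4 := (Cu_mul hγ h3).map (Sum.elim ![1, 0] ![] : Fin 2 ⊕ Fin 0 → Fin 2) (by decide)
  have h5 := (Cu_mul hγ ((Cd hγ).map (![some 0, some 1, none] : Fin 3 → Option (Fin 2))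
    (by decide))).ctr_map (Sum.elim ![none, some (some 0)] ![some none, some (some 1)] :
      Fin 2 ⊕ Fin 2 → Option (Option (Fin 2))) (by decide)
  have h1' := h1.cast (w' := 0) (by ring)
  have h2' := h2.cast (w' := 0) (by ring)
  have h4' := (h4.cast (w' := 0) (by ring)).mono_ord (o' := 2) le_rfl
  have h5' := (h5.cast (w' := 0) (by ring)).mono_ord (o' := 2) le_rfl
  refine (((h1'.sub h2').add h4').sub h5').congr fun σ I => ?_
  have e4 : ∑ l, ∑ m, σ.B.Cu l l m * σ.B.Cu m (I 1) (I 0)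
      = ∑ m, σ.B.Cu m (I 1) (I 0) * ∑ l, ∑ p, C (σ.B.gi l p) * σ.B.Cd p l m := by
    simp only [← Expansion.Cu_eq_Cd, Finset.mul_sum]
    rw [Finset.sum_comm]
    exact Finset.sum_congr rfl fun _ _ => Finset.sum_congr rfl fun _ _ => mul_comm _ _
  have e5 : ∑ l, ∑ m, σ.B.Cu l (I 1) m * σ.B.Cu m l (I 0)
      = ∑ l, ∑ p, C (σ.B.gi l p) * ∑ m, σ.B.Cu m l (I 0) * σ.B.Cd p (I 1) m := by
    refine Finset.sum_congr rfl fun l _ => ?_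
    simp only [Finset.mul_sum]
    rw [Finset.sum_comm]
    refine Finset.sum_congr rfl fun m _ => ?_
    rw [Expansion.Cu_eq_Cd _ l, Finset.sum_mul]
    exact Finset.sum_congr rfl fun p _ => by ring
  rw [Expansion.Rh_eq, Expansion.LinRh, e4, e5]
  simp only [mul_sub, Finset.sum_sub_distrib]
  simp [cons1, cons2]
  ring

theorem trψ (hk : 1 ≤ k) (hγ : HG k s (K + 1)) :
    SRep k s 1 2 K (fun σ (_ : Fin 0 → Fin σ.n) => σ.B.rho.trψ) :=
  ((ictr_map (hγ.mono_K (Nat.le_succ K)) (ψ hk hγ) (![none, some none] :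
    Fin 2 → Option (Option (Fin 0))) (by decide)).cast (by ring)).congr fun σ I =>
      σ.B.trψ_series

theorem g_trψ_sub (hk : 1 ≤ k) (hγ : HG k s (K + 1)) :
    SRep k s 2 0 (K + 1) (fun σ (I : Fin 2 → Fin σ.n) => σ.B.γ (I 0) (I 1) * σ.B.rho.trψ
      - C (σ.B.g (I 0) (I 1)) * ∑ p, ∑ q, C (σ.B.gi p q) * σ.B.rho.ψ p q) := by
  have h1 := mul_map_of_vanish (K := K + 1) (v := 1) (v' := 0) (hh hγ) (trψ hk hγ)
    (fun l hl σ I => by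
      obtain rfl := Nat.lt_one_iff.1 hl
      exact σ.B.coeff_zero_hh _ _) (by simp) le_rfl le_rfl
    (Sum.elim ![0, 1] ![] : Fin 2 ⊕ Fin 0 → Fin 2) (by decide)
  have h2 := (metric (k := k) (s := s) (K := K + 1)).mul_map
    (ictr_sub_map hγ (ψ hk hγ) le_rfl (![none, some none] : Fin 2 → Option (Option (Fin 0)))
      (by decide)) (Sum.elim ![0, 1] ![] : Fin 2 ⊕ Fin 0 → Fin 2) (by decide)
  have h1' := (h1.cast (w' := 0) (by ring)).mono_ord (o' := 2) le_rfl
  have h2' := (h2.cast (w' := 0) (by ring)).mono_ord (o' := 2) le_rfl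
  refine (h1'.add h2').congr fun σ I => ?_
  simp only [sub_mul, Finset.sum_sub_distrib, Expansion.hh, ← Expansion.trψ_series]
  simp [cons2, sub_mul, Finset.sum_sub_distrib, ← Expansion.trψ_series]
  ring

theorem ric_quad (hk : 1 ≤ k) (hγ : HG k s (K + 1)) :
    SRep k s 2 2 K (fun σ (I : Fin 2 → Fin σ.n) => σ.B.rho.trψ * σ.B.rho.ψ (I 1) (I 0)
      - ∑ l, σ.B.rho.ψu (I 1) l * σ.B.rho.ψ l (I 0)
      - ∑ l, σ.B.rho.f l (I 1) * σ.B.rho.ψu (I 0) l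
      + (σ.B.rho.r (I 0) (I 1) - WeylAmbient.dX (σ.B.rho.ψ (I 1) (I 0)))) := by
  have hψ := ψ hk hγ
  have hγ' := hγ.mono_K (Nat.le_succ K)
  have h1 := (trψ hk hγ).mul_map hψ (Sum.elim ![] ![1, 0] : Fin 0 ⊕ Fin 2 → Fin 2) (by decide)
  have h2 := ictr_map hγ' (hψ.mul_map hψ (Sum.elim ![0, 1] ![2, 3] : Fin 2 ⊕ Fin 2 → Fin 4)
    (by decide)) (![some (some 1), none, some none, some (some 0)] :
      Fin 4 → Option (Option (Fin 2))) (by decide)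
  have h3 := ictr_map hγ' ((f hk).mul_map hψ (Sum.elim ![0, 1] ![2, 3] : Fin 2 ⊕ Fin 2 → Fin 4)
    (by decide)) (![some none, some (some 1), some (some 0), none] :
      Fin 4 → Option (Option (Fin 2))) (by decide)
  have h1' := (h1.cast (w' := 2) (by ring)).mono_ord (o' := 2) le_rfl
  have h2' := (h2.cast (w' := 2) (by ring)).mono_ord (o' := 2) le_rfl
  have h3' := (h3.cast (w' := 2) (by ring)).mono_ord (o' := 2) le_rfl
  refine (((h1'.sub h2').sub h3').add (r_sub hk hγ)).congr fun σ I => ?_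
  have e2 : ∑ l, σ.B.rho.ψu (I 1) l * σ.B.rho.ψ l (I 0)
      = ∑ p, ∑ q, σ.B.γi p q * (σ.B.rho.ψ (I 1) p * σ.B.rho.ψ q (I 0)) := by
    simp only [Expansion.ψu_eq, Finset.sum_mul]
    rw [Finset.sum_comm]
    exact Finset.sum_congr rfl fun p _ => Finset.sum_congr rfl fun q _ => by ring
  have e3 : ∑ l, σ.B.rho.f l (I 1) * σ.B.rho.ψu (I 0) l
      = ∑ p, ∑ q, σ.B.γi p q * (σ.B.rho.f q (I 1) * σ.B.rho.ψ (I 0) p) := by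
    simp only [Expansion.ψu_eq, Finset.mul_sum]
    rw [Finset.sum_comm]
    exact Finset.sum_congr rfl fun p _ => Finset.sum_congr rfl fun q _ => by ring
  rw [e2, e3]
  simp [cons2]

end SRep

namespace Rep

variable {k s : ℕ}

theorem ricci_hh {m : ℕ} (hm : 1 ≤ m) (hmk : m < k) (hγ : SRep.HG k s (m + 1)) :
    Rep k s 2 (2 * m) (fun σ (I : Fin 2 → Fin σ.n) =>
      (2 * (m : ℝ) + 2 - σ.n) • coeff m (σ.B.rho.ψ (I 1) (I 0))
        - σ.B.g (I 0) (I 1) * ∑ p, ∑ q, σ.B.gi p q * coeff m (σ.B.rho.ψ p q)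
        + coeff m (σ.B.LinRh (I 0) (I 1))) := by
  have hk : 1 ≤ k := by omega
  have h1 := (((SRep.Rh_sub hγ).add SRep.f_sub).sub (SRep.g_trψ_sub hk hγ)).add
    (((SRep.ric_quad hk hγ).X_mul.csmul 2).cast (by ring))
  have h2 := (h1 m (Nat.lt_succ_self m)).neg
  rw [zero_add] at h2
  refine h2.congr fun σ I => ?_
  have h := σ.coeff_ric_hh hmk (I 0) (I 1)
  rw [σ.B.rho.ric_hh] at h
  obtain ⟨m, rfl⟩ : ∃ m', m = m' + 1 := ⟨m - 1, by omega⟩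
  have hX : ∀ f : PowerSeries σ.A, coeff (m + 1) (2 * σ.B.rho.ρ * f) = 2 * coeff m f := fun f => by
    change coeff (m + 1) (2 * X * f) = _
    rw [mul_assoc, show (2 : PowerSeries σ.A) = C 2 from (map_ofNat C 2).symm, coeff_C_mul,
      coeff_succ_X_mul]
  have hg : σ.B.rho.g (I 1) (I 0) = σ.B.γ (I 0) (I 1) := σ.B.γ_symm _ _
  have hC : ∀ a : σ.A, coeff (m + 1) (C a) = 0 := fun a => by
    rw [coeff_C, if_neg (Nat.succ_ne_zero m)]
  rw [hg] at h
  simp only [map_add, map_sub, map_sum, hX, coeff_smul, hC, coeff_C_mul, coeff_succ_X_mul,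
    coeff_dX, two_smul ℝ (X * _), Finset.sum_const_zero] at h ⊢
  have e : (2 * ((m + 1 : ℕ) : ℝ) + 2 - σ.n) • coeff (m + 1) (σ.B.rho.ψ (I 1) (I 0))
      = 2 * (((m : ℝ) + 1) • coeff (m + 1) (σ.B.rho.ψ (I 1) (I 0)))
        - ((σ.n : ℝ) - 2) • coeff (m + 1) (σ.B.rho.ψ (I 1) (I 0)) := by
    have h2 : ∀ y : σ.A, 2 * y = (2 : ℝ) • y := fun y => by rw [two_smul, two_mul]
    rw [h2]; push_cast; module
  rw [e]
  linear_combination h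

theorem ricci_mm {m : ℕ} (hm : 1 ≤ m) (hmk : m < k) (hγ : SRep.HG k s (m + 1)) :
    Rep k s 2 (2 * m + 2) (fun σ (_ : Fin 0 → Fin σ.n) =>
      ∑ p, ∑ q, σ.B.gi p q * coeff m (σ.B.rho.ψ p q)) := by
  have hk : 1 ≤ k := by omega
  obtain ⟨m, rfl⟩ : ∃ m', m = m' + 1 := ⟨m - 1, by omega⟩
  have hr := SRep.r_sub hk hγ
  have hψ' := (SRep.ψ hk hγ).deriv
  have h0 : SRep k s 1 2 m (fun σ (I : Fin 2 → Fin σ.n) => σ.B.rho.r (I 0) (I 1)) :=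
    (((hr.mono_ord (by omega)).mono_K (Nat.le_succ m)).add ((hψ'.map (![1, 0] : Fin 2 → Fin 2)
      (by decide)).cast (by ring))).congr fun σ I => by
        simp
  have h1 := SRep.ictr_sub_map (K := m + 1) (hγ.mono_K (by omega)) h0 le_rfl
    (![some none, none] : Fin 2 → Option (Option (Fin 0))) (by decide)
  have h2 := hr.ctr_map (![some none, none] : Fin 2 → Option (Option (Fin 0))) (by decide)
  have h3 := (((h1.add h2) m (Nat.lt_succ_self m)).csmul (-((m : ℝ) + 1)⁻¹))
  have hw : (2 + 2 + 2 * m : ℤ) = 2 * ((m + 1 : ℕ) : ℤ) + 2 := by push_cast; ring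
  rw [hw] at h3
  refine h3.congr fun σ I => ?_
  have h := σ.coeff_ric (by omega : m + 1 < k) (.inr 1) (.inr 1)
  rw [σ.B.rho.ric_mm, map_neg, neg_eq_zero] at h
  have h4 : ∑ j, ∑ l, σ.B.rho.gi j l * σ.B.rho.r l j
      = (∑ p, ∑ q, (σ.B.γi p q - C (σ.B.gi p q)) * σ.B.rho.r q p
        + ∑ p, ∑ q, C (σ.B.gi p q) * (σ.B.rho.r q p - dX (σ.B.rho.ψ p q)))
        + ∑ p, ∑ q, C (σ.B.gi p q) * dX (σ.B.rho.ψ p q) := by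
    simp only [← Finset.sum_add_distrib]
    refine Finset.sum_congr rfl fun p _ => Finset.sum_congr rfl fun q _ => ?_
    change σ.B.γi p q * _ = _
    ring
  rw [h4, map_add] at h
  have h5 : coeff m (∑ p, ∑ q, C (σ.B.gi p q) * dX (σ.B.rho.ψ p q))
      = ((m : ℝ) + 1) • ∑ p, ∑ q, σ.B.gi p q * coeff (m + 1) (σ.B.rho.ψ p q) := by
    simp only [map_sum, coeff_C_mul, coeff_dX, Finset.smul_sum, mul_smul_comm]
  rw [h5, ← eq_neg_iff_add_eq_zero] at h
  have hm0 : ((m : ℝ) + 1) ≠ 0 := by positivity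
  refine Eq.trans ?_ (congrArg (fun x => (-((m : ℝ) + 1)⁻¹) • x) h.symm)
  simp only [smul_neg, smul_smul, neg_mul, inv_mul_cancel₀ hm0, neg_smul, one_smul, neg_neg]

theorem ricci_mh {m : ℕ} (hmk : m + 1 < k) (hγ : SRep.HG k s (m + 2)) :
    Rep k s 2 (2 * m + 2) (fun σ (I : Fin 1 → Fin σ.n) => ∑ l, ∑ q, σ.B.gi l q *
      (σ.B.nab ((2 * m : ℤ) : ℝ) (fun I : Fin 2 → Fin σ.n => coeff m (σ.B.rho.ψ (I 0) (I 1))) l ![I 0, q]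
      - σ.B.nab ((2 * m : ℤ) : ℝ) (fun I : Fin 2 → Fin σ.n => coeff m (σ.B.rho.ψ (I 0) (I 1))) (I 0)
        ![l, q])) := by
  have hk : 1 ≤ k := by omega
  have hN := SRep.N2 hk hγ
  have hN' := SRep.N2_sub hk hγ
  have f1 := (hN.map (![1, 0, 2] : Fin 3 → Fin 3) (by decide)).sub hN
  have f2 := (hN'.map (![1, 0, 2] : Fin 3 → Fin 3) (by decide)).sub hN'
  have h1 := SRep.ictr_sub_map (K := m + 1) (hγ.mono_K (by omega)) f1 (by omega)
    (![some (some 0), none, some none] : Fin 3 → Option (Option (Fin 1))) (by decide)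
  have h2 := f2.ctr_map (![some (some 0), none, some none] : Fin 3 → Option (Option (Fin 1)))
    (by decide)
  have h3 := (SRep.ictr_map (hγ.mono_K (by omega)) (((SRep.f hk).mul_map
    (SRep.dX_al (k := k) (s := s) (K := m + 1)) (Sum.elim ![0, 1] ![2] : Fin 2 ⊕ Fin 1 → Fin 3)
      (by decide)).X_mul.mono_K (K' := m + 1) (by omega))
    (![none, some (some 0), some none] : Fin 3 → Option (Option (Fin 1))) (by decide)).mono_ord
      (o' := 2) (by omega)
  have h4 := (((h1.add h2).sub ((h3.cast (w' := 0 + 2) (by ring)).csmul 2)) m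
    (Nat.lt_succ_self m)).neg
  have hw : (0 + 2 + 2 * m : ℤ) = 2 * (m : ℤ) + 2 := by push_cast; ring
  rw [hw] at h4
  refine h4.congr fun σ I => ?_
  have h := σ.coeff_ric hmk (.inr 1) (.inl (I 0))
  have h5 : ∑ l, ∑ q, σ.B.rho.gi l q * (σ.B.rho.N2 l (I 0) q - σ.B.rho.N2 (I 0) l q)
        - 2 * σ.B.rho.ρ * ∑ l, σ.B.rho.f l (I 0) * σ.B.rho.au l
      = (∑ p, ∑ q, (σ.B.γi p q - C (σ.B.gi p q))
          * (σ.B.rho.N2 p (I 0) q - σ.B.rho.N2 (I 0) p q)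
        + ∑ p, ∑ q, C (σ.B.gi p q) * ((σ.B.rho.N2 p (I 0) q
          - σ.B.snab 0 (fun I : Fin 2 → Fin σ.n => σ.B.rho.ψ (I 0) (I 1)) p ![I 0, q])
          - (σ.B.rho.N2 (I 0) p q
          - σ.B.snab 0 (fun I : Fin 2 → Fin σ.n => σ.B.rho.ψ (I 0) (I 1)) (I 0) ![p, q]))
        - (2 : ℝ) • ∑ p, ∑ q, σ.B.γi p q * (X * (σ.B.rho.f p (I 0) * dX (σ.B.al q))))
        + ∑ p, ∑ q, C (σ.B.gi p q)
          * (σ.B.snab 0 (fun I : Fin 2 → Fin σ.n => σ.B.rho.ψ (I 0) (I 1)) p ![I 0, q]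
            - σ.B.snab 0 (fun I : Fin 2 → Fin σ.n => σ.B.rho.ψ (I 0) (I 1)) (I 0) ![p, q]) := by
    have e1 : ∑ l, σ.B.rho.f l (I 0) * σ.B.rho.au l
        = ∑ p, ∑ q, σ.B.γi p q * (σ.B.rho.f p (I 0) * dX (σ.B.al q)) := by
      simp only [RhoGeo.au, Finset.mul_sum]
      refine Finset.sum_congr rfl fun p _ => Finset.sum_congr rfl fun q _ => ?_
      change _ * (σ.B.γi p q * dX (σ.B.rho.a q)) = _
      rw [Expansion.dX_rho_a]; ring
    have e2 : ∑ p, ∑ q, σ.B.γi p q * (X * (σ.B.rho.f p (I 0) * dX (σ.B.al q)))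
        = X * ∑ p, ∑ q, σ.B.γi p q * (σ.B.rho.f p (I 0) * dX (σ.B.al q)) := by
      simp only [Finset.mul_sum]
      exact Finset.sum_congr rfl fun p _ => Finset.sum_congr rfl fun q _ => by ring
    have e3 : ∑ l, ∑ q, σ.B.rho.gi l q * (σ.B.rho.N2 l (I 0) q - σ.B.rho.N2 (I 0) l q)
        = ∑ l, ∑ q, σ.B.γi l q * (σ.B.rho.N2 l (I 0) q - σ.B.rho.N2 (I 0) l q) := rfl
    have e4 : σ.B.rho.ρ = X := rfl
    rw [e1, e2, e3, e4, two_smul]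
    simp only [sub_mul, mul_sub, Finset.sum_sub_distrib]
    ring
  rw [σ.B.rho.ric_mh, h5, map_add, ← eq_neg_iff_add_eq_zero] at h
  refine Eq.trans ?_ (congrArg Neg.neg h.symm)
  rw [neg_neg]
  simp only [map_sum, coeff_C_mul, map_sub, Geo.coeff_snab, zero_add]

end Rep

end

end WeylAmbient

namespace WeylAmbient

noncomputable section

/-! ### Second derivatives of tensors -/

open PowerSeries

namespace Geo

variable {n : ℕ} {A : Type} [CommRing A] [Algebra ℝ A] (B : Geo n A)
variable {κ κ' : Type} [Fintype κ] [DecidableEq κ] [Fintype κ'] [DecidableEq κ']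

/-- The covariant derivative as a tensor. -/
def nabO (w : ℝ) (T : (κ → Fin n) → A) (J : Option κ → Fin n) : A :=
  B.nab w T (J none) fun s => J (some s)

theorem nabO_nabO (w : ℝ) (T : (κ → Fin n) → A) (i j : Fin n) (I : κ → Fin n) :
    B.nabO w (B.nabO w T) (cons2 i j I) = B.nab w (fun J : Option κ → Fin n =>
      B.nab w T (J none) fun s => J (some s)) i (cons1 j I) := by
  rw [nabO]
  change B.nab w (B.nabO w T) i _ = B.nab w (B.nabO w T) i _
  congr 1
  funext s
  rcases s with _ | s <;> rfl

/-- The second covariant derivative `∇_i ∇_j T_{ab}`. -/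
def dd (w : ℝ) (T : (Fin 2 → Fin n) → A) (i j a b : Fin n) : A :=
  B.nabO w (B.nabO w T) (cons2 i j ![a, b])

/-- The Laplacian of a tensor of rank two. -/
def lap (w : ℝ) (T : (Fin 2 → Fin n) → A) (a b : Fin n) : A :=
  ∑ p, ∑ q, B.gi p q * B.dd w T p q a b

/-- The divergence `∇^p T_{ap}`. -/
def div2 (w : ℝ) (T : (Fin 2 → Fin n) → A) (a : Fin n) : A :=
  ∑ p, ∑ q, B.gi p q * B.nab w T p ![a, q]

/-- The trace of a tensor of rank two. -/
def tr2 (T : (Fin 2 → Fin n) → A) : A := ∑ p, ∑ q, B.gi p q * T ![p, q]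

theorem nab_congr {w : ℝ} {T T' : (κ → Fin n) → A} (h : ∀ I, T I = T' I) (i : Fin n)
    (I : κ → Fin n) : B.nab w T i I = B.nab w T' i I := by
  rw [funext h]

theorem nab_nab_perm (w : ℝ) (T : (Fin 2 → Fin n) → A) (f : Option (Fin 2) → Fin 3)
    (hf : Function.Bijective f) (i : Fin n) (I : Fin 3 → Fin n) :
    B.nab w (fun I : Fin 3 → Fin n => B.nab w T (I (f none)) ![I (f (some 0)), I (f (some 1))]) i I
      = B.dd w T i (I (f none)) (I (f (some 0))) (I (f (some 1))) := by
  have h := B.nab_reindex w (B.nabO w T) (Equiv.ofBijective f hf) i I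
  refine Eq.trans ?_ (h.trans ?_)
  · refine B.nab_congr (fun I => ?_) i I
    rw [nabO]
    congr 1
    ext s; fin_cases s <;> rfl
  · rw [dd, nabO]
    congr 1
    funext s
    rcases s with _ | s
    · rfl
    · fin_cases s <;> rfl

theorem sum_dd_div (w : ℝ) (T : (Fin 2 → Fin n) → A) (j a : Fin n) :
    ∑ p, ∑ q, B.gi p q * B.dd w T j p a q
      = B.nab (w + 2) (fun I : Fin 1 → Fin n => B.div2 w T (I 0)) j ![a] := by
  set f : Option (Fin 2) → Option (Option (Fin 1)) :=
    fun s => s.elim none ![some (some 0), some none] with hf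
  have hb : Function.Bijective f := by decide
  have h := B.nab_ctr w (fun J : Option (Option (Fin 1)) → Fin n =>
    B.nabO w T fun s => J (f s)) j ![a]
  have h1 : ∀ J, B.nab w (fun J : Option (Option (Fin 1)) → Fin n => B.nabO w T fun s => J (f s)) j J
      = B.dd w T j (J none) (J (some (some 0))) (J (some none)) := by
    intro J
    refine (B.nab_reindex w (B.nabO w T) (Equiv.ofBijective f hb) j J).trans ?_
    rw [dd, nabO]
    congr 1
    funext s
    rcases s with _ | s
    · rfl
    · fin_cases s <;> rfl
  simp only [h1] at h
  refine Eq.trans ?_ (h.symm.trans ?_)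
  · rfl
  · refine B.nab_congr (fun I => ?_) j _
    rw [ctr, div2]
    refine Finset.sum_congr rfl fun p _ => Finset.sum_congr rfl fun q _ => ?_
    rw [nabO]
    congr 2
    ext s; fin_cases s <;> rfl

theorem nab_tr2 (w : ℝ) (T : (Fin 2 → Fin n) → A) (j : Fin n) (I : Fin 0 → Fin n) :
    B.nab (w + 2) (fun _ : Fin 0 → Fin n => B.tr2 T) j I
      = ∑ p, ∑ q, B.gi p q * B.nab w T j ![p, q] := by
  set f : Fin 2 → Option (Option (Fin 0)) := ![none, some none] with hf
  have hb : Function.Bijective f := by decide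
  have h := B.nab_ctr w (fun J : Option (Option (Fin 0)) → Fin n => T fun s => J (f s)) j I
  have h1 : ∀ J, B.nab w (fun J : Option (Option (Fin 0)) → Fin n => T fun s => J (f s)) j J
      = B.nab w T j ![J none, J (some none)] := by
    intro J
    refine (B.nab_reindex w T (Equiv.ofBijective f hb) j J).trans ?_
    congr 1
    ext s; fin_cases s <;> rfl
  simp only [h1] at h
  refine Eq.trans ?_ (h.trans rfl)
  refine B.nab_congr (fun I => ?_) j _
  rw [ctr, tr2]
  refine Finset.sum_congr rfl fun p _ => Finset.sum_congr rfl fun q _ => ?_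
  congr 2
  ext s; fin_cases s <;> rfl

theorem sum_dd_tr (w : ℝ) (T : (Fin 2 → Fin n) → A) (i j : Fin n) :
    ∑ p, ∑ q, B.gi p q * B.dd w T i j p q
      = B.nab (w + 2) (fun I : Fin 1 → Fin n =>
        B.nab (w + 2) (fun _ : Fin 0 → Fin n => B.tr2 T) (I 0) ![]) i ![j] := by
  set f : Option (Fin 2) → Option (Option (Fin 1)) :=
    fun s => s.elim (some (some 0)) ![none, some none] with hf
  have hb : Function.Bijective f := by decide
  have h := B.nab_ctr w (fun J : Option (Option (Fin 1)) → Fin n =>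
    B.nabO w T fun s => J (f s)) i ![j]
  have h1 : ∀ J, B.nab w (fun J : Option (Option (Fin 1)) → Fin n => B.nabO w T fun s => J (f s)) i J
      = B.dd w T i (J (some (some 0))) (J none) (J (some none)) := by
    intro J
    refine (B.nab_reindex w (B.nabO w T) (Equiv.ofBijective f hb) i J).trans ?_
    rw [dd, nabO]
    congr 1
    funext s
    rcases s with _ | s
    · rfl
    · fin_cases s <;> rfl
  simp only [h1] at h
  refine Eq.trans ?_ (h.symm.trans ?_)
  · rfl
  · refine B.nab_congr (fun I => ?_) i _
    rw [nab_tr2, ctr]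
    refine Finset.sum_congr rfl fun p _ => Finset.sum_congr rfl fun q _ => ?_
    rw [nabO]
    congr 2
    ext s; fin_cases s <;> rfl

/-- The curvature of the Weyl connection with all indices lowered. -/
def R4 (p a i j : Fin n) : A := ∑ q, B.g p q * curv B.d B.Γ q a i j

theorem R4_eq (p a i j : Fin n) : B.R4 p a i j = B.W p a i j - B.g p a * B.F i j
    + B.g p i * B.P a j + B.P p i * B.g a j - B.g p j * B.P a i - B.P p j * B.g a i := by
  have h : ∑ m, B.g p m * B.riem m a i j = B.R4 p a i j + B.g p a * B.F i j := by
    simp [riem, R4, mul_add, Finset.sum_add_distrib]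
  rw [W, h]; ring

theorem curv_eq (m a i j : Fin n) : curv B.d B.Γ m a i j = ∑ p, B.gi m p * B.R4 p a i j := by
  simp only [R4, Finset.mul_sum, ← mul_assoc]
  rw [Finset.sum_comm]
  simp only [← Finset.sum_mul, B.gi_g]
  simp

theorem dF (i j l : Fin n) :
    B.nab 0 (fun I : Fin 2 → Fin n => B.F (I 0) (I 1)) i ![j, l]
      + B.nab 0 (fun I : Fin 2 → Fin n => B.F (I 0) (I 1)) j ![l, i]
      + B.nab 0 (fun I : Fin 2 → Fin n => B.F (I 0) (I 1)) l ![i, j] = 0 := by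
  have h1 : ∀ a b m : Fin n, Function.update ![a, b] 0 m = ![m, b] :=
    fun a b m => by ext t; fin_cases t <;> rfl
  have h2 : ∀ a b m : Fin n, Function.update ![a, b] 1 m = ![a, m] :=
    fun a b m => by ext t; fin_cases t <;> rfl
  have hF : ∀ a b, B.F a b = -B.F b a := fun a b => by rw [F, F]; ring
  simp only [nab_def, Fin.sum_univ_two, h1, h2, zero_smul, Matrix.cons_val_zero, Matrix.cons_val_one,
    add_zero]
  have e : ∀ a b c : Fin n, ∑ m, B.Γ m a b * B.F c m = -∑ m, B.Γ m b a * B.F m c := fun a b c => by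
    rw [← Finset.sum_neg_distrib]
    exact Finset.sum_congr rfl fun m _ => by rw [hF c m, B.Γ_symm]; ring
  rw [e i l j, e j i l, e l j i]
  simp only [F, map_sub]
  rw [B.d_comm i j, B.d_comm i l, B.d_comm j l]
  ring

end Geo

namespace Rep

variable {k s : ℕ} {o : ℕ} {w : ℤ} {κ : Type}

theorem curvature (hk : 1 ≤ k) : Rep k s 1 (-2) (fun σ (I : Fin 4 → Fin σ.n) =>
    σ.B.R4 (I 0) (I 1) (I 2) (I 3)) := by
  have hg : Rep k s 0 (-2) (fun σ (I : Fin 2 → Fin σ.n) => σ.B.g (I 0) (I 1)) :=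
    Rep.mono .metric (Equiv.refl _) le_rfl
  have hW : Rep k s 1 (-2) (fun σ (I : Fin 4 → Fin σ.n) => σ.B.W (I 0) (I 1) (I 2) (I 3)) :=
    Rep.mono .weyl (Equiv.refl _) le_rfl
  have h1 := hg.mul_map (fieldStrength hk) (Sum.elim ![0, 1] ![2, 3] : Fin 2 ⊕ Fin 2 → Fin 4)
    (by decide)
  have h2 : ∀ f : Fin 2 ⊕ Fin 2 → Fin 4, Function.Bijective f → _ :=
    fun f hf => hg.mul_map (schouten (k := k) (s := s)) f hf
  refine (((((hW.sub h1).add (h2 (Sum.elim ![0, 2] ![1, 3]) (by decide))).add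
    (h2 (Sum.elim ![1, 3] ![0, 2]) (by decide))).sub
    (h2 (Sum.elim ![0, 3] ![1, 2]) (by decide))).sub
    (h2 (Sum.elim ![1, 2] ![0, 3]) (by decide))).congr fun σ I => ?_
  rw [Geo.R4_eq]
  simp
  ring

/-- The positions of the indices in a commutator of covariant derivatives. -/
def commMap [DecidableEq κ] (s : κ) : Fin 4 ⊕ κ → Option (Option (Option (Option κ)))
  | .inl 0 => some none
  | .inl 1 => some (some (some (some s)))
  | .inl 2 => some (some none)
  | .inl 3 => some (some (some none))
  | .inr t => if t = s then none else some (some (some (some t)))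

theorem commMap_bijective [DecidableEq κ] (s : κ) : Function.Bijective (commMap s) := by
  constructor
  · rintro (i | t) (j | t') h <;> (try fin_cases i) <;> (try fin_cases j) <;>
      simp only [commMap] at h <;> (try split_ifs at h) <;> simp_all
  · rintro (_ | _ | _ | _ | t)
    · exact ⟨.inr s, by simp [commMap]⟩
    · exact ⟨.inl 0, rfl⟩
    · exact ⟨.inl 2, rfl⟩
    · exact ⟨.inl 3, rfl⟩
    · by_cases h : t = s
      · exact ⟨.inl 1, by simp [commMap, h]⟩
      · exact ⟨.inr t, by simp [commMap, h]⟩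

/-- Commutators of covariant derivatives are of higher order. -/
theorem nab_comm (hk : 1 ≤ k) [Fintype κ] [DecidableEq κ] {T : Fld k κ} (h : Rep k s o w T) :
    Rep k s (1 + o) w (fun σ (I : Option (Option κ) → Fin σ.n) =>
      σ.B.nabO w (σ.B.nabO w (T σ)) (cons2 (I none) (I (some none)) fun s => I (some (some s)))
      - σ.B.nabO w (σ.B.nabO w (T σ)) (cons2 (I (some none)) (I none) fun s => I (some (some s)))) := by
  have h1 := Rep.sum (Finset.univ : Finset κ) fun t _ =>
    ((curvature (s := s) hk).mul_map h (commMap t) (commMap_bijective t)).ctr_map id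
      Function.bijective_id
  have h2 := ((fieldStrength (s := s) hk).mul_map h (fun t => t.elim ![none, some none]
    fun t => some (some t) : Fin 2 ⊕ κ → Option (Option κ)) (by
      constructor
      · rintro (i | t) (j | t') h <;> (try fin_cases i) <;> (try fin_cases j) <;> simp_all
      · rintro (_ | _ | t)
        exacts [⟨.inl 0, rfl⟩, ⟨.inl 1, rfl⟩, ⟨.inr t, rfl⟩])).csmul (w : ℝ)
  rw [show (-2 + w + 2 : ℤ) = w by ring] at h1
  rw [zero_add] at h2
  refine (h1.neg.add h2).congr fun σ I => ?_
  rw [Geo.nabO_nabO, Geo.nabO_nabO, σ.B.toGeo.nab_nab_comm (w : ℝ) (T σ)]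
  · congr 1
    congr 1
    refine Finset.sum_congr rfl fun t _ => Finset.sum_congr rfl fun m _ => ?_
    rw [Geo.curv_eq, Finset.sum_mul]
    refine Finset.sum_congr rfl fun p _ => ?_
    have e : (fun x => cons2 m p I (id (commMap t (.inr x))))
        = Function.update (fun s => I (some (some s))) t m := by
      funext x
      by_cases hx : x = t
      · subst hx; simp [commMap, cons2]
      · simp [commMap, hx, cons2]
    rw [e, mul_assoc]
    rfl

end Rep

end

end WeylAmbient

namespace WeylAmbient

noncomputable section

/-! ### The recursion for the coefficients of the metric -/

open PowerSeries

namespace Geo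

variable {n : ℕ} {A : Type} [CommRing A] [Algebra ℝ A] (B : Geo n A)

theorem dd_swap (T : (Fin 2 → Fin n) → A) (w : ℝ) (i j a b : Fin n) :
    B.dd w (fun I => T ![I 1, I 0]) i j a b = B.dd w T i j b a := by
  have h0 : (fun I : Fin 2 → Fin n => T ![I 1, I 0]) = fun I => T fun s => I (Equiv.swap 0 1 s) := by
    funext I
    congr 1
    ext s; fin_cases s <;> rfl
  have h1 : ∀ J, B.nabO w (fun I => T ![I 1, I 0]) J
      = B.nabO w T (fun s => J (Equiv.optionCongr (Equiv.swap 0 1) s)) := by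
    intro J
    rw [nabO, h0]
    exact B.nab_reindex w T (Equiv.swap 0 1) (J none) fun s => J (some s)
  rw [dd, nabO]
  conv_lhs => rw [funext h1]
  refine (B.nab_reindex w (B.nabO w T) (Equiv.optionCongr (Equiv.swap 0 1)) _ _).trans ?_
  rw [dd, nabO]
  congr 1
  funext s
  rcases s with _ | s
  · rfl
  · fin_cases s <;> rfl

theorem dd_symm {T : (Fin 2 → Fin n) → A} (hT : ∀ a b, T ![a, b] = T ![b, a]) (w : ℝ)
    (i j a b : Fin n) : B.dd w T i j a b = B.dd w T i j b a := by
  have h0 : T = fun I => T ![I 1, I 0] := by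
    funext I
    rw [← hT]
    congr 1
    ext s; fin_cases s <;> rfl
  conv_lhs => rw [h0]
  exact B.dd_swap T w i j a b

theorem nabO_add (w : ℝ) {κ : Type} [Fintype κ] [DecidableEq κ] (T T' : (κ → Fin n) → A) :
    B.nabO w (fun I => T I + T' I) = fun I => B.nabO w T I + B.nabO w T' I :=
  funext fun _ => B.nab_add w T T' _ _

theorem nabO_smul (w c : ℝ) {κ : Type} [Fintype κ] [DecidableEq κ] (T : (κ → Fin n) → A) :
    B.nabO w (fun I => c • T I) = fun I => c • B.nabO w T I :=
  funext fun _ => B.nab_smul w c T _ _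

theorem lap_add (w : ℝ) (T T' : (Fin 2 → Fin n) → A) (a b : Fin n) :
    B.lap w (fun I => T I + T' I) a b = B.lap w T a b + B.lap w T' a b := by
  simp only [lap, dd, nabO_add, mul_add, Finset.sum_add_distrib]

theorem lap_smul (w c : ℝ) (T : (Fin 2 → Fin n) → A) (a b : Fin n) :
    B.lap w (fun I => c • T I) a b = c • B.lap w T a b := by
  simp only [lap, dd, nabO_smul, mul_smul_comm, Finset.smul_sum]

theorem div2_add (w : ℝ) (T T' : (Fin 2 → Fin n) → A) (a : Fin n) :
    B.div2 w (fun I => T I + T' I) a = B.div2 w T a + B.div2 w T' a := by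
  simp only [div2, nab_add, mul_add, Finset.sum_add_distrib]

theorem div2_smul (w c : ℝ) (T : (Fin 2 → Fin n) → A) (a : Fin n) :
    B.div2 w (fun I => c • T I) a = c • B.div2 w T a := by
  simp only [div2, nab_smul, mul_smul_comm, Finset.smul_sum]

theorem tr2_add (T T' : (Fin 2 → Fin n) → A) :
    B.tr2 (fun I => T I + T' I) = B.tr2 T + B.tr2 T' := by
  simp only [tr2, mul_add, Finset.sum_add_distrib]

theorem tr2_smul (c : ℝ) (T : (Fin 2 → Fin n) → A) :
    B.tr2 (fun I => c • T I) = c • B.tr2 T := by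
  simp only [tr2, mul_smul_comm, Finset.smul_sum]

end Geo

namespace Expansion

variable {n : ℕ} {A : Type} [CommRing A] [Algebra ℝ A] (B : Expansion n A)

/-- The coefficient of `ρ^m` in `γ`. -/
def γc (m : ℕ) (I : Fin 2 → Fin n) : A := coeff m (B.γ (I 0) (I 1))

theorem γc_symm (m : ℕ) (a b : Fin n) : B.γc m ![a, b] = B.γc m ![b, a] :=
  congrArg (coeff m) (B.γ_symm a b)

/-- The weight of the coefficient of `ρ^m` in `γ`. -/
abbrev γw (m : ℕ) : ℤ := -2 + 2 * m

theorem coeff_snab_Lc (m : ℕ) (i p j k : Fin n) :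
    coeff m (B.snab (-2) (fun I : Fin 3 → Fin n => B.Lc (I 0) (I 1) (I 2)) i ![p, j, k])
      = (1 / 2 : ℝ) • (B.dd (γw m) (B.γc m) i j k p + B.dd (γw m) (B.γc m) i k j p
        - B.dd (γw m) (B.γc m) i p j k) := by
  have h : (fun I : Fin 3 → Fin n => coeff m (B.Lc (I 0) (I 1) (I 2))) = fun I => (1 / 2 : ℝ) •
      ((B.nab (γw m) (B.γc m) (I 1) ![I 2, I 0] + B.nab (γw m) (B.γc m) (I 2) ![I 1, I 0])
        - B.nab (γw m) (B.γc m) (I 0) ![I 1, I 2]) := by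
    funext I
    simp only [Lc, coeff_smul, map_add, map_sub, Geo.coeff_snab]
    rfl
  rw [Geo.coeff_snab, h, Geo.nab_smul, Geo.nab_sub, Geo.nab_add]
  have e1 := B.nab_nab_perm (γw m) (B.γc m) (fun s => s.elim 1 ![2, 0]) (by decide) i ![p, j, k]
  have e2 := B.nab_nab_perm (γw m) (B.γc m) (fun s => s.elim 2 ![1, 0]) (by decide) i ![p, j, k]
  have e3 := B.nab_nab_perm (γw m) (B.γc m) (fun s => s.elim 0 ![1, 2]) (by decide) i ![p, j, k]
  congr 1
  exact congrArg₂ _ (congrArg₂ _ e1 e2) e3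

theorem coeff_LinRh (m : ℕ) (k j : Fin n) : coeff m (B.LinRh k j) = (1 / 2 : ℝ) •
    (∑ p, ∑ q, B.gi p q * B.dd (γw m) (B.γc m) p j k q
      + ∑ p, ∑ q, B.gi p q * B.dd (γw m) (B.γc m) p k j q
      - B.lap (γw m) (B.γc m) j k
      - ∑ p, ∑ q, B.gi p q * B.dd (γw m) (B.γc m) j k p q) := by
  have e : ∑ p, ∑ q, B.gi p q * B.dd (γw m) (B.γc m) j p k q
      = ∑ p, ∑ q, B.gi p q * B.dd (γw m) (B.γc m) j q p k := by
    rw [Finset.sum_comm]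
    exact Finset.sum_congr rfl fun p _ => Finset.sum_congr rfl fun q _ => by
      rw [B.gi_symm, B.dd_symm (B.γc_symm m)]
  simp only [LinRh, map_sum, coeff_C_mul, map_sub, coeff_snab_Lc, Geo.lap]
  simp only [mul_sub, mul_add, mul_smul_comm, Finset.sum_sub_distrib, Finset.sum_add_distrib,
    ← Finset.smul_sum, ← smul_sub, ← smul_add]
  congr 1
  linear_combination -e

theorem γc_eq_ψ (m : ℕ) (I : Fin 2 → Fin n) : B.γc (m + 1) I = ((m : ℝ) + 1)⁻¹ •
    ((2 : ℝ) • coeff m (B.rho.ψ (I 0) (I 1)) + (-1 : ℝ) • coeff m (B.rho.f (I 0) (I 1))) := by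
  have hm : ((m : ℝ) + 1) ≠ 0 := by positivity
  rw [ψ_eq, coeff_smul, smul_smul, map_add, coeff_dX]
  norm_num
  rw [smul_smul, inv_mul_cancel₀ hm, one_smul]
  rfl

end Expansion

namespace Rep

variable {k s : ℕ} {o : ℕ} {w : ℤ} {κ : Type}

theorem cast {T : Fld k κ} {w' : ℤ} (h : Rep k s o w T) (hw : w = w') : Rep k s o w' T := hw ▸ h

theorem metric : Rep k s 0 (-2) (fun σ (I : Fin 2 → Fin σ.n) => σ.B.g (I 0) (I 1)) :=
  Rep.mono .metric (Equiv.refl _) le_rfl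

/-- The covariant derivative of a covector. -/
theorem nabla1 {T : Fld k (Fin 1)} (h : Rep k s o w T) :
    Rep k s o w (fun σ (I : Fin 2 → Fin σ.n) => σ.B.nab w (T σ) (I 0) ![I 1]) := by
  refine (h.nabla.map (fun t => t.elim 0 ![1] : Option (Fin 1) → Fin 2) (by decide)).congr
    fun σ I => ?_
  congr 1
  ext t; fin_cases t; rfl

/-- The differential of a density. -/
theorem nabla0 {T : Fld k (Fin 0)} (h : Rep k s o w T) :
    Rep k s o w (fun σ (I : Fin 1 → Fin σ.n) => σ.B.nab w (T σ) (I 0) ![]) := by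
  refine (h.nabla.map (fun t => t.elim 0 ![] : Option (Fin 0) → Fin 1) (by decide)).congr
    fun σ I => ?_
  congr 1
  ext t; exact t.elim0

variable {T : Fld k (Fin 2)}

theorem nabla2 (h : Rep k s o w T) :
    Rep k s o w (fun σ (I : Fin 3 → Fin σ.n) => σ.B.nab w (T σ) (I 0) ![I 1, I 2]) := by
  refine (h.nabla.map (fun t => t.elim 0 ![1, 2] : Option (Fin 2) → Fin 3) (by decide)).congr
    fun σ I => ?_
  congr 1
  ext t; fin_cases t <;> rfl

theorem div2 (h : Rep k s o w T) :
    Rep k s o (w + 2) (fun σ (I : Fin 1 → Fin σ.n) => σ.B.div2 w (T σ) (I 0)) :=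
  (h.nabla2.ctr_map (![none, some (some 0), some none] : Fin 3 → Option (Option (Fin 1)))
    (by decide)).congr fun _ _ => rfl

theorem tr2 (h : Rep k s o w T) :
    Rep k s o (w + 2) (fun σ (_ : Fin 0 → Fin σ.n) => σ.B.tr2 (T σ)) := by
  refine (h.ctr_map (![none, some none] : Fin 2 → Option (Option (Fin 0))) (by decide)).congr
    fun σ I => Finset.sum_congr rfl fun p _ => Finset.sum_congr rfl fun q _ => ?_
  congr 2
  ext t; fin_cases t <;> rfl

theorem dd (h : Rep k s o w T) :
    Rep k s o w (fun σ (I : Fin 4 → Fin σ.n) => σ.B.dd w (T σ) (I 0) (I 1) (I 2) (I 3)) := by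
  refine (h.nabla.nabla.map (fun t => t.elim 0 fun t => t.elim 1 ![2, 3] :
    Option (Option (Fin 2)) → Fin 4) (by decide)).congr fun σ I => ?_
  rw [Geo.dd, Geo.nabO_nabO]
  congr 1
  funext t
  rcases t with _ | t
  · rfl
  · fin_cases t <;> rfl

theorem lap (h : Rep k s o w T) :
    Rep k s o (w + 2) (fun σ (I : Fin 2 → Fin σ.n) => σ.B.lap w (T σ) (I 0) (I 1)) :=
  (h.dd.ctr_map (![none, some none, some (some 0), some (some 1)] : Fin 4 → Option (Option (Fin 2)))
    (by decide)).congr fun _ _ => rfl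

theorem dd_comm (hk : 1 ≤ k) (h : Rep k s o w T) :
    Rep k s (1 + o) w (fun σ (I : Fin 4 → Fin σ.n) =>
      σ.B.dd w (T σ) (I 0) (I 1) (I 2) (I 3) - σ.B.dd w (T σ) (I 1) (I 0) (I 2) (I 3)) := by
  refine ((h.nab_comm hk).map (fun t => t.elim 0 fun t => t.elim 1 ![2, 3] :
    Option (Option (Fin 2)) → Fin 4) (by decide)).congr fun σ I => ?_
  have e : (fun t : Fin 2 => I ((some (some t) : Option (Option (Fin 2))).elim 0 fun t => t.elim 1 ![2, 3]))
      = ![I 2, I 3] := by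
    ext t; fin_cases t <;> rfl
  rw [e]
  rfl

/-- The divergence of a second derivative is the derivative of the divergence, up to terms of
higher order. -/
theorem div_comm (hk : 1 ≤ k) (h : Rep k s o w T) :
    Rep k s (1 + o) (w + 2) (fun σ (I : Fin 2 → Fin σ.n) =>
      ∑ p, ∑ q, σ.B.gi p q * σ.B.dd w (T σ) p (I 0) (I 1) q
      - σ.B.nab ((w + 2 : ℤ) : ℝ) (fun J : Fin 1 → Fin σ.n => σ.B.div2 w (T σ) (J 0)) (I 0) ![I 1]) := by
  refine ((h.dd_comm hk).ctr_map (![none, some (some 0), some (some 1), some none] :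
    Fin 4 → Option (Option (Fin 2))) (by decide)).congr fun σ I => ?_
  push_cast
  rw [← Geo.sum_dd_div]
  simp only [← Finset.sum_sub_distrib, ← mul_sub]
  rfl

theorem γc {K m : ℕ} (hm : 1 ≤ m) (hγ : SRep.HG k s K) (hK : m < K) :
    Rep k s 1 (Expansion.γw m) (fun σ => σ.B.γc m) := by
  refine ord_one (o := 0) (hγ m hK) ?_
  simp only [Fintype.card_fin, Expansion.γw]; push_cast; omega

/-- The linearized Ricci tensor in terms of the Laplacian, the divergence and the trace. -/
theorem LinRh {m : ℕ} (hk : 1 ≤ k) (hm : 1 ≤ m) (hγ : SRep.HG k s (m + 1)) :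
    Rep k s 2 (2 * m) (fun σ (I : Fin 2 → Fin σ.n) => coeff m (σ.B.LinRh (I 1) (I 0))
      - (1 / 2 : ℝ) • (σ.B.nab ((2 * m : ℤ) : ℝ) (fun J : Fin 1 → Fin σ.n =>
          σ.B.div2 (Expansion.γw m) (σ.B.γc m) (J 0)) (I 0) ![I 1]
        + σ.B.nab ((2 * m : ℤ) : ℝ) (fun J : Fin 1 → Fin σ.n =>
          σ.B.div2 (Expansion.γw m) (σ.B.γc m) (J 0)) (I 1) ![I 0]
        - σ.B.lap (Expansion.γw m) (σ.B.γc m) (I 0) (I 1)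
        - σ.B.nab ((2 * m : ℤ) : ℝ) (fun J : Fin 1 → Fin σ.n => σ.B.nab ((2 * m : ℤ) : ℝ)
          (fun _ : Fin 0 → Fin σ.n => σ.B.tr2 (σ.B.γc m)) (J 0) ![]) (I 0) ![I 1])) := by
  have hw : Expansion.γw m + 2 = 2 * m := by simp only [Expansion.γw]; ring
  have h1 := (γc hm hγ (Nat.lt_succ_self m)).div_comm hk
  simp only [hw] at h1
  refine ((h1.add (h1.map (![1, 0] : Fin 2 → Fin 2) (by decide))).csmul (1 / 2)).congr fun σ I => ?_
  have h2 : ((Expansion.γw m : ℤ) : ℝ) + 2 = ((2 * m : ℤ) : ℝ) := by rw [← hw]; push_cast; ring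
  rw [Expansion.coeff_LinRh, Geo.sum_dd_tr, h2, ← smul_sub]
  congr 1
  simp only [Matrix.cons_val_zero, Matrix.cons_val_one]
  ring

theorem f_coeff {m : ℕ} (hm : 1 ≤ m) : Rep k s 2 (2 * m) (fun σ (I : Fin 2 → Fin σ.n) =>
    coeff m (σ.B.rho.f (I 0) (I 1))) := by
  have := (SRep.f_sub (k := k) (s := s) (K := m + 1)) m (Nat.lt_succ_self m)
  rw [zero_add] at this
  refine this.congr fun σ I => ?_
  rw [map_sub, coeff_C, if_neg (by omega), sub_zero]

/-- The equation for the coefficient of order `m + 1` in terms of the one of order `m`. -/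
theorem ricci_γ {m : ℕ} (hm : 1 ≤ m) (hmk : m < k) (hγ : SRep.HG k s (m + 1)) :
    Rep k s 2 (2 * m) (fun σ (I : Fin 2 → Fin σ.n) =>
      (2 * (m : ℝ) + 2 - σ.n) • ((m : ℝ) + 1) • σ.B.γc (m + 1) ![I 0, I 1]
        + (σ.B.nab ((2 * m : ℤ) : ℝ) (fun J : Fin 1 → Fin σ.n =>
          σ.B.div2 (Expansion.γw m) (σ.B.γc m) (J 0)) (I 0) ![I 1]
        + σ.B.nab ((2 * m : ℤ) : ℝ) (fun J : Fin 1 → Fin σ.n =>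
          σ.B.div2 (Expansion.γw m) (σ.B.γc m) (J 0)) (I 1) ![I 0]
        - σ.B.lap (Expansion.γw m) (σ.B.γc m) (I 0) (I 1)
        - σ.B.nab ((2 * m : ℤ) : ℝ) (fun J : Fin 1 → Fin σ.n => σ.B.nab ((2 * m : ℤ) : ℝ)
          (fun _ : Fin 0 → Fin σ.n => σ.B.tr2 (σ.B.γc m)) (J 0) ![]) (I 0) ![I 1])) := by
  have hk : 1 ≤ k := by omega
  have h1 := (ricci_hh hm hmk hγ).map (![1, 0] : Fin 2 → Fin 2) (by decide)
  have h2 := LinRh hk hm hγ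
  have h3 := ((metric (k := k) (s := s)).mul_map (ricci_mm hm hmk hγ)
    (Sum.elim ![1, 0] ![] : Fin 2 ⊕ Fin 0 → Fin 2) (by decide)).cast (w' := 2 * m) (by ring)
  have hc : IsCf s fun n => 2 * (m : ℝ) + 2 - n := by
    have := IsCf.of_poly (s := s) (Polynomial.C (2 * (m : ℝ) + 2) - Polynomial.X)
    simpa using this
  have h4 := ((f_coeff (k := k) (s := s) hm).smul hc)
  refine ((((h1.add (h3.mono_ord (by omega))).sub h2).csmul 2).sub h4).congr fun σ I => ?_
  have hm0 : ((m : ℝ) + 1) ≠ 0 := by positivity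
  rw [Expansion.γc_eq_ψ, smul_smul ((m : ℝ) + 1), mul_inv_cancel₀ hm0, one_smul]
  simp only [Matrix.cons_val_zero, Matrix.cons_val_one, Sum.elim_inl, Sum.elim_inr]
  module

end Rep

end

end WeylAmbient

namespace WeylAmbient

noncomputable section

/-! ### The coefficients of the metric up to terms of second order -/

open PowerSeries

namespace Geo

variable {n : ℕ} {A : Type} [CommRing A] [Algebra ℝ A] (B : Geo n A)

theorem ddF (i j a b : Fin n) : B.dd 0 (fun I : Fin 2 → Fin n => B.F (I 0) (I 1)) i j a b
    = B.dd 0 (fun I : Fin 2 → Fin n => B.F (I 0) (I 1)) i b a j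
      - B.dd 0 (fun I : Fin 2 → Fin n => B.F (I 0) (I 1)) i a b j := by
  set T : (Fin 2 → Fin n) → A := fun I => B.F (I 0) (I 1) with hT
  have e1 := B.nab_nab_perm 0 T (fun s => s.elim 0 ![1, 2]) (by decide) i ![j, a, b]
  have e2 := B.nab_nab_perm 0 T (fun s => s.elim 1 ![2, 0]) (by decide) i ![j, a, b]
  have e3 := B.nab_nab_perm 0 T (fun s => s.elim 2 ![0, 1]) (by decide) i ![j, a, b]
  have h := B.nab_zero (κ := Fin 3) 0 i ![j, a, b]
  rw [B.nab_congr (T' := fun I : Fin 3 → Fin n => (B.nab 0 T (I 0) ![I 1, I 2]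
    + B.nab 0 T (I 1) ![I 2, I 0]) + B.nab 0 T (I 2) ![I 0, I 1]) (fun I => (B.dF _ _ _).symm),
    nab_add, nab_add] at h
  have e4 : B.dd 0 T i b j a = -B.dd 0 T i b a j := by
    rw [← B.dd_swap T]
    have : (fun I : Fin 2 → Fin n => T ![I 1, I 0]) = fun I => (-1 : ℝ) • T I := by
      funext I
      simp [hT, F]
    rw [this, dd, nabO_smul, nabO_smul]
    change (-1 : ℝ) • _ = _
    rw [neg_one_smul]
    rfl
  have h' := (congrArg₂ (· + ·) (congrArg₂ (· + ·) e1 e2) e3).symm.trans h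
  simp only [Option.elim, Matrix.cons_val_zero, Matrix.cons_val_one, Matrix.cons_val] at h'
  rw [e4] at h'
  linear_combination h'

theorem ev_laplace (M : TMono 2) (I : Fin 2 → Fin n) :
    B.ev (.laplace M) I = B.lap M.weight (B.ev M) (I 0) (I 1) := by
  have h : ∀ i I, B.nab M.weight (B.ev (.nabla M)) i I
      = B.nab M.weight (B.nabO M.weight (B.ev M)) i (fun s => I ((finSuccEquiv 2).symm s)) := by
    intro i I
    refine Eq.trans ?_ (B.nab_reindex (M.weight : ℝ) (B.nabO M.weight (B.ev M))
      (finSuccEquiv 2).symm i I)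
    exact B.nab_congr (fun I => rfl) i I
  change ∑ p, ∑ q, B.gi p q * B.nab M.weight (B.ev (.nabla M)) _ _ = _
  rw [lap]
  refine Finset.sum_congr rfl fun p _ => Finset.sum_congr rfl fun q _ => ?_
  rw [h, dd, nabO]
  congr 2
  funext s
  rcases s with _ | s
  · rfl
  · fin_cases s <;> rfl

theorem ev_divSchouten (I : Fin 1 → Fin n) :
    B.ev .divSchouten I = B.div2 0 (fun I => B.P (I 0) (I 1)) (I 0) := by
  simp only [TMono.divSchouten, ev, div2, TMono.weight, Int.cast_zero]
  refine Finset.sum_congr rfl fun p _ => Finset.sum_congr rfl fun q _ => ?_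
  congr 2
  ext s; fin_cases s <;> rfl

theorem ev_gradDivSchouten (I : Fin 2 → Fin n) : B.ev .gradDivSchouten I
    = B.nab 2 (fun J : Fin 1 → Fin n => B.div2 0 (fun I => B.P (I 0) (I 1)) (J 0)) (I 1) ![I 0] := by
  have h : B.ev .divSchouten = fun J : Fin 1 → Fin n => B.div2 0 (fun I => B.P (I 0) (I 1)) (J 0) :=
    funext B.ev_divSchouten
  rw [TMono.gradDivSchouten, ev, ev, h]
  have hw : ((TMono.divSchouten.weight : ℤ) : ℝ) = 2 := by
    simp [TMono.divSchouten, TMono.weight]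
  rw [hw]
  rfl

end Geo

namespace Rep

variable {k s : ℕ} {o : ℕ} {w : ℤ} {κ : Type}

theorem tr2_γc {m : ℕ} (hm : 1 ≤ m) (hmk : m < k) (hγ : SRep.HG k s (m + 1)) :
    Rep k s 2 (2 * (m + 1 : ℕ)) (fun σ (_ : Fin 0 → Fin σ.n) => σ.B.tr2 (σ.B.γc (m + 1))) := by
  have h1 := (ricci_mm hm hmk hγ).cast (w' := 2 * (m + 1 : ℕ)) (by push_cast; ring)
  have h2 := (f_coeff (k := k) (s := s) hm).tr2.cast (w' := 2 * (m + 1 : ℕ)) (by push_cast; ring)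
  refine (((h1.csmul 2).add (h2.csmul (-1))).csmul ((m : ℝ) + 1)⁻¹).congr fun σ I => ?_
  rw [funext (σ.B.γc_eq_ψ m), Geo.tr2_smul, Geo.tr2_add, Geo.tr2_smul, Geo.tr2_smul]
  rfl

theorem div2_γc {m : ℕ} (hm : 1 ≤ m) (hmk : m + 1 < k) (hγ : SRep.HG k s (m + 2)) :
    Rep k s 2 (2 * (m + 1 : ℕ)) (fun σ (I : Fin 1 → Fin σ.n) =>
      σ.B.div2 (Expansion.γw (m + 1)) (σ.B.γc (m + 1)) (I 0)) := by
  have hw : Expansion.γw (m + 1) = 2 * m := by simp only [Expansion.γw]; push_cast; ring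
  have h1 := (ricci_mh hmk hγ).cast (w' := 2 * (m + 1 : ℕ)) (by push_cast; ring)
  have h2 := ((ricci_mm hm (by omega) (hγ.mono_K (Nat.le_succ _))).nabla0).cast
    (w' := 2 * (m + 1 : ℕ)) (by push_cast; ring)
  have h3 := (f_coeff (k := k) (s := s) hm).div2.cast (w' := 2 * (m + 1 : ℕ)) (by push_cast; ring)
  refine ((((h1.add h2).csmul 2).add (h3.csmul (-1))).csmul ((m : ℝ) + 1)⁻¹).congr fun σ I => ?_
  rw [funext (σ.B.γc_eq_ψ m), Geo.div2_smul, Geo.div2_add, Geo.div2_smul, Geo.div2_smul, hw]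
  have h4 := σ.B.nab_tr2 ((2 * m : ℤ) : ℝ) (fun I : Fin 2 → Fin σ.n => coeff m (σ.B.rho.ψ (I 0) (I 1)))
    (I 0) ![]
  have h5 : ((2 * (m : ℤ) : ℤ) : ℝ) + 2 = ((2 * (m : ℤ) + 2 : ℤ) : ℝ) := by push_cast; ring
  rw [h5] at h4
  have h6 : σ.B.nab ((2 * (m : ℤ) + 2 : ℤ) : ℝ) (fun _ : Fin 0 → Fin σ.n => ∑ p, ∑ q, σ.B.gi p q
      * coeff m (σ.B.rho.ψ p q)) (I 0) ![] = _ := h4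
  rw [h6]
  simp only [← Finset.sum_add_distrib, ← mul_add, sub_add_cancel]
  rfl

/-- The recursion for `γ^{(m)}`, `m ≥ 2`. -/
theorem γc_succ {m : ℕ} (hm : 2 ≤ m) (hmk : m < k) (hγ : SRep.HG k s (m + 1)) :
    Rep k s 2 (2 * m) (fun σ (I : Fin 2 → Fin σ.n) =>
      (2 * (m : ℝ) + 2 - σ.n) • ((m : ℝ) + 1) • σ.B.γc (m + 1) I
        - σ.B.lap (Expansion.γw m) (σ.B.γc m) (I 0) (I 1)) := by
  have h1 := ricci_γ (by omega : 1 ≤ m) hmk hγ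
  obtain ⟨m, rfl⟩ : ∃ m', m = m' + 1 := ⟨m - 1, by omega⟩
  have h2 := (div2_γc (by omega) hmk hγ).nabla1
  have h3 := (tr2_γc (by omega : 1 ≤ m) (by omega) (hγ.mono_K (Nat.le_succ _))).nabla0.nabla1
  refine (((h1.sub h2).sub (h2.map (![1, 0] : Fin 2 → Fin 2) (by decide))).add h3).congr
    fun σ I => ?_
  have e : (![I 0, I 1] : Fin 2 → Fin σ.n) = I := by ext t; fin_cases t <;> rfl
  rw [e]
  simp only [Matrix.cons_val_zero, Matrix.cons_val_one]
  ring

/-- The tensor `P_{ij}` as a family. -/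
abbrev Pf {k : ℕ} : Fld k (Fin 2) := fun σ I => σ.B.P (I 0) (I 1)

/-- The recursion for `γ^{(2)}`. -/
theorem γc_two (hk : 2 ≤ k) (hγ : SRep.HG k s 2) :
    Rep k s 2 2 (fun σ (I : Fin 2 → Fin σ.n) => (4 - (σ.n : ℝ)) • σ.B.γc 2 I
      - (σ.B.lap 0 (Pf σ) (I 0) (I 1) - σ.B.nab 2 (fun J : Fin 1 → Fin σ.n =>
        σ.B.div2 0 (Pf σ) (J 0)) (I 1) ![I 0])) := by
  have hk1 : 1 ≤ k := by omega
  have h1 := ricci_γ le_rfl (by omega : 1 < k) hγ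
  have h3 := (fieldStrength (s := s) hk1).div_comm hk1
  have h3' := h3.map (![1, 0] : Fin 2 → Fin 2) (by decide)
  rw [Nat.cast_one, mul_one] at h1
  rw [zero_add] at h3 h3'
  refine (((h1.add (h3'.sub h3)).csmul (1 / 2))).congr fun σ I => ?_
  set P : (Fin 2 → Fin σ.n) → σ.A := Pf σ with hP
  set P' : (Fin 2 → Fin σ.n) → σ.A := fun I => σ.B.P (I 1) (I 0) with hP'
  have e0 : σ.B.γc 1 = fun I => P I + P' I := by
    funext I
    rw [show (1 : ℕ) = 0 + 1 from rfl, σ.B.γc_eq_ψ, σ.coeff_zero_ψ hk1, σ.B.coeff_zero_f,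
      σ.F_eq hk1, two_smul]
    simp [hP, hP', add_comm]
  have eF : (fun I : Fin 2 → Fin σ.n => σ.B.F (I 0) (I 1)) = fun I => P' I + (-1 : ℝ) • P I := by
    funext I
    rw [σ.F_eq hk1]; simp [hP, hP', sub_eq_add_neg]
  have etr : σ.B.tr2 P' = σ.B.tr2 P := by
    rw [Geo.tr2, Geo.tr2, Finset.sum_comm]
    exact Finset.sum_congr rfl fun p _ => Finset.sum_congr rfl fun q _ => by
      rw [σ.B.gi_symm]; rfl
  have ediv : ∀ j, σ.B.div2 0 P' j = σ.B.nab 2 (fun _ : Fin 0 → Fin σ.n => σ.B.tr2 P) j ![] := by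
    intro j
    have h4 := σ.B.nab_tr2 0 P' j ![]
    rw [zero_add, etr] at h4
    rw [h4]
    exact σ.div_P hk j
  have elap : ∀ a b, σ.B.lap 0 P' a b - σ.B.lap 0 P a b
      = ∑ p, ∑ q, σ.B.gi p q * σ.B.dd 0 (fun I : Fin 2 → Fin σ.n => σ.B.F (I 0) (I 1)) p b a q
        - ∑ p, ∑ q, σ.B.gi p q * σ.B.dd 0 (fun I : Fin 2 → Fin σ.n => σ.B.F (I 0) (I 1)) p a b q := by
    intro a b
    have h5 := σ.B.lap_add 0 P' (fun I => (-1 : ℝ) • P I) a b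
    rw [← eF, Geo.lap_smul, neg_one_smul, ← sub_eq_add_neg] at h5
    rw [← h5, Geo.lap]
    simp only [← Finset.sum_sub_distrib, ← mul_sub]
    exact Finset.sum_congr rfl fun p _ => Finset.sum_congr rfl fun q _ => by rw [← Geo.ddF]
  have eγw : ((Expansion.γw 1 : ℤ) : ℝ) = 0 := by simp [Expansion.γw]
  have ed : ∀ a b : Fin σ.n, σ.B.nab 2 (fun J : Fin 1 → Fin σ.n => σ.B.div2 0 (σ.B.γc 1) (J 0)) a ![b]
      = σ.B.nab 2 (fun J : Fin 1 → Fin σ.n => σ.B.div2 0 P (J 0)) a ![b]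
        + σ.B.nab 2 (fun J : Fin 1 → Fin σ.n => σ.B.div2 0 P' (J 0)) a ![b] := by
    intro a b
    rw [← Geo.nab_add]
    exact σ.B.nab_congr (fun J => by rw [e0, Geo.div2_add]) _ _
  have eFd : ∀ a b : Fin σ.n, σ.B.nab 2 (fun J : Fin 1 → Fin σ.n =>
      σ.B.div2 0 (fun I => σ.B.F (I 0) (I 1)) (J 0)) a ![b]
      = σ.B.nab 2 (fun J : Fin 1 → Fin σ.n => σ.B.div2 0 P' (J 0)) a ![b]
        - σ.B.nab 2 (fun J : Fin 1 → Fin σ.n => σ.B.div2 0 P (J 0)) a ![b] := by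
    intro a b
    rw [← Geo.nab_sub]
    exact σ.B.nab_congr (fun J => by
      rw [eF, Geo.div2_add, Geo.div2_smul, neg_one_smul, ← sub_eq_add_neg]) _ _
  have etr' : ∀ a b : Fin σ.n, σ.B.nab 2 (fun J : Fin 1 → Fin σ.n =>
      σ.B.nab 2 (fun _ : Fin 0 → Fin σ.n => σ.B.tr2 (σ.B.γc 1)) (J 0) ![]) a ![b]
      = 2 * σ.B.nab 2 (fun J : Fin 1 → Fin σ.n => σ.B.div2 0 P' (J 0)) a ![b] := by
    intro a b
    rw [two_mul, ← Geo.nab_add]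
    refine σ.B.nab_congr (fun J => ?_) _ _
    rw [ediv, ← Geo.nab_add]
    exact σ.B.nab_congr (fun J => by rw [e0, Geo.tr2_add, etr]) _ _
  have elap' : σ.B.lap 0 (σ.B.γc 1) (I 0) (I 1) = σ.B.lap 0 P (I 0) (I 1) + σ.B.lap 0 P' (I 0) (I 1) := by
    rw [e0, Geo.lap_add]
  have hl := elap (I 0) (I 1)
  have eI : (![I 0, I 1] : Fin 2 → Fin σ.n) = I := by ext t; fin_cases t <;> rfl
  simp only [Int.cast_ofNat, Int.cast_zero, eγw, Matrix.cons_val_zero, Matrix.cons_val_one, ed, eFd, etr',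
    elap', eI, Nat.cast_one, mul_one]
  rw [two_mul]
  linear_combination (norm := module) (1 / 2 : ℝ) • hl

end Rep

end

end WeylAmbient

namespace WeylAmbient

noncomputable section

/-! ### The leading part of the coefficients of the metric -/

open PowerSeries

namespace TMono

theorem weight_iterLaplace {r : ℕ} (m : ℕ) (M : TMono r) :
    (iterLaplace m M).weight = M.weight + 2 * m := by
  induction m with
  | zero => simp [iterLaplace]
  | succ m ih =>
    rw [iterLaplace, Function.iterate_succ_apply']
    change (iterLaplace m M).weight + 2 = _
    rw [ih]; push_cast; ring

theorem iterLaplace_succ {r : ℕ} (m : ℕ) (M : TMono r) :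
    iterLaplace (m + 1) M = (iterLaplace m M).laplace := Function.iterate_succ_apply' _ _ _

theorem weight_gradDivSchouten : gradDivSchouten.weight = 2 := rfl

end TMono

theorem IsCf.inv_den (s : ℕ) (c : ℝ) : IsCf s fun n => c * (den s n)⁻¹ := by
  refine (IsCf.const c).mul ⟨denP s, 2, fun n => ?_⟩
  rw [eval_denP]
  by_cases h : den s n = 0
  · simp [h]
  · field_simp

theorem IsCf.den_poly (s : ℕ) (c : ℝ) : IsCf s fun n => c * den s n := by
  refine (IsCf.const c).mul ⟨denP s, 0, fun n => ?_⟩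
  rw [eval_denP, pow_zero, mul_one]

theorem den_succ {s : ℕ} (hs : 1 ≤ s) (n : ℕ) :
    den (s + 1) n = den s n * ((n : ℝ) - 2 * ((s : ℝ) + 1)) := by
  rw [den, ← Finset.insert_Icc_right_eq_Icc_add_one (by omega), Finset.prod_insert (by simp), mul_comm]
  push_cast
  rfl

/-- The factor of the leading part of `γ^{(m)}`. -/
def lfac (m n : ℕ) : ℝ := 2 / (m.factorial : ℝ) * (-1) ^ (m - 1) * (den m n)⁻¹

theorem isCf_lfac (m : ℕ) : IsCf m (lfac m) := IsCf.inv_den m _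

theorem isCf_inv_lfac (m : ℕ) : IsCf m fun n => (lfac m n)⁻¹ := by
  have h : (fun n => (lfac m n)⁻¹) = fun n => (2 / (m.factorial : ℝ) * (-1) ^ (m - 1))⁻¹ * den m n := by
    funext n
    rw [lfac, mul_inv, inv_inv]
  rw [h]
  exact IsCf.den_poly m _

theorem lfac_ne_zero {m n : ℕ} (h : ∀ j ∈ Finset.Icc 2 m, n ≠ 2 * j) : lfac m n ≠ 0 := by
  have h1 := den_ne_zero h
  have h2 : (m.factorial : ℝ) ≠ 0 := by exact_mod_cast m.factorial_ne_zero
  rw [lfac]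
  positivity

theorem lfac_two (n : ℕ) : lfac 2 n = ((4 : ℝ) - n)⁻¹ := by
  rw [lfac, den_succ le_rfl]
  simp [den, ← inv_neg]
  norm_num

theorem lfac_succ {m : ℕ} (hm : 1 ≤ m) (n : ℕ) :
    lfac (m + 1) n = ((2 * (m : ℝ) + 2 - n) * ((m : ℝ) + 1))⁻¹ * lfac m n := by
  obtain ⟨m, rfl⟩ : ∃ m', m = m' + 1 := ⟨m - 1, by omega⟩
  have e : (2 * ((m + 1 : ℕ) : ℝ) + 2 - n) = -((n : ℝ) - 2 * (((m + 1 : ℕ) : ℝ) + 1)) := by ring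
  rw [lfac, lfac, den_succ hm, e, Nat.factorial_succ (m + 1)]
  simp only [Nat.add_sub_cancel, Nat.cast_mul, pow_succ, mul_inv, div_eq_mul_inv, inv_neg]
  push_cast
  ring

/-- The leading part of `γ^{(m)}`. -/
def leadF (m : ℕ) {k : ℕ} : Fld k (Fin 2) := fun σ I =>
  σ.B.ev (.iterLaplace (m - 1) .schouten) I - σ.B.ev (.iterLaplace (m - 2) .gradDivSchouten) I

namespace Rep

variable {k s : ℕ}

theorem leadF {m : ℕ} (hm : 2 ≤ m) : Rep k s 0 (Expansion.γw m) (WeylAmbient.leadF m (k := k)) := by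
  have h1 : Rep k s 0 (Expansion.γw m) (fun σ (I : Fin 2 → Fin σ.n) =>
      σ.B.ev (.iterLaplace (m - 1) .schouten) I) := by
    refine (Rep.mono (TMono.iterLaplace (m - 1) .schouten) (Equiv.refl _) (Nat.zero_le _)).cast ?_
    rw [TMono.weight_iterLaplace, TMono.weight]; push_cast [show 1 ≤ m by omega]; ring
  have h2 : Rep k s 0 (Expansion.γw m) (fun σ (I : Fin 2 → Fin σ.n) =>
      σ.B.ev (.iterLaplace (m - 2) .gradDivSchouten) I) := by
    refine (Rep.mono (TMono.iterLaplace (m - 2) .gradDivSchouten) (Equiv.refl _)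
      (Nat.zero_le _)).cast ?_
    rw [TMono.weight_iterLaplace, TMono.weight_gradDivSchouten]; push_cast [hm]; ring
  exact h1.sub h2

end Rep

theorem lap_leadF {k m : ℕ} (hm : 2 ≤ m) (σ : Sit k) (I : Fin 2 → Fin σ.n) :
    σ.B.lap (Expansion.γw m) (leadF m σ) (I 0) (I 1) = leadF (m + 1) σ I := by
  obtain ⟨m, rfl⟩ : ∃ m', m = m' + 2 := ⟨m - 2, by omega⟩
  have h1 := σ.B.ev_laplace (.iterLaplace (m + 1) .schouten) I
  have h2 := σ.B.ev_laplace (.iterLaplace m .gradDivSchouten) I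
  rw [← TMono.iterLaplace_succ] at h1 h2
  have e1 : (TMono.iterLaplace (m + 1) .schouten).weight = Expansion.γw (m + 2) := by
    rw [TMono.weight_iterLaplace, TMono.weight, Expansion.γw]; push_cast; ring
  have e2 : (TMono.iterLaplace m .gradDivSchouten).weight = Expansion.γw (m + 2) := by
    rw [TMono.weight_iterLaplace, TMono.weight_gradDivSchouten, Expansion.γw]; push_cast; ring
  rw [e1] at h1
  rw [e2] at h2
  have e : leadF (m + 2) σ = fun I => σ.B.ev (.iterLaplace (m + 1) .schouten) I
      + (-1 : ℝ) • σ.B.ev (.iterLaplace m .gradDivSchouten) I := by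
    funext I; rw [neg_one_smul, ← sub_eq_add_neg]; rfl
  rw [e, Geo.lap_add, Geo.lap_smul, neg_one_smul, ← sub_eq_add_neg, leadF]
  exact congrArg₂ (· - ·) h1.symm h2.symm

namespace Rep

variable {k : ℕ}

theorem HG_succ {s s' K : ℕ} (hs : s ≤ s') (h : SRep.HG k s K)
    (hK : Rep k s' 0 (Expansion.γw K) (fun σ => σ.B.γc K)) : SRep.HG k s' (K + 1) := by
  intro l hl
  rcases Nat.lt_succ_iff_lt_or_eq.1 hl with h' | rfl
  · exact (h l h').mono_cf hs
  · exact hK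

theorem HG_two (hk : 2 ≤ k) : SRep.HG k 1 2 := by
  have h0 : SRep.HG k 1 0 := fun l hl => absurd hl (Nat.not_lt_zero l)
  refine HG_succ le_rfl (HG_succ le_rfl h0 ?_) ?_
  · exact metric.congr fun σ I => σ.B.coeff_zero_γ _ _
  · refine ((schouten.add (schouten.map (![1, 0] : Fin 2 → Fin 2) (by decide))).mono_ord
      (Nat.zero_le 1)).congr fun σ I => ?_
    rw [show σ.B.γc 1 I = _ from σ.B.γc_eq_ψ 0 I, σ.coeff_zero_ψ (by omega : 1 ≤ k), σ.B.coeff_zero_f,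
      σ.F_eq (by omega : 1 ≤ k), two_smul]
    simp [add_comm]

/-- The coefficient `γ^{(m)}` is representable, and its terms that are linear in the curvature are
known. -/
theorem γc_eq_lead {m : ℕ} (hm : 2 ≤ m) (hmk : m ≤ k) : SRep.HG k m (m + 1) ∧
    ∃ L : Fld k (Fin 2), Rep k (m - 1) 2 (Expansion.γw m) L ∧
      ∀ σ I, σ.B.γc m I = lfac m σ.n • (WeylAmbient.leadF m σ I + L σ I) := by
  have step : ∀ {m : ℕ} {L : Fld k (Fin 2)}, 2 ≤ m → SRep.HG k (m - 1) m →
      Rep k (m - 1) 2 (Expansion.γw m) L →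
      (∀ σ I, σ.B.γc m I = lfac m σ.n • (WeylAmbient.leadF m σ I + L σ I)) →
      SRep.HG k m (m + 1) := fun {m L} hm h hL e =>
    HG_succ (Nat.sub_le m 1) h <| (((leadF (s := m) hm).add ((hL.mono_cf (Nat.sub_le m 1)).mono_ord
      (Nat.zero_le 2))).smul (isCf_lfac m)).congr e
  induction m, hm using Nat.le_induction with
  | base =>
    have h1 := γc_two hmk (HG_two hmk)
    have h2 : ∀ σ : Sit k, ∀ I, σ.B.γc 2 I = lfac 2 σ.n • (WeylAmbient.leadF 2 σ I
        + ((4 - (σ.n : ℝ)) • σ.B.γc 2 I - WeylAmbient.leadF 2 σ I)) := by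
      intro σ I
      have h3 : (σ.n : ℝ) ≠ 4 := by
        have := σ.ne_even 2 (Finset.mem_Icc.2 ⟨le_rfl, hmk⟩)
        exact_mod_cast this
      rw [add_sub_cancel, smul_smul, lfac_two, inv_mul_cancel₀ (sub_ne_zero.2 h3.symm), one_smul]
    have h3 : Rep k 1 2 (Expansion.γw 2) fun σ I =>
        (4 - (σ.n : ℝ)) • σ.B.γc 2 I - WeylAmbient.leadF 2 σ I := by
      refine (h1.cast (w' := Expansion.γw 2) (by norm_num [Expansion.γw])).congr fun σ I => ?_
      have e1 := σ.B.ev_laplace .schouten I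
      have e2 := σ.B.ev_gradDivSchouten I
      have e : WeylAmbient.leadF 2 σ I = σ.B.ev (.laplace .schouten) I - σ.B.ev .gradDivSchouten I := rfl
      rw [e, e1, e2, TMono.weight, Int.cast_zero]
      rfl
    exact ⟨step le_rfl (HG_two hmk) h3 h2, _, h3, h2⟩
  | succ m hm ih =>
    obtain ⟨hγ, L, hL, e⟩ := ih (by omega)
    have h1 := γc_succ hm (by omega : m < k) hγ
    set R : Fld k (Fin 2) := fun σ (I : Fin 2 → Fin σ.n) =>
      (2 * (m : ℝ) + 2 - σ.n) • ((m : ℝ) + 1) • σ.B.γc (m + 1) I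
        - σ.B.lap (Expansion.γw m) (σ.B.γc m) (I 0) (I 1) with hR
    have hw : Expansion.γw m + 2 = Expansion.γw (m + 1) := by simp only [Expansion.γw]; push_cast; ring
    have h2 : Rep k m 2 (Expansion.γw (m + 1)) (fun σ I =>
        σ.B.lap (Expansion.γw m) (L σ) (I 0) (I 1) + (lfac m σ.n)⁻¹ • R σ I) := by
      refine ((hL.mono_cf (Nat.sub_le m 1)).lap.cast hw).add ((h1.smul (isCf_inv_lfac m)).cast ?_)
      simp only [Expansion.γw]; push_cast; ring
    have h3 : ∀ σ : Sit k, ∀ I, σ.B.γc (m + 1) I = lfac (m + 1) σ.n • (WeylAmbient.leadF (m + 1) σ I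
        + (σ.B.lap (Expansion.γw m) (L σ) (I 0) (I 1) + (lfac m σ.n)⁻¹ • R σ I)) := by
      intro σ I
      have hn : (2 * (m : ℝ) + 2 - σ.n) ≠ 0 := by
        have h3 := σ.ne_even (m + 1) (Finset.mem_Icc.2 ⟨by omega, hmk⟩)
        intro h4
        apply h3
        have h5 : (σ.n : ℝ) = 2 * (m + 1 : ℕ) := by push_cast; linarith
        exact_mod_cast h5
      have hm1 : ((m : ℝ) + 1) ≠ 0 := by positivity
      have hl : lfac m σ.n ≠ 0 := lfac_ne_zero fun j hj => σ.ne_even j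
        (Finset.mem_Icc.2 ⟨(Finset.mem_Icc.1 hj).1, by have := (Finset.mem_Icc.1 hj).2; omega⟩)
      have e2 : σ.B.lap (Expansion.γw m) (σ.B.γc m) (I 0) (I 1) = lfac m σ.n •
          (WeylAmbient.leadF (m + 1) σ I + σ.B.lap (Expansion.γw m) (L σ) (I 0) (I 1)) := by
        rw [funext (e σ), Geo.lap_smul, Geo.lap_add, lap_leadF hm]
      rw [lfac_succ (by omega), mul_smul, ← add_assoc, smul_add, smul_smul (lfac m σ.n),
        mul_inv_cancel₀ hl, one_smul, ← e2, hR]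
      simp only [add_sub_cancel]
      rw [smul_smul, smul_smul, mul_assoc, inv_mul_cancel₀ (mul_ne_zero hn hm1), one_smul]
    exact ⟨step (by omega) hγ h2 h3, _, h2, h3⟩

end Rep

end

end WeylAmbient

namespace WeylAmbient

noncomputable section

/-! ### Representable tensors in the ambient frame -/

open PowerSeries

/-- Families of tensors in the ambient frame, with values in power series in `ρ`. -/
abbrev EFld (k : ℕ) (κ : Type) : Type 1 := ∀ σ : Sit k, (κ → Fin σ.n ⊕ Fin 2) → PowerSeries σ.A

/-- Frame indices which are horizontal where `τ` is `none`, and vertical otherwise. -/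
def pat {κ α : Type} (τ : κ → Option (Fin 2)) (I : κ → α) (x : κ) : α ⊕ Fin 2 :=
  (τ x).elim (.inl (I x)) .inr

/-- The number of indices `-`. -/
def cnt {κ : Type} [Fintype κ] (τ : κ → Option (Fin 2)) : ℤ := ∑ x, if τ x = some 1 then 1 else 0

/-- `f` enumerates the horizontal indices of `τ`. -/
abbrev Enum {ι κ : Type} (τ : κ → Option (Fin 2)) (f : ι → κ) : Prop :=
  Function.Injective f ∧ ∀ x, τ x = none ↔ ∃ t, f t = x

theorem enum_val {κ : Type} (τ : κ → Option (Fin 2)) :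
    Enum τ (Subtype.val : {x // τ x = none} → κ) :=
  ⟨Subtype.val_injective, fun x => ⟨fun h => ⟨⟨x, h⟩, rfl⟩, by rintro ⟨t, rfl⟩; exact t.2⟩⟩

theorem Enum.bijective {ι ι' κ κ' : Type} {τ : κ → Option (Fin 2)} {τ' : κ' → Option (Fin 2)}
    {f : ι → κ} {f' : ι' → κ'} (hf : Enum τ f) (hf' : Enum τ' f') {e : κ → κ'}
    (he : Function.Injective e) (hτ : ∀ y, τ' y = none → ∃ x, e x = y ∧ τ x = none) {g : ι → ι'}
    (hg : ∀ t, f' (g t) = e (f t)) : Function.Bijective g := by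
  refine ⟨fun t t' h => hf.1 (he ?_), fun t' => ?_⟩
  · rw [← hg, ← hg, h]
  · obtain ⟨x, hx, hx'⟩ := hτ _ ((hf'.2 _).2 ⟨t', rfl⟩)
    obtain ⟨t, rfl⟩ := (hf.2 x).1 hx'
    exact ⟨t, hf'.1 ((hg t).trans hx)⟩

/-- The components of `T` with the pattern `τ` are representable. -/
def PatRep (k s : ℕ) (w : ℤ) (K : ℕ) {κ : Type} [Fintype κ] (T : EFld k κ)
    (τ : κ → Option (Fin 2)) : Prop :=
  ∃ (ι : Type) (f : ι → κ), Enum τ f ∧ ∃ T' : SFld k ι, SRep k s 0 (w + 2 * cnt τ) K T' ∧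
    ∀ σ I, T σ (pat τ I) = T' σ fun t => I (f t)

/-- All components of `T` are representable. The index `-` has weight 2. -/
def ERep (k s : ℕ) (w : ℤ) (K : ℕ) {κ : Type} [Fintype κ] (T : EFld k κ) : Prop :=
  ∀ τ, PatRep k s w K T τ

theorem PatRep.on {k s K : ℕ} {w : ℤ} {κ ι : Type} [Fintype κ] {T : EFld k κ}
    {τ : κ → Option (Fin 2)} (h : PatRep k s w K T τ) {f : ι → κ} (hf : Enum τ f) :
    ∃ T' : SFld k ι, SRep k s 0 (w + 2 * cnt τ) K T' ∧
      ∀ σ I, T σ (pat τ I) = T' σ fun t => I (f t) := by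
  obtain ⟨ι', f', hf', T', hT', e⟩ := h
  have h1 : ∀ t, ∃ t', f t' = f' t := fun t => (hf.2 _).1 ((hf'.2 _).2 ⟨t, rfl⟩)
  choose g hg using h1
  refine ⟨_, hT'.map g (hf'.bijective hf (e := id) Function.injective_id
    (fun y hy => ⟨y, rfl, hy⟩) hg), fun σ I => ?_⟩
  rw [e]
  exact congrArg (T' σ) (funext fun t => congrArg I (hg t).symm)

theorem PatRep.zero {k s K : ℕ} {w : ℤ} {κ : Type} [Fintype κ] {T : EFld k κ}
    {τ : κ → Option (Fin 2)} (h : ∀ σ I, T σ (pat τ I) = 0) : PatRep k s w K T τ :=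
  ⟨_, _, enum_val τ, _, SRep.zero, h⟩

theorem PatRep.mk {k s K : ℕ} {w w' : ℤ} {κ ι : Type} [Fintype κ] {T : EFld k κ}
    {τ : κ → Option (Fin 2)} (f : ι → κ) (hf : Enum τ f) {T' : SFld k ι} (h : SRep k s 0 w' K T')
    (hw : w' = w + 2 * cnt τ) (e : ∀ σ I, T σ (pat τ I) = T' σ fun t => I (f t)) :
    PatRep k s w K T τ := ⟨ι, f, hf, T', h.cast hw, e⟩

namespace ERep

variable {k s : ℕ} {w w' : ℤ} {K K' : ℕ} {κ κ' κ₁ κ₂ : Type} [Fintype κ] [Fintype κ'] [Fintype κ₁]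
  [Fintype κ₂]

theorem congr {T T' : EFld k κ} (h : ERep k s w K T) (e : ∀ σ J, T' σ J = T σ J) :
    ERep k s w K T' := fun τ => by
  obtain ⟨ι, f, hf, S, hS, eS⟩ := h τ
  exact ⟨ι, f, hf, S, hS, fun σ I => (e _ _).trans (eS σ I)⟩

theorem cast {T : EFld k κ} (h : ERep k s w K T) (hw : w = w') : ERep k s w' K T := hw ▸ h

theorem mono_K {T : EFld k κ} (h : ERep k s w K T) (hK : K' ≤ K) : ERep k s w K' T := fun τ => by
  obtain ⟨ι, f, hf, S, hS, eS⟩ := h τ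
  exact ⟨ι, f, hf, S, hS.mono_K hK, eS⟩

theorem add {T T' : EFld k κ} (h : ERep k s w K T) (h' : ERep k s w K T') :
    ERep k s w K (fun σ J => T σ J + T' σ J) := fun τ => by
  obtain ⟨S, hS, e⟩ := (h τ).on (enum_val τ)
  obtain ⟨S', hS', e'⟩ := (h' τ).on (enum_val τ)
  exact ⟨_, _, enum_val τ, _, hS.add hS', fun σ I => congrArg₂ (· + ·) (e σ I) (e' σ I)⟩

theorem csmul {T : EFld k κ} (c : ℝ) (h : ERep k s w K T) :
    ERep k s w K (fun σ J => c • T σ J) := fun τ => by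
  obtain ⟨ι, f, hf, S, hS, eS⟩ := h τ
  exact ⟨ι, f, hf, _, hS.csmul c, fun σ I => congrArg (c • ·) (eS σ I)⟩

theorem sub {T T' : EFld k κ} (h : ERep k s w K T) (h' : ERep k s w K T') :
    ERep k s w K (fun σ J => T σ J - T' σ J) :=
  (h.add (h'.csmul (-1))).congr fun σ J => by rw [neg_one_smul, sub_eq_add_neg]

theorem sum {ι : Type} (S : Finset ι) {T : ι → EFld k κ} (h : ∀ x ∈ S, ERep k s w K (T x)) :
    ERep k s w K (fun σ J => ∑ x ∈ S, T x σ J) := by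
  classical
  induction S using Finset.induction_on with
  | empty => exact fun τ => PatRep.zero fun σ I => by simp
  | insert a S ha ih =>
    refine ((h a (by simp)).add (ih fun x hx => h x (by simp [hx]))).congr fun σ J => ?_
    rw [Finset.sum_insert ha]

theorem map {T : EFld k κ'} (h : ERep k s w K T) (e : κ' → κ) (he : Function.Bijective e) :
    ERep k s w K (fun σ J => T σ fun x => J (e x)) := fun τ => by
  obtain ⟨S, hS, eS⟩ := (h (τ ∘ e)).on (enum_val _)
  refine PatRep.mk _ (enum_val τ) (hS.map (fun t => (⟨e t.1, t.2⟩ : {x // τ x = none})) ?_) ?_ fun σ I =>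
    eS σ fun x => I (e x)
  · exact (enum_val _).bijective (enum_val τ) he.1
      (fun y hy => by obtain ⟨x, rfl⟩ := he.2 y; exact ⟨x, rfl, hy⟩) fun _ => rfl
  · congr 2
    exact (Equiv.ofBijective e he).sum_comp fun x => if τ x = some 1 then (1 : ℤ) else 0

theorem mul {T : EFld k κ₁} {T' : EFld k κ₂} (h : ERep k s w K T) (h' : ERep k s w' K T') :
    ERep k s (w + w') K (fun σ (J : κ₁ ⊕ κ₂ → Fin σ.n ⊕ Fin 2) =>
      T σ (fun x => J (.inl x)) * T' σ fun x => J (.inr x)) := fun τ => by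
  obtain ⟨ι₁, f₁, h₁, S, hS, e⟩ := h fun x => τ (.inl x)
  obtain ⟨ι₂, f₂, h₂, S', hS', e'⟩ := h' fun x => τ (.inr x)
  refine PatRep.mk (Sum.map f₁ f₂) ⟨h₁.1.sumMap h₂.1, ?_⟩
    (hS.mul_map hS' id Function.bijective_id) ?_ fun σ I => ?_
  · rintro (x | x)
    · exact (h₁.2 x).trans (by simp)
    · exact (h₂.2 x).trans (by simp)
  · simp only [cnt, Fintype.sum_sum_type]; ring
  · exact congrArg₂ (· * ·) (e σ fun x => I (.inl x)) (e' σ fun x => I (.inr x))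

/-- The map of horizontal indices of a contraction. -/
def ctrMap (τ : κ → Option (Fin 2)) : {x : Option (Option κ) // cons2 none none τ x = none} →
    Option (Option {x // τ x = none})
  | ⟨none, _⟩ => none
  | ⟨some none, _⟩ => some none
  | ⟨some (some x), h⟩ => some (some ⟨x, h⟩)

theorem ctrMap_bijective (τ : κ → Option (Fin 2)) : Function.Bijective (ctrMap τ) := by
  constructor
  · rintro ⟨_ | _ | x, hx⟩ ⟨_ | _ | y, hy⟩ h <;> simp_all [ctrMap]
    exact congrArg Subtype.val h
  · rintro (_ | _ | x)
    exacts [⟨⟨none, rfl⟩, rfl⟩, ⟨⟨some none, rfl⟩, rfl⟩, ⟨⟨some (some x.1), x.2⟩, rfl⟩]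

theorem cnt_cons2 (τ : κ → Option (Fin 2)) (a b : Option (Fin 2)) : cnt (cons2 a b τ)
    = (if a = some 1 then 1 else 0) + ((if b = some 1 then 1 else 0) + cnt τ) := by
  rw [cnt, Fintype.sum_option, Fintype.sum_option]
  rfl

theorem pat_cons2 {α : Type} (τ : κ → Option (Fin 2)) (a b : Option (Fin 2)) (I : κ → α) (p q : α) :
    pat (cons2 a b τ) (cons2 p q I) = cons2 (a.elim (.inl p) .inr) (b.elim (.inl q) .inr) (pat τ I) := by
  funext x; rcases x with _ | _ | x <;> rfl

end ERep

namespace Expansion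

variable {n : ℕ} {A : Type} [CommRing A] [Algebra ℝ A] (B : Expansion n A)

/-- The flat metric of the frame, with the boundary metric in the horizontal directions. -/
def eta : Fin n ⊕ Fin 2 → Fin n ⊕ Fin 2 → A⟦X⟧ :=
  Sum.elim (fun i => Sum.elim (fun j => C (B.g i j)) ![0, 0])
    ![Sum.elim (fun _ => 0) ![0, 1], Sum.elim (fun _ => 0) ![1, 0]]

/-- Its inverse. -/
def etaI : Fin n ⊕ Fin 2 → Fin n ⊕ Fin 2 → A⟦X⟧ :=
  Sum.elim (fun i => Sum.elim (fun j => C (B.gi i j)) ![0, 0])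
    ![Sum.elim (fun _ => 0) ![0, 1], Sum.elim (fun _ => 0) ![1, 0]]

theorem sum_etaI (T : Fin n ⊕ Fin 2 → Fin n ⊕ Fin 2 → A⟦X⟧) : ∑ a, ∑ b, B.etaI a b * T a b
    = ∑ p, ∑ q, C (B.gi p q) * T (.inl p) (.inl q) + (T (.inr 0) (.inr 1) + T (.inr 1) (.inr 0)) := by
  simp [Fintype.sum_sum_type, etaI]

theorem sum_eta (a : Fin n ⊕ Fin 2) (T : Fin n ⊕ Fin 2 → A⟦X⟧) : ∑ b, B.eta a b * T b
    = Sum.elim (fun i => ∑ j, C (B.g i j) * T (.inl j)) ![T (.inr 1), T (.inr 0)] a := by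
  obtain ⟨i, rfl⟩ | rfl | rfl := amb_cases a <;> simp [Fintype.sum_sum_type, eta]

theorem etaI_eta (a c : Fin n ⊕ Fin 2) : ∑ b, B.etaI a b * B.eta b c = if a = c then 1 else 0 := by
  obtain ⟨i, rfl⟩ | rfl | rfl := amb_cases a <;> obtain ⟨j, rfl⟩ | rfl | rfl := amb_cases c <;>
    simp [Fintype.sum_sum_type, eta, etaI, B.sum_C_gi_g]

theorem sum_etaI_eta (T Y : Fin n ⊕ Fin 2 → A⟦X⟧) :
    ∑ a, ∑ b, B.etaI a b * ((∑ c, B.eta b c * T c) * Y a) = ∑ a, T a * Y a := by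
  refine Finset.sum_congr rfl fun a _ => ?_
  have h : ∀ b, B.etaI a b * ((∑ c, B.eta b c * T c) * Y a)
      = ∑ c, (B.etaI a b * B.eta b c) * (T c * Y a) := fun b => by
    rw [Finset.sum_mul, Finset.mul_sum]
    exact Finset.sum_congr rfl fun c _ => by ring
  simp only [h]
  rw [Finset.sum_comm]
  simp only [← Finset.sum_mul, etaI_eta]
  simp

end Expansion

namespace ERep

variable {k s : ℕ} {w w' : ℤ} {K K' : ℕ} {κ κ' κ₁ κ₂ : Type} [Fintype κ] [Fintype κ'] [Fintype κ₁]
  [Fintype κ₂]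

theorem ctr {T : EFld k (Option (Option κ))} (h : ERep k s w K T) :
    ERep k s (w + 2) K (fun σ J => ∑ a, ∑ b, σ.B.etaI a b * T σ (cons2 a b J)) := fun τ => by
  obtain ⟨S, hS, e⟩ := (h (cons2 none none τ)).on (enum_val _)
  obtain ⟨S₁, hS₁, e₁⟩ := (h (cons2 (some 0) (some 1) τ)).on
    (f := fun x : {x // τ x = none} => some (some x.1)) ⟨fun x y => by simp [Subtype.ext_iff], by
      rintro (_ | _ | x) <;> simp [cons2]⟩
  obtain ⟨S₂, hS₂, e₂⟩ := (h (cons2 (some 1) (some 0) τ)).on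
    (f := fun x : {x // τ x = none} => some (some x.1)) ⟨fun x y => by simp [Subtype.ext_iff], by
      rintro (_ | _ | x) <;> simp [cons2]⟩
  simp only [cnt_cons2] at hS hS₁ hS₂
  refine PatRep.mk _ (enum_val τ) (((hS.ctr_map _ (ctrMap_bijective τ)).cast (by simp; ring)).add
    ((hS₁.cast (by simp; ring)).add (hS₂.cast (by simp; ring)))) rfl fun σ I => ?_
  rw [σ.B.sum_etaI]
  have h0 : ∀ p q, T σ (cons2 (.inl p) (.inl q) (pat τ I)) = T σ (pat (cons2 none none τ) (cons2 p q I)) :=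
    fun p q => by rw [pat_cons2]; rfl
  have d : Fin σ.n := ⟨0, by have := σ.three_le; omega⟩
  have h1 : T σ (cons2 (.inr 0) (.inr 1) (pat τ I)) = T σ (pat (cons2 (some 0) (some 1) τ) (cons2 d d I)) := by
    rw [pat_cons2]; rfl
  have h2 : T σ (cons2 (.inr 1) (.inr 0) (pat τ I)) = T σ (pat (cons2 (some 1) (some 0) τ) (cons2 d d I)) := by
    rw [pat_cons2]; rfl
  rw [h1, h2, e₁, e₂]
  refine congrArg₂ (· + ·) (Finset.sum_congr rfl fun p _ => Finset.sum_congr rfl fun q _ => ?_) rfl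
  rw [h0, e]
  congr 2
  funext x
  obtain ⟨_ | _ | x, hx⟩ := x <;> rfl

theorem ctr_map {T : EFld k κ'} (h : ERep k s w K T) (f : κ' → Option (Option κ))
    (hf : Function.Bijective f) : ERep k s (w + 2) K
      (fun σ J => ∑ a, ∑ b, σ.B.etaI a b * T σ fun x => cons2 a b J (f x)) :=
  (h.map f hf).ctr

end ERep

end

end WeylAmbient

namespace WeylAmbient

noncomputable section

/-! ### The curvature in the ambient frame -/

open PowerSeries

namespace Expansion

variable {n : ℕ} {A : Type} [CommRing A] [Algebra ℝ A] (B : Expansion n A)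

/-- The boundary connection in the ambient frame. -/
def om0 : Fin n ⊕ Fin 2 → Fin n ⊕ Fin 2 → Fin n ⊕ Fin 2 → A⟦X⟧ :=
  Sum.elim (fun i => Sum.elim (fun j => Sum.elim (fun k => C (B.Γ k i j)) ![0, 0])
    ![fun _ => 0, Sum.elim (fun _ => 0) ![0, -2 * C (B.a 0 i)]]) ![fun _ _ => 0, fun _ _ => 0]

/-- The boundary Weyl connection in the ambient frame. -/
def aF : Fin n ⊕ Fin 2 → A⟦X⟧ := Sum.elim (fun i => C (B.a 0 i)) ![0, 0]

/-- The difference of the ambient connection and the boundary connection. -/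
def dom (a b c : Fin n ⊕ Fin 2) : A⟦X⟧ := B.rho.om a b c - B.om0 a b c

/-- The lowered form of `dom`. -/
def domL (J : Fin 3 → Fin n ⊕ Fin 2) : A⟦X⟧ := ∑ c, B.eta (J 0) c * B.dom (J 1) (J 2) c

theorem domL_eq (J : Fin 3 → Fin n ⊕ Fin 2) : B.domL J
    = Sum.elim (fun i => ∑ j, C (B.g i j) * B.dom (J 1) (J 2) (.inl j))
      ![B.dom (J 1) (J 2) (.inr 1), B.dom (J 1) (J 2) (.inr 0)] (J 0) := B.sum_eta _ _

/-- The covariant derivative with the boundary connection, along the ambient frame. -/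
def covN (w : ℤ) {κ : Type} [Fintype κ] [DecidableEq κ] (T : (κ → Fin n ⊕ Fin 2) → A⟦X⟧)
    (a : Fin n ⊕ Fin 2) (P : κ → Fin n ⊕ Fin 2) : A⟦X⟧ :=
  B.rho.e a (T P) - ∑ x, ∑ c, B.om0 a (P x) c * T (Function.update P x c) + (w : ℝ) • (B.aF a * T P)

variable {κ : Type} [Fintype κ] [DecidableEq κ]

theorem covN_p (w : ℤ) (T : (κ → Fin n ⊕ Fin 2) → A⟦X⟧) (P : κ → Fin n ⊕ Fin 2) :
    B.covN w T (.inr 0) P = -(X * dX (T P)) := by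
  rw [covN, RhoGeo.e_p]
  simp [om0, aF]
  rfl

theorem covN_m (w : ℤ) (T : (κ → Fin n ⊕ Fin 2) → A⟦X⟧) (P : κ → Fin n ⊕ Fin 2) :
    B.covN w T (.inr 1) P = dX (T P) := by
  rw [covN, RhoGeo.e_m]
  simp [om0, aF]
  rfl

theorem update_pat {α : Type} (τ : κ → Option (Fin 2)) (I : κ → α) {x : κ} (hx : τ x = none) (m : α) :
    Function.update (pat τ I) x (.inl m) = pat τ (Function.update I x m) := by
  funext y
  rcases eq_or_ne y x with rfl | h
  · simp [pat, hx]
  · simp [pat, h]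

theorem sum_om0_pat (τ : κ → Option (Fin 2)) (I : κ → Fin n) (i : Fin n)
    (T : (κ → Fin n ⊕ Fin 2) → A⟦X⟧) {T' : ({x // τ x = none} → Fin n) → A⟦X⟧}
    (e : ∀ I, T (pat τ I) = T' fun t => I t) :
    ∑ x, ∑ c, B.om0 (.inl i) (pat τ I x) c * T (Function.update (pat τ I) x c)
      = ∑ t : {x // τ x = none}, ∑ m, C (B.Γ m i (I t)) * T' (Function.update (fun t => I t) t m)
        + (cnt τ : ℝ) • ((-2 : ℝ) • (C (B.a 0 i) * T (pat τ I))) := by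
  set F : κ → A⟦X⟧ := fun x => ∑ c, B.om0 (.inl i) (pat τ I x) c * T (Function.update (pat τ I) x c)
    with hF
  set b : A⟦X⟧ := (-2 : ℝ) • (C (B.a 0 i) * T (pat τ I)) with hb
  have h1 : ∀ x, τ x ≠ none → F x = if τ x = some 1 then b else 0 := by
    intro x hx
    obtain ⟨c, hc⟩ := Option.ne_none_iff_exists'.1 hx
    have hp : pat τ I x = .inr c := by rw [pat, hc]; rfl
    have hu : Function.update (pat τ I) x (.inr c) = pat τ I := by rw [← hp, Function.update_eq_self]
    simp only [hF, hp, hc]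
    fin_cases c
    · simp [om0]
    · simp only [Fin.mk_one, Fintype.sum_sum_type, Fin.sum_univ_two] at hu ⊢
      rw [hu, hb, Algebra.smul_def]
      simp [om0, mul_assoc, map_ofNat]
  have h2 : ∀ t : {x // τ x = none}, F t
      = ∑ m, C (B.Γ m i (I t)) * T' (Function.update (fun t => I t) t m) := by
    rintro ⟨x, hx⟩
    have hp : pat τ I x = .inl (I x) := by rw [pat, hx]; rfl
    simp only [hF, hp, Fintype.sum_sum_type, om0, Sum.elim_inl, Sum.elim_inr, Fin.sum_univ_two]
    simp only [Matrix.cons_val_zero, Matrix.cons_val_one, zero_mul, add_zero]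
    refine Finset.sum_congr rfl fun m _ => ?_
    rw [update_pat τ I hx, e]
    congr 2
    funext t
    simp only [Function.update_apply, Subtype.ext_iff]
  have h3 : (cnt τ : ℝ) • b = ∑ x, if τ x = some 1 then b else 0 := by
    simp only [cnt, Int.cast_sum, Finset.sum_smul]
    exact Finset.sum_congr rfl fun x _ => by split_ifs <;> simp
  rw [h3, ← Fintype.sum_subtype_add_sum_subtype (fun x => τ x = none) F,
    ← Fintype.sum_subtype_add_sum_subtype (fun x => τ x = none) (fun x => if τ x = some 1 then b else 0)]
  have h4 : ∑ t : {x // τ x = none}, (if τ t = some 1 then b else 0) = 0 :=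
    Finset.sum_eq_zero fun t _ => by rw [t.2, if_neg (by simp)]
  rw [h4, zero_add]
  exact congrArg₂ (· + ·) (Finset.sum_congr rfl fun t _ => h2 t)
    (Finset.sum_congr rfl fun t _ => h1 t t.2)

theorem covN_h (w : ℤ) (τ : κ → Option (Fin 2)) (I : κ → Fin n) (i : Fin n)
    (T : (κ → Fin n ⊕ Fin 2) → A⟦X⟧) {T' : ({x // τ x = none} → Fin n) → A⟦X⟧}
    (e : ∀ I, T (pat τ I) = T' fun t => I t) :
    B.covN w T (.inl i) (pat τ I) = B.snab (w + 2 * cnt τ) T' i (fun t => I t)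
      + (2 : ℝ) • (X * (B.al i * dX (T' fun t => I t))) := by
  rw [covN, B.sum_om0_pat τ I i T e, RhoGeo.e_h, rho_h, Geo.snab, e]
  simp only [aF, Sum.elim_inl]
  push_cast
  rw [smul_smul, add_smul, mul_comm (cnt τ : ℝ), two_smul ℝ (X * _), ← neg_mul_eq_neg_mul, neg_smul]
  ring

end Expansion

namespace ERep

variable {k s : ℕ} {w w' : ℤ} {K : ℕ} {κ : Type} [Fintype κ] [DecidableEq κ]

theorem covN {T : EFld k κ} (h : ERep k s w (K + 1) T) :
    ERep k s w K (fun σ (J : Option κ → Fin σ.n ⊕ Fin 2) =>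
      σ.B.covN w (T σ) (J none) fun x => J (some x)) := fun τ => by
  set τ' : κ → Option (Fin 2) := fun x => τ (some x) with hτ'
  obtain ⟨S, hS, e⟩ := (h τ').on (enum_val τ')
  have hc : cnt τ = (if τ none = some 1 then 1 else 0) + cnt τ' := by
    rw [cnt, Fintype.sum_option, cnt]
  rcases hτ : τ none with _ | c
  · have hS' := hS.mono_K (Nat.le_succ K)
    refine PatRep.mk (fun t : Option {x // τ' x = none} => t.map Subtype.val) ⟨?_, ?_⟩
      (hS'.snab.add (((SRep.X_al_dX hS' (fun t => t.elim (fun _ => none) some :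
        Fin 1 ⊕ {x // τ' x = none} → Option {x // τ' x = none}) ?_).csmul 2).mono_ord
          (Nat.zero_le _))) (by rw [hc, hτ]; simp) fun σ I => ?_
    · exact Option.map_injective Subtype.val_injective
    · rintro (_ | x)
      · exact ⟨fun _ => ⟨none, rfl⟩, fun _ => hτ⟩
      · refine ⟨fun h => ⟨some ⟨x, h⟩, rfl⟩, ?_⟩
        rintro ⟨_ | ⟨y, hy⟩, h⟩
        · simp at h
        · simp only [Option.map_some, Option.some.injEq] at h
          exact h ▸ hy
    · constructor
      · rintro (i | t) (j | t') h <;> simp_all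
        exact Subsingleton.elim _ _
      · rintro (_ | t)
        exacts [⟨.inl 0, rfl⟩, ⟨.inr t, rfl⟩]
    · have h1 : pat τ I none = .inl (I none) := by rw [pat, hτ]; rfl
      have h2 := σ.B.covN_h w τ' (fun x => I (some x)) (I none) (T σ) (e σ)
      rw [h1]
      exact h2
  · have h1 : ∀ σ : Sit k, ∀ I : Option κ → Fin σ.n, pat τ I none = .inr c := fun σ I => by
      rw [pat, hτ]; rfl
    have hf : Enum τ (fun t : {x // τ' x = none} => some t.1) := ⟨fun x y h =>
      Subtype.ext (Option.some_injective _ h), by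
        rintro (_ | x)
        · simp [hτ]
        · exact ⟨fun h => ⟨⟨x, h⟩, rfl⟩, by rintro ⟨t, ht⟩; exact Option.some_injective _ ht ▸ t.2⟩⟩
    fin_cases c
    · refine PatRep.mk _ hf (hS.deriv.X_mul.neg.mono_K (Nat.le_succ K)) (by rw [hc, hτ]; simp) fun σ I => ?_
      simp only [h1]
      exact (σ.B.covN_p w (T σ) _).trans (congrArg (fun f => -(X * dX f)) (e σ fun x => I (some x)))
    · refine PatRep.mk _ hf hS.deriv (by rw [hc, hτ]; simp; ring) fun σ I => ?_
      simp only [h1]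
      exact (σ.B.covN_m w (T σ) _).trans (congrArg dX (e σ fun x => I (some x)))

/-- The map of indices for the action of the connection on the index `t`. -/
def domMap (t : κ) : Fin 3 ⊕ κ → Option (Option (Option κ))
  | .inl 0 => some none
  | .inl 1 => some (some none)
  | .inl 2 => some (some (some t))
  | .inr x => if x = t then none else some (some (some x))

theorem domMap_bijective (t : κ) : Function.Bijective (domMap t) := by
  constructor
  · rintro (i | x) (j | y) h <;> (try fin_cases i) <;> (try fin_cases j) <;> simp [domMap] at h ⊢ <;> grind
  · rintro (_ | _ | _ | x)
    · exact ⟨.inr t, if_pos rfl⟩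
    · exact ⟨.inl 0, rfl⟩
    · exact ⟨.inl 1, rfl⟩
    · by_cases hx : x = t
      · exact ⟨.inl 2, by rw [hx]; rfl⟩
      · exact ⟨.inr x, if_neg hx⟩

theorem dom_upd {T : EFld k κ} (hd : ERep k s (-2) K fun σ => σ.B.domL) (h : ERep k s w K T) (t : κ) :
    ERep k s w K (fun σ (J : Option κ → Fin σ.n ⊕ Fin 2) =>
      ∑ c, σ.B.dom (J none) (J (some t)) c * T σ (Function.update (fun x => J (some x)) t c)) := by
  refine (((hd.mul h).ctr_map _ (domMap_bijective t)).cast (by ring)).congr fun σ J => ?_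
  rw [← σ.B.sum_etaI_eta]
  refine Finset.sum_congr rfl fun a _ => Finset.sum_congr rfl fun b _ => ?_
  have e : (fun x => cons2 a b J (domMap t (.inr x))) = Function.update (fun x => J (some x)) t a := by
    funext x
    by_cases hx : x = t
    · subst hx; simp [domMap, cons2]
    · simp [domMap, cons2, hx]
  rw [e]
  rfl

theorem ψd (hk : 1 ≤ k) (hγ : SRep.HG k s (K + 1)) : SRep k s 0 0 K (fun σ (I : Fin 2 → Fin σ.n) =>
    ∑ j, C (σ.B.g (I 0) j) * σ.B.rho.ψu (I 1) j) := by
  refine ((((SRep.ictr_map (hγ.mono_K (Nat.le_succ K)) (((SRep.ψ hk hγ).mul_map SRep.metric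
    (Sum.elim ![0, 1] ![2, 3] : Fin 2 ⊕ Fin 2 → Fin 4) (by decide)).cast (w' := -2) (by ring))
    (![some (some 1), none, some (some 0), some none] : Fin 4 → Option (Option (Fin 2)))
    (by decide)).cast (by ring)).mono_ord (Nat.zero_le _))).congr fun σ I => ?_
  rw [Finset.sum_comm]
  refine Finset.sum_congr rfl fun j _ => ?_
  rw [Expansion.ψu_eq, Finset.mul_sum]
  exact Finset.sum_congr rfl fun m _ => by
    simp [cons2]
    ring

theorem aud (hγ : SRep.HG k s (K + 1)) : SRep k s 0 2 K (fun σ (I : Fin 1 → Fin σ.n) =>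
    ∑ j, C (σ.B.g (I 0) j) * σ.B.rho.au j) := by
  refine ((((SRep.ictr_map (hγ.mono_K (Nat.le_succ K)) ((SRep.metric.mul_map SRep.dX_al
    (Sum.elim ![0, 1] ![2] : Fin 2 ⊕ Fin 1 → Fin 3) (by decide)).cast (w' := 0) (by ring))
    (![some (some 0), none, some none] : Fin 3 → Option (Option (Fin 1)))
    (by decide)).cast (by ring)).mono_ord (Nat.zero_le _))).congr fun σ I => ?_
  refine Finset.sum_congr rfl fun j _ => ?_
  rw [RhoGeo.au, Finset.mul_sum]
  refine Finset.sum_congr rfl fun m _ => ?_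
  have h : σ.B.rho.dr (σ.B.rho.a m) = dX (σ.B.al m) := σ.B.dX_rho_a m
  rw [h]
  simp [cons2, Expansion.rho]
  ring

end ERep

theorem option_cases (a : Option (Fin 2)) : a = none ∨ a = some 0 ∨ a = some 1 := by
  revert a; decide

theorem ERep.domL {k s K : ℕ} (hk : 1 ≤ k) (hγ : SRep.HG k s (K + 1)) :
    ERep k s (-2) K fun σ => σ.B.domL := by
  intro τ
  obtain ⟨c, a, b, rfl⟩ : ∃ c a b, τ = ![c, a, b] :=
    ⟨τ 0, τ 1, τ 2, by funext x; fin_cases x <;> rfl⟩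
  have hψ := (SRep.ψ hk hγ).mono_ord (Nat.zero_le 1)
  have hψd := ERep.ψd hk hγ
  have hau := ERep.aud (k := k) (s := s) hγ
  have hal := (SRep.dX_al (k := k) (s := s) (K := K)).mono_ord (Nat.zero_le 2)
  have hg := SRep.metric (k := k) (s := s) (K := K)
  have hX : ∀ {w : ℤ} {κ : Type} {T : SFld k κ}, SRep k s 0 w K T →
      SRep k s 0 (w - 2) K fun σ I => X * T σ I := fun h => h.X_mul.mono_K (Nat.le_succ K)
  have h1 : SRep k s 0 0 K fun σ (_ : Fin 0 → Fin σ.n) => (1 : PowerSeries σ.A) :=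
    (SRep.const Rep.one).congr fun σ I => (map_one C).symm
  obtain rfl | rfl | rfl := option_cases c <;> obtain rfl | rfl | rfl := option_cases a <;>
    obtain rfl | rfl | rfl := option_cases b
  all_goals try (refine PatRep.zero fun σ I => ?_); simp [Expansion.domL_eq, pat, Expansion.dom, Expansion.om0]; done
  refine PatRep.mk ![0, 1, 2] (by decide) ((SRep.Cd (hγ.mono_K (Nat.le_succ K))).mono_ord (Nat.zero_le 1)) (by decide) ?_; rotate_left
  refine PatRep.mk ![0, 1] (by decide) (hg.sub (hX hψd)) (by decide) ?_; rotate_left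
  refine PatRep.mk ![0, 1] (by decide) hψd (by decide) ?_; rotate_left
  refine PatRep.mk ![0, 2] (by decide) (hg.sub (hX hψd)) (by decide) ?_; rotate_left
  refine PatRep.mk ![0] (by decide) (hX (hX hau)) (by decide) ?_; rotate_left
  refine PatRep.mk ![0] (by decide) (hX hau).neg (by decide) ?_; rotate_left
  refine PatRep.mk ![0, 2] (by decide) hψd (by decide) ?_; rotate_left
  refine PatRep.mk ![0] (by decide) (hX hau).neg (by decide) ?_; rotate_left
  refine PatRep.mk ![0] (by decide) hau (by decide) ?_; rotate_left
  refine PatRep.mk ![1, 2] (by decide) ((hγ.mono_K (Nat.le_succ K)).neg.add (hX hψ)) (by decide) ?_; rotate_left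
  refine PatRep.mk ![1] (by decide) (SRep.al.mono_ord (Nat.zero_le 2) |>.csmul (-2)) (by decide) ?_; rotate_left
  refine PatRep.mk ![2] (by decide) (hX (hX hal)).neg (by decide) ?_; rotate_left
  refine PatRep.mk ![] (by decide) h1 (by decide) ?_; rotate_left
  refine PatRep.mk ![2] (by decide) (hX hal) (by decide) ?_; rotate_left
  refine PatRep.mk ![1, 2] (by decide) hψ.neg (by decide) ?_; rotate_left
  refine PatRep.mk ![2] (by decide) (hX hal) (by decide) ?_; rotate_left
  refine PatRep.mk ![] (by decide) h1 (by decide) ?_; rotate_left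
  refine PatRep.mk ![2] (by decide) hal.neg (by decide) ?_; rotate_left
  all_goals
    intro σ I
    have e : ∀ f, σ.B.rho.dr f = dX f := fun _ => rfl
    have e' : σ.B.rho.ρ = X := rfl
    have e'' : σ.B.rho.g = σ.B.γ := rfl
    simp [Expansion.domL_eq, pat, Expansion.dom, Expansion.om0, Expansion.Cd, Expansion.Cu, mul_sub,
      Finset.mul_sum, e, e', e'', mul_left_comm, pow_two, mul_assoc, Expansion.rho_a, mul_add,
      two_smul, two_mul, dX_C]

end

end WeylAmbient

namespace WeylAmbient

noncomputable section

/-! ### Covariant derivatives of the curvature in the ambient frame -/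

open PowerSeries

namespace Expansion

variable {n : ℕ} {A : Type} [CommRing A] [Algebra ℝ A] (B : Expansion n A)

/-- The curvature of the boundary connection in the ambient frame. -/
def Z (a b c d : Fin n ⊕ Fin 2) : A⟦X⟧ := frameCurv (fun a => B.rho.e a) B.om0 a b c d

/-- The derivative of `dom` with the boundary connection. -/
def Ndom (e a b c : Fin n ⊕ Fin 2) : A⟦X⟧ := B.rho.e e (B.dom a b c) - ∑ f, B.om0 e a f * B.dom f b c
  - ∑ f, B.om0 e b f * B.dom a f c + ∑ f, B.om0 e f c * B.dom a b f

theorem dom_symm (c d : Fin n ⊕ Fin 2) (k : Fin n) : B.dom c d (.inl k) = B.dom d c (.inl k) := by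
  obtain ⟨i, rfl⟩ | rfl | rfl := amb_cases c <;> obtain ⟨j, rfl⟩ | rfl | rfl := amb_cases d <;>
    simp [dom, om0, B.rho.Γh_symm, B.toGeo.Γ_symm k, eq_comm]

theorem fc_eq (a b c d : Fin n ⊕ Fin 2) : B.rho.fc a b c d = B.Z a b c d
    + (B.Ndom c d b a - B.Ndom d c b a)
    + (∑ f, B.dom d b f * B.dom c f a - ∑ f, B.dom c b f * B.dom d f a)
    - (∑ f, B.dom c d f * B.dom f b a - ∑ f, B.dom d c f * B.dom f b a) := by
  have h0 : ∑ f, (B.dom c d f - B.dom d c f) * B.om0 f b a = 0 := by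
    rw [Fintype.sum_sum_type, Fin.sum_univ_two]
    simp [B.dom_symm c d, om0]
  have h : ∀ a b c, B.rho.om a b c = B.om0 a b c + B.dom a b c := fun a b c => by rw [dom]; ring
  simp only [sub_mul, Finset.sum_sub_distrib] at h0
  simp only [RhoGeo.fc, Z, frameCurv, h, Ndom, map_add, add_mul, mul_add, sub_mul,
    Finset.sum_add_distrib, Finset.sum_sub_distrib, mul_comm (B.dom _ _ _) (B.om0 _ _ _),
    mul_comm (B.dom d b _) (B.dom c _ _), mul_comm (B.dom c b _) (B.dom d _ _)] at h0 ⊢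
  linear_combination -h0

theorem e_eta (c a b : Fin n ⊕ Fin 2) : B.rho.e c (B.eta a b) = ∑ f, B.om0 c a f * B.eta f b
    + ∑ f, B.om0 c b f * B.eta a f + 2 * B.aF c * B.eta a b := by
  have h : ∀ f : A⟦X⟧, B.rho.dr f = dX f := fun _ => rfl
  have h2 : ∀ (i : Fin n) (f : A⟦X⟧), B.rho.d i f = liftD (B.d i) f := fun _ _ => rfl
  obtain ⟨i, rfl⟩ | rfl | rfl := amb_cases c <;> obtain ⟨j, rfl⟩ | rfl | rfl := amb_cases a <;>
  obtain ⟨l, rfl⟩ | rfl | rfl := amb_cases b <;>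
  simp [eta, om0, aF, RhoGeo.h_apply, h, h2, liftD_C, dX_C, B.toGeo.d_g, map_ofNat]

theorem sum_eta_Ndom (a c d b : Fin n ⊕ Fin 2) : ∑ f, B.eta a f * B.Ndom c d b f
    = B.covN (-2) B.domL c ![a, d, b] := by
  have h0 : ∀ f, Function.update ![a, d, b] 0 f = ![f, d, b] := fun f => by
    ext t; fin_cases t <;> rfl
  have h1 : ∀ f, Function.update ![a, d, b] 1 f = ![a, f, b] := fun f => by
    ext t; fin_cases t <;> rfl
  have h2 : ∀ f, Function.update ![a, d, b] 2 f = ![a, d, f] := fun f => by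
    ext t; fin_cases t <;> rfl
  have e1 : ∑ x, B.eta a x * ∑ f, B.om0 c f x * B.dom d b f
      = ∑ x, (∑ f, B.om0 c x f * B.eta a f) * B.dom d b x := by
    simp only [Finset.mul_sum, Finset.sum_mul]
    rw [Finset.sum_comm]
    exact Finset.sum_congr rfl fun x _ => Finset.sum_congr rfl fun y _ => by ring
  have e2 : ∀ u : Fin n ⊕ Fin 2 → A⟦X⟧, ∀ v : Fin n ⊕ Fin 2 → Fin n ⊕ Fin 2 → A⟦X⟧,
      ∑ x, B.eta a x * ∑ f, u f * v f x = ∑ f, u f * ∑ x, B.eta a x * v f x := by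
    intro u v
    simp only [Finset.mul_sum]
    rw [Finset.sum_comm]
    exact Finset.sum_congr rfl fun x _ => Finset.sum_congr rfl fun y _ => by ring
  have e3 : ∑ f, B.om0 c a f * ∑ x, B.eta f x * B.dom d b x
      = ∑ x, (∑ f, B.om0 c a f * B.eta f x) * B.dom d b x := by
    simp only [Finset.mul_sum, Finset.sum_mul]
    rw [Finset.sum_comm]
    exact Finset.sum_congr rfl fun x _ => Finset.sum_congr rfl fun y _ => by ring
  simp only [covN, Fin.sum_univ_three, Matrix.cons_val_zero, Matrix.cons_val_one, Matrix.cons_val, h0, h1,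
    h2, domL, Ndom, mul_sub, mul_add, Finset.sum_sub_distrib, Finset.sum_add_distrib, map_sum,
    Derivation.leibniz, smul_eq_mul, e_eta, e1, e2, e3, add_mul]
  have e4 : ∑ x, B.dom d b x * (2 * B.aF c * B.eta a x) = (2 : ℝ) • (B.aF c * ∑ x, B.eta a x * B.dom d b x) := by
    rw [two_smul, ← two_mul, Finset.mul_sum, Finset.mul_sum]
    exact Finset.sum_congr rfl fun x _ => by ring
  rw [e4]
  simp only [mul_comm (B.dom d b _)]
  push_cast
  rw [neg_smul]
  ring

theorem Z_vert {c d : Fin n ⊕ Fin 2} (h : (∃ x, c = .inr x) ∨ ∃ x, d = .inr x) (a b : Fin n ⊕ Fin 2) :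
    B.Z a b c d = 0 := by
  have h3 : dX (2 : A⟦X⟧) = 0 := by rw [show (2 : A⟦X⟧) = C 2 from (map_ofNat C 2).symm, dX_C]
  have h4 : ∀ x a b c, B.rho.e (.inr x) (B.om0 a b c) = 0 := by
    intro x a b c
    have h5 : B.rho.dr (B.om0 a b c) = 0 := by
      change dX (B.om0 a b c) = 0
      obtain ⟨i, rfl⟩ | rfl | rfl := amb_cases a <;> obtain ⟨j, rfl⟩ | rfl | rfl := amb_cases b <;>
      obtain ⟨l, rfl⟩ | rfl | rfl := amb_cases c <;> simp [om0, dX_C, Derivation.leibniz, h3]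
    fin_cases x
    · exact (B.rho.e_p _).trans (by rw [h5, mul_zero, neg_zero])
    · exact h5
  have h6 : ∀ x a b, B.om0 (.inr x) a b = 0 := fun x a b => by fin_cases x <;> rfl
  have h7 : ∀ x a c, B.om0 a (.inr x) (.inl c) = 0 := fun x a c => by
    obtain ⟨i, rfl⟩ | rfl | rfl := amb_cases a <;> fin_cases x <;> rfl
  rcases h with ⟨x, rfl⟩ | ⟨x, rfl⟩ <;>
  simp [Z, frameCurv, h4, h6, h7, Fintype.sum_sum_type]

theorem Z_hhhh (a b c d : Fin n) :
    B.Z (.inl a) (.inl b) (.inl c) (.inl d) = C (curv B.d B.Γ a b c d) := by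
  simp [Z, frameCurv, om0, curv, rho_h, liftD_C, dX_C, B.toGeo.Γ_symm _ c d]

theorem Z_mmhh (c d : Fin n) : B.Z (.inr 1) (.inr 1) (.inl c) (.inl d) = -2 * C (B.F c d) := by
  have h2 : ∀ i : Fin n, liftD (B.d i) (2 : A⟦X⟧) = 0 := fun i => by
    simpa using (liftD (B.d i)).map_natCast 2
  have h3 : dX (2 : A⟦X⟧) = 0 := by rw [show (2 : A⟦X⟧) = C 2 from (map_ofNat C 2).symm, dX_C]
  simp [Z, frameCurv, om0, rho_h, liftD_C, dX_C, B.toGeo.Γ_symm _ c d, Geo.F, Derivation.leibniz, h2, h3]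
  ring

end Expansion

namespace ERep

variable {k s K : ℕ}

theorem Z (hk : 1 ≤ k) : ERep k s (-2) K fun σ (J : Fin 4 → Fin σ.n ⊕ Fin 2) =>
    ∑ f, σ.B.eta (J 0) f * σ.B.Z f (J 1) (J 2) (J 3) := by
  intro τ
  obtain ⟨a, b, c, d, rfl⟩ : ∃ a b c d, τ = ![a, b, c, d] :=
    ⟨τ 0, τ 1, τ 2, τ 3, by funext x; fin_cases x <;> rfl⟩
  by_cases hv : (∃ x, c = some x) ∨ ∃ x, d = some x
  · refine PatRep.zero fun σ I => Finset.sum_eq_zero fun f _ => ?_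
    rw [σ.B.Z_vert, mul_zero]
    rcases hv with ⟨x, rfl⟩ | ⟨x, rfl⟩
    exacts [.inl ⟨x, rfl⟩, .inr ⟨x, rfl⟩]
  · obtain rfl : c = none := by by_contra h; exact hv (.inl (Option.ne_none_iff_exists'.1 h))
    obtain rfl : d = none := by by_contra h; exact hv (.inr (Option.ne_none_iff_exists'.1 h))
    obtain rfl | rfl | rfl := option_cases a <;> obtain rfl | rfl | rfl := option_cases b
    · refine PatRep.mk ![0, 1, 2, 3] (by decide) (SRep.const ((Rep.curvature hk).mono_ord (Nat.zero_le 1)))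
        (by decide) fun σ I => ?_
      simp [σ.B.sum_eta, pat, σ.B.Z_hhhh, Geo.R4]
    all_goals try (refine PatRep.zero fun σ I => ?_); simp [σ.B.sum_eta, pat, Expansion.Z, frameCurv, Expansion.om0]; done
    refine PatRep.mk ![2, 3] (by decide) (SRep.const (((Rep.fieldStrength hk).csmul (-2)).mono_ord
      (Nat.zero_le 1))) (by decide) fun σ I => ?_
    simp [σ.B.sum_eta, pat, σ.B.Z_mmhh, two_smul, two_mul]
    try ring

/-- The curvature, with the first index lowered by the boundary metric. -/
theorem fc (hk : 1 ≤ k) (hγ : SRep.HG k s (K + 2)) :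
    ERep k s (-2) K fun σ (J : Fin 4 → Fin σ.n ⊕ Fin 2) =>
      ∑ f, σ.B.eta (J 0) f * σ.B.rho.fc f (J 1) (J 2) (J 3) := by
  have hd := ERep.domL hk hγ
  have hd' := hd.mono_K (Nat.le_succ K)
  have hN := hd.covN
  have hN1 := hN.map (fun t => t.elim 2 ![0, 3, 1] : Option (Fin 3) → Fin 4) (by decide)
  have hN2 := hN.map (fun t => t.elim 3 ![0, 2, 1] : Option (Fin 3) → Fin 4) (by decide)
  have q2 := dom_upd hd' hd' 2
  have q1 := dom_upd hd' hd' 1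
  have hQ1 := q2.map (fun t => t.elim 3 ![0, 2, 1] : Option (Fin 3) → Fin 4) (by decide)
  have hQ2 := q2.map (fun t => t.elim 2 ![0, 3, 1] : Option (Fin 3) → Fin 4) (by decide)
  have hT1 := q1.map (fun t => t.elim 2 ![0, 3, 1] : Option (Fin 3) → Fin 4) (by decide)
  have hT2 := q1.map (fun t => t.elim 3 ![0, 2, 1] : Option (Fin 3) → Fin 4) (by decide)
  refine ((((Z hk).add (hN1.sub hN2)).add (hQ1.sub hQ2)).sub (hT1.sub hT2)).congr fun σ J => ?_
  have e2 : ∀ u : Fin σ.n ⊕ Fin 2 → PowerSeries σ.A, ∀ v : Fin σ.n ⊕ Fin 2 → Fin σ.n ⊕ Fin 2 → PowerSeries σ.A,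
      ∑ x, σ.B.eta (J 0) x * ∑ f, u f * v f x = ∑ f, u f * ∑ x, σ.B.eta (J 0) x * v f x := by
    intro u v
    simp only [Finset.mul_sum]
    rw [Finset.sum_comm]
    exact Finset.sum_congr rfl fun x _ => Finset.sum_congr rfl fun y _ => by ring
  simp only [Expansion.fc_eq, mul_add, mul_sub, Finset.sum_add_distrib, Finset.sum_sub_distrib,
    Expansion.sum_eta_Ndom, e2]
  have c3 : ∀ a b c : Fin 4, (fun x : Fin 3 => J ((fun t => t.elim 0 ![a, b, c] : Option (Fin 3) → Fin 4) (some x)))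
      = ![J a, J b, J c] := fun a b c => by ext t; fin_cases t <;> rfl
  have c2 : ∀ a b c d : Fin σ.n ⊕ Fin 2, Function.update ![a, b, c] 2 d = ![a, b, d] :=
    fun a b c d => by ext t; fin_cases t <;> rfl
  have c1 : ∀ a b c d : Fin σ.n ⊕ Fin 2, Function.update ![a, b, c] 1 d = ![a, d, c] :=
    fun a b c d => by ext t; fin_cases t <;> rfl
  simp only [Option.elim] at c3 ⊢
  simp only [c3, c2, c1]
  rfl

theorem gF (hγ : SRep.HG k s K) : ERep k s (-2) K fun σ (J : Fin 2 → Fin σ.n ⊕ Fin 2) =>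
    σ.B.rho.gF (J 0) (J 1) := by
  intro τ
  obtain ⟨a, b, rfl⟩ : ∃ a b, τ = ![a, b] := ⟨τ 0, τ 1, by funext x; fin_cases x <;> rfl⟩
  have h1 : SRep k s 0 0 K fun σ (_ : Fin 0 → Fin σ.n) => (1 : PowerSeries σ.A) :=
    (SRep.const Rep.one).congr fun σ I => (map_one C).symm
  obtain rfl | rfl | rfl := option_cases a <;> obtain rfl | rfl | rfl := option_cases b
  all_goals try (refine PatRep.zero fun σ I => ?_); simp [pat, RhoGeo.gF]; done
  · exact PatRep.mk ![0, 1] (by decide) hγ (by decide) fun σ I => by simp [pat, RhoGeo.gF]; rfl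
  · exact PatRep.mk ![] (by decide) h1 (by decide) fun σ I => by simp [pat, RhoGeo.gF]
  · exact PatRep.mk ![] (by decide) h1 (by decide) fun σ I => by simp [pat, RhoGeo.gF]

/-- The weight that is not accounted for by the boundary connection. -/
theorem wt : ERep k s 0 K fun σ (J : Fin 1 → Fin σ.n ⊕ Fin 2) =>
    σ.B.rho.wt (J 0) + σ.B.aF (J 0) := by
  intro τ
  obtain ⟨a, rfl⟩ : ∃ a, τ = ![a] := ⟨τ 0, by funext x; fin_cases x; rfl⟩
  obtain rfl | rfl | rfl := option_cases a
  · exact PatRep.mk ![0] (by decide) (SRep.al.mono_ord (Nat.zero_le 2)).neg (by decide) fun σ I => by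
      simp [pat, RhoGeo.wt, Expansion.aF, Expansion.rho_a]
  · exact PatRep.mk ![] (by decide) ((SRep.const Rep.one).congr fun σ I => (map_one C).symm)
      (by decide) fun σ I => by simp [pat, RhoGeo.wt, Expansion.aF]
  · exact PatRep.zero fun σ I => by simp [pat, RhoGeo.wt, Expansion.aF]

theorem covF {r : ℕ} (hk : 1 ≤ k) (hγ : SRep.HG k s (K + 1)) {T : EFld k (Fin r)}
    (h : ERep k s (-2) (K + 1) T) : ERep k s (-2) K fun σ (J : Option (Fin r) → Fin σ.n ⊕ Fin 2) =>
      σ.B.rho.covF (T σ) (J none) fun x => J (some x) := by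
  have h' := h.mono_K (Nat.le_succ K)
  have h2 := ((wt.mul h').map (fun t => t.elim (fun _ => none) some : Fin 1 ⊕ Fin r → Option (Fin r)) (by
    constructor
    · rintro (i | t) (j | t') h <;> simp_all
      exact Subsingleton.elim _ _
    · rintro (_ | t)
      exacts [⟨.inl 0, rfl⟩, ⟨.inr t, rfl⟩])).csmul 2
  have h3 := ERep.sum Finset.univ fun t _ => dom_upd (ERep.domL hk hγ) h' t
  refine ((h.covN.add (h2.cast (by ring))).sub h3).congr fun σ J => ?_
  have e : ∀ a b c, σ.B.rho.om a b c = σ.B.om0 a b c + σ.B.dom a b c := fun a b c => by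
    rw [Expansion.dom]; ring
  rw [RhoGeo.covF, Expansion.covN]
  simp only [e, add_mul, Finset.sum_add_distrib, Sum.elim_inl, Sum.elim_inr]
  push_cast
  rw [neg_smul, two_smul, two_smul]
  ring

theorem Y (hk : 1 ≤ k) (m : ℕ) : ∀ {K}, SRep.HG k s (K + m + 2) →
    ERep k s (-2) K fun σ => σ.B.rho.Y m := by
  induction m with
  | zero =>
    intro K hγ
    have h := ((gF (hγ.mono_K (by omega : K ≤ K + 0 + 2))).mul (fc hk hγ)).ctr_map
      (Sum.elim ![some (some 0), none] ![some none, some (some 1), some (some 2), some (some 3)] :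
        Fin 2 ⊕ Fin 4 → Option (Option (Fin 4))) (by decide)
    refine (h.cast (by ring)).congr fun σ J => ?_
    change ∑ b, σ.B.rho.gF (J 0) b * σ.B.rho.fc b (J 1) (J 2) (J 3) = _
    simp only [mul_comm (σ.B.rho.gF (J 0) _)]
    rw [← σ.B.sum_etaI_eta]
    exact Finset.sum_congr rfl fun a _ => Finset.sum_congr rfl fun b _ => by rw [mul_comm (Finset.sum _ _)]; rfl
  | succ m ih =>
    intro K hγ
    refine ((covF hk (hγ.mono_K (by omega)) (ih (K := K + 1) (by
      rwa [show K + 1 + m + 2 = K + (m + 1) + 2 by ring]))).map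
        (finSuccEquiv (4 + m)).symm (Equiv.bijective _)).congr fun σ J => rfl

end ERep

end

end WeylAmbient

namespace WeylAmbient

noncomputable section

/-! ### The extended obstruction tensors -/

open PowerSeries

namespace ERep

variable {k s : ℕ} {w : ℤ} {K : ℕ} {κ : Type} [Fintype κ] [DecidableEq κ]

theorem cnt_update (τ : κ → Option (Fin 2)) (x : κ) (c : Option (Fin 2)) :
    cnt (Function.update τ x c) = cnt τ - (if τ x = some 1 then 1 else 0) + if c = some 1 then 1 else 0 := by
  simp only [cnt, ← Finset.add_sum_erase _ _ (Finset.mem_univ x), Function.update_self]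
  have : ∑ y ∈ Finset.univ.erase x, (if Function.update τ x c y = some 1 then (1 : ℤ) else 0)
      = ∑ y ∈ Finset.univ.erase x, if τ y = some 1 then 1 else 0 :=
    Finset.sum_congr rfl fun y hy => by rw [Function.update_of_ne (Finset.ne_of_mem_erase hy)]
  rw [this]; ring

theorem update_pat_some {α : Type} (τ : κ → Option (Fin 2)) (I : κ → α) (x : κ) (c : Fin 2) :
    Function.update (pat τ I) x (.inr c) = pat (Function.update τ x (some c)) I := by
  funext y
  rcases eq_or_ne y x with rfl | h
  · simp [pat]
  · simp [pat, h]

theorem update_pat_none {α : Type} (τ : κ → Option (Fin 2)) (I : κ → α) (x : κ) (m : α) :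
    Function.update (pat τ I) x (.inl m) = pat (Function.update τ x none) (Function.update I x m) := by
  funext y
  rcases eq_or_ne y x with rfl | h
  · simp [pat]
  · simp [pat, h]

theorem om_m_minus {T : EFld k κ} (hγ : SRep.HG k s (K + 1)) (h : ERep k s w K T)
    {τ : κ → Option (Fin 2)} {f : Fin 2 → κ} (hf : Enum τ f) {x : κ} (hx : τ x = some 1) :
    ∃ S : SFld k (Fin 2), SRep k s 2 (w + 2 * cnt τ + 2) K S ∧ ∀ σ I,
      ∑ c, σ.B.rho.om (.inr 1) (pat τ I x) c * T σ (Function.update (pat τ I) x c)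
        = S σ fun t => I (f t) := by
  have hfx : ∀ t, f t ≠ x := fun t ht => by
    have := (hf.2 x).2 ⟨t, ht⟩
    rw [hx] at this; cases this
  have hf' : Enum (Function.update τ x none) ![x, f 0, f 1] := by
    refine ⟨?_, fun y => ?_⟩
    · intro a b hab
      have h01 : f 0 ≠ f 1 := fun h => absurd (hf.1 h) (by decide)
      fin_cases a <;> fin_cases b <;> simp_all [eq_comm]
    · simp only [Fin.exists_fin_succ, Function.update_apply]
      rcases eq_or_ne y x with rfl | hy
      · simp
      · rw [if_neg hy, hf.2 y]; simp [Fin.exists_fin_succ, hy.symm]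
  obtain ⟨T', hT', e⟩ := (h (Function.update τ x none)).on hf'
  refine ⟨_, (SRep.ictr_map (hγ.mono_K (Nat.le_succ K)) ((hT'.mul_map SRep.dX_al
    (Sum.elim ![0, 1, 2] ![3] : Fin 3 ⊕ Fin 1 → Fin 4) (by decide)))
    (![none, some (some 0), some (some 1), some none] : Fin 4 → Option (Option (Fin 2)))
    (by decide)).cast ?_, fun σ I => ?_⟩
  · rw [cnt_update, hx]; simp; ring
  · have h1 : pat τ I x = .inr 1 := by rw [pat, hx]; rfl
    rw [h1, Fintype.sum_sum_type]
    simp only [RhoGeo.om_mmh, Fin.sum_univ_two, RhoGeo.om_mmp, RhoGeo.om_mmm, zero_mul, add_zero]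
    refine Finset.sum_congr rfl fun p _ => ?_
    rw [RhoGeo.au, Finset.sum_mul]
    refine Finset.sum_congr rfl fun q _ => ?_
    have h2 : σ.B.rho.dr (σ.B.rho.a q) = dX (σ.B.al q) := σ.B.dX_rho_a q
    rw [h2, update_pat_none, e, mul_assoc, mul_comm (dX _)]
    have e1 : (fun t => Function.update I x p (![x, f 0, f 1] t)) = ![p, I (f 0), I (f 1)] := by
      ext t; fin_cases t <;> simp [hfx]
    rw [e1]
    have e2 : (fun p_1 : Fin 3 => (cons2 p q (fun t => I (f t)) ((![none, some (some 0), some (some 1), some none] : Fin 4 → Option (Option (Fin 2)))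
      ((Sum.elim ![0, 1, 2] ![3] : Fin 3 ⊕ Fin 1 → Fin 4) (.inl p_1))))) = ![p, I (f 0), I (f 1)] := by
      ext t; fin_cases t <;> rfl
    rw [e2]
    rfl

theorem om_m_horizontal {T : EFld k κ} (hk : 1 ≤ k) (hγ : SRep.HG k s (K + 1)) (h : ERep k s w K T)
    {τ : κ → Option (Fin 2)} {f : Fin 2 → κ} (hf : Enum τ f) (hw : 0 < w + 2 * cnt τ) :
    ∃ S : SFld k (Fin 2), SRep k s 2 (w + 2 * cnt τ + 2) K S ∧ ∀ σ I,
      ∑ c, σ.B.rho.om (.inr 1) (pat τ I (f 0)) c * T σ (Function.update (pat τ I) (f 0) c)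
        = S σ fun t => I (f t) := by
  have hx : τ (f 0) = none := (hf.2 _).2 ⟨0, rfl⟩
  have h01 : f 0 ≠ f 1 := fun h => absurd (hf.1 h) (by decide)
  have hf' : ∀ c : Fin 2, Enum (Function.update τ (f 0) (some c)) ![f 1] := by
    refine fun c => ⟨Function.injective_of_subsingleton _, fun y => ?_⟩
    simp only [Fin.exists_fin_succ, Function.update_apply]
    by_cases hy : y = f 0
    · subst hy
      simp [h01.symm]
    · rw [if_neg hy, hf.2 y]
      simp [Fin.exists_fin_succ, Ne.symm hy]
  obtain ⟨T', hT', e⟩ := (h τ).on hf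
  have hT1 := hT'.ord_one fun l _ => .inl (by simp only [Fintype.card_fin]; push_cast; omega)
  obtain ⟨T0, hT0, e0⟩ := (h _).on (hf' 0)
  obtain ⟨T1, hT1', e1⟩ := (h _).on (hf' 1)
  have s1 := (SRep.ictr_map (hγ.mono_K (Nat.le_succ K)) (((SRep.ψ hk hγ).mul_map hT1
    (Sum.elim ![0, 1] ![2, 3] : Fin 2 ⊕ Fin 2 → Fin 4) (by decide)))
    (![some (some 0), none, some none, some (some 1)] : Fin 4 → Option (Option (Fin 2)))
    (by decide)).cast (w' := w + 2 * cnt τ + 2) (by ring)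
  have s2 := (((SRep.dX_al (k := k) (s := s) (K := K)).mul_map hT0
    (Sum.elim ![0] ![1] : Fin 1 ⊕ Fin 1 → Fin 2) (by decide))).cast
      (w' := w + 2 * cnt τ + 2) (by rw [cnt_update, hx]; simp; ring)
  have s3 := ((((SRep.dX_al (k := k) (s := s) (K := K)).mul_map hT1'
    (Sum.elim ![0] ![1] : Fin 1 ⊕ Fin 1 → Fin 2) (by decide))).X_mul.cast
      (w' := w + 2 * cnt τ + 2) (by rw [cnt_update, hx]; simp; ring)).mono_K (Nat.le_succ K)
  refine ⟨_, (s1.sub s2).add s3, fun σ I => ?_⟩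
  have h1 : pat τ I (f 0) = .inl (I (f 0)) := by rw [pat, hx]; rfl
  have h2 : ∀ q, σ.B.rho.dr (σ.B.rho.a q) = dX (σ.B.al q) := σ.B.dX_rho_a
  have h3 : ∀ q, (fun t => Function.update I (f 0) q (f t)) = ![q, I (f 1)] := fun q => by
    ext t; fin_cases t <;> simp [h01.symm]
  have h4 : (fun t => I (![f 1] t)) = ![I (f 1)] := by ext t; fin_cases t; rfl
  rw [h1, Fintype.sum_sum_type]
  simp only [RhoGeo.om_mhh, Fin.sum_univ_two, RhoGeo.om_mhp, RhoGeo.om_mhm, h2, update_pat_some, e0, e1,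
    Expansion.update_pat τ I hx, e, h3, h4]
  have h5 : ∀ p q, (fun q_1 : Fin 2 => cons2 p q (fun t => I (f t))
      ((![some (some 0), none, some none, some (some 1)] : Fin 4 → Option (Option (Fin 2)))
        ((Sum.elim ![0, 1] ![2, 3] : Fin 2 ⊕ Fin 2 → Fin 4) (.inr q_1)))) = ![q, I (f 1)] := by
    intro p q; ext t; fin_cases t <;> rfl
  have h6 : (fun q : Fin 1 => I (f ((Sum.elim ![0] ![1] : Fin 1 ⊕ Fin 1 → Fin 2) (.inr q)))) = ![I (f 1)] := by
    ext t; fin_cases t; rfl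
  simp only [h5, h6]
  rw [Finset.sum_comm, neg_mul, ← add_assoc, ← sub_eq_add_neg, mul_assoc]
  refine congrArg (· - _ + _) (Finset.sum_congr rfl fun q _ => ?_)
  rw [Expansion.ψu_eq, Finset.sum_mul]
  refine Finset.sum_congr rfl fun p _ => ?_
  simp [cons2]
  ring

theorem sum_om_m {T : EFld k κ} (hk : 1 ≤ k) (hγ : SRep.HG k s (K + 1)) (h : ERep k s w K T)
    {τ : κ → Option (Fin 2)} {f : Fin 2 → κ} (hf : Enum τ f) (hτ : ∀ x, τ x ≠ some 0)
    (hw : 0 < w + 2 * cnt τ) :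
    ∃ S : SFld k (Fin 2), SRep k s 2 (w + 2 * cnt τ + 2) K S ∧ ∀ σ I,
      ∑ x, ∑ c, σ.B.rho.om (.inr 1) (pat τ I x) c * T σ (Function.update (pat τ I) x c)
        = S σ fun t => I (f t) := by
  have h1 : ∀ x, ∃ S : SFld k (Fin 2), SRep k s 2 (w + 2 * cnt τ + 2) K S ∧ ∀ σ I,
      ∑ c, σ.B.rho.om (.inr 1) (pat τ I x) c * T σ (Function.update (pat τ I) x c)
        = S σ fun t => I (f t) := by
    intro x
    obtain hx | hx | hx := option_cases (τ x)
    · obtain ⟨t, rfl⟩ := (hf.2 x).1 hx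
      fin_cases t
      · exact om_m_horizontal hk hγ h hf hw
      · obtain ⟨S, hS, e⟩ := om_m_horizontal hk hγ h (f := f ∘ ![1, 0]) ⟨hf.1.comp (by decide), fun y =>
          (hf.2 y).trans (by simp [Fin.exists_fin_succ, or_comm])⟩ hw
        refine ⟨_, hS.map ![1, 0] (by decide), fun σ I => (e σ I).trans ?_⟩
        rfl
    · exact absurd hx (hτ x)
    · exact om_m_minus hγ h hf hx
  choose S hS e using h1
  refine ⟨fun σ I => ∑ x, S x σ I, ?_, fun σ I => Finset.sum_congr rfl fun x _ => e x σ I⟩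
  have h2 : ∀ l < K, Rep k s 2 (w + 2 * cnt τ + 2 + 2 * l) (fun σ I => ∑ x, coeff l (S x σ I)) :=
    fun l hl => Rep.sum _ fun x _ => hS x l hl
  exact fun l hl => (h2 l hl).congr fun σ I => by rw [map_sum]

end ERep

/-- The pattern of indices of the extended obstruction tensors. -/
def obsPat (m : ℕ) (t : Fin (4 + m)) : Option (Fin 2) :=
  if (t : ℕ) = m + 1 ∨ (t : ℕ) = m + 2 then none else some 1

/-- The positions of the horizontal indices of the extended obstruction tensors. -/
def obsPos (m : ℕ) : Fin 2 → Fin (4 + m) := ![⟨m + 1, by omega⟩, ⟨m + 2, by omega⟩]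

theorem enum_obsPos (m : ℕ) : Enum (obsPat m) (obsPos m) := by
  refine ⟨fun a b h => ?_, fun x => ?_⟩
  · fin_cases a <;> fin_cases b <;> simp_all [obsPos]
  · simp [obsPat, obsPos, Fin.exists_fin_succ, Fin.ext_iff, eq_comm]
    tauto

theorem obsPat_succ (m : ℕ) (t : Fin (4 + m)) : obsPat (m + 1) t.succ = obsPat m t := by
  simp [obsPat]

theorem cnt_obsPat (m : ℕ) : cnt (obsPat m) = m + 2 := by
  induction m with
  | zero => decide
  | succ m ih =>
    have h := Fin.sum_univ_succ fun t : Fin (4 + m + 1) => if obsPat (m + 1) t = some 1 then (1 : ℤ) else 0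
    simp only [obsPat_succ] at h
    rw [cnt] at ih
    rw [ih] at h
    refine h.trans ?_
    simp [obsPat]
    ring

theorem coeff_zero_iterate_dX {A : Type} [CommRing A] [Algebra ℝ A] (m : ℕ) (f : A⟦X⟧) :
    coeff 0 (dX^[m] f) = (m.factorial : ℝ) • coeff m f := by
  induction m generalizing f with
  | zero => simp
  | succ m ih =>
    rw [Function.iterate_succ_apply, ih, coeff_dX, smul_smul, Nat.factorial_succ]
    push_cast
    rw [mul_comm]

namespace Rep

variable {k s : ℕ}

theorem Y_obsPat (hk : 1 ≤ k) (m : ℕ) : ∀ {K}, SRep.HG k s (K + m + 1) →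
    ∃ S : SFld k (Fin 2), SRep k s 2 (2 * m + 2) K S ∧ ∀ σ I, σ.B.rho.Y m (pat (obsPat m) I)
      = dX^[m + 1] (σ.B.rho.ψ (I (obsPos m 1)) (I (obsPos m 0))) + S σ fun t => I (obsPos m t) := by
  induction m with
  | zero =>
    intro K hγ
    refine ⟨_, SRep.r_sub hk hγ, fun σ I => ?_⟩
    have h : σ.B.rho.Y 0 (pat (obsPat 0) I) = σ.B.rho.fc (.inr 0) (.inl (I 1)) (.inl (I 2)) (.inr 1) := by
      change ∑ b, σ.B.rho.gF (.inr 1) b * σ.B.rho.fc b (.inl (I 1)) (.inl (I 2)) (.inr 1) = _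
      simp [RhoGeo.gF]
    rw [h, RhoGeo.fc_phhm]
    exact (add_sub_cancel _ _).symm
  | succ m ih =>
    intro K hγ
    obtain ⟨S, hS, e⟩ := ih (K := K + 1) (by rwa [add_right_comm K 1 m])
    obtain ⟨S', hS', e'⟩ := ERep.sum_om_m hk (hγ.mono_K (by omega)) (ERep.Y hk m (K := K) hγ) (enum_obsPos m)
      (fun x => by simp only [obsPat]; split_ifs <;> decide) (by rw [cnt_obsPat]; omega)
    refine ⟨_, (hS.deriv.cast (by push_cast; ring)).sub (hS'.cast (by rw [cnt_obsPat]; push_cast; ring)),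
      fun σ I => ?_⟩
    have h0 : pat (obsPat (m + 1)) I 0 = .inr 1 := by simp [pat, obsPat]
    have h1 : Fin.tail (pat (obsPat (m + 1)) I) = pat (obsPat m) fun t => I t.succ := by
      funext t
      simp only [Fin.tail, pat, obsPat_succ]
    have h2 : ∀ t, (obsPos m t).succ = obsPos (m + 1) t := fun t => by fin_cases t <;> rfl
    have h4 : σ.B.rho.Y (m + 1) (pat (obsPat (m + 1)) I) = σ.B.rho.covF (σ.B.rho.Y m)
      (pat (obsPat (m + 1)) I 0) (Fin.tail (pat (obsPat (m + 1)) I)) := rfl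
    rw [h4, RhoGeo.covF, h0, h1, e', e]
    simp only [h2]
    have h3 : ∀ x, σ.B.rho.e (.inr 1) x = dX x := fun _ => rfl
    rw [h3, map_add, ← Function.iterate_succ_apply' (⇑dX)]
    simp [RhoGeo.wt]
    ring

theorem obstruction (hk : 2 ≤ k) (hγ : SRep.HG k s k) : ∃ L : Fld k (Fin 2),
    Rep k s 2 (Expansion.γw k) L ∧ ∀ σ : Sit k, ∀ i j : Fin σ.n,
      coeff 0 (σ.B.rho.Y (k - 2) fun t => if (t : ℕ) = k - 2 + 1 then .inl i
        else if (t : ℕ) = k - 2 + 2 then .inl j else .inr 1)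
      = ((k.factorial : ℝ) / 2) • σ.B.γc k ![i, j] + L σ ![i, j] := by
  obtain ⟨m, rfl⟩ : ∃ m, k = m + 2 := ⟨k - 2, by omega⟩
  obtain ⟨S, hS, e⟩ := Y_obsPat (k := m + 2) (s := s) (by omega) m (K := 1) (by
    rwa [add_comm 1 m])
  have hf := (SRep.f_sub (k := m + 2) (s := s) (K := m + 2) (m + 1) (by omega)).map
    (![1, 0] : Fin 2 → Fin 2) (by decide)
  refine ⟨_, ((hf.csmul ((m + 1).factorial / 2)).cast ?_).add (hS.coeff_zero.cast ?_), fun σ i j => ?_⟩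
  · simp only [Expansion.γw]; push_cast; ring
  · simp only [Expansion.γw]; push_cast; ring
  have h := e σ fun t => if (t : ℕ) = m + 1 then i else j
  have h1 : pat (obsPat m) (fun t => if (t : ℕ) = m + 1 then i else j)
      = fun t : Fin (4 + m) => if (t : ℕ) = m + 1 then Sum.inl i
        else if (t : ℕ) = m + 2 then .inl j else .inr 1 := by
    funext t
    simp only [pat, obsPat]
    split_ifs <;> first | rfl | omega
  have h2 : (fun t => if (obsPos m t : ℕ) = m + 1 then i else j) = ![i, j] := by
    funext t; fin_cases t <;> simp [obsPos]
  rw [h1] at h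
  refine (congrArg (coeff 0) h).trans ?_
  have h5 := congrFun h2 0
  have h6 := congrFun h2 1
  rw [h2, h5, h6, map_add, coeff_zero_iterate_dX, ← add_assoc]
  congr 1
  have h3 : σ.B.rho.ψ j i = (1 / 2 : ℝ) • (dX (σ.B.γ j i) + σ.B.rho.f j i) := rfl
  have h4 : coeff (m + 2) (σ.B.γ j i) = σ.B.γc (m + 2) ![i, j] := σ.B.γc_symm _ j i
  simp only [Matrix.cons_val_zero, Matrix.cons_val_one, h3, coeff_smul, map_add, map_sub,
    coeff_dX, coeff_C, if_neg (Nat.succ_ne_zero m), sub_zero, h4]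
  rw [Nat.factorial_succ (m + 1), smul_smul, smul_add, smul_smul]
  congr 1
  · congr 1; push_cast; ring
  · congr 1; ring

end Rep

end

end WeylAmbient

namespace WeylAmbient

noncomputable section

/-! ### Formal tensors with a common denominator -/

namespace FormalTensor

open Polynomial

/-- The value of a combination of monomials with polynomial coefficients. -/
def psum (Q : TMono 2 →₀ ℂ[X]) (d : ℂ) (v : TMono 2 → ℂ) : ℂ := Q.sum fun M q => q.eval d * v M

theorem psum_add (P Q : TMono 2 →₀ ℂ[X]) (d : ℂ) (v : TMono 2 → ℂ) :
    psum (P + Q) d v = psum P d v + psum Q d v :=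
  Finsupp.sum_add_index' (by simp) (by simp [add_mul])

theorem psum_smul (p : ℂ[X]) (Q : TMono 2 →₀ ℂ[X]) (d : ℂ) (v : TMono 2 → ℂ) :
    psum (p • Q) d v = p.eval d * psum Q d v := by
  rw [psum, Finsupp.sum_smul_index (by simp), psum, Finsupp.mul_sum]
  simp [Finsupp.sum, mul_assoc]

theorem psum_single (M : TMono 2) (p : ℂ[X]) (d : ℂ) (v : TMono 2 → ℂ) :
    psum (Finsupp.single M p) d v = p.eval d * v M := Finsupp.sum_single_index (by simp)

/-- The formal tensor with the coefficients `q / p`, for the coefficients `q` of `Q`. -/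
def frac (Q : TMono 2 →₀ ℂ[X]) (p : ℂ[X]) : FormalTensor :=
  Q.mapRange (fun q => algebraMap _ (RatFunc ℂ) q / algebraMap _ _ p) (by simp)

variable (Q : TMono 2 →₀ ℂ[X]) {p : ℂ[X]}

theorem ratFunc_eval_div (q : ℂ[X]) {d : ℂ} (hp : p.eval d ≠ 0) :
    (algebraMap _ (RatFunc ℂ) q / algebraMap _ _ p).eval (RingHom.id ℂ) d = q.eval d / p.eval d := by
  have h0 : p ≠ 0 := by rintro rfl; simp at hp
  have h1 : algebraMap _ (RatFunc ℂ) p ≠ 0 := RatFunc.algebraMap_ne_zero h0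
  have h2 : (algebraMap _ (RatFunc ℂ) q / algebraMap _ _ p).denom.eval₂ (RingHom.id ℂ) d ≠ 0 := by
    intro h
    obtain ⟨c, hc⟩ := RatFunc.denom_div_dvd q p
    apply hp
    rw [hc, eval_mul]
    rw [← Polynomial.eval₂_id, h, zero_mul]
  have h3 := RatFunc.eval_mul (f := RingHom.id ℂ) (a := d) h2 (y := algebraMap _ (RatFunc ℂ) p) (by simp)
  rw [div_mul_cancel₀ _ h1] at h3
  rw [eq_div_iff hp]
  simpa [RatFunc.eval_algebraMap] using h3.symm

theorem coeff_frac (M : TMono 2) {d : ℂ} (hp : p.eval d ≠ 0) :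
    (frac Q p).coeff M d = (Q M).eval d / p.eval d := ratFunc_eval_div _ hp

theorem analyticAt_frac (M : TMono 2) {d : ℂ} (hp : p.eval d ≠ 0) :
    AnalyticAt ℂ ((frac Q p).coeff M) d := by
  have h1 : ∀ q : ℂ[X], AnalyticAt ℂ (fun d => q.eval d) d := fun q =>
    (AnalyticOnNhd.eval_polynomial q) d (Set.mem_univ d)
  refine ((h1 (Q M)).div (h1 p) hp).congr ?_
  filter_upwards [p.continuous.continuousAt.eventually_ne hp] with x hx
  exact (coeff_frac Q M hx).symm

theorem evalAt_frac {n : ℕ} (hp : p.eval (n : ℂ) ≠ 0) (B : WeylData n) (x : Fin n → ℝ) (i j : Fin n) :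
    (frac Q p).evalAt B x i j
      = psum Q n (fun M => ((M.eval B x ![i, j] : ℝ) : ℂ)) / p.eval (n : ℂ) := by
  have h : (frac Q p).evalAt B x i j
      = ∑ M ∈ Q.support, (frac Q p).coeff M (n : ℂ) * ((M.eval B x ![i, j] : ℝ) : ℂ) := by
    refine Finset.sum_subset Finsupp.support_mapRange fun M _ hM => ?_
    rw [coeff, Finsupp.notMem_support_iff.1 hM, RatFunc.eval_zero, zero_mul]
  rw [h, psum, Finsupp.sum, Finset.sum_div]
  exact Finset.sum_congr rfl fun M _ => by rw [coeff_frac Q M hp]; ring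

theorem tendsto_frac {p' : ℂ[X]} {N : ℂ} (hp : p = p' * (X - C N)) (hN : p'.eval N ≠ 0) (M : TMono 2) :
    Tendsto (fun d => (d - N) * (frac Q p).coeff M d) (𝓝[≠] N) (𝓝 ((Q M).eval N / p'.eval N)) := by
  have h1 : Tendsto (fun d => (Q M).eval d / p'.eval d) (𝓝[≠] N) (𝓝 ((Q M).eval N / p'.eval N)) :=
    (((Q M).continuous.continuousAt.div p'.continuous.continuousAt hN).tendsto).mono_left
      nhdsWithin_le_nhds
  refine h1.congr' ?_
  filter_upwards [self_mem_nhdsWithin, nhdsWithin_le_nhds (p'.continuous.continuousAt.eventually_ne hN)]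
    with d hd hd'
  have h2 : d - N ≠ 0 := sub_ne_zero.2 hd
  have h3 : p.eval d = p'.eval d * (d - N) := by rw [hp]; simp
  rw [coeff_frac Q M (by rw [h3]; exact mul_ne_zero hd' h2), h3]
  field_simp

end FormalTensor

theorem residueEval_mapRange (Q : TMono 2 →₀ Polynomial ℂ) (N c : ℂ) {n : ℕ} (B : WeylData n)
    (x : Fin n → ℝ) (i j : Fin n) :
    residueEval (Q.mapRange (fun q => q.eval N / c) (by simp)) B x i j
      = FormalTensor.psum Q N (fun M => ((M.eval B x ![i, j] : ℝ) : ℂ)) / c := by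
  have h : residueEval (Q.mapRange (fun q => q.eval N / c) (by simp)) B x i j
      = ∑ M ∈ Q.support, ((Q M).eval N / c) * ((M.eval B x ![i, j] : ℝ) : ℂ) := by
    refine Finset.sum_subset Finsupp.support_mapRange fun M _ hM => ?_
    rw [Finsupp.notMem_support_iff.1 hM, zero_mul]
  rw [h, FormalTensor.psum, Finsupp.sum, Finset.sum_div]
  exact Finset.sum_congr rfl fun M _ => by ring

open Polynomial in
/-- The denominator, as a polynomial in the formal dimension. -/
def denC (s : ℕ) : ℂ[X] := ∏ j ∈ Finset.Icc 2 s, (X - C (2 * (j : ℂ)))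

theorem eval_denC (s n : ℕ) : (denC s).eval (n : ℂ) = (den s n : ℝ) := by
  simp [denC, den, Polynomial.eval_prod]

theorem eval_denC_ne_zero {s : ℕ} {d : ℂ} (h : ∀ m ∈ Finset.Icc 2 s, d ≠ 2 * (m : ℂ)) :
    (denC s).eval d ≠ 0 := by
  simp only [denC, Polynomial.eval_prod, Finset.prod_ne_zero_iff, Polynomial.eval_sub, Polynomial.eval_X,
    Polynomial.eval_C]
  exact fun j hj => sub_ne_zero.2 (h j hj)

open Polynomial in
theorem Rep.exists_formal {k s o : ℕ} {w : ℤ} {κ : Type} {T : Fld k κ} (h : Rep k s o w T)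
    (ε : Fin 2 ≃ κ) : ∃ (N : ℕ) (Q : TMono 2 →₀ ℂ[X]),
      (∀ M ∈ Q.support, o ≤ M.ord ∧ M.weight = w) ∧
      ∀ (σ : Sit k) (e : σ.A →ₐ[ℝ] ℝ) (I : κ → Fin σ.n),
        ((denC s).eval (σ.n : ℂ)) ^ N * ((e (T σ I) : ℝ) : ℂ)
          = FormalTensor.psum Q σ.n fun M => ((e (σ.B.ev M fun t => I (ε t)) : ℝ) : ℂ) := by
  induction h with
  | @mono κ o r M e ho =>
    obtain rfl : r = 2 := by simpa using Fintype.card_congr (e.trans ε.symm)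
    refine ⟨0, Finsupp.single (.perm (e.trans ε.symm) M) 1, fun M' hM' => ?_, fun σ e' I => ?_⟩
    · obtain rfl := Finset.mem_singleton.1 (Finsupp.support_single_subset hM')
      exact ⟨ho, rfl⟩
    · rw [FormalTensor.psum_single]
      simp [Geo.ev]
  | one => exact isEmptyElim (ε 0)
  | zero => exact ⟨0, 0, by simp, by simp [FormalTensor.psum]⟩
  | add _ _ ih ih' =>
    obtain ⟨N, Q, hQ, e⟩ := ih ε
    obtain ⟨N', Q', hQ', e'⟩ := ih' ε
    classical
    refine ⟨N + N', (denC s) ^ N' • Q + (denC s) ^ N • Q', fun M hM => ?_, fun σ f I => ?_⟩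
    · rcases Finset.mem_union.1 (Finsupp.support_add hM) with h | h
      · exact hQ M (Finsupp.support_smul h)
      · exact hQ' M (Finsupp.support_smul h)
    · rw [FormalTensor.psum_add, FormalTensor.psum_smul, FormalTensor.psum_smul, ← e, ← e', map_add]
      simp only [eval_pow]
      push_cast
      ring
  | @smul κ o w T c hc _ ih =>
    obtain ⟨N, Q, hQ, e⟩ := ih ε
    obtain ⟨p, N', hp⟩ := hc
    refine ⟨N' + N, p.map (algebraMap ℝ ℂ) • Q, fun M hM => ?_, fun σ f I => ?_⟩
    · exact hQ M (Finsupp.support_smul hM)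
    · rw [FormalTensor.psum_smul, ← e, map_smul]
      have h1 : (p.map (algebraMap ℝ ℂ)).eval (σ.n : ℂ) = ((p.eval (σ.n : ℝ) : ℝ) : ℂ) := by
        have := Polynomial.eval_map_apply (algebraMap ℝ ℂ) (p := p) (x := (σ.n : ℝ))
        simpa using this
      rw [h1, ← hp, eval_denC]
      push_cast
      simp
      ring

end

end WeylAmbient

namespace WeylAmbient

noncomputable section

/-! ### Plane waves -/

namespace Geo

variable {n : ℕ} {A : Type} [CommRing A] [Algebra ℝ A]

/-- The metric `2 du dv + H du² + …` of a plane wave with the profile `H`, a function of `y`, and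
the trivial Weyl connection. -/
structure IsWave (B : Geo n A) (u v y : Fin n) (H : A) : Prop where
  uv : u ≠ v
  uy : u ≠ y
  vy : v ≠ y
  g_eq : ∀ i j, B.g i j = (if j = Equiv.swap u v i then 1 else 0) + if i = u ∧ j = u then H else 0
  gi_eq : ∀ i j, B.gi i j = (if j = Equiv.swap u v i then 1 else 0) - if i = v ∧ j = v then H else 0
  a_eq : ∀ m i, B.a m i = 0
  d_H : ∀ i, i ≠ y → B.d i H = 0

/-- The boost weight of an index. -/
def boost (u v i : Fin n) : ℤ := if i = u then 1 else if i = v then -1 else 0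

/-- Functions of `y` which vanish if `c` is negative. -/
def Bst (B : Geo n A) (y : Fin n) (c : ℤ) (f : A) : Prop := (∀ i, i ≠ y → B.d i f = 0) ∧ (c < 0 → f = 0)

namespace Bst

variable {B : Geo n A} {y : Fin n} {c c' : ℤ} {f f' : A}

theorem mono (h : B.Bst y c f) (hc : c ≤ c') : B.Bst y c' f := ⟨h.1, fun hc' => h.2 (by omega)⟩

theorem zero : B.Bst y c 0 := ⟨fun _ _ => map_zero _, fun _ => rfl⟩

theorem add (h : B.Bst y c f) (h' : B.Bst y c f') : B.Bst y c (f + f') :=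
  ⟨fun i hi => by rw [map_add, h.1 i hi, h'.1 i hi, add_zero], fun hc => by rw [h.2 hc, h'.2 hc, add_zero]⟩

theorem smul (r : ℝ) (h : B.Bst y c f) : B.Bst y c (r • f) :=
  ⟨fun i hi => by rw [Derivation.map_smul, h.1 i hi, smul_zero], fun hc => by rw [h.2 hc, smul_zero]⟩

theorem sub (h : B.Bst y c f) (h' : B.Bst y c f') : B.Bst y c (f - f') := by
  have := h.add (h'.smul (-1))
  rwa [neg_one_smul, ← sub_eq_add_neg] at this

theorem mul (h : B.Bst y c f) (h' : B.Bst y c' f') : B.Bst y (c + c') (f * f') := by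
  refine ⟨fun i hi => by rw [Derivation.leibniz, h.1 i hi, h'.1 i hi, smul_zero, smul_zero, add_zero],
    fun hc => ?_⟩
  by_cases h0 : c < 0
  · rw [h.2 h0, zero_mul]
  · rw [h'.2 (by omega), mul_zero]

theorem sum {ι : Type} [Fintype ι] {f : ι → A} (h : ∀ x, B.Bst y c (f x)) : B.Bst y c (∑ x, f x) :=
  ⟨fun i hi => by rw [map_sum]; exact Finset.sum_eq_zero fun x _ => (h x).1 i hi,
    fun hc => Finset.sum_eq_zero fun x _ => (h x).2 hc⟩

end Bst

namespace IsWave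

variable {B : Geo n A} {u v y : Fin n} {H : A} (h : B.IsWave u v y H)

include h

theorem boost_swap (i : Fin n) : boost u v (Equiv.swap u v i) = -boost u v i := by
  simp only [boost, Equiv.swap_apply_def]
  have := h.uv
  split_ifs <;> simp_all

theorem bst_d {c c' : ℤ} {f : A} (hf : B.Bst y c f) (i : Fin n) (hc : c + boost u v i ≤ c') :
    B.Bst y c' (B.d i f) := by
  refine ⟨fun j hj => by rw [B.d_comm, hf.1 j hj, map_zero], fun hc' => ?_⟩
  by_cases hi : i = y
  · have : boost u v i = 0 := by simp [boost, hi, h.uy.symm, h.vy.symm]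
    rw [hf.2 (by omega), map_zero]
  · exact hf.1 i hi

theorem bst_g (i j : Fin n) : B.Bst y (boost u v i + boost u v j) (B.g i j) := by
  rw [h.g_eq]
  refine .add ⟨fun l _ => by split_ifs <;> simp, fun hc => if_neg ?_⟩
    ⟨fun l hl => by split_ifs <;> simp [h.d_H l hl], fun hc => if_neg ?_⟩
  · rintro rfl
    rw [h.boost_swap] at hc
    omega
  · rintro ⟨rfl, rfl⟩
    simp [boost] at hc

theorem bst_gi (i j : Fin n) : B.Bst y (-boost u v i - boost u v j) (B.gi i j) := by
  rw [h.gi_eq]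
  refine .sub ⟨fun l _ => by split_ifs <;> simp, fun hc => if_neg ?_⟩
    ⟨fun l hl => by split_ifs <;> simp [h.d_H l hl], fun hc => if_neg ?_⟩
  · rintro rfl
    rw [h.boost_swap] at hc
    omega
  · rintro ⟨rfl, rfl⟩
    simp [boost, h.uv.symm] at hc

theorem gi_y (l : Fin n) : B.gi y l = if l = y then 1 else 0 := by
  rw [h.gi_eq, Equiv.swap_apply_of_ne_of_ne h.uy.symm h.vy.symm]
  simp [h.vy.symm]

theorem d_g (i j l : Fin n) : B.d i (B.g j l) = if j = u ∧ l = u then B.d i H else 0 := by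
  rw [h.g_eq, map_add]
  split_ifs <;> simp

theorem bst_d_g (i j l : Fin n) :
    B.Bst y (boost u v i + boost u v j + boost u v l - 2) (B.d i (B.g j l)) := by
  rw [h.d_g]
  refine ⟨fun p hp => ?_, fun hc => ?_⟩
  · split_ifs
    · rw [B.d_comm, h.d_H p hp, map_zero]
    · exact map_zero _
  · split_ifs with h1
    · refine h.d_H i ?_
      rintro rfl
      simp [boost, h1.1, h1.2, h.uy.symm, h.vy.symm] at hc
    · rfl

theorem Γ_eq (k i j : Fin n) : B.Γ k i j = lcCoeff B.d B.g B.gi k i j := by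
  simp [Γ, h.a_eq]

theorem bst_Γ (k i j : Fin n) :
    B.Bst y (boost u v i + boost u v j - boost u v k - 2) (B.Γ k i j) := by
  rw [h.Γ_eq]
  refine .smul _ (.sum fun l => ((h.bst_gi k l).mul (c' := boost u v i + boost u v j + boost u v l - 2)
    (((?_ : B.Bst y _ _).add ?_).sub ?_)).mono (by omega))
  · exact (h.bst_d_g _ _ _).mono (by omega)
  · exact (h.bst_d_g _ _ _).mono (by omega)
  · exact (h.bst_d_g _ _ _).mono (by omega)

theorem F_eq (i j : Fin n) : B.F i j = 0 := by simp [F, h.a_eq]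

theorem bst_ΓΓ (i k m l j : Fin n) :
    B.Bst y (boost u v j + boost u v k + boost u v l - boost u v i - 4) (B.Γ i k m * B.Γ m l j) :=
  ((h.bst_Γ i k m).mul (h.bst_Γ m l j)).mono (by omega)

theorem bst_riem (i j k l : Fin n) :
    B.Bst y (boost u v j + boost u v k + boost u v l - boost u v i - 2) (B.riem i j k l) := by
  rw [riem, h.F_eq, mul_zero, add_zero, curv]
  refine ((h.bst_d (h.bst_Γ _ _ _) _ (by omega)).sub (h.bst_d (h.bst_Γ _ _ _) _ (by omega))).add
    (.sum fun m => ?_)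
  exact ((h.bst_ΓΓ _ _ _ _ _).mono (by omega)).sub ((h.bst_ΓΓ _ _ _ _ _).mono (by omega))

theorem bst_ric (i j : Fin n) : B.Bst y (boost u v i + boost u v j - 2) (B.ric i j) :=
  .sum fun _ => (h.bst_riem _ _ _ _).mono (by omega)

theorem bst_scal : B.Bst y (-2) B.scal :=
  .sum fun _ => .sum fun _ => ((h.bst_gi _ _).mul (h.bst_ric _ _)).mono (by omega)

theorem bst_P (i j : Fin n) : B.Bst y (boost u v i + boost u v j - 2) (B.P i j) :=
  .smul _ ((h.bst_ric i j).sub (.smul _ ((h.bst_scal.mul (h.bst_g i j)).mono (by omega))))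

theorem bst_W (i j k l : Fin n) :
    B.Bst y (boost u v i + boost u v j + boost u v k + boost u v l - 2) (B.W i j k l) := by
  have h1 : ∀ a b c d, B.Bst y (boost u v a + boost u v b + boost u v c + boost u v d - 2) (B.g a b * B.P c d) :=
    fun _ _ _ _ => ((h.bst_g _ _).mul (h.bst_P _ _)).mono (by omega)
  have h2 : ∀ a b c d, B.Bst y (boost u v a + boost u v b + boost u v c + boost u v d - 2) (B.P a b * B.g c d) :=
    fun _ _ _ _ => ((h.bst_P _ _).mul (h.bst_g _ _)).mono (by omega)
  refine (((Bst.sub (.sub (.sum fun m => ?_) ?_) ?_).add ?_).add ?_)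
  · exact ((h.bst_g _ _).mul (h.bst_riem _ _ _ _)).mono (by omega)
  exacts [(h1 _ _ _ _).mono (by omega), (h2 _ _ _ _).mono (by omega), (h1 _ _ _ _).mono (by omega),
    (h2 _ _ _ _).mono (by omega)]

theorem bst_nab {κ : Type} [Fintype κ] [DecidableEq κ] {T : (κ → Fin n) → A} {c : ℤ}
    (hT : ∀ I, B.Bst y (∑ s, boost u v (I s) - c) (T I)) (w : ℝ) (i : Fin n) (I : κ → Fin n) :
    B.Bst y (boost u v i + ∑ s, boost u v (I s) - c - 2) (B.nab w T i I - B.d i (T I)) := by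
  rw [nab_def, h.a_eq, zero_mul, smul_zero, add_zero, sub_sub_cancel_left, ← neg_one_smul ℝ]
  refine .smul _ (.sum fun s => .sum fun m => ((h.bst_Γ m i (I s)).mul (hT _)).mono ?_)
  have h1 : ∑ t, boost u v (Function.update I s m t)
      = ∑ t, boost u v (I t) - boost u v (I s) + boost u v m := by
    rw [← Finset.add_sum_erase _ _ (Finset.mem_univ s), ← Finset.add_sum_erase _ _ (Finset.mem_univ s),
      Function.update_self, Finset.sum_congr rfl fun t ht => by
        rw [Function.update_of_ne (Finset.ne_of_mem_erase ht)]]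
    ring
  rw [h1]
  omega

theorem bst_nab' {κ : Type} [Fintype κ] [DecidableEq κ] {T : (κ → Fin n) → A} {c : ℤ}
    (hT : ∀ I, B.Bst y (∑ s, boost u v (I s) - c) (T I)) (w : ℝ) (i : Fin n) (I : κ → Fin n) :
    B.Bst y (boost u v i + ∑ s, boost u v (I s) - c) (B.nab w T i I) := by
  have h1 := ((h.bst_nab hT w i I).mono (by omega)).add (h.bst_d (hT I) i
    (c' := boost u v i + ∑ s, boost u v (I s) - c) (by omega))
  rwa [sub_add_cancel] at h1

theorem bst_ev {r : ℕ} (M : TMono r) (I : Fin r → Fin n) :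
    B.Bst y (∑ s, boost u v (I s) - 2 * M.ord) (B.ev M I) := by
  induction M with
  | metric => exact (h.bst_g _ _).mono (by simp [Fin.sum_univ_two, TMono.ord])
  | schouten => exact (h.bst_P _ _).mono (by simp [Fin.sum_univ_two, TMono.ord])
  | weyl => exact (h.bst_W _ _ _ _).mono (by simp [Fin.sum_univ_four, TMono.ord])
  | mode m => simp only [ev, h.a_eq]; exact .zero
  | nabla M ih =>
    refine (h.bst_nab' ih _ _ _).mono ?_
    rw [Fin.sum_univ_succ]
    exact le_rfl
  | tensor M N ihM ihN =>
    refine ((ihM _).mul (ihN _)).mono ?_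
    rw [Fin.sum_univ_add, TMono.ord]
    push_cast
    omega
  | contr M ih =>
    refine .sum fun p => .sum fun q => ((h.bst_gi p q).mul (ih _)).mono ?_
    rw [Fin.sum_univ_succ, Fin.sum_univ_succ]
    simp only [Fin.cons_zero, Fin.cons_succ, TMono.ord]
    omega
  | perm σ M ih =>
    refine (ih _).mono ?_
    rw [Equiv.sum_comp σ fun s => boost u v (I s)]
    exact le_rfl

theorem ev_eq_zero (M : TMono 2) (hM : 2 ≤ M.ord) : B.ev M ![u, u] = 0 := by
  refine (h.bst_ev M _).2 ?_
  simp [Fin.sum_univ_two, boost]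
  omega

theorem ev_laplace_uu (M : TMono 2) (hM : 1 ≤ M.ord) :
    B.ev M.laplace ![u, u] = B.d y (B.d y (B.ev M ![u, u])) := by
  set f := B.ev M ![u, u] with hf
  obtain ⟨c, hc⟩ : ∃ c, c = B.d y (B.d y f) := ⟨_, rfl⟩
  have hd : ∀ p q, B.d p (B.d q f) = if p = y ∧ q = y then c else 0 := by
    intro p q
    by_cases hq : q = y
    · by_cases hp : p = y
      · rw [hp, hq, if_pos ⟨rfl, rfl⟩, hc]
      · rw [B.d_comm, (h.bst_ev M _).1 p hp, map_zero, if_neg (by tauto)]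
    · rw [(h.bst_ev M _).1 q hq, map_zero, if_neg (by tauto)]
  have hI : ∑ s, boost u v (![u, u] s) = 2 := by simp [Fin.sum_univ_two, boost]
  have h1 : ∀ p q, B.Bst y (boost u v p + boost u v q + 2 - 2 * M.ord - 2)
      (B.ev (.nabla (.nabla M)) (Fin.cons p (Fin.cons q ![u, u])) - B.d p (B.d q f)) := by
    intro p q
    have e1 := h.bst_nab (h.bst_ev M.nabla) M.nabla.weight p (Fin.cons q ![u, u])
    have e2 := h.bst_d (h.bst_nab (h.bst_ev M) M.weight q ![u, u]) p le_rfl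
    rw [Fin.sum_univ_succ] at e1
    simp only [Fin.cons_zero, Fin.cons_succ, hI, TMono.ord] at e1 e2
    have e3 := (e1.mono (c' := boost u v p + boost u v q + 2 - 2 * M.ord - 2) (by omega)).add
      (e2.mono (by omega))
    rw [map_sub] at e3
    exact (sub_add_sub_cancel (B.ev (.nabla (.nabla M)) (Fin.cons p (Fin.cons q ![u, u])))
      (B.d p (B.nab M.weight (B.ev M) q ![u, u])) (B.d p (B.d q f))) ▸ e3
  have h2 : ∑ p, ∑ q, B.gi p q * (B.ev (.nabla (.nabla M)) (Fin.cons p (Fin.cons q ![u, u])) - B.d p (B.d q f)) = 0 := by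
    refine (Bst.sum fun p => .sum fun q => ((h.bst_gi p q).mul (h1 p q)).mono (c' := -2) ?_).2 (by omega)
    omega
  simp only [mul_sub, Finset.sum_sub_distrib, hd] at h2
  rw [sub_eq_zero] at h2
  refine h2.trans ?_
  rw [Finset.sum_eq_single y (fun p _ hp => Finset.sum_eq_zero fun q _ => by
      rw [if_neg (by tauto), mul_zero]) (by simp), Finset.sum_eq_single y (fun q _ hq => by
      rw [if_neg (by tauto), mul_zero]) (by simp), if_pos ⟨rfl, rfl⟩, h.gi_y, if_pos rfl, one_mul, hc]

theorem ev_iterLaplace_uu (m : ℕ) (M : TMono 2) (hM : 1 ≤ M.ord) :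
    1 ≤ (TMono.iterLaplace m M).ord ∧
      B.ev (TMono.iterLaplace m M) ![u, u] = (B.d y)^[2 * m] (B.ev M ![u, u]) := by
  induction m with
  | zero => exact ⟨hM, rfl⟩
  | succ m ih =>
    rw [TMono.iterLaplace_succ]
    refine ⟨ih.1, ?_⟩
    rw [h.ev_laplace_uu _ ih.1, ih.2, mul_add, mul_one, Function.iterate_succ_apply',
      Function.iterate_succ_apply']

theorem ev_gradDivSchouten_uu : B.ev .gradDivSchouten ![u, u] = 0 := by
  have h1 := h.bst_nab (h.bst_ev .divSchouten) TMono.divSchouten.weight u ![u]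
  have h2 := h1.2 (by simp [TMono.divSchouten, TMono.ord, boost])
  rw [(h.bst_ev .divSchouten _).1 u h.uy, sub_zero] at h2
  rw [← h2]
  change B.nab _ _ _ _ = _
  congr 1
  ext s; fin_cases s; rfl

theorem P_uu : B.P u u = (-((n : ℝ) - 2)⁻¹ / 2) • B.d y (B.d y H) := by
  have h1 : ∀ k m, B.Γ k k m * B.Γ m u u - B.Γ k u m * B.Γ m k u = 0 := fun k m =>
    (((h.bst_ΓΓ k k m u u).mono (c' := -2) (by simp [boost])).sub
      ((h.bst_ΓΓ k u m k u).mono (by simp [boost]))).2 (by omega)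
  have h2 : B.Γ y u u = (-(1 / 2) : ℝ) • B.d y H := by
    rw [h.Γ_eq, lcCoeff]
    simp only [h.d_g, h.gi_y, h.uy.symm, h.d_H u h.uy, ite_mul, one_mul, zero_mul, Finset.sum_ite_eq',
      Finset.mem_univ, if_true, and_false, if_false, and_self, zero_add, add_zero, zero_sub]
    rw [smul_neg, neg_smul]
  have h3 : B.ric u u = (-(1 / 2) : ℝ) • B.d y (B.d y H) := by
    have e1 : ∀ k, B.riem k u k u = B.d k (B.Γ k u u) := fun k => by
      rw [riem, h.F_eq, mul_zero, add_zero, curv, (h.bst_Γ _ _ _).1 u h.uy, sub_zero,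
        Finset.sum_eq_zero fun m _ => h1 k m, add_zero]
    rw [ric, Finset.sum_congr rfl fun k _ => e1 k, Finset.sum_eq_single y (fun k _ hk =>
      (h.bst_Γ _ _ _).1 k hk) (by simp), h2, Derivation.map_smul]
  rw [P, h3, h.bst_scal.2 (by omega), zero_mul, smul_zero, sub_zero, smul_smul]
  congr 1
  ring

theorem iterate_d_smul (m : ℕ) (r : ℝ) (f : A) : (B.d y)^[m] (r • f) = r • (B.d y)^[m] f := by
  induction m generalizing f with
  | zero => rfl
  | succ m ih => rw [Function.iterate_succ_apply, Derivation.map_smul, ih, Function.iterate_succ_apply]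

/-- The leading part of the obstruction tensor of a plane wave. -/
theorem ev_lead_uu {k : ℕ} (hk : 2 ≤ k) : B.ev (.iterLaplace (k - 1) .schouten) ![u, u]
    - B.ev (.iterLaplace (k - 2) .gradDivSchouten) ![u, u]
      = (-((n : ℝ) - 2)⁻¹ / 2) • (B.d y)^[2 * k] H := by
  have h0 : (B.d y)^[2 * (k - 2)] 0 = 0 := by
    have := h.iterate_d_smul (2 * (k - 2)) 0 0
    rwa [zero_smul, zero_smul] at this
  have h1 : B.ev .schouten ![u, u] = B.P u u := rfl
  rw [(h.ev_iterLaplace_uu _ _ le_rfl).2, (h.ev_iterLaplace_uu _ _ le_rfl).2, h.ev_gradDivSchouten_uu, h0,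
    sub_zero, h1, h.P_uu, h.iterate_d_smul, ← Function.iterate_succ_apply, ← Function.iterate_succ_apply]
  congr 3
  omega

end IsWave

end Geo

theorem iterate_derivation_pow {A : Type} [CommRing A] [Algebra ℝ A] (D : Derivation ℝ A A) {Y : A}
    (hY : D Y = 1) (m : ℕ) : D^[m] (Y ^ m) = (m.factorial : ℝ) • (1 : A) := by
  have h : ∀ m (r : ℝ) (f : A), D^[m] (r • f) = r • D^[m] f := by
    intro m
    induction m with
    | zero => exact fun _ _ => rfl
    | succ m ih => exact fun r f => by rw [Function.iterate_succ_apply, Derivation.map_smul, ih,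
        Function.iterate_succ_apply]
  induction m with
  | zero => simp
  | succ m ih =>
    have h1 : D (Y ^ (m + 1)) = ((m + 1 : ℕ) : ℝ) • Y ^ m := by
      rw [D.leibniz_pow, hY, Nat.add_sub_cancel, smul_eq_mul, mul_one, Nat.cast_smul_eq_nsmul]
    rw [Function.iterate_succ_apply, h1, h, ih, smul_smul, Nat.factorial_succ]
    push_cast
    rfl

theorem wave_inverse {n : ℕ} {A : Type} [CommRing A] {u v : Fin n} (huv : u ≠ v) (H : A) :
    (Matrix.of fun i j => (if j = Equiv.swap u v i then 1 else 0) + if i = u ∧ j = u then H else 0) *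
      (Matrix.of fun i j => (if j = Equiv.swap u v i then 1 else 0) - if i = v ∧ j = v then H else 0)
      = (1 : Matrix (Fin n) (Fin n) A) := by
  ext i j
  rw [Matrix.mul_apply]
  simp only [Matrix.of_apply, add_mul, ite_mul, one_mul, zero_mul, Finset.sum_add_distrib,
    Finset.sum_ite_eq', Finset.mem_univ, if_true, Equiv.swap_apply_self, ite_and, Matrix.one_apply]
  have h1 : Equiv.swap u v i = v ↔ i = u := by rw [Equiv.swap_apply_eq_iff, Equiv.swap_apply_right]
  rcases eq_or_ne i u with rfl | hi
  · simp [huv, huv.symm, eq_comm]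
  · simp [h1, hi, eq_comm]

namespace WeylData

variable {n : ℕ}

/-- The plane wave with the profile `y ^ m`. -/
def wave (u v y : Fin n) (m : ℕ) : WeylData n where
  metric x := Matrix.of fun i j => (if j = Equiv.swap u v i then 1 else 0)
    + if i = u ∧ j = u then x y ^ m else 0
  mode _ _ _ := 0

variable {u v y : Fin n} (huv : u ≠ v) (m : ℕ)

include huv in
theorem isRegularOn_wave : (wave u v y m).IsRegularOn (⊤ : TopologicalSpace.Opens (Fin n → ℝ)) := by
  refine ⟨isOpen_univ, fun i j => ContDiff.contDiffOn ?_, fun _ _ => contDiffOn_const, fun x _ => ?_,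
    fun x _ h0 => ?_⟩
  · refine contDiff_const.add ?_
    split_ifs
    · exact (contDiff_apply ℝ ℝ y).pow m
    · exact contDiff_const
  · refine Matrix.IsSymm.ext fun i j => ?_
    have h1 : i = Equiv.swap u v j ↔ j = Equiv.swap u v i := by rw [eq_comm, Equiv.swap_apply_eq_iff]
    simp [wave, h1, and_comm]
  · have h1 := congrArg Matrix.det (wave_inverse huv (x y ^ m))
    rw [Matrix.det_mul, Matrix.det_one] at h1
    exact one_ne_zero (h1.symm.trans (by rw [show Matrix.det (Matrix.of _) = _ from h0, zero_mul]))

/-- The coordinate `y` as a smooth function. -/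
def coordFn (y : Fin n) : SmoothFn (⊤ : TopologicalSpace.Opens (Fin n → ℝ)) :=
  SmoothFn.ofFun (fun x => x y) (contDiff_apply ℝ ℝ y).contDiffOn

theorem pderiv_coordFn (i y : Fin n) : SmoothFn.pderiv i (coordFn y) = if i = y then 1 else 0 := by
  refine SmoothFn.ext_ev fun x => ?_
  rw [SmoothFn.pderiv_eq_pd i _ (fun x => x y) fun _ => rfl, pd, (hasFDerivAt_apply y (x : Fin n → ℝ)).fderiv]
  split_ifs with h
  · subst h; simp
  · simp [Ne.symm h]

theorem isWave (huy : u ≠ y) (hvy : v ≠ y) :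
    (geo (isRegularOn_wave (y := y) huv m)).IsWave u v y (coordFn y ^ m) := by
  set B := geo (isRegularOn_wave (y := y) huv m) with hB
  have hg : ∀ i j, B.g i j = (if j = Equiv.swap u v i then 1 else 0)
      + if i = u ∧ j = u then coordFn y ^ m else 0 := fun i j =>
    SmoothFn.ext_ev fun x => by
      change (wave u v y m).metric x i j = _
      rw [← SmoothFn.evalAt_apply]
      simp only [wave, Matrix.of_apply, map_add, apply_ite (SmoothFn.evalAt x), map_one, map_zero, map_pow]
      rfl
  refine ⟨huv, huy, hvy, hg, fun i j => ?_, fun m i => SmoothFn.ext_ev fun x => rfl, fun i hi => ?_⟩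
  · have h1 : Matrix.of B.g * Matrix.of B.gi = 1 := by
      ext1 i j
      rw [Matrix.mul_apply, Matrix.one_apply]
      exact B.g_gi i j
    have h2 : Matrix.of B.g = Matrix.of fun i j => (if j = Equiv.swap u v i then 1 else 0)
      + if i = u ∧ j = u then coordFn y ^ m else 0 := by ext1 i j; exact hg i j
    have h3 := left_inv_eq_right_inv (mul_eq_one_comm.1 h1) (h2 ▸ wave_inverse huv (coordFn y ^ m))
    exact congrFun (congrFun h3 i) j
  · change SmoothFn.pderiv i _ = 0
    rw [Derivation.leibniz_pow, pderiv_coordFn, if_neg hi, smul_zero, smul_zero]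

end WeylData

/-- There is a Weyl geometry in dimension `2k` where the terms of second order vanish, but the
leading part of the obstruction tensor does not. -/
theorem exists_wave {k : ℕ} (hk : 2 ≤ k) : ∃ (B : WeylData (2 * k)) (U : Set (Fin (2 * k) → ℝ)),
    B.IsRegularOn U ∧ ∃ x ∈ U, ∃ u, (∀ M : TMono 2, 2 ≤ M.ord → M.eval B x ![u, u] = 0) ∧
      (TMono.iterLaplace (k - 1) .schouten).eval B x ![u, u]
        - (TMono.iterLaplace (k - 2) .gradDivSchouten).eval B x ![u, u] ≠ 0 := by
  have huv : (⟨0, by omega⟩ : Fin (2 * k)) ≠ ⟨1, by omega⟩ := by simp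
  have hw := WeylData.isWave huv (2 * k) (y := ⟨2, by omega⟩) (by simp) (by simp)
  obtain ⟨x⟩ : Nonempty (⊤ : TopologicalSpace.Opens (Fin (2 * k) → ℝ)) := ⟨⟨0, trivial⟩⟩
  refine ⟨_, _, WeylData.isRegularOn_wave huv (2 * k) (y := ⟨2, by omega⟩), x, x.2, ⟨0, by omega⟩,
    fun M hM => ?_, ?_⟩
  · rw [WeylData.geo_ev (WeylData.isRegularOn_wave huv (2 * k)) M x, hw.ev_eq_zero M hM, map_zero]
  · have h1 := fun M : TMono 2 => WeylData.geo_ev (WeylData.isRegularOn_wave huv (2 * k)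
      (y := ⟨2, by omega⟩)) M x ![⟨0, by omega⟩, ⟨0, by omega⟩]
    have h4 := iterate_derivation_pow (SmoothFn.pderiv (⟨2, by omega⟩ : Fin (2 * k)))
      (Y := WeylData.coordFn ⟨2, by omega⟩) (by rw [WeylData.pderiv_coordFn, if_pos rfl]) (2 * k)
    refine ne_of_eq_of_ne ((congrArg₂ (· - ·) (h1 _) (h1 _)).trans ((map_sub _ _ _).symm.trans
      (congrArg (SmoothFn.evalAt x) ((hw.ev_lead_uu hk).trans (congrArg _ h4))))) ?_
    rw [map_smul, map_smul, map_one]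
    have h2 : ((2 * k : ℕ) : ℝ) - 2 ≠ 0 := by
      have : (2 : ℝ) ≤ k := by exact_mod_cast hk
      push_cast; linarith
    have h3 : ((2 * k).factorial : ℝ) ≠ 0 := by exact_mod_cast Nat.factorial_ne_zero _
    simp only [smul_eq_mul, mul_one]
    exact mul_ne_zero (div_ne_zero (neg_ne_zero.2 (inv_ne_zero h2)) two_ne_zero) h3

end

end WeylAmbient

namespace WeylAmbient

noncomputable section

/-! ### The coefficients in formal dimension -/

open Polynomial FormalTensor

theorem denC_succ {s : ℕ} (hs : 1 ≤ s) : denC (s + 1) = denC s * (X - C (2 * ((s + 1 : ℕ) : ℂ))) := by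
  rw [denC, ← Finset.insert_Icc_right_eq_Icc_add_one (by omega), Finset.prod_insert (by simp), mul_comm]
  rfl

theorem gammaFactor_eq {k : ℕ} (hk : 1 ≤ k) {d : ℂ} (hd : ∀ j : ℕ, d / 2 - k ≠ -(j : ℂ)) :
    gammaFactor k d = (-1) ^ (k - 1) / (denC k).eval d := by
  have h1 : (2 : ℂ) ^ (k - 1) * Complex.Gamma (d / 2 - 1) = (denC k).eval d * Complex.Gamma (d / 2 - k) := by
    induction k, hk using Nat.le_induction with
    | base => simp [denC]
    | succ k hk ih =>
      have h2 : d / 2 - k = d / 2 - (k + 1 : ℕ) + 1 := by push_cast; ring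
      have h3 := Complex.Gamma_add_one (d / 2 - (k + 1 : ℕ)) (by simpa using hd 0)
      have h4 := ih fun j h => hd (j + 1) (by push_cast; linear_combination h)
      obtain ⟨k, rfl⟩ : ∃ k', k = k' + 1 := ⟨k - 1, by omega⟩
      rw [h2, h3] at h4
      rw [denC_succ (by omega)]
      simp only [Nat.add_sub_cancel, eval_mul, eval_sub, eval_X, eval_C] at h4 ⊢
      rw [pow_succ]
      linear_combination 2 * h4
  have h2 : Complex.Gamma (d / 2 - k) ≠ 0 := Complex.Gamma_ne_zero hd
  rw [gammaFactor, h1, mul_comm ((denC k).eval d), mul_comm ((-1) ^ (k - 1)), mul_div_mul_left _ _ h2]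

/-- The leading part, with polynomial coefficients. -/
def leadP (k : ℕ) : TMono 2 →₀ ℂ[X] := Finsupp.single (.iterLaplace (k - 1) .schouten) 1
  + Finsupp.single (.iterLaplace (k - 2) .gradDivSchouten) (-1)

theorem psum_leadP (k : ℕ) (d : ℂ) (v : TMono 2 → ℂ) : psum (leadP k) d v
    = v (.iterLaplace (k - 1) .schouten) - v (.iterLaplace (k - 2) .gradDivSchouten) := by
  rw [leadP, psum_add, psum_single, psum_single]
  simp [sub_eq_add_neg]

theorem leadingPart_apply (k : ℕ) (M : TMono 2) :
    leadingPart k M = algebraMap _ (RatFunc ℂ) (leadP k M) := by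
  classical
  simp only [leadingPart, leadP, Finsupp.sub_apply, Finsupp.add_apply, Finsupp.neg_apply, Finsupp.single_apply, sub_eq_add_neg,
    map_add, apply_ite (algebraMap ℂ[X] (RatFunc ℂ)), map_one, map_neg, map_zero, neg_ite, neg_zero]

theorem leadingPart_add_frac (k : ℕ) (Q : TMono 2 →₀ ℂ[X]) {p : ℂ[X]} (hp : p ≠ 0) :
    leadingPart k + frac Q p = frac (p • leadP k + Q) p := by
  ext1 M
  have h1 : algebraMap _ (RatFunc ℂ) p ≠ 0 := RatFunc.algebraMap_ne_zero hp
  simp only [frac, Finsupp.add_apply, Finsupp.mapRange_apply, Finsupp.smul_apply, smul_eq_mul, map_add,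
    map_mul, leadingPart_apply]
  field_simp

theorem psum_eq_zero {Q : TMono 2 →₀ ℂ[X]} {v : TMono 2 → ℂ} (h : ∀ M ∈ Q.support, v M = 0) (d : ℂ) :
    psum Q d v = 0 := Finset.sum_eq_zero fun M hM => mul_eq_zero_of_right _ (h M hM)

theorem eval_denC_ne {k : ℕ} : (denC (k - 1)).eval ((2 * k : ℕ) : ℂ) ≠ 0 := by
  refine eval_denC_ne_zero fun m hm h => ?_
  have h1 : 2 * k = 2 * m := by exact_mod_cast h
  have := Finset.mem_Icc.1 hm
  omega

theorem hasSimplePole_frac {k : ℕ} (hk : 2 ≤ k) (N : ℕ) {c : ℂ} (hc : c ≠ 0) {Q : TMono 2 →₀ ℂ[X]}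
    (hQ : ∀ M ∈ Q.support, 2 ≤ M.ord) :
    HasSimplePole (frac (C c • (denC (k - 1) ^ N • leadP k + Q))
      (denC (k - 1) ^ (N + 1) * (X - C ((2 * k : ℕ) : ℂ)))) (2 * k)
      ((C c • (denC (k - 1) ^ N • leadP k + Q)).mapRange (fun q => q.eval ((2 * k : ℕ) : ℂ)
        / (denC (k - 1) ^ (N + 1)).eval ((2 * k : ℕ) : ℂ)) (by simp)) := by
  have h0 : (denC (k - 1) ^ (N + 1)).eval ((2 * k : ℕ) : ℂ) ≠ 0 := by
    rw [eval_pow]; exact pow_ne_zero _ eval_denC_ne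
  refine ⟨fun M => ?_, ?_⟩
  · rw [Finsupp.mapRange_apply]
    exact tendsto_frac _ rfl h0 M
  · obtain ⟨B, U, hB, x, hx, u, h2, h3⟩ := exists_wave hk
    refine ⟨B, U, hB, x, hx, u, u, ?_⟩
    rw [residueEval_mapRange, psum_smul, psum_add, psum_smul, psum_leadP,
      psum_eq_zero fun M hM => by rw [h2 M (hQ M hM), Complex.ofReal_zero], eval_C, add_zero, eval_pow,
      ← Complex.ofReal_sub]
    exact div_ne_zero (mul_ne_zero hc (mul_ne_zero (pow_ne_zero _ eval_denC_ne)
      (Complex.ofReal_ne_zero.2 h3))) h0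

/-- The expressions for the coefficient of the metric and for the extended obstruction tensor. -/
theorem exists_psum {k : ℕ} (hk : 2 ≤ k) : ∃ (N : ℕ) (P Q : TMono 2 →₀ ℂ[X]),
    (∀ M ∈ P.support, 2 ≤ M.ord ∧ M.weight = Expansion.γw k) ∧
    (∀ M ∈ Q.support, 2 ≤ M.ord ∧ M.weight = Expansion.γw k) ∧
    ∀ n : ℕ, 3 ≤ n → (∀ m ∈ Finset.Icc 2 k, n ≠ 2 * m) →
      ∀ (D : AmbientData n) (O : Set ((Fin n → ℝ) × ℝ)), D.IsRegularOn O → D.RicciFlatToOrder O k →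
        ∀ x : Fin n → ℝ, (x, (0 : ℝ)) ∈ O → ∀ i j : Fin n, ∃ l z : ℂ,
          psum P n (fun M => ((M.eval D.boundary x ![i, j] : ℝ) : ℂ)) = (denC (k - 1)).eval (n : ℂ) ^ N * l ∧
          psum Q n (fun M => ((M.eval D.boundary x ![i, j] : ℝ) : ℂ)) = (denC (k - 1)).eval (n : ℂ) ^ N * z ∧
          ((D.gamCoeff k x i j : ℝ) : ℂ) = 2 / (k.factorial : ℂ) * (-1) ^ (k - 1) / (denC k).eval (n : ℂ)
            * (psum (leadP k) n (fun M => ((M.eval D.boundary x ![i, j] : ℝ) : ℂ)) + l) ∧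
          ((D.extObstruction (k - 2) x i j : ℝ) : ℂ)
            = (k.factorial : ℂ) / 2 * ((D.gamCoeff k x i j : ℝ) : ℂ) + z := by
  obtain ⟨-, L, hL, eL⟩ := Rep.γc_eq_lead hk le_rfl
  have hγ : SRep.HG k (k - 1) k := by
    rcases hk.eq_or_lt with rfl | hk'
    · exact Rep.HG_two le_rfl
    · have := (Rep.γc_eq_lead (by omega : 2 ≤ k - 1) (Nat.sub_le k 1)).1
      rwa [Nat.sub_add_cancel (by omega)] at this
  obtain ⟨Z, hZ, eZ⟩ := Rep.obstruction hk hγ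
  obtain ⟨N, P, hP, eP⟩ := hL.exists_formal (Equiv.refl _)
  obtain ⟨N', Q, hQ, eQ⟩ := hZ.exists_formal (Equiv.refl _)
  refine ⟨N + N', denC (k - 1) ^ N' • P, denC (k - 1) ^ N • Q, fun M hM => hP M (Finsupp.support_smul hM),
    fun M hM => hQ M (Finsupp.support_smul hM), fun n h3 hn D O h hR x hx i j => ?_⟩
  set σ : Sit k := ⟨n, _, h3, hn, AmbientData.expansion h, AmbientData.isFlat_expansion h (by omega) hR⟩ with hσ
  set e := SmoothFn.evalAt (⟨x, hx⟩ : AmbientData.bdom h.1) with he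
  have hev : ∀ M : TMono 2, M.eval D.boundary x ![i, j] = e (σ.B.ev M ![i, j]) := fun M =>
    WeylData.geo_ev (AmbientData.boundary_isRegularOn h) M ⟨x, hx⟩ _
  have hc : D.gamCoeff k x i j = e (σ.B.γc k ![i, j]) :=
    (AmbientData.coeff_taylor_g h k ⟨x, hx⟩ i j).symm
  refine ⟨(e (L σ ![i, j]) : ℝ), (e (Z σ ![i, j]) : ℝ), ?_, ?_, ?_, ?_⟩
  · rw [psum_smul, eval_pow, pow_add, mul_comm (_ ^ N), mul_assoc, eP σ e ![i, j]]
    simp only [hev]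
    rfl
  · rw [psum_smul, eval_pow, pow_add, mul_assoc, eQ σ e ![i, j]]
    simp only [hev]
    rfl
  · rw [psum_leadP, hc, eL σ, eval_denC, hev, hev, map_smul, map_add, leadF, map_sub, lfac]
    simp [div_eq_mul_inv, show den k σ.n = den k n from rfl]
  · rw [AmbientData.extObstruction_eq h _ ⟨x, hx⟩, hc]
    refine (congrArg (fun y => ((e y : ℝ) : ℂ)) (eZ σ i j)).trans ?_
    simp

end

end WeylAmbient

open WeylAmbient WeylAmbient.FormalTensor Polynomial in
theorem mainTheorem4 (k : ℕ) (hk : 2 ≤ k) :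
    ∃ (Ω γ lower : WeylAmbient.FormalTensor) (resΩ resγ : WeylAmbient.TMono 2 →₀ ℂ),
      -- `Ω` is the extended Weyl-obstruction tensor `Ω^{(k-1)}`, and `γ` is `γ^{(k)}`
      WeylAmbient.Represents k Ω (fun _ D => D.extObstruction (k - 2)) ∧
      WeylAmbient.Represents k γ (fun _ D => D.gamCoeff k) ∧
      -- both are holomorphic in `d` away from `4, 6, …, 2k`, with a simple pole at `2k`
      Ω.HolomorphicOff (Finset.Icc 2 k) ∧
      γ.HolomorphicOff (Finset.Icc 2 k) ∧
      WeylAmbient.HasSimplePole Ω (2 * k) resΩ ∧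
      WeylAmbient.HasSimplePole γ (2 * k) resγ ∧
      -- the residues
      resΩ = ((k.factorial : ℂ) / 2) • resγ ∧
      -- the explicit form; the terms of lower order have fewer than `2k - 2` derivatives
      (∀ M ∈ lower.support, M.numNabla < 2 * k - 2) ∧
      lower.HolomorphicOff (Finset.Icc 2 (k - 1)) ∧
      (∀ M, ∀ d : ℂ, (∀ j : ℕ, d / 2 - k ≠ -(j : ℂ)) →
        Ω.coeff M d = WeylAmbient.gammaFactor k d * (WeylAmbient.leadingPart k + lower).coeff M d) := by
  classical
  obtain ⟨N, P, Q, hP, hQ, e⟩ := exists_psum hk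
  set D := denC (k - 1) with hD
  have hDk : denC k = D * (X - C ((2 * k : ℕ) : ℂ)) := by
    have := denC_succ (s := k - 1) (by omega)
    rw [Nat.sub_add_cancel (by omega)] at this
    rw [this]; push_cast; rfl
  set s : ℂ := (-1) ^ (k - 1) with hs
  have hss : s * s = 1 := by rw [hs, ← mul_pow]; simp
  have hs0 : s ≠ 0 := left_ne_zero_of_mul_eq_one hss
  have hf : (k.factorial : ℂ) ≠ 0 := by exact_mod_cast k.factorial_ne_zero
  set R := P + (C s * denC k) • Q with hR
  have hR' : ∀ M ∈ R.support, 2 ≤ M.ord ∧ M.weight = Expansion.γw k := fun M hM =>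
    (Finset.mem_union.1 (Finsupp.support_add hM)).elim (hP M) fun h => hQ M (Finsupp.support_smul h)
  set p := D ^ (N + 1) * (X - C ((2 * k : ℕ) : ℂ)) with hp
  have hp' : p = D ^ N * denC k := by rw [hp, hDk]; ring
  have hD0 : ∀ {d : ℂ}, (denC k).eval d ≠ 0 → D.eval d ≠ 0 := fun h => by
    rw [hDk, eval_mul] at h; exact left_ne_zero_of_mul h
  have hp0 : ∀ {d : ℂ}, (denC k).eval d ≠ 0 → p.eval d ≠ 0 := fun h => by
    rw [hp', eval_mul, eval_pow]; exact mul_ne_zero (pow_ne_zero _ (hD0 h)) h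
  have hn : ∀ {n : ℕ}, (∀ m ∈ Finset.Icc 2 k, n ≠ 2 * m) → (denC k).eval (n : ℂ) ≠ 0 := fun h =>
    eval_denC_ne_zero fun m hm h' => h m hm (by exact_mod_cast h')
  refine ⟨frac (C s • (D ^ N • leadP k + R)) p, frac (C (2 / (k.factorial : ℂ) * s) • (D ^ N • leadP k + P)) p,
    frac R (D ^ N), _, _, fun n h3 hne A O hA hF x hx i j => ?_, fun n h3 hne A O hA hF x hx i j => ?_,
    fun M d hd => analyticAt_frac _ M (hp0 (eval_denC_ne_zero hd)),
    fun M d hd => analyticAt_frac _ M (hp0 (eval_denC_ne_zero hd)),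
    hasSimplePole_frac hk N hs0 fun M hM => (hR' M hM).1,
    hasSimplePole_frac hk N (mul_ne_zero (div_ne_zero two_ne_zero hf) hs0) fun M hM => (hP M hM).1,
    ?_, fun M hM => ?_, fun M d hd => analyticAt_frac _ M ?_, fun M d hd => ?_⟩
  · obtain ⟨l, z, e1, e2, e3, e4⟩ := e n h3 hne A O hA hF x hx i j
    have h0 := hn hne
    have h1 := hD0 h0
    rw [evalAt_frac _ (hp0 h0), e4, e3, psum_smul, psum_add, psum_smul, psum_add, psum_smul, e1, e2, hp']
    simp only [eval_mul, eval_pow, eval_C]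
    field_simp
    linear_combination (-(eval (n : ℂ) (denC k)) * z) * hss
  · obtain ⟨l, z, e1, -, e3, -⟩ := e n h3 hne A O hA hF x hx i j
    have h0 := hn hne
    have h1 := hD0 h0
    rw [evalAt_frac _ (hp0 h0), e3, psum_smul, psum_add, psum_smul, e1, hp']
    simp only [eval_mul, eval_pow, eval_C]
    field_simp
  · ext M
    have h0 : (denC k).eval ((2 * k : ℕ) : ℂ) = 0 := by rw [hDk]; simp
    simp only [Finsupp.smul_apply, Finsupp.mapRange_apply, Finsupp.add_apply, smul_eq_mul, eval_mul, eval_add,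
      eval_C, hR, h0, mul_zero, zero_mul, add_zero]
    field_simp
  · have h1 := hR' M (Finsupp.support_mapRange hM)
    have h2 := M.two_mul_rank_add_weight
    rw [h1.2, Expansion.γw] at h2
    push_cast at h2
    omega
  · rw [eval_pow]; exact pow_ne_zero _ (eval_denC_ne_zero hd)
  · have h0 : (denC k).eval d ≠ 0 := eval_denC_ne_zero fun m hm h => hd (k - m) (by
      rw [h, Nat.cast_sub (Finset.mem_Icc.1 hm).2]; ring)
    have h1 := hD0 h0
    have h2 : (D ^ N).eval d ≠ 0 := by rw [eval_pow]; exact pow_ne_zero _ h1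
    rw [leadingPart_add_frac k R (by rintro h; rw [h] at h2; simp at h2), coeff_frac _ _ (hp0 h0),
      coeff_frac _ _ h2, gammaFactor_eq (by omega) hd, hp', Finsupp.smul_apply, smul_eq_mul]
    simp only [eval_mul, eval_C]
    field_simp
    rw [hs, mul_comm]
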